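/- Let $Z\to M\xrightarrow{\pi}B$ be a smooth fiber bundle of closed connected manifolds with oriented fibers, $n=\dim Z$, and let $\int_Z$ denote integration over the fiber, from $r$-forms on $M$ to $(r-n)$-forms on $B$. Let $HM\subset TM$ be a smooth complement of $VM=\ker\pi_*$, and write $\xi^H$ for horizontal lifts. Let $E\to M$ be a complex vector bundle of finite rank with a connection $\nabla^E$ and curvature $R^E\in\Omega^2(M,\operatorname{End}E)$. Let $\mathcal E=\pi_*E$ be the bundle over $B$ with fibers $\mathcal E_b=\Gamma(E|_{Z_b})$, a section $r$ of $\mathcal E$ being smooth if $\tilde r(x)=r(\pi(x))(x)$ is a smooth section of $E$. The Bismut connection on $\mathcal E$ is $(\nabla_\xi r)(z)=(\nabla^E_{\xi^H}\tilde r)(z)$, and its curvature is $\Omega^B(X,Y)=[\nabla_X,\nabla_Y]-\nabla_{[X,Y]}$. (1) For $b\in B$ and $\xi_1,\xi_2\in T_bB$, the curvature $\Omega^B(\xi_1,\xi_2)$ acts on $\mathcal E_b$ as an element $(V,s)$ of the Lie algebra of the automorphism group of the bundle $E|_{Z_b}\to Z_b$ (infinitesimal bundle automorphisms $s$ covering a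 vector field $V$ on $Z_b$, acting on sections by $\sigma\mapsto s(\sigma)-d\sigma(V)$). Its vertical part with respect to the splitting of $T(E|_{Z_b})$ defined by $\nabla^E$, i.e. the endomorphism $s^v$ of $E|_{Z_b}$ such that $(V,s)$ acts on sections as $s^v-\nabla^E_V$, is at $z\in Z_b$ equal to $R^E_z(\xi_1^H,\xi_2^H)$. (2) In this sense $(\Omega^B)^v=R^E$, and one sets $$c_k(\Omega^B)=\int_Z\operatorname{tr}\big(((\Omega^B)^v)^k\big)=\int_Z\operatorname{tr}\big((R^E)^k\big)\in\Omega^{2k-n}(B).$$ For all $k$ with $2k\ge n$ these forms on $B$ are smooth and closed, and their de Rham classes do not depend on the choice of the connection $\nabla^E$: for any two connections on $E$ the two forms differ by an exact form (for $2k=n$, they are equal). (3) Let $S^+,S^-,K$ be complex vector bundles of finite rank over $M$ with connections with curvatures $\Omega^{S^\pm},\Omega^K$, and give $S^\pm\otimes K$ the tensor product connections (for a family of coupled Dirac operators, $S^\pm$ are the half-spinor bundles and $K$ is the coefficient bundle). Let $\operatorname{ch}(\Omega)=\operatorname{tr}\exp(c\,\Omega)$ with any fixed normalizing constant $c\in\mathbb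 C$. Then the Chern character form of the superbundle $\mathcal E=\pi_*(S^+\otimes K)\oplus\pi_*(S^-\otimes K)$, i.e. $\operatorname{ch}(\mathcal E)=\int_Z\operatorname{ch}(R^{S^+\otimes K})-\int_Z\operatorname{ch}(R^{S^-\otimes K})$, is $$\operatorname{ch}(\mathcal E)=\int_Z\operatorname{ch}(\Omega^{S^+-S^-})\cup\operatorname{ch}(\Omega^K),\qquad \operatorname{ch}(\Omega^{S^+-S^-})=\operatorname{ch}(\Omega^{S^+})-\operatorname{ch}(\Omega^{S^-}),$$ as differential forms on $B$, in each degree. -/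

import Mathlib

open scoped Manifold ContDiff Topology
open Bundle MeasureTheory

noncomputable section

namespace FamiliesChernWeil

/-- The model space of a manifold of dimension `d`. -/
abbrev Euc (d : ℕ) : Type := EuclideanSpace ℝ (Fin d)

/-! ### Differential forms on manifolds -/

section Forms

variable {d : ℕ} {M : Type*} [TopologicalSpace M] [ChartedSpace (Euc d) M]
  {G : Type*} [NormedAddCommGroup G] [NormedSpace ℝ G]

/-- Differential `p`-forms on a `d`-manifold `M`, with values in `G` (no regularity imposed).
The tangent space `TangentSpace (𝓡 d) x` is, by definition, the model space `Euc d`,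
identified with the geometric tangent space through the preferred chart at `x`. -/
abbrev DForm (d : ℕ) (M : Type*) (p : ℕ) (G : Type*) [NormedAddCommGroup G] [NormedSpace ℝ G] :
    Type _ :=
  M → Euc d [⋀^Fin p]→L[ℝ] G

/-- The expression of a form in the preferred chart `c` at `x₀`, i.e. the pullback of `θ` under
`c⁻¹`. -/
def chartForm {p : ℕ} (θ : DForm d M p G) (x₀ : M) (y : Euc d) : Euc d [⋀^Fin p]→L[ℝ] G :=
  (θ ((extChartAt (𝓡 d) x₀).symm y)).compContinuousLinearMap
    (mfderiv 𝓘(ℝ, Euc d) (𝓡 d) (extChartAt (𝓡 d) x₀).symm y)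

/-- A form is smooth if all its chart expressions are. -/
def IsSmoothForm {p : ℕ} (θ : DForm d M p G) : Prop :=
  ∀ x₀ : M, ContDiffOn ℝ ∞ (chartForm θ x₀) (extChartAt (𝓡 d) x₀).target

/-- The exterior derivative, computed at `x` in the preferred chart at `x` (whose differential at
`x` is the identity in the identification of `TangentSpace (𝓡 d) x` with `Euc d`). -/
def dForm {p : ℕ} (θ : DForm d M p G) : DForm d M (p + 1) G :=
  fun x => extDeriv (chartForm θ x) (extChartAt (𝓡 d) x x)

/-- Exact forms: `0` in degree `0`, and exterior derivatives of smooth forms in positive degree. -/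
def IsExactForm : {p : ℕ} → DForm d M p G → Prop
  | 0, θ => θ = 0
  | p + 1, θ => ∃ η : DForm d M p G, IsSmoothForm η ∧ θ = dForm η

end Forms

/-! ### Exterior algebra -/

section Exterior

/-- Wedge product of alternating forms with values in an algebra `A`, in the normalization
`(α ∧ β)(v) = ∑ over (p, q)-shuffles of sign • α(..) * β(..)`. -/
def wedge {V A : Type*} [AddCommGroup V] [Module ℝ V] [Ring A] [Algebra ℝ A] {p q r : ℕ}
    (h : p + q = r) (α : V [⋀^Fin p]→ₗ[ℝ] A) (β : V [⋀^Fin q]→ₗ[ℝ] A) : V [⋀^Fin r]→ₗ[ℝ] A :=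
  ((LinearMap.mul' ℝ A).compAlternatingMap (α.domCoprod β)).domDomCongr
    (finSumFinEquiv.trans (finCongr h))

/-- The `k`-th wedge power of an algebra valued `2`-form. -/
def wedgePow {V A : Type*} [AddCommGroup V] [Module ℝ V] [Ring A] [Algebra ℝ A]
    (α : V [⋀^Fin 2]→ₗ[ℝ] A) : (k : ℕ) → V [⋀^Fin (2 * k)]→ₗ[ℝ] A
  | 0 => AlternatingMap.constOfIsEmpty ℝ V (Fin 0) (1 : A)
  | k + 1 => wedge (by ring) (wedgePow α k) α

theorem continuous_alternating {d p : ℕ} (α : Euc d [⋀^Fin p]→ₗ[ℝ] ℂ) : Continuous α := by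
  classical
  let b := (EuclideanSpace.basisFun (Fin d) ℝ).toBasis
  have key : ∀ v : Fin p → Euc d, α v =
      ∑ r : Fin p → Fin d, (∏ i, b.repr (v i) (r i)) • α (fun i => b (r i)) := by
    intro v
    conv_lhs => rw [show v = fun i => ∑ j, b.repr (v i) j • b j from
      funext fun i => (b.sum_repr (v i)).symm]
    have := α.toMultilinearMap.map_sum (fun i j => b.repr (v i) j • b j)
    simp only [AlternatingMap.coe_multilinearMap] at this
    rw [this]
    refine Finset.sum_congr rfl fun r _ => ?_
    exact α.toMultilinearMap.map_smul_univ _ _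
  rw [show (α : (Fin p → Euc d) → ℂ) = fun v =>
    ∑ r : Fin p → Fin d, (∏ i, b.repr (v i) (r i)) • α (fun i => b (r i)) from funext key]
  refine continuous_finsetSum _ fun r _ => ?_
  refine Continuous.smul (f := fun v : Fin p → Euc d => ∏ i, b.repr (v i) (r i)) ?_
    continuous_const
  refine continuous_finsetProd _ fun i _ => ?_
  exact (LinearMap.continuous_of_finiteDimensional (b.coord (r i))).comp (continuous_apply i)

/-- On a finite dimensional space every alternating form is continuous. -/
def toContinuous {d p : ℕ} (α : Euc d [⋀^Fin p]→ₗ[ℝ] ℂ) : Euc d [⋀^Fin p]→L[ℝ] ℂ :=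
  { α with cont := continuous_alternating α }

/-- The wedge product of complex differential forms. -/
def wedgeForm {d : ℕ} {M : Type*} {p q r : ℕ} (h : p + q = r)
    (α : DForm d M p ℂ) (β : DForm d M q ℂ) : DForm d M r ℂ :=
  fun x => toContinuous (wedge h (α x).toAlternatingMap (β x).toAlternatingMap)

theorem append_update {U W : Type*} {p n : ℕ} [DecidableEq (Fin p)] (ξ : Fin p → U) (j : Fin p)
    (L : U → W) (w : Fin n → W) (c : U) :
    (fun i => Fin.append (fun k => L (Function.update ξ j c k)) w i) =
      Function.update (Fin.append (fun k => L (ξ k)) w) (Fin.castAdd n j) (L c) := by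
  funext i
  refine Fin.addCases (fun k => ?_) (fun k => ?_) i
  · rcases eq_or_ne k j with rfl | hk
    · simp
    · have : Fin.castAdd n k ≠ Fin.castAdd n j := fun h => hk (Fin.castAdd_injective _ _ h)
      simp [hk]
  · have : Fin.natAdd p k ≠ Fin.castAdd n j := by
      intro h
      have := congrArg Fin.val h
      simp at this
      omega
    simp [this]

/-- For `θ` an `r`-form on `W` with `r = p + n`, a linear map `L : U → W` and vectors
`w₁, …, wₙ` of `W`, the `p`-form `(ξ₁, …, ξₚ) ↦ θ(L ξ₁, …, L ξₚ, w₁, …, wₙ)` on `U`. -/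
def contractLast {U W : Type*} [NormedAddCommGroup U] [NormedSpace ℝ U]
    [NormedAddCommGroup W] [NormedSpace ℝ W] {p n r : ℕ} (h : p + n = r)
    (θ : W [⋀^Fin r]→L[ℝ] ℂ) (L : U →L[ℝ] W) (w : Fin n → W) : U [⋀^Fin p]→L[ℝ] ℂ where
  toFun ξ := θ fun i => Fin.append (fun j => L (ξ j)) w (Fin.cast h.symm i)
  map_update_add' := by
    intro _ ξ j a b
    subst h
    have key := append_update ξ j L w
    simp only [Fin.cast_eq_self]
    rw [key, key, key, map_add, θ.map_update_add]
  map_update_smul' := by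
    intro _ ξ j a b
    subst h
    have key := append_update ξ j L w
    simp only [Fin.cast_eq_self]
    rw [key, key, map_smul, θ.map_update_smul]
  map_eq_zero_of_eq' := by
    intro ξ i j hij hne
    subst h
    refine θ.map_eq_zero_of_eq _ (i := Fin.castAdd n i) (j := Fin.castAdd n j) ?_ ?_
    · simp [hij]
    · exact fun h => hne (Fin.castAdd_injective _ _ h)
  cont := by
    subst h
    refine θ.cont.comp (continuous_pi fun i => ?_)
    refine Fin.addCases (fun k => ?_) (fun k => ?_) i
    · simpa [Function.comp_def] using L.continuous.comp (continuous_apply k)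
    · simpa using continuous_const

end Exterior

/-! ### Complex vector bundles with connection -/

section Bundles

/-- A smooth complex vector bundle of finite rank over a `d`-manifold `M`: the local
trivializations are complex linear, and the transition functions are smooth over `ℝ`.
(The real linear structure is the one underlying the complex one.) -/
structure ComplexBundle (d : ℕ) (M : Type*) [TopologicalSpace M] [ChartedSpace (Euc d) M] where
  /-- the model fiber -/
  Model : Type*
  /-- the fibers -/
  Fiber : M → Type*
  [normModel : NormedAddCommGroup Model]
  [spaceModel : NormedSpace ℂ Model]
  [finModel : FiniteDimensional ℂ Model]
  [topTotal : TopologicalSpace (TotalSpace Model Fiber)]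
  [addFiber : ∀ x, AddCommGroup (Fiber x)]
  [modFiber : ∀ x, Module ℂ (Fiber x)]
  [topFiber : ∀ x, TopologicalSpace (Fiber x)]
  [topAddFiber : ∀ x, IsTopologicalAddGroup (Fiber x)]
  [smulFiber : ∀ x, ContinuousSMul ℝ (Fiber x)]
  [fiberBundle : FiberBundle Model Fiber]
  [complexBundle : VectorBundle ℂ Model Fiber]
  [realBundle : VectorBundle ℝ Model Fiber]
  [smoothBundle : ContMDiffVectorBundle ∞ Model Fiber (𝓡 d)]

attribute [instance] ComplexBundle.normModel ComplexBundle.spaceModel ComplexBundle.finModel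
  ComplexBundle.topTotal ComplexBundle.addFiber ComplexBundle.modFiber ComplexBundle.topFiber
  ComplexBundle.topAddFiber ComplexBundle.smulFiber ComplexBundle.fiberBundle
  ComplexBundle.complexBundle ComplexBundle.realBundle ComplexBundle.smoothBundle

variable {d : ℕ} {M : Type*} [TopologicalSpace M] [ChartedSpace (Euc d) M]

/-- Smooth sections of a complex vector bundle. -/
def ComplexBundle.IsSmooth (E : ComplexBundle d M) (σ : ∀ x, E.Fiber x) : Prop :=
  ContMDiff (𝓡 d) ((𝓡 d).prod 𝓘(ℝ, E.Model)) ∞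
    (fun x => (⟨x, σ x⟩ : TotalSpace E.Model E.Fiber))

/-- Smooth vector fields. -/
def IsSmoothField [IsManifold (𝓡 d) ∞ M] (X : ∀ x : M, TangentSpace (𝓡 d) x) : Prop :=
  ContMDiff (𝓡 d) ((𝓡 d).prod 𝓘(ℝ, Euc d)) ∞
    (fun x => (⟨x, X x⟩ : TangentBundle (𝓡 d) M))

theorem ComplexBundle.IsSmooth.add {E : ComplexBundle d M} {σ τ : ∀ x, E.Fiber x}
    (hσ : E.IsSmooth σ) (hτ : E.IsSmooth τ) : E.IsSmooth (σ + τ) :=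
  ContMDiff.add_section hσ hτ

theorem ComplexBundle.isSmooth_zero (E : ComplexBundle d M) :
    E.IsSmooth (0 : ∀ x, E.Fiber x) :=
  contMDiff_zeroSection ℝ E.Fiber

theorem ComplexBundle.IsSmooth.smul {E : ComplexBundle d M} {σ : ∀ x, E.Fiber x} (c : ℂ)
    (hσ : E.IsSmooth σ) : E.IsSmooth (c • σ) := by
  intro x
  have h := hσ x
  rw [contMDiffAt_section] at h ⊢
  have h2 : ContMDiffAt (𝓡 d) 𝓘(ℝ, E.Model) ∞
      (fun y => c • (trivializationAt E.Model E.Fiber x ⟨y, σ y⟩).2) x := by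
    have hc : ContMDiff 𝓘(ℝ, E.Model) 𝓘(ℝ, E.Model) ∞ (fun v : E.Model => c • v) :=
      (contDiff_const_smul c).contMDiff
    exact hc.contMDiffAt.comp x h
  refine h2.congr_of_eventuallyEq ?_
  filter_upwards [(trivializationAt E.Model E.Fiber x).open_baseSet.mem_nhds
    (FiberBundle.mem_baseSet_trivializationAt' x)] with y hy
  exact ((trivializationAt E.Model E.Fiber x).linear ℂ hy).map_smul c (σ y)

variable [IsManifold (𝓡 d) ∞ M]

/-- A smooth connection on a complex vector bundle: a smooth covariant derivative that is complex
linear. -/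
structure Connection (E : ComplexBundle d M) where
  /-- the underlying covariant derivative; `cov σ x u` is `(∇_u σ)(x)` -/
  cov : CovariantDerivative (𝓡 d) E.Model E.Fiber
  smooth : CovariantDerivative.ContMDiffCovariantDerivative cov ∞
  complex_linear : ∀ σ, E.IsSmooth σ → ∀ (x : M) (u : TangentSpace (𝓡 d) x),
    cov (Complex.I • σ) x u = Complex.I • cov σ x u

/-- `R` is the curvature of `∇`:
`R(X, Y) σ = ∇_X ∇_Y σ - ∇_Y ∇_X σ - ∇_[X, Y] σ` for all smooth `X`, `Y`, `σ`. -/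
def Connection.IsCurvature {E : ComplexBundle d M} (D : Connection E)
    (R : ∀ x : M, Euc d [⋀^Fin 2]→ₗ[ℝ] Module.End ℂ (E.Fiber x)) : Prop :=
  ∀ X Y : ∀ x : M, TangentSpace (𝓡 d) x, IsSmoothField X → IsSmoothField Y →
    ∀ σ : ∀ x, E.Fiber x, E.IsSmooth σ → ∀ x : M,
      R x ![X x, Y x] (σ x) =
        D.cov (fun y => D.cov σ y (Y y)) x (X x) - D.cov (fun y => D.cov σ y (X y)) x (Y x)
          - D.cov σ x (VectorField.mlieBracket (𝓡 d) X Y x)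

open scoped Classical in
/-- The curvature of a connection, as an `End(E)`-valued `2`-form: the unique tensor that computes
the commutator of covariant derivatives. -/
def Connection.curvature {E : ComplexBundle d M} (D : Connection E) :
    ∀ x : M, Euc d [⋀^Fin 2]→ₗ[ℝ] Module.End ℂ (E.Fiber x) :=
  if h : ∃ R, D.IsCurvature R then h.choose else 0

/-- The `2k`-form `tr (R^k)`, where `R` is the curvature of the connection and `R^k` its wedge
power in the algebra of `End(E)`-valued forms. -/
def Connection.trPow {E : ComplexBundle d M} (D : Connection E) (k : ℕ) : DForm d M (2 * k) ℂ :=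
  fun x => toContinuous
    (((LinearMap.trace ℂ (E.Fiber x)).restrictScalars ℝ).compAlternatingMap
      (wedgePow (D.curvature x) k))

/-- The degree `2k` component of the Chern character form `tr (exp (c R))`, where `c` is the
normalizing constant (`c = 1`, or `c = i / (2 * Real.pi)` for the topological normalization). -/
def Connection.ch {E : ComplexBundle d M} (D : Connection E) (c : ℂ) (k : ℕ) :
    DForm d M (2 * k) ℂ :=
  (c ^ k / (Nat.factorial k : ℂ)) • D.trPow k

/-- The degree `2k` component of the product form `ch(Ω^{S⁺ - S⁻}) ∪ ch(Ω^K)`, where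
`ch(Ω^{S⁺ - S⁻}) = ch(Ω^{S⁺}) - ch(Ω^{S⁻})`. -/
def superChernProduct {S₁ S₂ K : ComplexBundle d M} (D₁ : Connection S₁) (D₂ : Connection S₂)
    (DK : Connection K) (c : ℂ) (k : ℕ) : DForm d M (2 * k) ℂ :=
  ∑ i : Fin (k + 1), wedgeForm (p := 2 * (i : ℕ)) (q := 2 * (k - i)) (by omega)
    (D₁.ch c i - D₂.ch c i) (DK.ch c (k - i))

/-- A tensor product `E` of the complex vector bundles `S` and `K`: fiberwise a tensor product
over `ℂ`, through a bilinear pairing that is smooth. -/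
structure TensorBundle (S K E : ComplexBundle d M) where
  /-- the universal pairing `(s, k) ↦ s ⊗ k` -/
  tmul : ∀ x, S.Fiber x →ₗ[ℂ] K.Fiber x →ₗ[ℂ] E.Fiber x
  isTensorProduct : ∀ x, IsTensorProduct (tmul x)
  smooth : ∀ s k, S.IsSmooth s → K.IsSmooth k → E.IsSmooth (fun x => tmul x (s x) (k x))

/-- `D` is the tensor product connection `∇^S ⊗ 1 + 1 ⊗ ∇^K`. -/
def TensorBundle.IsTensorConnection {S K E : ComplexBundle d M} (T : TensorBundle S K E)
    (DS : Connection S) (DK : Connection K) (D : Connection E) : Prop :=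
  ∀ s k, S.IsSmooth s → K.IsSmooth k → ∀ (x : M) (u : TangentSpace (𝓡 d) x),
    D.cov (fun y => T.tmul y (s y) (k y)) x u =
      T.tmul x (DS.cov s x u) (k x) + T.tmul x (s x) (DK.cov k x u)

end Bundles

/-! ### Smooth fibrations and integration over the fiber -/

section Fibrations

variable {q m n : ℕ}
  {B : Type*} [TopologicalSpace B] [ChartedSpace (Euc q) B] [IsManifold (𝓡 q) ∞ B]
  {M : Type*} [TopologicalSpace M] [ChartedSpace (Euc m) M] [IsManifold (𝓡 m) ∞ M]

/-- `pr : M → B` is a smooth fiber bundle with typical fiber `Z`. -/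
structure IsSmoothFibration (pr : M → B) (n : ℕ) (Z : Type*) [TopologicalSpace Z]
    [ChartedSpace (Euc n) Z] : Prop where
  smooth : ContMDiff (𝓡 m) (𝓡 q) ∞ pr
  locally_trivial : ∀ b : B, ∃ e : Trivialization Z pr, b ∈ e.baseSet ∧
    ContMDiffOn (𝓡 m) ((𝓡 q).prod (𝓡 n)) ∞ e e.source ∧
    ContMDiffOn ((𝓡 q).prod (𝓡 n)) (𝓡 m) ∞ e.toOpenPartialHomeomorph.symm e.target

/-- An orientation of the fibers of `pr`, varying continuously along `M`, represented by a smooth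
real `n`-form on `M` that restricts to a volume form on every (`n`-dimensional) fiber. Only its
sign on vertical frames is used. -/
structure FiberOrientation (pr : M → B) (n : ℕ) where
  /-- the representing form -/
  form : DForm m M n ℝ
  smooth : IsSmoothForm form
  nonvanishing : ∀ (x : M) (v : Fin n → TangentSpace (𝓡 m) x),
    (∀ j, mfderiv (𝓡 m) (𝓡 q) pr x (v j) = 0) → LinearIndependent ℝ v → form x v ≠ 0

/-- A chosen smooth partition of unity subordinate to the preferred charts. -/
def chartPartition (n : ℕ) (Z : Type*) [TopologicalSpace Z] [T2Space Z] [CompactSpace Z]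
    [ChartedSpace (Euc n) Z] [IsManifold (𝓡 n) ∞ Z] :
    SmoothPartitionOfUnity Z (𝓡 n) Z Set.univ :=
  (SmoothPartitionOfUnity.exists_isSubordinate_chartAt_source (𝓡 n) Z).choose

/-- The integral of a density `δ` with values in `W` over a closed manifold `Z`; a density is given
by its values on `n`-tuples of tangent vectors. It is computed with a partition of unity `ρ`, as the
sum over charts `c` of the Lebesgue integrals of `ρ δ(∂₁, …, ∂ₙ)` in the coordinates of `c`. -/
def integrateDensity {Z : Type*} [TopologicalSpace Z] [T2Space Z] [CompactSpace Z]
    [ChartedSpace (Euc n) Z] [IsManifold (𝓡 n) ∞ Z]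
    {W : Type*} [NormedAddCommGroup W] [NormedSpace ℝ W]
    (δ : ∀ z : Z, (Fin n → TangentSpace (𝓡 n) z) → W) : W :=
  ∑ᶠ z₀ : Z, ∫ y in (extChartAt (𝓡 n) z₀).target,
    chartPartition n Z z₀ ((extChartAt (𝓡 n) z₀).symm y) •
      δ ((extChartAt (𝓡 n) z₀).symm y)
        (fun j => mfderiv 𝓘(ℝ, Euc n) (𝓡 n) (extChartAt (𝓡 n) z₀).symm y
          (EuclideanSpace.single j (1 : ℝ)))

/-- Integration over the fiber. For an `r`-form `θ` on `M` with `r = p + n`, `∫_Z θ` is the `p`-form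
on `B` whose value on `ξ₁, …, ξₚ ∈ T_b B` is the integral over the oriented fiber `Z_b` of the
`n`-form `(w₁, …, wₙ) ↦ θ(ξ̃₁, …, ξ̃ₚ, w₁, …, wₙ)`, with `ξ̃ᵢ` lifts of `ξᵢ` along `Z_b` (the
restriction to `Z_b` does not depend on the lifts). The fiber is parametrized, and the lifts are
taken, by a local trivialization around `b`. -/
def fiberIntegral {pr : M → B} {Z : Type*} [TopologicalSpace Z] [T2Space Z] [CompactSpace Z]
    [ChartedSpace (Euc n) Z] [IsManifold (𝓡 n) ∞ Z]
    (hp : IsSmoothFibration (m := m) (q := q) pr n Z)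
    (o : FiberOrientation (m := m) (q := q) pr n) {p r : ℕ} (h : p + n = r)
    (θ : DForm m M r ℂ) : DForm q B p ℂ := fun b =>
  let Φ : B × Z → M := (hp.locally_trivial b).choose.toOpenPartialHomeomorph.symm
  integrateDensity fun (z : Z) (v : Fin n → TangentSpace (𝓡 n) z) =>
    let w : Fin n → Euc m := fun j => mfderiv (𝓡 n) (𝓡 m) (fun z' => Φ (b, z')) z (v j)
    (SignType.sign (o.form (Φ (b, z)) w) : ℝ) •
      contractLast h (θ (Φ (b, z)))
        (mfderiv (𝓡 q) (𝓡 m) (fun b' => Φ (b', z)) b : Euc q →L[ℝ] Euc m) w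

/-! ### The push-forward bundle and its Bismut connection -/

/-- The horizontal lift of `ξ ∈ T_{pr x} B` to `x`, relative to a family of complements `H` of the
vertical spaces: the vector `u ∈ H x` with `dpr u = ξ`. -/
def horizontalLift (pr : M → B) (H : ∀ x : M, Submodule ℝ (TangentSpace (𝓡 m) x)) (x : M)
    (ξ : TangentSpace (𝓡 q) (pr x)) : TangentSpace (𝓡 m) x :=
  Classical.epsilon fun u => u ∈ H x ∧ mfderiv (𝓡 m) (𝓡 q) pr x u = ξ

/-- A smooth complement `HM` of the vertical bundle `VM = ker pr_*` in `TM`. -/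
structure HorizontalComplement (pr : M → B) where
  /-- the horizontal spaces -/
  H : ∀ x : M, Submodule ℝ (TangentSpace (𝓡 m) x)
  isCompl : ∀ x, IsCompl (H x) (LinearMap.ker (mfderiv (𝓡 m) (𝓡 q) pr x).toLinearMap)
  smooth : ∀ X : ∀ b : B, TangentSpace (𝓡 q) b, IsSmoothField X →
    IsSmoothField fun x => horizontalLift pr H x (X (pr x))

/-- The horizontal lift to a point `z` of the fiber over `b` of a vector `ξ ∈ T_b B`. -/
def HorizontalComplement.lift {pr : M → B} (HM : HorizontalComplement (m := m) (q := q) pr) {b : B}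
    (ξ : TangentSpace (𝓡 q) b) (z : pr ⁻¹' {b}) : TangentSpace (𝓡 m) (z : M) :=
  horizontalLift pr HM.H z ((z.2 : pr z = b).symm ▸ ξ)

variable (E : ComplexBundle m M) (pr : M → B)

/-- Arbitrary sections of `E` over the fiber `Z_b`. -/
abbrev FiberSection (b : B) : Type _ := ∀ z : pr ⁻¹' {b}, E.Fiber z

/-- The fiber `𝓔_b = Γ(E|Z_b)` of `𝓔 = pr_* E`: the smooth sections of `E` over the closed
submanifold `Z_b`, i.e. the restrictions to `Z_b` of smooth sections of `E`. -/
def PushFiber (b : B) : Submodule ℂ (FiberSection E pr b) where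
  carrier := {s | ∃ σ : ∀ x, E.Fiber x, E.IsSmooth σ ∧ ∀ z : pr ⁻¹' {b}, s z = σ z}
  add_mem' := by
    rintro s t ⟨σ, hσ, hs⟩ ⟨τ, hτ, ht⟩
    exact ⟨σ + τ, hσ.add hτ, fun z => by simp [hs z, ht z]⟩
  zero_mem' := ⟨0, E.isSmooth_zero, fun z => by simp⟩
  smul_mem' := by
    rintro c s ⟨σ, hσ, hs⟩
    exact ⟨c • σ, hσ.smul c, fun z => by simp [hs z]⟩

variable {E pr}

/-- The section `r̃` of `E` over `M` defined by a section `r` of `𝓔`: `r̃(x) = r(pr x)(x)`. -/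
def tilde (r : ∀ b : B, FiberSection E pr b) (x : M) : E.Fiber x := r (pr x) ⟨x, rfl⟩

/-- A section `r` of `𝓔` is smooth if `r̃` is a smooth section of `E`. -/
def IsSmoothPush (r : ∀ b : B, FiberSection E pr b) : Prop := E.IsSmooth (tilde r)

theorem IsSmoothPush.mem {r : ∀ b : B, FiberSection E pr b} (hr : IsSmoothPush r) (b : B) :
    r b ∈ PushFiber E pr b :=
  ⟨tilde r, hr, by rintro ⟨z, rfl⟩; rfl⟩

/-- The restriction to `Z_b` of a smooth section of `E`, as an element of `𝓔_b`. -/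
def restrictSection {σ : ∀ x, E.Fiber x} (hσ : E.IsSmooth σ) (b : B) : PushFiber E pr b :=
  ⟨fun z => σ z, σ, hσ, fun _ => rfl⟩

/-- The Bismut connection on `𝓔 = pr_* E`: for `ξ ∈ T_b B` and a section `r` of `𝓔`,
`(∇_ξ r)(z) = (∇^E_{ξ^H} r̃)(z)` for `z ∈ Z_b`. -/
def bismut (D : Connection E) (HM : HorizontalComplement (m := m) (q := q) pr) {b : B}
    (ξ : TangentSpace (𝓡 q) b) (r : ∀ b : B, FiberSection E pr b) : FiberSection E pr b :=
  fun z => D.cov (tilde r) z (HM.lift ξ z)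

/-- The curvature of the Bismut connection,
`Ω(X, Y) r = ∇_X ∇_Y r - ∇_Y ∇_X r - ∇_[X, Y] r`. -/
def bismutCurvature (D : Connection E) (HM : HorizontalComplement (m := m) (q := q) pr)
    (X Y : ∀ b : B, TangentSpace (𝓡 q) b) (r : ∀ b : B, FiberSection E pr b) (b : B) :
    FiberSection E pr b :=
  bismut D HM (X b) (fun b' => bismut D HM (Y b') r)
    - bismut D HM (Y b) (fun b' => bismut D HM (X b') r)
    - bismut D HM (VectorField.mlieBracket (𝓡 q) X Y b) r

variable (E pr) in
/-- An element `(V, s)` of the Lie algebra `𝔤` of the group of automorphisms `(φ, f)` of the bundle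
`E|Z_b → Z_b` (`φ` a diffeomorphism of `Z_b` and `f` linear on fibers, covering `φ`), through its
faithful infinitesimal action on `Γ(E|Z_b)`. Differentiating `σ ↦ f σ φ⁻¹` at the identity shows
that `(V, s)` acts by `σ ↦ s(σ) - dσ(V)`, which is an operator obeying the Leibniz rule
`f σ ↦ f (action on σ) - V(f) σ`; conversely each such operator comes from a linear vector field `s`
on `E|Z_b` covering `V`. -/
structure InfinitesimalAut (b : B) where
  /-- the vector field `V` on `Z_b` -/
  field : ∀ z : pr ⁻¹' {b}, TangentSpace (𝓡 m) (z : M)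
  vertical : ∀ z : pr ⁻¹' {b}, mfderiv (𝓡 m) (𝓡 q) pr (z : M) (field z) = 0
  smooth : ∃ W : ∀ x : M, TangentSpace (𝓡 m) x, IsSmoothField W ∧ ∀ z, field z = W z
  /-- the action on `Γ(E|Z_b)` -/
  act : PushFiber E pr b →ₗ[ℂ] PushFiber E pr b
  leibniz : ∀ f : M → ℂ, ContMDiff (𝓡 m) 𝓘(ℝ, ℂ) ∞ f →
    ∀ s t : PushFiber E pr b, (∀ z : pr ⁻¹' {b}, t.1 z = f z • s.1 z) →
      ∀ z : pr ⁻¹' {b}, (act t).1 z = f z • (act s).1 z - mvfderiv (𝓡 m) f z (field z) • s.1 z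

/-- `A` is the vertical part of `(V, s)` for the splitting `T(E_b) = V(E_b) ⊕ H(E_b)` defined by
`∇^E`. Since the horizontal lift of `V` is `dσ(V) - ∇_V σ` at points of a section `σ`, the vertical
part of `s(σ)` is (action of `(V, s)` on `σ`) `+ ∇_V σ`; it is a fiberwise endomorphism `A`. In other
words `A` is the zeroth order term in the decomposition of the operator `(V, s)` into
`-∇_V` (horizontal) and an endomorphism (vertical). -/
def InfinitesimalAut.IsVerticalPart {b : B} (g : InfinitesimalAut (m := m) (q := q) E pr b)
    (D : Connection E) (A : ∀ z : pr ⁻¹' {b}, Module.End ℂ (E.Fiber z)) : Prop :=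
  ∀ (σ : ∀ x, E.Fiber x) (hσ : E.IsSmooth σ) (z : pr ⁻¹' {b}),
    A z (σ z) = (g.act (restrictSection hσ b)).1 z + D.cov σ z (g.field z)

/-- `g ∈ 𝔤` is the value `Ω(ξ₁, ξ₂)` at `b` of the curvature of the Bismut connection. -/
def IsBismutCurvatureAt (D : Connection E) (HM : HorizontalComplement (m := m) (q := q) pr) {b : B}
    (ξ₁ ξ₂ : TangentSpace (𝓡 q) b) (g : InfinitesimalAut (m := m) (q := q) E pr b) : Prop :=
  ∀ X Y : ∀ b : B, TangentSpace (𝓡 q) b, IsSmoothField X → IsSmoothField Y →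
    X b = ξ₁ → Y b = ξ₂ → ∀ (r : ∀ b : B, FiberSection E pr b) (hr : IsSmoothPush r),
      (g.act ⟨r b, hr.mem b⟩).1 = bismutCurvature D HM X Y r b

/-- The characteristic form `c_k(Ω) = ∫_Z tr ((Ω^v)^k)` of the Bismut connection, in degree
`p = 2k - dim Z`, where `Ω^v = R^E`. -/
def charForm {n : ℕ} {Z : Type*} [TopologicalSpace Z] [T2Space Z] [CompactSpace Z]
    [ChartedSpace (Euc n) Z] [IsManifold (𝓡 n) ∞ Z]
    (hp : IsSmoothFibration (m := m) (q := q) pr n Z)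
    (o : FiberOrientation (m := m) (q := q) pr n) {p k : ℕ} (h : p + n = 2 * k)
    (D : Connection E) : DForm q B p ℂ :=
  fiberIntegral hp o h (D.trPow k)

/-- The Chern character form `∫_Z ch(Ω^v)` of the Bismut connection, in degree `p = 2k - dim Z`,
where `Ω^v = R^E`. -/
def pushChern {n : ℕ} {Z : Type*} [TopologicalSpace Z] [T2Space Z] [CompactSpace Z]
    [ChartedSpace (Euc n) Z] [IsManifold (𝓡 n) ∞ Z]
    (hp : IsSmoothFibration (m := m) (q := q) pr n Z)
    (o : FiberOrientation (m := m) (q := q) pr n) {p k : ℕ} (h : p + n = 2 * k)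
    (D : Connection E) (c : ℂ) : DForm q B p ℂ :=
  fiberIntegral hp o h (D.ch c k)

end Fibrations

end FamiliesChernWeil

end

set_option linter.unusedSectionVars false

noncomputable section
namespace FamiliesChernWeil
-- Shuffle expansion of the wedge product and contraction with a vector
section GradedAlgebra

open Equiv

/-! Curvature of the push-forward. Let `X^H`, `Y^H` be horizontal lifts. The Bismut commutator is
`∇_{X^H} ∇_{Y^H} - ∇_{Y^H} ∇_{X^H} - ∇_{[X,Y]^H}`, and by the definition of the curvature of `E` it
equals `R(X^H, Y^H) + ∇_T` with `T = [X^H, Y^H] - [X, Y]^H` (`bismutOperator_eq`). The lifts are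
`pr`-related to `X` and `Y`, so `T` is vertical (`bracketDefect_vertical`), and `T` at a point
depends only on the values of `X` and `Y` below it (`bracketDefect_congr`). A vertical derivative
sees only the restriction to the fiber (`Connection.cov_eq_zero_of_fiber`), so the operator acts on
one fiber as the infinitesimal automorphism with field `V = -T`, and its zeroth order part is `R`.
The Leibniz rule leaves no other choice of `V` wherever the fiber of `E` is nonzero.

Chern-Weil theory on `M`. In a chart and a frame a connection is `d + A` with curvature `F = dA + A
∧ A`. The Bianchi identity `dF = F A - A F` passes to powers, and the trace kills the commutators,
so `tr F^k` is closed. Along the affine path `A_t = A + t b` one has `d/dt tr F_t^(k+1) = d ((k+1)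
tr (b F_t^k))`; integration over `[0,1]` yields a primitive of the difference of the two forms
(`dForm_transgression`). The signs are handled in a ring `GForm` of families of forms in all
degrees. Its identities are proved by contracting with a vector and inducting on the degree, since
contraction is an antiderivation and determines a form of positive degree.

Fiber integration. The definition picks an unrelated trivialization at each point of the base. The
integrand is a density, because the sign of the orientation form turns determinants into their
absolute values, and it does not change when lifts are altered by vertical vectors. Hence the
integral of a form supported in one fibered chart can be computed with one fixed trivialization near
a given point of the base (`chartForm_fiberIntegral`). There it is a parameter integral: derivatives
along the base pass under the integral sign, and derivatives along the fiber integrate to zero. A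
partition of unity on `Z` reduces every form to this case, so fiber integration preserves smoothness
and commutes with `d` (`isSmoothForm_fiberIntegral`, `dForm_fiberIntegral`). In degree `0` the
integral of an exact form vanishes, which is Stokes on the closed fiber. Applied to `tr R^k` and to
its transgression form, this gives the second claim.

Superbundle. The tensor product connection has curvature `R^S ⊗ 1 + 1 ⊗ R^K`, a sum of commuting
even forms. The binomial theorem and the multiplicativity of the trace on tensor products make the
Chern character form multiplicative (`TensorBundle.ch_eq`); distributivity and the linearity of the
fiber integral finish the third claim. -/

/-- A permutation factors uniquely as one fixing `0` after the cycle that carries `j` to `0`, where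
`j` is the preimage of `0`. The cycle has sign `(-1)^j`, so the sum is sorted by the slot that
receives `x`, as in a Laplace expansion. -/
theorem sum_perm_succ_eq {r : ℕ} {V A : Type*} [AddCommGroup A] (f : (Fin (r + 1) → V) → A)
    (x : V) (w : Fin r → V) :
    ∑ σ : Perm (Fin (r + 1)), Perm.sign σ • f (Fin.cons (α := fun _ => V) x w ∘ σ) =
      ∑ j : Fin (r + 1), (-1 : ℤˣ) ^ (j : ℕ) • ∑ τ : Perm (Fin r),
        Perm.sign τ • f (Fin.insertNth (α := fun _ => V) j x (w ∘ τ)) := by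
  let e : Fin (r + 1) × Perm (Fin r) → Perm (Fin (r + 1)) := fun jτ =>
    Perm.decomposeFin.symm (0, jτ.2) * Fin.cycleRange jτ.1
  have he : Function.Bijective e := by
    refine (Fintype.bijective_iff_injective_and_card e).2 ⟨?_, ?_⟩
    · rintro ⟨j, τ⟩ ⟨j', τ'⟩ h
      have h0 : j = j' := by
        have h1 : (e (j, τ)).symm 0 = (e (j', τ')).symm 0 := by rw [h]
        have aux : ∀ j τ, (e (j, τ)).symm 0 = j := by
          intro j τ
          rw [Equiv.symm_apply_eq]
          simp [e, Perm.decomposeFin_symm_apply_zero]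
        rwa [aux, aux] at h1
      subst h0
      have h2 := mul_right_cancel h
      have h3 := Perm.decomposeFin.symm.injective h2
      simpa using h3
    · simp [Fintype.card_perm, Nat.factorial_succ]
  rw [← (Equiv.ofBijective e he).sum_comp, Fintype.sum_prod_type]
  refine Finset.sum_congr rfl fun j _ => ?_
  rw [Finset.smul_sum]
  refine Finset.sum_congr rfl fun τ _ => ?_
  have hs : Perm.sign (e (j, τ)) = (-1 : ℤˣ) ^ (j : ℕ) * Perm.sign τ := by
    simp only [e, Perm.sign_mul, Fin.sign_cycleRange, Perm.decomposeFin.symm_sign]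
    simp [mul_comm]
  have hf : (Fin.cons (α := fun _ => V) x w) ∘ (e (j, τ)) =
      Fin.insertNth (α := fun _ => V) j x (w ∘ τ) := by
    rw [← Fin.cons_comp_cycleRange]
    funext i
    simp only [e, Function.comp_apply, Perm.coe_mul]
    refine Fin.cases ?_ (fun k => ?_) (Fin.cycleRange j i)
    · simp
    · simp
  simp only [Equiv.ofBijective_apply, hs, hf, mul_smul]

variable {V A : Type*} [AddCommGroup V] [Module ℝ V] [Ring A] [Algebra ℝ A]

/-- Each shuffle is a coset of `S_p × S_q`, on which the signed summand is constant because `α` and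
`β` alternate. Summing over all permutations therefore counts it `p! q!` times. -/
theorem wedge_apply_perm {p q r : ℕ} (h : p + q = r) (α : V [⋀^Fin p]→ₗ[ℝ] A)
    (β : V [⋀^Fin q]→ₗ[ℝ] A) (v : Fin r → V) :
    (p.factorial * q.factorial) • wedge h α β v = ∑ σ : Perm (Fin r), Perm.sign σ •
      (α (fun i => v (σ (Fin.cast h (Fin.castAdd q i)))) *
        β (fun i => v (σ (Fin.cast h (Fin.natAdd p i))))) := by
  subst h
  have key := MultilinearMap.domCoprod_alternization_eq α β
  have key2 := DFunLike.congr_fun key (v ∘ finSumFinEquiv)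
  have key3 := congrArg (LinearMap.mul' ℝ A) key2
  simp only [Fintype.card_fin, AlternatingMap.smul_apply, map_nsmul] at key3
  have e1 : wedge rfl α β v = LinearMap.mul' ℝ A (α.domCoprod β (v ∘ finSumFinEquiv)) := rfl
  rw [e1, ← key3, MultilinearMap.alternatization_apply, map_sum,
    ← (finSumFinEquiv.permCongr).sum_comp]
  refine Finset.sum_congr rfl fun σ _ => ?_
  rw [Equiv.Perm.sign_permCongr]
  simp [MultilinearMap.domCoprod_apply, Function.comp_def]


theorem insertNth_castAdd_castAdd {X : Type*} {p q r : ℕ} (h : p + 1 + q = r + 1) (h' : p + q = r)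
    (i k : Fin (p + 1)) (x : X) (u : Fin r → X) :
    Fin.insertNth (α := fun _ => X) (Fin.cast h (Fin.castAdd q i)) x u
        (Fin.cast h (Fin.castAdd q k)) =
      Fin.insertNth (α := fun _ => X) i x (fun l => u (Fin.cast h' (Fin.castAdd q l))) k := by
  refine Fin.succAboveCases i ?_ (fun l => ?_) k
  · simp
  · have : Fin.cast h (Fin.castAdd q (i.succAbove l)) =
        (Fin.cast h (Fin.castAdd q i)).succAbove (Fin.cast h' (Fin.castAdd q l)) := by
      ext
      simp only [Fin.succAbove, Fin.lt_def, Fin.val_cast, Fin.val_castAdd, Fin.val_castSucc]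
      split_ifs <;> simp
    rw [this, Fin.insertNth_apply_succAbove, Fin.insertNth_apply_succAbove]

theorem insertNth_castAdd_natAdd {X : Type*} {p q r : ℕ} (h : p + 1 + q = r + 1) (h' : p + q = r)
    (i : Fin (p + 1)) (k : Fin q) (x : X) (u : Fin r → X) :
    Fin.insertNth (α := fun _ => X) (Fin.cast h (Fin.castAdd q i)) x u
        (Fin.cast h (Fin.natAdd (p + 1) k)) = u (Fin.cast h' (Fin.natAdd p k)) := by
  have : Fin.cast h (Fin.natAdd (p + 1) k) =
      (Fin.cast h (Fin.castAdd q i)).succAbove (Fin.cast h' (Fin.natAdd p k)) := by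
    ext
    simp only [Fin.succAbove, Fin.lt_def, Fin.val_cast, Fin.val_castAdd, Fin.val_castSucc,
      Fin.val_natAdd]
    split_ifs
    · omega
    · simp; omega
  rw [this, Fin.insertNth_apply_succAbove]

theorem insertNth_natAdd_natAdd {X : Type*} {p q r : ℕ} (h : p + (q + 1) = r + 1) (h' : p + q = r)
    (i k : Fin (q + 1)) (x : X) (u : Fin r → X) :
    Fin.insertNth (α := fun _ => X) (Fin.cast h (Fin.natAdd p i)) x u
        (Fin.cast h (Fin.natAdd p k)) =
      Fin.insertNth (α := fun _ => X) i x (fun l => u (Fin.cast h' (Fin.natAdd p l))) k := by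
  refine Fin.succAboveCases i ?_ (fun l => ?_) k
  · simp
  · have : Fin.cast h (Fin.natAdd p (i.succAbove l)) =
        (Fin.cast h (Fin.natAdd p i)).succAbove (Fin.cast h' (Fin.natAdd p l)) := by
      ext
      simp only [Fin.succAbove, Fin.lt_def, Fin.val_cast, Fin.val_natAdd, Fin.val_castSucc,
        add_lt_add_iff_left]
      split_ifs <;> simp [add_assoc]
    rw [this, Fin.insertNth_apply_succAbove, Fin.insertNth_apply_succAbove]

theorem insertNth_natAdd_castAdd {X : Type*} {p q r : ℕ} (h : p + (q + 1) = r + 1) (h' : p + q = r)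
    (i : Fin (q + 1)) (k : Fin p) (x : X) (u : Fin r → X) :
    Fin.insertNth (α := fun _ => X) (Fin.cast h (Fin.natAdd p i)) x u
        (Fin.cast h (Fin.castAdd (q + 1) k)) = u (Fin.cast h' (Fin.castAdd q k)) := by
  have : Fin.cast h (Fin.castAdd (q + 1) k) =
      (Fin.cast h (Fin.natAdd p i)).succAbove (Fin.cast h' (Fin.castAdd q k)) := by
    ext
    simp only [Fin.succAbove, Fin.lt_def, Fin.val_cast, Fin.val_castAdd, Fin.val_castSucc,
      Fin.val_natAdd]
    split_ifs
    · simp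
    · omega
  rw [this, Fin.insertNth_apply_succAbove]

/-- The part of the expansion of `wedge α β` at `(x, w)` in which `x` is an argument of `α`. -/
def wedgeLeftPart {p q r : ℕ} (h : p + q = r + 1) (α : V [⋀^Fin p]→ₗ[ℝ] A)
    (β : V [⋀^Fin q]→ₗ[ℝ] A) (x : V) (w : Fin r → V) : A :=
  ∑ i : Fin p, (-1 : ℤˣ) ^ (i : ℕ) • ∑ τ : Perm (Fin r), Perm.sign τ •
    (α (fun k => Fin.insertNth (α := fun _ => V) (Fin.cast h (Fin.castAdd q i)) x (w ∘ τ)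
        (Fin.cast h (Fin.castAdd q k))) *
      β (fun k => Fin.insertNth (α := fun _ => V) (Fin.cast h (Fin.castAdd q i)) x (w ∘ τ)
        (Fin.cast h (Fin.natAdd p k))))

/-- The part of the expansion of `wedge α β` at `(x, w)` in which `x` is an argument of `β`. -/
def wedgeRightPart {p q r : ℕ} (h : p + q = r + 1) (α : V [⋀^Fin p]→ₗ[ℝ] A)
    (β : V [⋀^Fin q]→ₗ[ℝ] A) (x : V) (w : Fin r → V) : A :=
  ∑ i : Fin q, (-1 : ℤˣ) ^ (p + i : ℕ) • ∑ τ : Perm (Fin r), Perm.sign τ •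
    (α (fun k => Fin.insertNth (α := fun _ => V) (Fin.cast h (Fin.natAdd p i)) x (w ∘ τ)
        (Fin.cast h (Fin.castAdd q k))) *
      β (fun k => Fin.insertNth (α := fun _ => V) (Fin.cast h (Fin.natAdd p i)) x (w ∘ τ)
        (Fin.cast h (Fin.natAdd p k))))

theorem wedge_cons_eq_parts {p q r : ℕ} (h : p + q = r + 1) (α : V [⋀^Fin p]→ₗ[ℝ] A)
    (β : V [⋀^Fin q]→ₗ[ℝ] A) (x : V) (w : Fin r → V) :
    (p.factorial * q.factorial) • wedge h α β (Fin.cons (α := fun _ => V) x w) =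
      wedgeLeftPart h α β x w + wedgeRightPart h α β x w := by
  rw [wedge_apply_perm]
  refine (sum_perm_succ_eq (fun v : Fin (r + 1) → V => (α (fun i => v (Fin.cast h (Fin.castAdd q i)))
    * β (fun i => v (Fin.cast h (Fin.natAdd p i))))) x w).trans ?_
  rw [← (finCongr h).sum_comp, Fin.sum_univ_add]
  rfl

theorem wedgeLeftPart_zero {q r : ℕ} (h : 0 + q = r + 1) (α : V [⋀^Fin 0]→ₗ[ℝ] A)
    (β : V [⋀^Fin q]→ₗ[ℝ] A) (x : V) (w : Fin r → V) : wedgeLeftPart h α β x w = 0 := by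
  simp [wedgeLeftPart]

theorem wedgeRightPart_zero {p r : ℕ} (h : p + 0 = r + 1) (α : V [⋀^Fin p]→ₗ[ℝ] A)
    (β : V [⋀^Fin 0]→ₗ[ℝ] A) (x : V) (w : Fin r → V) : wedgeRightPart h α β x w = 0 := by
  simp [wedgeRightPart]

theorem neg_one_smul_map_insertNth {W : Type*} [AddCommGroup W] [Module ℝ W] {p : ℕ}
    (α : V [⋀^Fin (p + 1)]→ₗ[ℝ] W) (i : Fin (p + 1)) (x : V)
    (u : Fin p → V) : (-1 : ℤˣ) ^ (i : ℕ) • α (Fin.insertNth (α := fun _ => V) i x u) =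
      α.curryLeft x u := by
  rw [AlternatingMap.curryLeft_apply_apply, ← AlternatingMap.neg_one_pow_smul_map_insertNth α i]
  rcases Nat.even_or_odd (i : ℕ) with hi | hi <;> rw [hi.neg_one_pow, hi.neg_one_pow] <;> simp

/-- The sign `(-1)^i` pays exactly for moving `x` to the front of the arguments of `α`. All `p + 1`
slots then contribute equally, which turns `p!` into `(p + 1)!`. -/
theorem wedgeLeftPart_succ {p q r : ℕ} (h : p + 1 + q = r + 1) (h' : p + q = r)
    (α : V [⋀^Fin (p + 1)]→ₗ[ℝ] A) (β : V [⋀^Fin q]→ₗ[ℝ] A) (x : V) (w : Fin r → V) :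
    wedgeLeftPart h α β x w =
      ((p + 1).factorial * q.factorial) • wedge h' (α.curryLeft x) β w := by
  rw [Nat.factorial_succ, mul_assoc, mul_smul, wedge_apply_perm, wedgeLeftPart]
  rw [Finset.sum_congr rfl (fun i _ => ?_), Finset.sum_const, Finset.card_univ, Fintype.card_fin]
  rw [Finset.smul_sum]
  refine Finset.sum_congr rfl fun τ _ => ?_
  simp only [insertNth_castAdd_castAdd h h', insertNth_castAdd_natAdd h h', Function.comp_apply]
  rw [smul_comm, ← smul_mul_assoc, neg_one_smul_map_insertNth]

theorem wedgeRightPart_succ {p q r : ℕ} (h : p + (q + 1) = r + 1) (h' : p + q = r)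
    (α : V [⋀^Fin p]→ₗ[ℝ] A) (β : V [⋀^Fin (q + 1)]→ₗ[ℝ] A) (x : V) (w : Fin r → V) :
    wedgeRightPart h α β x w = (p.factorial * (q + 1).factorial) •
      ((-1 : ℤˣ) ^ p • wedge h' α (β.curryLeft x) w) := by
  rw [Nat.factorial_succ, mul_left_comm, mul_smul, smul_comm _ ((-1 : ℤˣ) ^ p), wedge_apply_perm,
    wedgeRightPart]
  rw [Finset.sum_congr rfl (fun i _ => ?_), Finset.sum_const, Finset.card_univ, Fintype.card_fin]
  rw [pow_add, mul_smul, Finset.smul_sum]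
  congr 1
  refine Finset.sum_congr rfl fun τ _ => ?_
  simp only [insertNth_natAdd_natAdd h h', insertNth_natAdd_castAdd h h', Function.comp_apply]
  rw [smul_comm, ← mul_smul_comm, neg_one_smul_map_insertNth]

theorem nsmul_factorial_injective {W : Type*} [AddCommGroup W] [Module ℝ W] (p q : ℕ) {a b : W}
    (h : (p.factorial * q.factorial) • a = (p.factorial * q.factorial) • b) : a = b := by
  rw [← Nat.cast_smul_eq_nsmul ℝ, ← Nat.cast_smul_eq_nsmul ℝ] at h
  refine smul_right_injective W (r := ((p.factorial * q.factorial : ℕ) : ℝ)) (by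
    exact_mod_cast (Nat.mul_pos p.factorial_pos q.factorial_pos).ne') h

/-- The wedge product, extended by zero to incompatible degrees. -/
def wedgeTotal (p q r : ℕ) (α : V [⋀^Fin p]→ₗ[ℝ] A) (β : V [⋀^Fin q]→ₗ[ℝ] A) :
    V [⋀^Fin r]→ₗ[ℝ] A :=
  if h : p + q = r then wedge h α β else 0

/-- Contraction is an antiderivation: `x` is fed either to `α`, or to `β` after passing the `p + 1`
slots of `α`. The two following lemmas are the boundary cases in which one factor has degree `0`. -/
theorem curryLeft_wedgeTotal_succ_succ {p q r : ℕ} (h : p + q + 1 = r)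
    (α : V [⋀^Fin (p + 1)]→ₗ[ℝ] A) (β : V [⋀^Fin (q + 1)]→ₗ[ℝ] A) (x : V) :
    (wedgeTotal (p + 1) (q + 1) (r + 1) α β).curryLeft x =
      wedgeTotal p (q + 1) r (α.curryLeft x) β +
        (-1 : ℤˣ) ^ (p + 1) • wedgeTotal (p + 1) q r α (β.curryLeft x) := by
  have h1 : p + 1 + (q + 1) = r + 1 := by omega
  have h2 : p + (q + 1) = r := by omega
  have h3 : p + 1 + q = r := by omega
  ext w
  refine nsmul_factorial_injective (p + 1) (q + 1) ?_
  simp only [wedgeTotal, h1, h2, h3, dite_true, AlternatingMap.curryLeft_apply_apply]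
  have := wedge_cons_eq_parts h1 α β x w
  rw [wedgeLeftPart_succ h1 h2, wedgeRightPart_succ h1 h3, ← smul_add] at this
  exact this

theorem curryLeft_wedgeTotal_succ_zero {p r : ℕ} (h : p = r)
    (α : V [⋀^Fin (p + 1)]→ₗ[ℝ] A) (β : V [⋀^Fin 0]→ₗ[ℝ] A) (x : V) :
    (wedgeTotal (p + 1) 0 (r + 1) α β).curryLeft x = wedgeTotal p 0 r (α.curryLeft x) β := by
  have h1 : p + 1 + 0 = r + 1 := by omega
  have h2 : p + 0 = r := by omega
  ext w
  refine nsmul_factorial_injective (p + 1) 0 ?_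
  rw [wedgeTotal, wedgeTotal, dif_pos h1, dif_pos h2, AlternatingMap.curryLeft_apply_apply]
  have := wedge_cons_eq_parts h1 α β x w
  rw [wedgeLeftPart_succ h1 h2, wedgeRightPart_zero, add_zero] at this
  exact this

theorem curryLeft_wedgeTotal_zero_succ {q r : ℕ} (h : q = r)
    (α : V [⋀^Fin 0]→ₗ[ℝ] A) (β : V [⋀^Fin (q + 1)]→ₗ[ℝ] A) (x : V) :
    (wedgeTotal 0 (q + 1) (r + 1) α β).curryLeft x = wedgeTotal 0 q r α (β.curryLeft x) := by
  have h1 : 0 + (q + 1) = r + 1 := by omega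
  have h2 : 0 + q = r := by omega
  ext w
  refine nsmul_factorial_injective 0 (q + 1) ?_
  rw [wedgeTotal, wedgeTotal, dif_pos h1, dif_pos h2, AlternatingMap.curryLeft_apply_apply]
  have := wedge_cons_eq_parts h1 α β x w
  rw [wedgeRightPart_succ h1 h2, wedgeLeftPart_zero, zero_add, pow_zero, one_smul] at this
  exact this
end GradedAlgebra
end FamiliesChernWeil

end

noncomputable section
namespace FamiliesChernWeil
-- The ring of forms in all degrees
section GradedRing

open Equiv

variable {V A : Type*} [AddCommGroup V] [Module ℝ V]

/-- Families of alternating forms, one in each degree. -/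
def GForm (V A : Type*) [AddCommGroup V] [Module ℝ V] [AddCommGroup A] [Module ℝ A] : Type _ :=
  ∀ p : ℕ, V [⋀^Fin p]→ₗ[ℝ] A

namespace GForm

section Additive

variable [AddCommGroup A] [Module ℝ A]

instance : AddCommGroup (GForm V A) := inferInstanceAs (AddCommGroup (∀ p : ℕ, V [⋀^Fin p]→ₗ[ℝ] A))
instance : Module ℝ (GForm V A) := inferInstanceAs (Module ℝ (∀ p : ℕ, V [⋀^Fin p]→ₗ[ℝ] A))

@[ext] theorem ext {α β : GForm V A} (h : ∀ p, α p = β p) : α = β := funext h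

@[simp] theorem add_apply (α β : GForm V A) (p : ℕ) : (α + β) p = α p + β p := rfl
@[simp] theorem sub_apply (α β : GForm V A) (p : ℕ) : (α - β) p = α p - β p := rfl
@[simp] theorem neg_apply (α : GForm V A) (p : ℕ) : (-α) p = -α p := rfl
@[simp] theorem zero_apply (p : ℕ) : (0 : GForm V A) p = 0 := rfl
@[simp] theorem smul_apply (c : ℝ) (α : GForm V A) (p : ℕ) : (c • α) p = c • α p := rfl

/-- The degree `p` component, as a linear map. -/
def proj (p : ℕ) : GForm V A →ₗ[ℝ] V [⋀^Fin p]→ₗ[ℝ] A where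
  toFun α := α p
  map_add' _ _ := rfl
  map_smul' _ _ := rfl

@[simp] theorem proj_apply (p : ℕ) (α : GForm V A) : proj p α = α p := rfl

/-- A form of degree `p`, as a family of forms. -/
def of (p : ℕ) : (V [⋀^Fin p]→ₗ[ℝ] A) →ₗ[ℝ] GForm V A where
  toFun α := Pi.single (M := fun p => V [⋀^Fin p]→ₗ[ℝ] A) p α
  map_add' α β := Pi.single_add (f := fun p => V [⋀^Fin p]→ₗ[ℝ] A) p α β
  map_smul' c α := Pi.single_smul (f := fun p => V [⋀^Fin p]→ₗ[ℝ] A) p c α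

@[simp] theorem of_same (p : ℕ) (α : V [⋀^Fin p]→ₗ[ℝ] A) : of p α p = α :=
  Pi.single_eq_same (M := fun p => V [⋀^Fin p]→ₗ[ℝ] A) p α

theorem of_ne {p r : ℕ} (h : r ≠ p) (α : V [⋀^Fin p]→ₗ[ℝ] A) : of p α r = 0 :=
  Pi.single_eq_of_ne (M := fun p => V [⋀^Fin p]→ₗ[ℝ] A) h α

/-- Contraction with a vector. -/
def contr (x : V) : GForm V A →ₗ[ℝ] GForm V A where
  toFun α p := (α (p + 1)).curryLeft x
  map_add' _ _ := rfl
  map_smul' _ _ := rfl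

theorem contr_apply (x : V) (α : GForm V A) (p : ℕ) : contr x α p = (α (p + 1)).curryLeft x := rfl

/-- The parity involution. -/
def parity : GForm V A →ₗ[ℝ] GForm V A where
  toFun α p := (-1 : ℤˣ) ^ p • α p
  map_add' _ _ := funext fun _ => smul_add _ _ _
  map_smul' c α := funext fun p => smul_comm ((-1 : ℤˣ) ^ p) c (α p)

theorem parity_apply (α : GForm V A) (p : ℕ) : parity α p = (-1 : ℤˣ) ^ p • α p := rfl

@[simp] theorem parity_parity (α : GForm V A) : parity (parity α) = α := by
  ext p : 1
  rw [parity_apply, parity_apply, smul_smul, ← pow_add, ← two_mul, pow_mul]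
  simp

theorem contr_parity (x : V) (α : GForm V A) : contr x (parity α) = -parity (contr x α) := by
  ext p v
  simp [contr_apply, parity_apply, pow_succ]

theorem parity_contr (x : V) (α : GForm V A) : parity (contr x α) = -contr x (parity α) := by
  rw [contr_parity, neg_neg]

theorem parity_of (p : ℕ) (α : V [⋀^Fin p]→ₗ[ℝ] A) :
    parity (of p α) = (-1 : ℤˣ) ^ p • of p α := by
  ext r : 1
  by_cases h : r = p
  · subst h; simp [parity_apply]
    rw [show ((-1 : ℤˣ) ^ r • of r α) r = (-1 : ℤˣ) ^ r • (of r α r) from rfl, of_same]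
  · rw [parity_apply, show ((-1 : ℤˣ) ^ p • of p α) r = (-1 : ℤˣ) ^ p • (of p α r) from rfl, of_ne h,
      smul_zero, smul_zero]

theorem parity_of_even {p : ℕ} (hp : Even p) (α : V [⋀^Fin p]→ₗ[ℝ] A) :
    parity (of p α) = of p α := by
  rw [parity_of, hp.neg_one_pow, one_smul]

theorem parity_of_odd {p : ℕ} (hp : Odd p) (α : V [⋀^Fin p]→ₗ[ℝ] A) :
    parity (of p α) = -of p α := by
  rw [parity_of, hp.neg_one_pow, Units.neg_smul, one_smul]

/-- The engine of the inductions below: an identity in degree `r + 1` follows from its contractions,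
which live in degree `r`. -/
theorem eq_of_contr_eq {α β : GForm V A} {r : ℕ} (h : ∀ x, contr x α r = contr x β r) :
    α (r + 1) = β (r + 1) := by
  ext v
  have := DFunLike.congr_fun (h (v 0)) (Fin.tail v)
  simp only [contr_apply, AlternatingMap.curryLeft_apply_apply] at this
  rwa [show Matrix.vecCons (v 0) (Fin.tail v) = v from Fin.cons_self_tail v] at this

/-- Apply a linear map to the values. -/
def mapVal {W : Type*} [AddCommGroup W] [Module ℝ W] (φ : A →ₗ[ℝ] W) :
    GForm V A →ₗ[ℝ] GForm V W where
  toFun α p := φ.compAlternatingMap (α p)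
  map_add' α β := funext fun p => AlternatingMap.ext fun v => map_add φ (α p v) (β p v)
  map_smul' c α := funext fun p => AlternatingMap.ext fun v => map_smul φ c (α p v)

theorem mapVal_apply {W : Type*} [AddCommGroup W] [Module ℝ W] (φ : A →ₗ[ℝ] W) (α : GForm V A)
    (p : ℕ) : mapVal φ α p = φ.compAlternatingMap (α p) := rfl

theorem contr_mapVal {W : Type*} [AddCommGroup W] [Module ℝ W] (φ : A →ₗ[ℝ] W) (α : GForm V A)
    (x : V) : contr x (mapVal φ α) = mapVal φ (contr x α) := rfl

/-- The antisymmetrized derivative of a family of forms. -/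
def altDer (f : V →ₗ[ℝ] GForm V A) : GForm V A
  | 0 => 0
  | p + 1 => AlternatingMap.alternatizeUncurryFin (proj p ∘ₗ f)

theorem altDer_zero (f : V →ₗ[ℝ] GForm V A) : altDer f 0 = 0 := rfl
theorem altDer_succ (f : V →ₗ[ℝ] GForm V A) (p : ℕ) :
    altDer f (p + 1) = AlternatingMap.alternatizeUncurryFin (proj p ∘ₗ f) := rfl

theorem altDer_add (f g : V →ₗ[ℝ] GForm V A) : altDer (f + g) = altDer f + altDer g := by
  ext p : 1
  cases p with
  | zero => simp [altDer_zero]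
  | succ p => simp [altDer_succ, LinearMap.comp_add, AlternatingMap.alternatizeUncurryFin_add]

theorem altDer_smul (c : ℝ) (f : V →ₗ[ℝ] GForm V A) : altDer (c • f) = c • altDer f := by
  ext p : 1
  cases p with
  | zero => simp [altDer_zero]
  | succ p => simp [altDer_succ, LinearMap.comp_smul, AlternatingMap.alternatizeUncurryFin_smul]

/-- Cartan's formula `i_x d = L_x - d i_x` for constant `x`, with `f x` in the role of the Lie
derivative: the first summand of the alternating sum differentiates along `x`, the others keep `x`
as an argument. -/
theorem contr_altDer (f : V →ₗ[ℝ] GForm V A) (x : V) :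
    contr x (altDer f) = f x - altDer (contr x ∘ₗ f) := by
  ext p v
  cases p with
  | zero =>
    simp [contr_apply, altDer_succ, altDer_zero, AlternatingMap.alternatizeUncurryFin_apply]
  | succ p =>
    simp only [contr_apply, altDer_succ, AlternatingMap.alternatizeUncurryFin_apply,
      AlternatingMap.curryLeft_apply_apply, sub_apply, AlternatingMap.sub_apply,
      LinearMap.comp_apply, proj_apply]
    rw [Fin.sum_univ_succ]
    simp only [Fin.val_zero, pow_zero, one_smul, Fin.val_succ, pow_succ, mul_neg, mul_one, neg_smul,
      Finset.sum_neg_distrib, sub_eq_add_neg]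
    congr 2
    refine Finset.sum_congr rfl fun i _ => ?_
    congr 2
    ext k
    refine Fin.cases ?_ (fun k => ?_) k
    · simp [Fin.removeNth]
    · simp [Fin.removeNth]

theorem parity_altDer (f : V →ₗ[ℝ] GForm V A) :
    parity (altDer f) = -altDer (parity ∘ₗ f) := by
  ext p : 1
  cases p with
  | zero => simp [altDer_zero, parity_apply]
  | succ p =>
    ext v
    rw [parity_apply, neg_apply, altDer_succ, altDer_succ, AlternatingMap.smul_apply,
      AlternatingMap.neg_apply, AlternatingMap.alternatizeUncurryFin_apply,
      AlternatingMap.alternatizeUncurryFin_apply, Finset.smul_sum, ← Finset.sum_neg_distrib]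
    refine Finset.sum_congr rfl fun i _ => ?_
    rw [pow_succ, mul_neg, mul_one, Units.neg_smul, smul_comm]
    rfl

theorem mapVal_altDer {W : Type*} [AddCommGroup W] [Module ℝ W] (φ : A →ₗ[ℝ] W)
    (f : V →ₗ[ℝ] GForm V A) : mapVal φ (altDer f) = altDer (mapVal φ ∘ₗ f) := by
  ext p : 1
  cases p with
  | zero => ext; simp [altDer_zero, mapVal_apply]
  | succ p =>
    ext v
    simp [altDer_succ, mapVal_apply, AlternatingMap.alternatizeUncurryFin_apply]

end Additive

section Multiplicative

variable [Ring A] [Algebra ℝ A]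

theorem _root_.FamiliesChernWeil.wedge_add_left {p q r : ℕ} (h : p + q = r)
    (α α' : V [⋀^Fin p]→ₗ[ℝ] A) (β : V [⋀^Fin q]→ₗ[ℝ] A) :
    wedge h (α + α') β = wedge h α β + wedge h α' β := by
  ext v
  refine nsmul_factorial_injective p q ?_
  rw [AlternatingMap.add_apply, smul_add, wedge_apply_perm, wedge_apply_perm, wedge_apply_perm]
  simp [add_mul, Finset.sum_add_distrib]

theorem _root_.FamiliesChernWeil.wedge_add_right {p q r : ℕ} (h : p + q = r)
    (α : V [⋀^Fin p]→ₗ[ℝ] A) (β β' : V [⋀^Fin q]→ₗ[ℝ] A) :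
    wedge h α (β + β') = wedge h α β + wedge h α β' := by
  ext v
  refine nsmul_factorial_injective p q ?_
  rw [AlternatingMap.add_apply, smul_add, wedge_apply_perm, wedge_apply_perm, wedge_apply_perm]
  simp [mul_add, Finset.sum_add_distrib]

theorem _root_.FamiliesChernWeil.wedge_smul_left {p q r : ℕ} (h : p + q = r) (c : ℝ)
    (α : V [⋀^Fin p]→ₗ[ℝ] A) (β : V [⋀^Fin q]→ₗ[ℝ] A) :
    wedge h (c • α) β = c • wedge h α β := by
  ext v
  refine nsmul_factorial_injective p q ?_
  rw [AlternatingMap.smul_apply, smul_comm, wedge_apply_perm, wedge_apply_perm, Finset.smul_sum]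
  refine Finset.sum_congr rfl fun σ _ => ?_
  rw [smul_comm c, AlternatingMap.smul_apply, smul_mul_assoc]

theorem _root_.FamiliesChernWeil.wedge_smul_right {p q r : ℕ} (h : p + q = r) (c : ℝ)
    (α : V [⋀^Fin p]→ₗ[ℝ] A) (β : V [⋀^Fin q]→ₗ[ℝ] A) :
    wedge h α (c • β) = c • wedge h α β := by
  ext v
  refine nsmul_factorial_injective p q ?_
  rw [AlternatingMap.smul_apply, smul_comm, wedge_apply_perm, wedge_apply_perm, Finset.smul_sum]
  refine Finset.sum_congr rfl fun σ _ => ?_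
  rw [smul_comm c, AlternatingMap.smul_apply, mul_smul_comm]

/-- The wedge product as a bilinear map, zero in incompatible degrees. -/
def wedgeBilin (p q r : ℕ) :
    (V [⋀^Fin p]→ₗ[ℝ] A) →ₗ[ℝ] (V [⋀^Fin q]→ₗ[ℝ] A) →ₗ[ℝ] (V [⋀^Fin r]→ₗ[ℝ] A) :=
  LinearMap.mk₂ ℝ (wedgeTotal p q r)
    (fun _ _ _ => by unfold wedgeTotal; split_ifs <;> simp [wedge_add_left])
    (fun _ _ _ => by unfold wedgeTotal; split_ifs <;> simp [wedge_smul_left])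
    (fun _ _ _ => by unfold wedgeTotal; split_ifs <;> simp [wedge_add_right])
    (fun _ _ _ => by unfold wedgeTotal; split_ifs <;> simp [wedge_smul_right])

theorem wedgeBilin_apply (p q r : ℕ) (α : V [⋀^Fin p]→ₗ[ℝ] A) (β : V [⋀^Fin q]→ₗ[ℝ] A) :
    wedgeBilin p q r α β = wedgeTotal p q r α β := rfl

/-- The wedge product of families of forms. -/
def mulBilin : GForm V A →ₗ[ℝ] GForm V A →ₗ[ℝ] GForm V A :=
  LinearMap.mk₂ ℝ
    (fun α β r => ∑ ij ∈ Finset.HasAntidiagonal.antidiagonal r, wedgeBilin ij.1 ij.2 r (α ij.1) (β ij.2))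
    (fun α α' β => funext fun r => (Finset.sum_congr rfl (fun ij _ => by
      rw [add_apply, map_add, LinearMap.add_apply])).trans Finset.sum_add_distrib)
    (fun c α β => funext fun r => (Finset.sum_congr rfl (fun ij _ => by
      rw [smul_apply, map_smul, LinearMap.smul_apply])).trans Finset.smul_sum.symm)
    (fun α β β' => funext fun r => (Finset.sum_congr rfl (fun ij _ => by
      rw [add_apply, map_add])).trans Finset.sum_add_distrib)
    (fun c α β => funext fun r => (Finset.sum_congr rfl (fun ij _ => by
      rw [smul_apply, map_smul])).trans Finset.smul_sum.symm)

instance : Mul (GForm V A) := ⟨fun α β => mulBilin α β⟩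

theorem mul_def (α β : GForm V A) : α * β = mulBilin α β := rfl

theorem mul_apply (α β : GForm V A) (r : ℕ) :
    (α * β) r = ∑ ij ∈ Finset.HasAntidiagonal.antidiagonal r, wedgeTotal ij.1 ij.2 r (α ij.1) (β ij.2) := rfl

theorem mul_apply_zero (α β : GForm V A) (v : Fin 0 → V) :
    (α * β) 0 v = α 0 v * β 0 v := by
  have h0 : (0 : ℕ) + 0 = 0 := rfl
  rw [mul_apply, Finset.Nat.antidiagonal_zero, Finset.sum_singleton]
  refine nsmul_factorial_injective 0 0 ?_
  rw [wedgeTotal, dif_pos h0, wedge_apply_perm]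
  simp only [Nat.factorial_zero, one_mul, one_smul, Fintype.sum_unique]
  rw [show Perm.sign (default : Perm (Fin 0)) = 1 from rfl, one_smul]
  congr 2
  all_goals exact Subsingleton.elim _ _

theorem zero_degree_ext {W : Type*} [AddCommGroup W] [Module ℝ W] {α β : V [⋀^Fin 0]→ₗ[ℝ] W}
    (h : α ![] = β ![]) : α = β := by
  ext v
  rw [Subsingleton.elim v ![], h]

theorem curryLeft_sum {ι : Type*} (s : Finset ι) {r : ℕ} (f : ι → V [⋀^Fin (r + 1)]→ₗ[ℝ] A)
    (x : V) : (∑ i ∈ s, f i).curryLeft x = ∑ i ∈ s, (f i).curryLeft x := by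
  classical
  induction s using Finset.induction_on with
  | empty => rfl
  | insert i s hi ih =>
    rw [Finset.sum_insert hi, Finset.sum_insert hi, AlternatingMap.curryLeft_add,
      LinearMap.add_apply, ih]

theorem contr_mul (x : V) (α β : GForm V A) :
    contr x (α * β) = contr x α * β + parity α * contr x β := by
  ext r : 1
  -- `L` and `R` vanish where there is no slot for `x`, so the sum over pairs of total degree `r +
  -- 1` drops to pairs of total degree `r` in each of the two terms.
  let L : ℕ → ℕ → V [⋀^Fin r]→ₗ[ℝ] A := fun p q =>
    match p with
    | 0 => 0
    | p + 1 => wedgeTotal p q r ((α (p + 1)).curryLeft x) (β q)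
  let R : ℕ → ℕ → V [⋀^Fin r]→ₗ[ℝ] A := fun p q =>
    match q with
    | 0 => 0
    | q + 1 => (-1 : ℤˣ) ^ p • wedgeTotal p q r (α p) ((β (q + 1)).curryLeft x)
  have key : ∀ ij ∈ Finset.HasAntidiagonal.antidiagonal (r + 1),
      (wedgeTotal ij.1 ij.2 (r + 1) (α ij.1) (β ij.2)).curryLeft x = L ij.1 ij.2 + R ij.1 ij.2 := by
    rintro ⟨p, q⟩ hpq
    rw [Finset.HasAntidiagonal.mem_antidiagonal] at hpq
    dsimp only at hpq ⊢
    rcases p with _ | p <;> rcases q with _ | q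
    · omega
    · rw [curryLeft_wedgeTotal_zero_succ (by omega)]
      simp [L, R]
    · rw [curryLeft_wedgeTotal_succ_zero (by omega)]
      simp [L, R]
    · rw [curryLeft_wedgeTotal_succ_succ (by omega)]
  rw [contr_apply, mul_apply, curryLeft_sum, Finset.sum_congr rfl key, Finset.sum_add_distrib,
    Finset.Nat.sum_antidiagonal_succ, Finset.Nat.sum_antidiagonal_succ', add_apply, mul_apply,
    mul_apply]
  simp only [L, R, zero_add]
  congr 1
  refine Finset.sum_congr rfl fun ij _ => ?_
  rw [parity_apply, ← wedgeBilin_apply, ← wedgeBilin_apply, contr_apply]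
  rcases Nat.even_or_odd ij.1 with h | h <;> simp [h.neg_one_pow]

instance : One (GForm V A) := ⟨of 0 (AlternatingMap.constOfIsEmpty ℝ V (Fin 0) (1 : A))⟩

theorem one_def : (1 : GForm V A) = of 0 (AlternatingMap.constOfIsEmpty ℝ V (Fin 0) (1 : A)) := rfl

theorem one_apply_zero (v : Fin 0 → V) : (1 : GForm V A) 0 v = 1 := by
  rw [one_def, of_same]; rfl

theorem contr_one (x : V) : contr x (1 : GForm V A) = 0 := by
  ext p : 1
  rw [contr_apply, one_def, of_ne (Nat.succ_ne_zero p)]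
  rfl

theorem parity_one : parity (1 : GForm V A) = 1 := parity_of_even Even.zero _

theorem parity_mul (α β : GForm V A) : parity (α * β) = parity α * parity β := by
  ext r : 1
  rw [parity_apply, mul_apply, mul_apply, Finset.smul_sum]
  refine Finset.sum_congr rfl fun ij h => ?_
  rw [Finset.HasAntidiagonal.mem_antidiagonal] at h
  rw [← h, pow_add, parity_apply, parity_apply, ← wedgeBilin_apply, ← wedgeBilin_apply]
  rcases Nat.even_or_odd ij.1 with h | h <;> rcases Nat.even_or_odd ij.2 with h' | h' <;>
    simp [h.neg_one_pow, h'.neg_one_pow]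

protected theorem one_mul (α : GForm V A) : 1 * α = α := by
  suffices ∀ r, ∀ α : GForm V A, (1 * α) r = α r from ext fun r => this r α
  intro r
  induction r with
  | zero =>
    intro α
    refine zero_degree_ext ?_
    rw [mul_apply_zero, one_apply_zero, _root_.one_mul]
  | succ r ih =>
    intro α
    refine eq_of_contr_eq fun x => ?_
    rw [contr_mul, contr_one, parity_one, mul_def 0, map_zero, LinearMap.zero_apply, zero_add, ih]

protected theorem mul_one (α : GForm V A) : α * 1 = α := by
  suffices ∀ r, ∀ α : GForm V A, (α * 1) r = α r from ext fun r => this r α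
  intro r
  induction r with
  | zero =>
    intro α
    refine zero_degree_ext ?_
    rw [mul_apply_zero, one_apply_zero, _root_.mul_one]
  | succ r ih =>
    intro α
    refine eq_of_contr_eq fun x => ?_
    rw [contr_mul, contr_one, mul_def _ 0, map_zero, add_zero, ih]

protected theorem mul_assoc (α β γ : GForm V A) : α * β * γ = α * (β * γ) := by
  suffices ∀ r, ∀ α β γ : GForm V A, (α * β * γ) r = (α * (β * γ)) r from
    ext fun r => this r α β γ
  intro r
  induction r with
  | zero =>
    intro α β γ
    refine zero_degree_ext ?_
    simp only [mul_apply_zero, _root_.mul_assoc]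
  | succ r ih =>
    intro α β γ
    refine eq_of_contr_eq fun x => ?_
    -- Both bracketings contract to the same three terms, which agree in degree `r` by induction.
    have e1 : contr x (α * β * γ) = contr x α * β * γ + parity α * contr x β * γ +
        parity α * parity β * contr x γ := by
      rw [contr_mul, contr_mul, parity_mul]
      simp only [mul_def, map_add, LinearMap.add_apply]
    have e2 : contr x (α * (β * γ)) = contr x α * (β * γ) + (parity α * (contr x β * γ) +
        parity α * (parity β * contr x γ)) := by
      rw [contr_mul, contr_mul]
      simp only [mul_def, map_add]
    rw [e1, e2]
    simp only [add_apply, ih, add_assoc]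

instance : Ring (GForm V A) :=
  { (inferInstance : AddCommGroup (GForm V A)), (inferInstance : Mul (GForm V A)),
    (inferInstance : One (GForm V A)) with
    left_distrib := fun α β γ => map_add (mulBilin α) β γ
    right_distrib := fun α β γ => by simp only [mul_def, map_add, LinearMap.add_apply]
    zero_mul := fun α => by simp only [mul_def, map_zero, LinearMap.zero_apply]
    mul_zero := fun α => map_zero (mulBilin α)
    mul_assoc := GForm.mul_assoc
    one_mul := GForm.one_mul
    mul_one := GForm.mul_one }

instance : Algebra ℝ (GForm V A) :=
  Algebra.ofModule (fun c α β => by simp only [mul_def, map_smul, LinearMap.smul_apply])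
    (fun c α β => map_smul (mulBilin α) c β)

theorem altDer_mul_right (f : V →ₗ[ℝ] GForm V A) (β : GForm V A) :
    altDer (LinearMap.mulRight ℝ β ∘ₗ f) = altDer f * β := by
  suffices ∀ r, ∀ (f : V →ₗ[ℝ] GForm V A) (β : GForm V A),
      altDer (LinearMap.mulRight ℝ β ∘ₗ f) r = (altDer f * β) r from ext fun r => this r f β
  intro r
  induction r with
  | zero =>
    intro f β
    refine zero_degree_ext ?_
    rw [mul_apply_zero, altDer_zero, altDer_zero]
    simp
  | succ r ih =>
    intro f β
    refine eq_of_contr_eq fun x => ?_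
    have e1 : contr x ∘ₗ LinearMap.mulRight ℝ β ∘ₗ f =
        LinearMap.mulRight ℝ β ∘ₗ (contr x ∘ₗ f) +
          LinearMap.mulRight ℝ (contr x β) ∘ₗ (parity ∘ₗ f) := by
      ext u : 1
      simp [contr_mul]
    rw [contr_altDer, contr_mul, contr_altDer, e1, altDer_add, parity_altDer]
    simp only [sub_apply, add_apply, ih, LinearMap.comp_apply, LinearMap.mulRight_apply, sub_mul,
      neg_mul, neg_apply]
    abel

/-- The parity appears because the direction of differentiation must move past the arguments of the
undifferentiated factor `α`. With `altDer_mul_right` this is the graded Leibniz rule. -/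
theorem altDer_mul_left (α : GForm V A) (f : V →ₗ[ℝ] GForm V A) :
    altDer (LinearMap.mulLeft ℝ α ∘ₗ f) = parity α * altDer f := by
  suffices ∀ r, ∀ (α : GForm V A) (f : V →ₗ[ℝ] GForm V A),
      altDer (LinearMap.mulLeft ℝ α ∘ₗ f) r = (parity α * altDer f) r from ext fun r => this r α f
  intro r
  induction r with
  | zero =>
    intro f β
    refine zero_degree_ext ?_
    rw [mul_apply_zero, altDer_zero, altDer_zero]
    simp
  | succ r ih =>
    intro α f
    refine eq_of_contr_eq fun x => ?_
    have e1 : contr x ∘ₗ LinearMap.mulLeft ℝ α ∘ₗ f =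
        LinearMap.mulLeft ℝ (contr x α) ∘ₗ f +
          LinearMap.mulLeft ℝ (parity α) ∘ₗ (contr x ∘ₗ f) := by
      ext u : 1
      simp [contr_mul]
    rw [contr_altDer, contr_mul, contr_altDer, e1, altDer_add, parity_parity, contr_parity]
    simp only [sub_apply, add_apply, ih, LinearMap.comp_apply, LinearMap.mulLeft_apply, mul_sub,
      neg_mul, neg_apply, parity_parity]
    abel

/-- Graded commutativity under a linear map `φ` that does not see the order of the factors. -/
theorem mapVal_mul_comm {W : Type*} [AddCommGroup W] [Module ℝ W] (φ : A →ₗ[ℝ] W)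
    (S T : Submodule ℝ A) (hφ : ∀ a ∈ S, ∀ b ∈ T, φ (a * b) = φ (b * a)) (r : ℕ) :
    ∀ α β : GForm V A, (∀ p v, α p v ∈ S) → (∀ p v, β p v ∈ T) →
      (parity α = α → mapVal φ (α * β) r = mapVal φ (β * α) r) ∧
      (parity α = -α → mapVal φ (α * β) r = mapVal φ (parity β * α) r) := by
  have hS : ∀ (α : GForm V A) (x : V) (U : Submodule ℝ A), (∀ p v, α p v ∈ U) →
      ∀ p v, contr x α p v ∈ U := fun α x U h p v => h _ _
  have hP : ∀ (α : GForm V A) (U : Submodule ℝ A), (∀ p v, α p v ∈ U) →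
      ∀ p v, parity α p v ∈ U := by
    intro α U h p v
    rw [parity_apply]
    rcases Nat.even_or_odd p with hp | hp <;> simp [hp.neg_one_pow, h]
  -- Contraction exchanges even and odd `α`, so the two statements are carried through one
  -- induction. It also keeps the values in `S` and `T`, which allows both a trace on all of `A` and
  -- the identity on two commuting subalgebras.
  induction r with
  | zero =>
    intro α β hα hβ
    refine ⟨fun _ => zero_degree_ext ?_, fun _ => zero_degree_ext ?_⟩
    · simp only [mapVal_apply, LinearMap.compAlternatingMap_apply, mul_apply_zero]
      exact hφ _ (hα _ _) _ (hβ _ _)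
    · simp only [mapVal_apply, LinearMap.compAlternatingMap_apply, mul_apply_zero]
      rw [hφ _ (hα _ _) _ (hβ _ _), parity_apply, pow_zero, one_smul]
  | succ r ih =>
    intro α β hα hβ
    refine ⟨fun hp => eq_of_contr_eq fun x => ?_, fun hp => eq_of_contr_eq fun x => ?_⟩
    · have h1 : parity (contr x α) = -contr x α := by rw [parity_contr, hp]
      rw [contr_mapVal, contr_mapVal, contr_mul, contr_mul, hp, map_add, map_add, add_apply,
        add_apply, (ih _ _ (hS α x S hα) hβ).2 h1, (ih _ _ hα (hS β x T hβ)).1 hp, add_comm]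
    · have h1 : parity (contr x α) = contr x α := by rw [parity_contr, hp, map_neg, neg_neg]
      rw [contr_mapVal, contr_mapVal, contr_mul, contr_mul, hp, map_add, map_add, add_apply,
        add_apply, (ih _ _ (hS α x S hα) hβ).1 h1, parity_parity, neg_mul, map_neg, neg_apply,
        (ih _ _ hα (hS β x T hβ)).2 hp, contr_parity, neg_mul, map_neg, neg_apply, add_comm]

theorem of_mul_of {p q r : ℕ} (h : p + q = r) (α : V [⋀^Fin p]→ₗ[ℝ] A) (β : V [⋀^Fin q]→ₗ[ℝ] A) :
    of p α * of q β = of r (wedge h α β) := by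
  ext s : 1
  rw [mul_apply]
  by_cases hs : s = r
  · subst hs
    rw [Finset.sum_eq_single (p, q)]
    · rw [of_same, of_same, of_same, wedgeTotal, dif_pos h]
    · rintro ⟨p', q'⟩ h1 h2
      rw [Finset.HasAntidiagonal.mem_antidiagonal] at h1
      rw [← wedgeBilin_apply]
      by_cases hp : p' = p
      · have hq : q' ≠ q := fun hq => h2 (by rw [hp, hq])
        rw [of_ne hq, map_zero]
      · rw [of_ne hp, map_zero, LinearMap.zero_apply]
    · intro h1
      exact absurd (Finset.HasAntidiagonal.mem_antidiagonal.2 h) h1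
  · rw [of_ne hs]
    refine Finset.sum_eq_zero ?_
    rintro ⟨p', q'⟩ h1
    rw [Finset.HasAntidiagonal.mem_antidiagonal] at h1
    rw [← wedgeBilin_apply]
    by_cases hp : p' = p
    · have hq : q' ≠ q := by
        rintro rfl
        subst hp
        exact hs (h1.symm.trans h)
      rw [of_ne hq, map_zero]
    · rw [of_ne hp, map_zero, LinearMap.zero_apply]

/-- This makes ring identities in `GForm`, such as the binomial theorem, available for `wedgePow`.
-/
theorem of_pow (α : V [⋀^Fin 2]→ₗ[ℝ] A) (k : ℕ) : of 2 α ^ k = of (2 * k) (wedgePow α k) := by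
  induction k with
  | zero => rfl
  | succ k ih => rw [pow_succ, ih, of_mul_of (r := 2 * (k + 1)) (by ring)]; rfl

end Multiplicative

end GForm

/-- Wedge products are natural with respect to linear maps of the values. -/
theorem wedge_map {A B C D : Type*} [Ring C] [Algebra ℝ C] [Ring D] [Algebra ℝ D]
    [AddCommGroup A] [Module ℝ A] [AddCommGroup B] [Module ℝ B]
    (φ : C →ₗ[ℝ] D) (i₁ : A →ₗ[ℝ] C) (i₂ : B →ₗ[ℝ] C) (j₁ : A →ₗ[ℝ] D) (j₂ : B →ₗ[ℝ] D)
    (h : ∀ a b, φ (i₁ a * i₂ b) = j₁ a * j₂ b) {p q r : ℕ} (hr : p + q = r)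
    (α : V [⋀^Fin p]→ₗ[ℝ] A) (β : V [⋀^Fin q]→ₗ[ℝ] B) :
    φ.compAlternatingMap (wedge hr (i₁.compAlternatingMap α) (i₂.compAlternatingMap β)) =
      wedge hr (j₁.compAlternatingMap α) (j₂.compAlternatingMap β) := by
  ext v
  refine nsmul_factorial_injective p q ?_
  rw [wedge_apply_perm, LinearMap.compAlternatingMap_apply, ← map_nsmul, wedge_apply_perm, map_sum]
  refine Finset.sum_congr rfl fun σ _ => ?_
  rcases Int.units_eq_one_or (Perm.sign σ) with h1 | h1 <;> simp [h1, h]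

theorem wedge_compLinearMap {U : Type*} [AddCommGroup U] [Module ℝ U] [Ring A] [Algebra ℝ A]
    {p q r : ℕ} (hr : p + q = r) (α : V [⋀^Fin p]→ₗ[ℝ] A) (β : V [⋀^Fin q]→ₗ[ℝ] A)
    (L : U →ₗ[ℝ] V) :
    wedge hr (α.compLinearMap L) (β.compLinearMap L) = (wedge hr α β).compLinearMap L := by
  ext v
  refine nsmul_factorial_injective p q ?_
  rw [wedge_apply_perm, AlternatingMap.compLinearMap_apply, wedge_apply_perm]
  rfl

theorem wedgePow_map {A B : Type*} [Ring A] [Algebra ℝ A] [Ring B] [Algebra ℝ B] (φ : A →ₐ[ℝ] B)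
    (α : V [⋀^Fin 2]→ₗ[ℝ] A) (k : ℕ) :
    wedgePow (φ.toLinearMap.compAlternatingMap α) k =
      φ.toLinearMap.compAlternatingMap (wedgePow α k) := by
  induction k with
  | zero => ext; simp [wedgePow]
  | succ k ih =>
    rw [wedgePow, wedgePow, ih]
    exact (wedge_map φ.toLinearMap LinearMap.id LinearMap.id φ.toLinearMap φ.toLinearMap
      (fun a b => map_mul φ a b) _ _ _).symm

theorem wedgePow_compLinearMap {U : Type*} [AddCommGroup U] [Module ℝ U] [Ring A] [Algebra ℝ A]
    (α : V [⋀^Fin 2]→ₗ[ℝ] A) (L : U →ₗ[ℝ] V) (k : ℕ) :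
    wedgePow (α.compLinearMap L) k = (wedgePow α k).compLinearMap L := by
  induction k with
  | zero => rfl
  | succ k ih => rw [wedgePow, wedgePow, ih, wedge_compLinearMap]

end GradedRing
end FamiliesChernWeil

end

noncomputable section
namespace FamiliesChernWeil
-- Differentiation under the integral sign over a compact set
section ParametricIntegral

variable {P Y : Type} [NormedAddCommGroup P] [NormedSpace ℝ P] [FiniteDimensional ℝ P]
  [NormedAddCommGroup Y] [NormedSpace ℝ Y] [MeasurableSpace Y] [BorelSpace Y]
  [SecondCountableTopology Y] {μ : Measure Y} [IsFiniteMeasureOnCompacts μ]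

/-- The partial derivative of `f` in the first variable. -/
def fderivFst {W : Type} [NormedAddCommGroup W] [NormedSpace ℝ W] (f : P × Y → W) (z : P × Y) :
    P →L[ℝ] W := (fderiv ℝ f z).comp (ContinuousLinearMap.inl ℝ P Y)

theorem contDiffOn_fderivFst {W : Type} [NormedAddCommGroup W] [NormedSpace ℝ W] {f : P × Y → W}
    {U : Set P} (hU : IsOpen U) (hf : ContDiffOn ℝ ∞ f (U ×ˢ Set.univ)) :
    ContDiffOn ℝ ∞ (fderivFst f) (U ×ˢ Set.univ) := by
  have h := ((contDiffOn_infty_iff_fderiv_of_isOpen (hU.prod isOpen_univ)).1 hf).2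
  exact h.clm_comp contDiffOn_const

theorem hasFDerivAt_fst {W : Type} [NormedAddCommGroup W] [NormedSpace ℝ W] {f : P × Y → W}
    {U : Set P} (hU : IsOpen U) (hf : ContDiffOn ℝ ∞ f (U ×ˢ Set.univ)) {x : P} (hx : x ∈ U)
    (y : Y) : HasFDerivAt (fun x => f (x, y)) (fderivFst f (x, y)) x := by
  have h1 : DifferentiableAt ℝ f (x, y) :=
    ((hf.differentiableOn (by simp)) (x, y) ⟨hx, trivial⟩).differentiableAt
      ((hU.prod isOpen_univ).mem_nhds ⟨hx, trivial⟩)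
  exact h1.hasFDerivAt.comp x (hasFDerivAt_prodMk_left x y)

/-- Dominated differentiation: the partial derivative is continuous, hence bounded on the compact
product of a small closed ball and `K`, and constants are integrable over `K`. -/
theorem hasFDerivAt_setIntegral_compact {W : Type} [NormedAddCommGroup W] [NormedSpace ℝ W]
    {f : P × Y → W} {U : Set P} (hU : IsOpen U)
    (hf : ContDiffOn ℝ ∞ f (U ×ˢ Set.univ)) {K : Set Y} (hK : IsCompact K) {x : P} (hx : x ∈ U) :
    HasFDerivAt (fun x => ∫ y in K, f (x, y) ∂μ) (∫ y in K, fderivFst f (x, y) ∂μ) x := by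
  have hslice : ∀ {W' : Type} [NormedAddCommGroup W'] [NormedSpace ℝ W'] {g : P × Y → W'},
      ContDiffOn ℝ ∞ g (U ×ˢ Set.univ) → ∀ x ∈ U, Continuous fun y => g (x, y) := by
    intro W' _ _ g hg x hx
    exact hg.continuousOn.comp_continuous (by fun_prop) fun y => ⟨hx, trivial⟩
  obtain ⟨ε, hε, hball⟩ := Metric.isOpen_iff.1 hU x hx
  have hc : IsCompact (Metric.closedBall x (ε / 2)) := isCompact_closedBall x (ε / 2)
  have hsub : Metric.closedBall x (ε / 2) ⊆ U :=
    (Metric.closedBall_subset_ball (by linarith)).trans hball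
  have hf' := contDiffOn_fderivFst hU hf
  obtain ⟨C, hC⟩ := (hc.prod hK).exists_bound_of_continuousOn
    (hf'.continuousOn.mono (Set.prod_mono hsub (Set.subset_univ _)))
  have : IsFiniteMeasure (μ.restrict K) := ⟨by simpa using hK.measure_lt_top⟩
  refine hasFDerivAt_integral_of_dominated_of_fderiv_le (bound := fun _ => C)
    (s := Metric.closedBall x (ε / 2)) (F' := fun x y => fderivFst f (x, y))
    (Metric.closedBall_mem_nhds x (by linarith)) ?_ ?_ ?_ ?_ ?_ ?_
  · filter_upwards [hU.mem_nhds hx] with x' hx'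
    exact (hslice hf x' hx').aestronglyMeasurable
  · exact (hslice hf x hx).continuousOn.integrableOn_compact hK
  · exact (hslice hf' x hx).aestronglyMeasurable
  · refine (ae_restrict_mem hK.measurableSet).mono fun y hy x' hx' => hC (x', y) ⟨hx', hy⟩
  · exact integrable_const C
  · exact Filter.Eventually.of_forall fun y x' hx' => hasFDerivAt_fst hU hf (hsub hx') y

theorem contDiffOn_setIntegral_compact {U : Set P} (hU : IsOpen U) {K : Set Y} (hK : IsCompact K)
    {W : Type} [NormedAddCommGroup W] [NormedSpace ℝ W]
    {f : P × Y → W} (hf : ContDiffOn ℝ ∞ f (U ×ˢ Set.univ)) :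
    ContDiffOn ℝ ∞ (fun x => ∫ y in K, f (x, y) ∂μ) U := by
  rw [contDiffOn_infty]
  intro k
  -- The derivative is an integral of the same kind with values in `P →L[ℝ] W`, so the target space
  -- has to vary.
  induction k generalizing W with
  | zero =>
    refine contDiffOn_zero.2 fun x hx => ?_
    exact (hasFDerivAt_setIntegral_compact hU hf hK hx).continuousAt.continuousWithinAt
  | succ k ih =>
    push_cast
    refine (contDiffOn_succ_iff_fderiv_of_isOpen hU).2 ⟨fun x hx => ?_, by simp, ?_⟩
    · exact (hasFDerivAt_setIntegral_compact hU hf hK hx).differentiableAt.differentiableWithinAt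
    · refine (ih (contDiffOn_fderivFst hU hf)).congr fun x hx => ?_
      exact (hasFDerivAt_setIntegral_compact hU hf hK hx).fderiv

end ParametricIntegral

/-! ### Differentiating families of forms entry by entry -/

section FormCalculus

open GForm

variable {P V W W' A : Type*} [NormedAddCommGroup P] [NormedSpace ℝ P] [AddCommGroup V] [Module ℝ V]
  [NormedAddCommGroup W] [NormedSpace ℝ W] [NormedAddCommGroup W'] [NormedSpace ℝ W']
  [NormedRing A] [NormedAlgebra ℝ A]

/-- `θ'` is the derivative at `x` of the family of forms `θ`, tested on all tuples of vectors. -/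
def HasGDeriv (θ : P → GForm V W) (θ' : P →ₗ[ℝ] GForm V W) (x : P) : Prop :=
  ∀ p v, ∃ L : P →L[ℝ] W, (∀ u, L u = θ' u p v) ∧ HasFDerivAt (fun y => θ y p v) L x

/-- `θ` is a smooth family of forms, tested on all tuples of vectors. -/
def GSmoothOn (θ : P → GForm V W) (U : Set P) : Prop :=
  ∀ p v, ContDiffOn ℝ ∞ (fun y => θ y p v) U

theorem HasGDeriv.add {θ η : P → GForm V W} {θ' η' : P →ₗ[ℝ] GForm V W} {x : P}
    (h₁ : HasGDeriv θ θ' x) (h₂ : HasGDeriv η η' x) :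
    HasGDeriv (fun y => θ y + η y) (θ' + η') x := by
  intro p v
  obtain ⟨L₁, e₁, d₁⟩ := h₁ p v
  obtain ⟨L₂, e₂, d₂⟩ := h₂ p v
  exact ⟨L₁ + L₂, fun u => by simp [e₁, e₂], d₁.add d₂⟩

theorem GSmoothOn.add {θ η : P → GForm V W} {U : Set P} (h₁ : GSmoothOn θ U) (h₂ : GSmoothOn η U) :
    GSmoothOn (fun y => θ y + η y) U := fun p v => (h₁ p v).add (h₂ p v)

theorem hasGDeriv_const (α : GForm V W) (x : P) : HasGDeriv (fun _ => α) 0 x :=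
  fun p v => ⟨0, fun u => by simp, hasFDerivAt_const _ _⟩

theorem gSmoothOn_const (α : GForm V W) (U : Set P) : GSmoothOn (fun _ : P => α) U :=
  fun _ _ => contDiffOn_const

theorem wedge_apply_smul {p q r : ℕ} (h : p + q = r) (α : V [⋀^Fin p]→ₗ[ℝ] A)
    (β : V [⋀^Fin q]→ₗ[ℝ] A) (v : Fin r → V) :
    wedge h α β v = ((p.factorial * q.factorial : ℕ) : ℝ)⁻¹ • ∑ σ : Equiv.Perm (Fin r),
      Equiv.Perm.sign σ • (α (fun i => v (σ (Fin.cast h (Fin.castAdd q i)))) *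
        β (fun i => v (σ (Fin.cast h (Fin.natAdd p i))))) := by
  rw [← wedge_apply_perm, ← Nat.cast_smul_eq_nsmul ℝ, smul_smul, inv_mul_cancel₀, one_smul]
  exact_mod_cast (Nat.mul_pos p.factorial_pos q.factorial_pos).ne'

/-- A value of the product is a finite real combination of products of values of the factors, so the
product rules in `A` give the product rules for families of forms. -/
theorem GForm.mul_apply_smul (α β : GForm V A) (r : ℕ) (v : Fin r → V) :
    (α * β) r v = ∑ ij : {ij // ij ∈ Finset.HasAntidiagonal.antidiagonal r},
      ((ij.1.1.factorial * ij.1.2.factorial : ℕ) : ℝ)⁻¹ • ∑ σ : Equiv.Perm (Fin r),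
      ((Equiv.Perm.sign σ : ℤ) : ℝ) • (α ij.1.1 (fun i => v (σ (Fin.cast
          (Finset.HasAntidiagonal.mem_antidiagonal.1 ij.2) (Fin.castAdd ij.1.2 i)))) *
        β ij.1.2 (fun i => v (σ (Fin.cast
          (Finset.HasAntidiagonal.mem_antidiagonal.1 ij.2) (Fin.natAdd ij.1.1 i))))) := by
  rw [GForm.mul_apply, ← Finset.sum_coe_sort]
  have aux : ∀ (ι : Type) (s : Finset ι) (f : ι → V [⋀^Fin r]→ₗ[ℝ] A),
      (∑ i ∈ s, f i) v = ∑ i ∈ s, f i v := by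
    intro ι s f
    classical
    induction s using Finset.induction_on with
    | empty => rfl
    | insert i s hi ih => rw [Finset.sum_insert hi, Finset.sum_insert hi, AlternatingMap.add_apply, ih]
  rw [aux]
  refine Finset.sum_congr rfl fun ij _ => ?_
  have h := Finset.HasAntidiagonal.mem_antidiagonal.1 ij.2
  rw [wedgeTotal, dif_pos h, wedge_apply_smul]
  congr 1
  refine Finset.sum_congr rfl fun σ _ => ?_
  rw [Int.cast_smul_eq_zsmul]
  rfl

theorem GSmoothOn.mul {θ η : P → GForm V A} {U : Set P} (h₁ : GSmoothOn θ U) (h₂ : GSmoothOn η U) :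
    GSmoothOn (fun y => θ y * η y) U := by
  intro r v
  simp only [GForm.mul_apply_smul]
  refine ContDiffOn.sum fun ij _ => ContDiffOn.const_smul _ (ContDiffOn.sum fun σ _ =>
    ContDiffOn.const_smul _ ?_)
  exact (h₁ _ _).mul (h₂ _ _)

theorem HasGDeriv.mul {θ η : P → GForm V A} {θ' η' : P →ₗ[ℝ] GForm V A} {x : P}
    (h₁ : HasGDeriv θ θ' x) (h₂ : HasGDeriv η η' x) :
    HasGDeriv (fun y => θ y * η y)
      (LinearMap.mulRight ℝ (η x) ∘ₗ θ' + LinearMap.mulLeft ℝ (θ x) ∘ₗ η') x := by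
  choose L₁ e₁ d₁ using h₁
  choose L₂ e₂ d₂ using h₂
  intro r v
  simp only [GForm.mul_apply_smul]
  have key : ∀ (ij : {ij // ij ∈ Finset.HasAntidiagonal.antidiagonal r})
      (σ : Equiv.Perm (Fin r)), _ := fun ij σ =>
    ((d₁ ij.1.1 (fun i => v (σ (Fin.cast
          (Finset.HasAntidiagonal.mem_antidiagonal.1 ij.2) (Fin.castAdd ij.1.2 i))))).mul'
      (d₂ ij.1.2 (fun i => v (σ (Fin.cast
          (Finset.HasAntidiagonal.mem_antidiagonal.1 ij.2) (Fin.natAdd ij.1.1 i))))))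
  refine ⟨_, fun u => ?_, HasFDerivAt.fun_sum fun ij _ => HasFDerivAt.fun_const_smul
    (HasFDerivAt.fun_sum fun σ _ => HasFDerivAt.fun_const_smul (key ij σ) _) _⟩
  simp only [LinearMap.add_apply, LinearMap.comp_apply, LinearMap.mulRight_apply,
    LinearMap.mulLeft_apply, GForm.add_apply, AlternatingMap.add_apply, GForm.mul_apply_smul,
    _root_.sum_apply, _root_.smul_apply, _root_.add_apply, e₁, e₂]
  rw [← Finset.sum_add_distrib]
  refine Finset.sum_congr rfl fun ij _ => ?_
  rw [← smul_add, ← Finset.sum_add_distrib]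
  congr 1
  refine Finset.sum_congr rfl fun σ _ => ?_
  rw [← smul_add, add_comm]
  congr 1

theorem HasGDeriv.mapVal {θ : P → GForm V W} {θ' : P →ₗ[ℝ] GForm V W} {x : P}
    (h : HasGDeriv θ θ' x) (φ : W →L[ℝ] W') :
    HasGDeriv (fun y => GForm.mapVal (φ : W →ₗ[ℝ] W') (θ y)) (GForm.mapVal (φ : W →ₗ[ℝ] W') ∘ₗ θ')
      x := by
  intro p v
  obtain ⟨L, e, d⟩ := h p v
  exact ⟨φ.comp L, fun u => by simp [e, GForm.mapVal_apply], φ.hasFDerivAt.comp x d⟩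

theorem GSmoothOn.mapVal {θ : P → GForm V W} {U : Set P} (h : GSmoothOn θ U) (φ : W →L[ℝ] W') :
    GSmoothOn (fun y => GForm.mapVal (φ : W →ₗ[ℝ] W') (θ y)) U :=
  fun p v => φ.contDiff.comp_contDiffOn (h p v)

/-- The derivative of the `k`-th power of a family of forms. -/
def powDeriv (F : GForm V A) (F' : P →ₗ[ℝ] GForm V A) : ℕ → (P →ₗ[ℝ] GForm V A)
  | 0 => 0
  | k + 1 => LinearMap.mulRight ℝ F ∘ₗ powDeriv F F' k + LinearMap.mulLeft ℝ (F ^ k) ∘ₗ F'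

theorem HasGDeriv.pow {θ : P → GForm V A} {θ' : P →ₗ[ℝ] GForm V A} {x : P}
    (h : HasGDeriv θ θ' x) (k : ℕ) : HasGDeriv (fun y => θ y ^ k) (powDeriv (θ x) θ' k) x := by
  induction k with
  | zero => simpa using! hasGDeriv_const (1 : GForm V A) x
  | succ k ih => simpa only [pow_succ] using! ih.mul h

theorem GSmoothOn.pow {θ : P → GForm V A} {U : Set P} (h : GSmoothOn θ U) (k : ℕ) :
    GSmoothOn (fun y => θ y ^ k) U := by
  induction k with
  | zero => simpa using! gSmoothOn_const (1 : GForm V A) U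
  | succ k ih => simpa only [pow_succ] using! ih.mul h

end FormCalculus
end FamiliesChernWeil

end

noncomputable section
namespace FamiliesChernWeil
namespace GForm
-- Algebraic Chern-Weil theory: Bianchi, cyclicity of the trace, transgression
section ChernWeilAlgebra

variable {V A W : Type*} [AddCommGroup V] [Module ℝ V] [Ring A] [Algebra ℝ A]
  [AddCommGroup W] [Module ℝ W]

/-- `altDer` as a linear map. -/
def altDerLM (V W : Type*) [AddCommGroup V] [Module ℝ V] [AddCommGroup W] [Module ℝ W] :
    (V →ₗ[ℝ] GForm V W) →ₗ[ℝ] GForm V W where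
  toFun := altDer
  map_add' := altDer_add
  map_smul' := altDer_smul

@[simp] theorem altDerLM_apply (f : V →ₗ[ℝ] GForm V W) : altDerLM V W f = altDer f := rfl

/-- This is `d² = 0`. After contraction with `x`, Cartan's formula produces `d (f x)` twice with
opposite signs, by symmetry; the rest is the same statement for the contracted family. -/
theorem altDer_altDer_of_symm (f : V →ₗ[ℝ] V →ₗ[ℝ] GForm V W) (hf : ∀ u w, f u w = f w u) :
    altDer (altDerLM V W ∘ₗ f) = 0 := by
  suffices ∀ r, ∀ f : V →ₗ[ℝ] V →ₗ[ℝ] GForm V W, (∀ u w, f u w = f w u) →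
      altDer (altDerLM V W ∘ₗ f) r = 0 from ext fun r => this r f hf
  intro r
  induction r with
  | zero => intro f _; rfl
  | succ r ih =>
    intro f hf
    rw [← zero_apply]
    refine eq_of_contr_eq fun x => ?_
    let g : V →ₗ[ℝ] V →ₗ[ℝ] GForm V W := LinearMap.compr₂ f (contr x)
    have e : contr x ∘ₗ altDerLM V W ∘ₗ f = f x - altDerLM V W ∘ₗ g := by
      ext u : 1
      simp only [LinearMap.comp_apply, altDerLM_apply, contr_altDer, LinearMap.sub_apply, hf u x]
      rfl
    rw [contr_altDer, e, LinearMap.comp_apply, altDerLM_apply, sub_eq_add_neg (f x), altDer_add,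
      ← neg_one_smul ℝ, altDer_smul, sub_apply, add_apply, smul_apply,
      ih g (fun u w => by simp [g, hf u w])]
    simp

/-- The Bianchi identity. -/
theorem altDer_curvature {a : GForm V A} (ha : parity a = -a) (a' : V →ₗ[ℝ] GForm V A)
    (a'' : V →ₗ[ℝ] V →ₗ[ℝ] GForm V A) (hs : ∀ u w, a'' u w = a'' w u) :
    altDer (altDerLM V A ∘ₗ a'' + (LinearMap.mulRight ℝ a ∘ₗ a' + LinearMap.mulLeft ℝ a ∘ₗ a')) =
      (altDer a' + a * a) * a - a * (altDer a' + a * a) := by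
  -- Since `d (dA) = 0`, what is left is `dA A - A dA`; on the right-hand side the two cubic terms
  -- cancel.
  rw [altDer_add, altDer_add, altDer_altDer_of_symm _ hs, altDer_mul_right, altDer_mul_left, ha]
  noncomm_ring

theorem parity_pow {F : GForm V A} (hF : parity F = F) (k : ℕ) : parity (F ^ k) = F ^ k := by
  induction k with
  | zero => rw [pow_zero, parity_one]
  | succ k ih => rw [pow_succ, parity_mul, ih, hF]

theorem mapVal_mul_comm_even {τ : A →ₗ[ℝ] W} (hτ : ∀ a b, τ (a * b) = τ (b * a))
    {α : GForm V A} (hα : parity α = α) (β : GForm V A) :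
    mapVal τ (α * β) = mapVal τ (β * α) :=
  ext fun r => (mapVal_mul_comm τ ⊤ ⊤ (fun a _ b _ => hτ a b) r α β (fun _ _ => trivial)
    (fun _ _ => trivial)).1 hα

theorem mapVal_mul_comm_odd {τ : A →ₗ[ℝ] W} (hτ : ∀ a b, τ (a * b) = τ (b * a))
    {α : GForm V A} (hα : parity α = -α) (β : GForm V A) :
    mapVal τ (α * β) = mapVal τ (parity β * α) :=
  ext fun r => (mapVal_mul_comm τ ⊤ ⊤ (fun a _ b _ => hτ a b) r α β (fun _ _ => trivial)
    (fun _ _ => trivial)).2 hα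

end ChernWeilAlgebra

section ChernWeilDerivative

variable {P V A W : Type*} [NormedAddCommGroup P] [NormedSpace ℝ P] [NormedAddCommGroup V]
  [NormedSpace ℝ V] [NormedRing A] [NormedAlgebra ℝ A] [AddCommGroup W] [Module ℝ W]

/-- The commutator with `a` obeys the same product rule on even forms as `d` does, so `dF = F a - a
F` propagates to powers. -/
theorem altDer_powDeriv {F a : GForm V A} (hF : parity F = F) {F' : V →ₗ[ℝ] GForm V A}
    (h : altDer F' = F * a - a * F) (k : ℕ) :
    altDer (powDeriv F F' k) = F ^ k * a - a * F ^ k := by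
  induction k with
  | zero =>
    rw [powDeriv, pow_zero, one_mul, mul_one, sub_self]
    exact (altDerLM V A).map_zero
  | succ k ih =>
    rw [powDeriv, altDer_add, altDer_mul_right, altDer_mul_left, parity_pow hF, ih, h, pow_succ]
    noncomm_ring

/-- Closedness of `tr F^k`: its differential is the trace of a commutator with the even form `F^k`,
where graded cyclicity involves no sign. -/
theorem mapVal_altDer_powDeriv {F a : GForm V A} (hF : parity F = F) {F' : V →ₗ[ℝ] GForm V A}
    (h : altDer F' = F * a - a * F) {τ : A →ₗ[ℝ] W} (hτ : ∀ a b, τ (a * b) = τ (b * a)) (k : ℕ) :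
    altDer (mapVal τ ∘ₗ powDeriv F F' k) = 0 := by
  rw [← mapVal_altDer, altDer_powDeriv hF h, map_sub, mapVal_mul_comm_even hτ (parity_pow hF k),
    sub_self]

theorem mapVal_powDeriv {F : GForm V A} (hF : parity F = F) (F' : P →ₗ[ℝ] GForm V A)
    {τ : A →ₗ[ℝ] W} (hτ : ∀ a b, τ (a * b) = τ (b * a)) (k : ℕ) (u : P) :
    mapVal τ (powDeriv F F' (k + 1) u) = (k + 1 : ℝ) • mapVal τ (F' u * F ^ k) := by
  -- A trailing power `F ^ j` strengthens the induction: peeling one factor off the power returns it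
  -- to this tail, and cyclicity brings each term to the form `F' F^(k + j)`.
  suffices ∀ j, mapVal τ (powDeriv F F' (k + 1) u * F ^ j) =
      (k + 1 : ℝ) • mapVal τ (F' u * F ^ (k + j)) by simpa using this 0
  induction k with
  | zero => intro j; simp [powDeriv]
  | succ k ih =>
    intro j
    rw [powDeriv, LinearMap.add_apply, LinearMap.comp_apply, LinearMap.comp_apply,
      LinearMap.mulRight_apply, LinearMap.mulLeft_apply, add_mul, map_add, mul_assoc, ← pow_succ',
      ih (j + 1), mul_assoc, mapVal_mul_comm_even hτ (parity_pow hF _), mul_assoc, ← pow_add]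
    rw [show k + (j + 1) = k + 1 + j by ring, show j + (k + 1) = k + 1 + j by ring]
    push_cast
    module

/-- The Leibniz rule gives `db F^k - b (F^k a - a F^k)`. Moving the odd form `a` cyclically turns
the trace of `-b F^k a` into that of `a b F^k`, so the variation `db + a b + b a` of the curvature
appears. -/
theorem mapVal_altDer_transgression {F a b : GForm V A} (hF : parity F = F) (ha : parity a = -a)
    (hb : parity b = -b) {F' : V →ₗ[ℝ] GForm V A} (h : altDer F' = F * a - a * F)
    (b' : V →ₗ[ℝ] GForm V A) {τ : A →ₗ[ℝ] W} (hτ : ∀ a b, τ (a * b) = τ (b * a)) (k : ℕ) :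
    altDer (mapVal τ ∘ₗ (LinearMap.mulRight ℝ (F ^ k) ∘ₗ b' +
        LinearMap.mulLeft ℝ b ∘ₗ powDeriv F F' k)) =
      mapVal τ ((altDer b' + (a * b + b * a)) * F ^ k) := by
  have h1 : mapVal τ (a * (b * F ^ k)) = -mapVal τ (b * F ^ k * a) := by
    rw [mapVal_mul_comm_odd hτ ha, parity_mul, hb, parity_pow hF, neg_mul, neg_mul, map_neg]
  rw [← mapVal_altDer, altDer_add, altDer_mul_right, altDer_mul_left, hb, altDer_powDeriv hF h,
    add_mul, add_mul, map_add, map_add, map_add, mul_assoc a, h1, neg_mul, mul_sub, map_neg, map_sub,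
    mul_assoc, mul_assoc]
  abel

end ChernWeilDerivative
end GForm

/-! ### The curvature of a connection form on a vector space -/

section LocalChernWeil

set_option synthInstance.maxHeartbeats 200000

open GForm

/-- A vector valued `1`-form, as a family of forms. -/
def oneFormLM (V W : Type*) [NormedAddCommGroup V] [NormedSpace ℝ V] [NormedAddCommGroup W]
    [NormedSpace ℝ W] : (V →L[ℝ] W) →ₗ[ℝ] GForm V W where
  toFun L := GForm.of 1 (AlternatingMap.ofSubsingleton ℝ V W (0 : Fin 1) (L : V →ₗ[ℝ] W))
  map_add' L L' := by rw [← map_add]; rfl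
  map_smul' c L := by rw [RingHom.id_apply, ← map_smul]; rfl

/-- The exterior derivative of a `1`-form in terms of its derivative. -/
def dOneFormLM (V W : Type*) [NormedAddCommGroup V] [NormedSpace ℝ V] [NormedAddCommGroup W]
    [NormedSpace ℝ W] : (V →L[ℝ] V →L[ℝ] W) →ₗ[ℝ] GForm V W where
  toFun e := altDer (oneFormLM V W ∘ₗ (e : V →ₗ[ℝ] (V →L[ℝ] W)))
  map_add' e e' := by
    rw [← altDer_add]; congr 1; ext u : 1; exact map_add (oneFormLM V W) (e u) (e' u)
  map_smul' c e := by
    rw [RingHom.id_apply, ← altDer_smul]; congr 1; ext u : 1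
    exact map_smul (oneFormLM V W) c (e u)

variable {P V W A : Type*} [NormedAddCommGroup P] [NormedSpace ℝ P]
  [NormedAddCommGroup V] [NormedSpace ℝ V] [FiniteDimensional ℝ V]
  [NormedAddCommGroup W] [NormedSpace ℝ W] [NormedRing A] [NormedAlgebra ℝ A]
  [FiniteDimensional ℝ A]

theorem parity_oneFormLM (L : V →L[ℝ] W) : parity (oneFormLM V W L) = -oneFormLM V W L :=
  parity_of_odd odd_one _

theorem oneFormLM_apply_one (L : V →L[ℝ] W) (v : Fin 1 → V) : oneFormLM V W L 1 v = L (v 0) := by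
  change GForm.of 1 _ 1 v = _
  rw [of_same]
  rfl

theorem dOneFormLM_eq_of (e : V →L[ℝ] V →L[ℝ] W) :
    dOneFormLM V W e = GForm.of 2 (dOneFormLM V W e 2) := by
  ext p : 1
  by_cases hp : p = 2
  · subst hp; rw [of_same]
  · rw [of_ne hp]
    rcases p with _ | p
    · rfl
    · ext v
      change AlternatingMap.alternatizeUncurryFin _ v = 0
      rw [AlternatingMap.alternatizeUncurryFin_apply]
      refine Finset.sum_eq_zero fun i _ => ?_
      have : proj p (oneFormLM V W (e (v i))) = 0 := of_ne (by omega) _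
      rw [LinearMap.comp_apply, LinearMap.comp_apply]
      erw [this]
      simp

theorem dOneFormLM_apply_two (e : V →L[ℝ] V →L[ℝ] W) (u w : V) :
    dOneFormLM V W e 2 ![u, w] = e u w - e w u := by
  change AlternatingMap.alternatizeUncurryFin _ _ = _
  rw [AlternatingMap.alternatizeUncurryFin_apply, Fin.sum_univ_two]
  simp only [LinearMap.comp_apply, proj_apply]
  change (-1) ^ 0 • oneFormLM V W (e u) 1 _ + (-1) ^ 1 • oneFormLM V W (e w) 1 _ = _
  rw [oneFormLM_apply_one, oneFormLM_apply_one]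
  simp [Fin.removeNth, sub_eq_add_neg]

theorem wedge_one_one_apply {p : ℕ} (h : 1 + 1 = p) (α β : V [⋀^Fin 1]→ₗ[ℝ] A) (v : Fin p → V) :
    wedge h α β v = α (fun _ => v (Fin.cast h 0)) * β (fun _ => v (Fin.cast h 1)) -
      α (fun _ => v (Fin.cast h 1)) * β (fun _ => v (Fin.cast h 0)) := by
  subst h
  rw [wedge_apply_smul, show (Finset.univ : Finset (Equiv.Perm (Fin (1 + 1)))) =
    {1, Equiv.swap 0 1} from by decide]
  rw [Finset.sum_pair (by decide)]
  simp only [Equiv.Perm.sign_one, one_smul, Equiv.Perm.sign_swap (show (0 : Fin (1 + 1)) ≠ 1 by decide),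
    Units.neg_smul]
  simp [sub_eq_add_neg]
  congr 3 <;> (try congr 1) <;> (funext i; fin_cases i; rfl)

/-- The curvature `dA + A ∧ A` in terms of the value `L` and the derivative `e` of `A`. -/
def curvForm (L : V →L[ℝ] A) (e : V →L[ℝ] V →L[ℝ] A) : GForm V A :=
  dOneFormLM V A e + oneFormLM V A L * oneFormLM V A L

theorem curvForm_eq_of (L : V →L[ℝ] A) (e : V →L[ℝ] V →L[ℝ] A) :
    curvForm L e = GForm.of 2 (curvForm L e 2) := by
  have h1 : oneFormLM V A L * oneFormLM V A L = GForm.of 2 _ := of_mul_of (by norm_num) _ _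
  rw [curvForm, h1, dOneFormLM_eq_of, ← map_add, of_same]

theorem parity_curvForm (L : V →L[ℝ] A) (e : V →L[ℝ] V →L[ℝ] A) :
    parity (curvForm L e) = curvForm L e := by
  rw [curvForm_eq_of, parity_of_even even_two]

theorem curvForm_apply_two (L : V →L[ℝ] A) (e : V →L[ℝ] V →L[ℝ] A) (u w : V) :
    curvForm L e 2 ![u, w] = e u w - e w u + (L u * L w - L w * L u) := by
  have h1 : oneFormLM V A L * oneFormLM V A L = GForm.of 2 _ := of_mul_of (by norm_num) _ _
  rw [curvForm, GForm.add_apply, AlternatingMap.add_apply, dOneFormLM_apply_two, h1, of_same,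
    wedge_one_one_apply]
  rfl

theorem HasGDeriv.linear {E : Type*} [NormedAddCommGroup E] [NormedSpace ℝ E]
    [FiniteDimensional ℝ E] (T : E →ₗ[ℝ] GForm V W) {f : P → E} {f' : P →L[ℝ] E} {x : P}
    (h : HasFDerivAt f f' x) : HasGDeriv (fun y => T (f y)) (T ∘ₗ (f' : P →ₗ[ℝ] E)) x := by
  intro p v
  let Tv : E →ₗ[ℝ] W :=
    { toFun := fun e => T e p v
      map_add' := fun a b => by simp
      map_smul' := fun c a => by simp }
  exact ⟨(LinearMap.toContinuousLinearMap Tv).comp f', fun u => rfl,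
    (LinearMap.toContinuousLinearMap Tv).hasFDerivAt.comp x h⟩

theorem GSmoothOn.linear {E : Type*} [NormedAddCommGroup E] [NormedSpace ℝ E]
    [FiniteDimensional ℝ E] (T : E →ₗ[ℝ] GForm V W) {f : P → E} {U : Set P}
    (h : ContDiffOn ℝ ∞ f U) : GSmoothOn (fun y => T (f y)) U := by
  intro p v
  let Tv : E →ₗ[ℝ] W :=
    { toFun := fun e => T e p v
      map_add' := fun a b => by simp
      map_smul' := fun c a => by simp }
  exact (LinearMap.toContinuousLinearMap Tv).contDiff.comp_contDiffOn h

/-- The shape of the curvature: linear in the derivative of `A`, plus the square of a linear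
expression in its value. -/
theorem HasGDeriv.linear_add_sq {E₁ E₂ : Type*} [NormedAddCommGroup E₁] [NormedSpace ℝ E₁]
    [FiniteDimensional ℝ E₁] [NormedAddCommGroup E₂] [NormedSpace ℝ E₂]
    [FiniteDimensional ℝ E₂] (T₁ : E₁ →ₗ[ℝ] GForm V A) (T₂ : E₂ →ₗ[ℝ] GForm V A) {L : P → E₁}
    {e : P → E₂} {L' : P →L[ℝ] E₁} {e' : P →L[ℝ] E₂} {x : P}
    (hL : HasFDerivAt L L' x) (he : HasFDerivAt e e' x) :
    HasGDeriv (fun y => T₂ (e y) + T₁ (L y) * T₁ (L y))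
      (T₂ ∘ₗ (e' : P →ₗ[ℝ] E₂) +
        (LinearMap.mulRight ℝ (T₁ (L x)) ∘ₗ T₁ ∘ₗ (L' : P →ₗ[ℝ] E₁) +
          LinearMap.mulLeft ℝ (T₁ (L x)) ∘ₗ T₁ ∘ₗ (L' : P →ₗ[ℝ] E₁))) x :=
  (HasGDeriv.linear T₂ he).add ((HasGDeriv.linear T₁ hL).mul (HasGDeriv.linear T₁ hL))

theorem GSmoothOn.linear_add_sq {E₁ E₂ : Type*} [NormedAddCommGroup E₁] [NormedSpace ℝ E₁]
    [FiniteDimensional ℝ E₁] [NormedAddCommGroup E₂] [NormedSpace ℝ E₂]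
    [FiniteDimensional ℝ E₂] (T₁ : E₁ →ₗ[ℝ] GForm V A) (T₂ : E₂ →ₗ[ℝ] GForm V A) {L : P → E₁}
    {e : P → E₂} {U : Set P} (hL : ContDiffOn ℝ ∞ L U) (he : ContDiffOn ℝ ∞ e U) :
    GSmoothOn (fun y => T₂ (e y) + T₁ (L y) * T₁ (L y)) U :=
  (GSmoothOn.linear T₂ he).add ((GSmoothOn.linear T₁ hL).mul (GSmoothOn.linear T₁ hL))

theorem GSmoothOn.curvForm {L : P → V →L[ℝ] A} {e : P → V →L[ℝ] V →L[ℝ] A} {U : Set P}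
    (hL : ContDiffOn ℝ ∞ L U) (he : ContDiffOn ℝ ∞ e U) :
    GSmoothOn (fun y => curvForm (L y) (e y)) U :=
  GSmoothOn.linear_add_sq (E₁ := V →L[ℝ] A) (E₂ := V →L[ℝ] V →L[ℝ] A) _ _ hL he

set_option maxHeartbeats 1000000 in
/-- The derivative of `curvForm`. -/
theorem HasGDeriv.curvForm {L : P → V →L[ℝ] A} {e : P → V →L[ℝ] V →L[ℝ] A} {x : P}
    {L' : P →L[ℝ] V →L[ℝ] A} {e' : P →L[ℝ] V →L[ℝ] V →L[ℝ] A}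
    (hL : HasFDerivAt L L' x) (he : HasFDerivAt e e' x) :
    HasGDeriv (fun y => curvForm (L y) (e y))
      (dOneFormLM V A ∘ₗ (e' : P →ₗ[ℝ] V →L[ℝ] V →L[ℝ] A) +
        (LinearMap.mulRight ℝ (oneFormLM V A (L x)) ∘ₗ oneFormLM V A ∘ₗ (L' : P →ₗ[ℝ] V →L[ℝ] A) +
          LinearMap.mulLeft ℝ (oneFormLM V A (L x)) ∘ₗ oneFormLM V A ∘ₗ
            (L' : P →ₗ[ℝ] V →L[ℝ] A))) x :=
  HasGDeriv.linear_add_sq (E₁ := V →L[ℝ] A) (E₂ := V →L[ℝ] V →L[ℝ] A) _ _ hL he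

/-- The Bianchi identity for a connection form with symmetric second derivative. -/
theorem altDer_curvForm_deriv (L : V →L[ℝ] A) (L' : V →L[ℝ] V →L[ℝ] A)
    (e' : V →L[ℝ] V →L[ℝ] V →L[ℝ] A) (hs : ∀ u w, e' u w = e' w u) :
    altDer (dOneFormLM V A ∘ₗ (e' : V →ₗ[ℝ] V →L[ℝ] V →L[ℝ] A) +
        (LinearMap.mulRight ℝ (oneFormLM V A L) ∘ₗ oneFormLM V A ∘ₗ (L' : V →ₗ[ℝ] V →L[ℝ] A) +
          LinearMap.mulLeft ℝ (oneFormLM V A L) ∘ₗ oneFormLM V A ∘ₗ (L' : V →ₗ[ℝ] V →L[ℝ] A))) =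
      curvForm L L' * oneFormLM V A L - oneFormLM V A L * curvForm L L' := by
  let a'' : V →ₗ[ℝ] V →ₗ[ℝ] GForm V A :=
    LinearMap.mk₂ ℝ (fun u w => oneFormLM V A (e' u w)) (fun _ _ _ => by simp) (fun _ _ _ => by simp)
      (fun _ _ _ => by simp) (fun _ _ _ => by simp)
  exact altDer_curvature (parity_oneFormLM L) _ a'' (fun u w => by simp [a'', hs u w])

end LocalChernWeil
end FamiliesChernWeil

end

noncomputable section
namespace FamiliesChernWeil
-- Regularity of forms tested on tuples of vectors
section AlternatingEvaluation

variable {V W : Type*} [NormedAddCommGroup V] [NormedSpace ℝ V] [FiniteDimensional ℝ V]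
  [NormedAddCommGroup W] [NormedSpace ℝ W] [FiniteDimensional ℝ W]

/-- An alternating form depends continuously and linearly on its values. -/
theorem exists_alternating_of_values (V W : Type*) [NormedAddCommGroup V] [NormedSpace ℝ V]
    [FiniteDimensional ℝ V] [NormedAddCommGroup W] [NormedSpace ℝ W] [FiniteDimensional ℝ W]
    (p : ℕ) : ∃ (ι : Type) (_ : Fintype ι) (v : ι → Fin p → V)
      (g : (ι → W) →L[ℝ] V [⋀^Fin p]→L[ℝ] W), ∀ α, g (fun i => α (v i)) = α := by
  let b := Module.finBasis ℝ V
  let v : (Fin p → Fin (Module.finrank ℝ V)) → Fin p → V := fun r i => b (r i)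
  let ev : (V [⋀^Fin p]→L[ℝ] W) →ₗ[ℝ] ((Fin p → Fin (Module.finrank ℝ V)) → W) :=
    { toFun := fun α r => α (v r)
      map_add' := fun _ _ => rfl
      map_smul' := fun _ _ => rfl }
  have hinj : LinearMap.ker ev = ⊥ := by
    refine LinearMap.ker_eq_bot.2 fun α β h => ?_
    have : α.toAlternatingMap = β.toAlternatingMap :=
      Module.Basis.ext_alternating b fun r _ => congrFun h r
    exact ContinuousAlternatingMap.ext fun w => congrArg (fun γ => γ w) this
  -- Evaluation on basis tuples is injective; any linear left inverse is continuous, as the space of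
  -- values is finite dimensional.
  obtain ⟨g, hg⟩ := ev.exists_leftInverse_of_injective hinj
  exact ⟨_, inferInstance, v, LinearMap.toContinuousLinearMap g, fun α => LinearMap.congr_fun hg α⟩

theorem contDiffOn_alternating {P : Type*} [NormedAddCommGroup P] [NormedSpace ℝ P] {p : ℕ}
    {N : WithTop ℕ∞} {θ : P → V [⋀^Fin p]→L[ℝ] W} {U : Set P}
    (h : ∀ v, ContDiffOn ℝ N (fun y => θ y v) U) : ContDiffOn ℝ N θ U := by
  obtain ⟨ι, _, v, g, hg⟩ := exists_alternating_of_values V W p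
  have : θ = fun y => g (fun i => θ y (v i)) := funext fun y => (hg _).symm
  rw [this]
  exact g.contDiff.comp_contDiffOn (contDiffOn_pi.2 fun i => h (v i))

theorem continuous_alternating_iff {P : Type*} [TopologicalSpace P] {p : ℕ}
    {θ : P → V [⋀^Fin p]→L[ℝ] W} (h : ∀ v, Continuous (fun y => θ y v)) : Continuous θ := by
  obtain ⟨ι, _, v, g, hg⟩ := exists_alternating_of_values V W p
  have : θ = fun y => g (fun i => θ y (v i)) := funext fun y => (hg _).symm
  rw [this]
  exact g.continuous.comp (continuous_pi fun i => h (v i))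

end AlternatingEvaluation

/-! ### Closedness and transgression on an open subset of a vector space -/

section LocalTransgression

set_option synthInstance.maxHeartbeats 200000

open GForm
variable {V : Type} [NormedAddCommGroup V] [NormedSpace ℝ V] [FiniteDimensional ℝ V]
  {W : Type} [NormedAddCommGroup W] [NormedSpace ℝ W] [FiniteDimensional ℝ W]

/-- The bridge from the analytic exterior derivative to the algebra above: both are the same
alternating sum of directional derivatives. -/
theorem extDeriv_eq_altDer {p : ℕ} {θ : V → V [⋀^Fin p]→L[ℝ] W} {Ω : V → GForm V W}
    {Ω' : V →ₗ[ℝ] GForm V W} {x : V} (hθ : DifferentiableAt ℝ θ x)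
    (h : ∀ᶠ y in 𝓝 x, ∀ v, θ y v = Ω y p v) (hΩ : HasGDeriv Ω Ω' x) (v : Fin (p + 1) → V) :
    extDeriv θ x v = altDer Ω' (p + 1) v := by
  rw [extDeriv_apply hθ]
  change _ = AlternatingMap.alternatizeUncurryFin _ v
  rw [AlternatingMap.alternatizeUncurryFin_apply]
  refine Finset.sum_congr rfl fun i _ => ?_
  congr 1
  obtain ⟨L, hL, hd⟩ := hΩ p (i.removeNth v)
  rw [(hd.congr_of_eventuallyEq (h.mono fun y hy => hy _)).fderiv, hL]
  rfl

variable {A : Type*} [NormedRing A] [NormedAlgebra ℝ A] [FiniteDimensional ℝ A]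

theorem HasGDeriv.const_smul {P : Type*} [NormedAddCommGroup P] [NormedSpace ℝ P]
    {θ : P → GForm V W} {θ' : P →ₗ[ℝ] GForm V W} {x : P} (h : HasGDeriv θ θ' x) (c : ℝ) :
    HasGDeriv (fun y => c • θ y) (c • θ') x := by
  intro p v
  obtain ⟨l, hl, hd⟩ := h p v
  exact ⟨c • l, fun u => congrArg (fun z => c • z) (hl u), hd.const_smul c⟩

/-- The curvature form of a connection form on an open set of a vector space. -/
def locCurv (L : V → V →L[ℝ] A) (y : V) : GForm V A := curvForm (L y) (fderiv ℝ L y)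

theorem parity_locCurv (L : V → V →L[ℝ] A) (y : V) : parity (locCurv L y) = locCurv L y :=
  parity_curvForm _ _

theorem contDiffOn_fderiv_of_isOpen {F : Type*} [NormedAddCommGroup F] [NormedSpace ℝ F]
    {f : V → F} {U : Set V} (hU : IsOpen U) (hf : ContDiffOn ℝ ∞ f U) :
    ContDiffOn ℝ ∞ (fderiv ℝ f) U := ((contDiffOn_infty_iff_fderiv_of_isOpen hU).1 hf).2

theorem gSmoothOn_locCurv {L : V → V →L[ℝ] A} {U : Set V} (hU : IsOpen U)
    (hL : ContDiffOn ℝ ∞ L U) : GSmoothOn (locCurv L) U :=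
  GSmoothOn.curvForm hL (contDiffOn_fderiv_of_isOpen hU hL)

theorem differentiableAt_of_contDiffOn {F : Type*} [NormedAddCommGroup F] [NormedSpace ℝ F]
    {f : V → F} {U : Set V} (hU : IsOpen U) (hf : ContDiffOn ℝ ∞ f U) {x : V} (hx : x ∈ U) :
    DifferentiableAt ℝ f x :=
  ((hf x hx).contDiffAt (hU.mem_nhds hx)).differentiableAt (by simp)

/-- The algebraic Bianchi identity applies because the second derivative of the smooth map `L` is
symmetric. -/
theorem exists_hasGDeriv_locCurv {L : V → V →L[ℝ] A} {U : Set V} (hU : IsOpen U)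
    (hL : ContDiffOn ℝ ∞ L U) {x : V} (hx : x ∈ U) : ∃ F' : V →ₗ[ℝ] GForm V A,
    HasGDeriv (locCurv L) F' x ∧
      altDer F' = locCurv L x * oneFormLM V A (L x) - oneFormLM V A (L x) * locCurv L x := by
  have hL1 := contDiffOn_fderiv_of_isOpen hU hL
  refine ⟨_, HasGDeriv.curvForm (differentiableAt_of_contDiffOn hU hL hx).hasFDerivAt
    (differentiableAt_of_contDiffOn hU hL1 hx).hasFDerivAt, altDer_curvForm_deriv _ _ _ fun u w => ?_⟩
  have hsymm : IsSymmSndFDerivAt ℝ L x :=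
    ((hL x hx).contDiffAt (hU.mem_nhds hx)).isSymmSndFDerivAt
      (by simpa using WithTop.coe_le_coe.2 (le_top (a := (2 : ℕ∞))))
  exact hsymm u w

variable {τ : A →L[ℝ] W}

theorem contDiffOn_trace_pow {L : V → V →L[ℝ] A} {U : Set V} (hU : IsOpen U)
    (hL : ContDiffOn ℝ ∞ L U) {p k : ℕ} {θ : V → V [⋀^Fin p]→L[ℝ] W}
    (hθ : ∀ y ∈ U, ∀ v, θ y v = mapVal (τ : A →ₗ[ℝ] W) (locCurv L y ^ k) p v) :
    ContDiffOn ℝ ∞ θ U :=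
  contDiffOn_alternating fun v => (((gSmoothOn_locCurv hU hL).pow k).mapVal τ p v).congr
    fun y hy => hθ y hy v

theorem extDeriv_trace_pow {L : V → V →L[ℝ] A} {U : Set V} (hU : IsOpen U)
    (hL : ContDiffOn ℝ ∞ L U) (hτ : ∀ a b, τ (a * b) = τ (b * a)) {p k : ℕ}
    {θ : V → V [⋀^Fin p]→L[ℝ] W}
    (hθ : ∀ y ∈ U, ∀ v, θ y v = mapVal (τ : A →ₗ[ℝ] W) (locCurv L y ^ k) p v) {x : V} (hx : x ∈ U) :
    extDeriv θ x = 0 := by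
  obtain ⟨F', hF', hb⟩ := exists_hasGDeriv_locCurv hU hL hx
  ext v
  rw [extDeriv_eq_altDer (differentiableAt_of_contDiffOn hU (contDiffOn_trace_pow hU hL hθ) hx)
    (Filter.mem_of_superset (hU.mem_nhds hx) fun y hy v => hθ y hy v) ((hF'.pow k).mapVal τ),
    mapVal_altDer_powDeriv (τ := (τ : A →ₗ[ℝ] W)) (parity_locCurv L x) hb hτ]
  rfl

/-- The affine path of connection forms. -/
def pathForm (L b : V → V →L[ℝ] A) (t : ℝ) (y : V) : V →L[ℝ] A := L y + t • b y

/-- The transgression form of an affine path of connection forms, before integration over the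
path. -/
def transgressionForm (τ : A →L[ℝ] W) (L b : V → V →L[ℝ] A) (k : ℕ) (t : ℝ) (y : V) : GForm V W :=
  (k + 1 : ℝ) • mapVal (τ : A →ₗ[ℝ] W) (oneFormLM V A (b y) * locCurv (pathForm L b t) y ^ k)

theorem contDiffOn_pathForm {L b : V → V →L[ℝ] A} {U : Set V}
    (hL : ContDiffOn ℝ ∞ L U) (hb : ContDiffOn ℝ ∞ b U) (t : ℝ) :
    ContDiffOn ℝ ∞ (pathForm L b t) U :=
  hL.add (hb.const_smul t)

theorem fderiv_pathForm {L b : V → V →L[ℝ] A} {x : V} (hL : DifferentiableAt ℝ L x)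
    (hb : DifferentiableAt ℝ b x) (t : ℝ) :
    fderiv ℝ (pathForm L b t) x = fderiv ℝ L x + t • fderiv ℝ b x :=
  (hL.hasFDerivAt.add (hb.hasFDerivAt.const_smul t)).fderiv

theorem gSmoothOn_curv_path {L b : V → V →L[ℝ] A} {U : Set V} (hU : IsOpen U)
    (hL : ContDiffOn ℝ ∞ L U) (hb : ContDiffOn ℝ ∞ b U) :
    GSmoothOn (fun z : V × ℝ => locCurv (pathForm L b z.2) z.1) (U ×ˢ Set.univ) := by
  have hfst : ∀ {F : Type _} [NormedAddCommGroup F] [NormedSpace ℝ F] {f : V → F},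
      ContDiffOn ℝ ∞ f U → ContDiffOn ℝ ∞ (fun z : V × ℝ => f z.1) (U ×ˢ Set.univ) := fun hf =>
    hf.comp contDiffOn_fst fun z hz => hz.1
  have hsnd : ∀ {F : Type _} [NormedAddCommGroup F] [NormedSpace ℝ F] {f : V → F},
      ContDiffOn ℝ ∞ f U → ContDiffOn ℝ ∞ (fun z : V × ℝ => z.2 • f z.1) (U ×ˢ Set.univ) :=
    fun hf => contDiffOn_snd.smul (hfst hf)
  have h := GSmoothOn.curvForm ((hfst hL).add (hsnd hb))
    ((hfst (contDiffOn_fderiv_of_isOpen hU hL)).add (hsnd (contDiffOn_fderiv_of_isOpen hU hb)))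
  intro p v
  refine (h p v).congr fun z hz => ?_
  change curvForm _ (fderiv ℝ (pathForm L b z.2) z.1) p v = _
  rw [fderiv_pathForm (differentiableAt_of_contDiffOn hU hL hz.1)
    (differentiableAt_of_contDiffOn hU hb hz.1)]
  rfl

theorem gSmoothOn_transgressionForm {L b : V → V →L[ℝ] A} {U : Set V} (hU : IsOpen U)
    (hL : ContDiffOn ℝ ∞ L U) (hb : ContDiffOn ℝ ∞ b U) (k : ℕ) :
    GSmoothOn (fun z : V × ℝ => transgressionForm τ L b k z.2 z.1) (U ×ˢ Set.univ) := by
  intro p v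
  have h1 : GSmoothOn (fun z : V × ℝ => oneFormLM V A (b z.1)) (U ×ˢ Set.univ) :=
    GSmoothOn.linear (E := V →L[ℝ] A) _ (hb.comp contDiffOn_fst fun z hz => hz.1)
  exact ((h1.mul ((gSmoothOn_curv_path hU hL hb).pow k)).mapVal τ p v).const_smul _


theorem hasGDeriv_curv_path {L b : V → V →L[ℝ] A} {x : V} (hL : DifferentiableAt ℝ L x)
    (hb : DifferentiableAt ℝ b x) (t : ℝ) :
    ∃ F' : ℝ →ₗ[ℝ] GForm V A, HasGDeriv (fun t => locCurv (pathForm L b t) x) F' t ∧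
      F' 1 = dOneFormLM V A (fderiv ℝ b x) +
        (oneFormLM V A (b x) * oneFormLM V A (pathForm L b t x) +
          oneFormLM V A (pathForm L b t x) * oneFormLM V A (b x)) := by
  have aux : ∀ {E : Type _} [NormedAddCommGroup E] [NormedSpace ℝ E] (e₀ e₁ : E),
      HasFDerivAt (fun t : ℝ => e₀ + t • e₁) (ContinuousLinearMap.toSpanSingleton ℝ e₁) t :=
    fun e₀ e₁ => (ContinuousLinearMap.toSpanSingleton ℝ e₁).hasFDerivAt.const_add e₀
  have h := HasGDeriv.curvForm (aux (L x) (b x)) (aux (fderiv ℝ L x) (fderiv ℝ b x))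
  have e : (fun t => locCurv (pathForm L b t) x) = fun t : ℝ =>
      curvForm (L x + t • b x) (fderiv ℝ L x + t • fderiv ℝ b x) := by
    funext t
    rw [← fderiv_pathForm hL hb]
    rfl
  rw [e]
  refine ⟨_, h, ?_⟩
  simp only [LinearMap.add_apply, LinearMap.comp_apply, LinearMap.mulRight_apply,
    LinearMap.mulLeft_apply, ContinuousLinearMap.coe_coe,
    ContinuousLinearMap.toSpanSingleton_apply, one_smul]
  rfl

/-- The exterior derivative in space equals the derivative in `t`, since both are `(k + 1) tr ((db +
A_t b + b A_t) F_t^k)`: the first by `mapVal_altDer_transgression`, the second by `mapVal_powDeriv`.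
-/
theorem exists_hasGDeriv_transgressionForm {L b : V → V →L[ℝ] A} {U : Set V} (hU : IsOpen U)
    (hL : ContDiffOn ℝ ∞ L U) (hb : ContDiffOn ℝ ∞ b U) (hτ : ∀ a b, τ (a * b) = τ (b * a))
    (k : ℕ) {x : V} (hx : x ∈ U) (t : ℝ) : ∃ Ω' : V →ₗ[ℝ] GForm V W,
      HasGDeriv (transgressionForm τ L b k t) Ω' x ∧
      ∀ r v, HasDerivAt (fun t => mapVal (τ : A →ₗ[ℝ] W) (locCurv (pathForm L b t) x ^ (k + 1)) r v)
        (altDer Ω' r v) t := by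
  have hLd := differentiableAt_of_contDiffOn hU hL hx
  have hbd := differentiableAt_of_contDiffOn hU hb hx
  obtain ⟨F', hF', hbi⟩ := exists_hasGDeriv_locCurv hU (contDiffOn_pathForm hL hb t) hx
  obtain ⟨G', hG', hG1⟩ := hasGDeriv_curv_path hLd hbd t
  have hB : HasGDeriv (fun y => oneFormLM V A (b y)) _ x :=
    HasGDeriv.linear (E := V →L[ℝ] A) _ hbd.hasFDerivAt
  refine ⟨_, ((hB.mul (hF'.pow k)).mapVal τ).const_smul (k + 1 : ℝ), fun r v => ?_⟩
  · obtain ⟨l, hl, hd⟩ := ((hG'.pow (k + 1)).mapVal τ) r v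
    have h2 := hd.hasDerivAt
    rw [hl, LinearMap.comp_apply, mapVal_powDeriv (τ := (τ : A →ₗ[ℝ] W)) (parity_locCurv _ _) _ hτ,
      hG1] at h2
    rw [altDer_smul, mapVal_altDer_transgression (τ := (τ : A →ₗ[ℝ] W)) (parity_locCurv _ _)
      (parity_oneFormLM _) (parity_oneFormLM _) hbi _ hτ,
      add_comm (oneFormLM V A (pathForm L b t x) * _)]
    exact h2

/-- The transgression formula on an open subset of a vector space. -/
theorem extDeriv_transgression {L b : V → V →L[ℝ] A} {U : Set V} (hU : IsOpen U)
    (hL : ContDiffOn ℝ ∞ L U) (hb : ContDiffOn ℝ ∞ b U) (hτ : ∀ a b, τ (a * b) = τ (b * a))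
    (k : ℕ) {p : ℕ} {η : V → V [⋀^Fin p]→L[ℝ] W}
    (hη : ∀ y ∈ U, ∀ v, η y v = ∫ t in Set.Icc (0 : ℝ) 1, transgressionForm τ L b k t y p v) :
    ContDiffOn ℝ ∞ η U ∧ ∀ x ∈ U, ∀ v, extDeriv η x v =
      mapVal (τ : A →ₗ[ℝ] W) (locCurv (pathForm L b 1) x ^ (k + 1)) (p + 1) v -
        mapVal (τ : A →ₗ[ℝ] W) (locCurv (pathForm L b 0) x ^ (k + 1)) (p + 1) v := by
  have hsm := gSmoothOn_transgressionForm (τ := τ) hU hL hb k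
  have hsmooth : ContDiffOn ℝ ∞ η U := contDiffOn_alternating fun v =>
    (contDiffOn_setIntegral_compact (μ := volume) hU isCompact_Icc (hsm p v)).congr
      fun y hy => hη y hy v
  refine ⟨hsmooth, fun x hx v => ?_⟩
  choose Ω' hΩ hD using fun t => exists_hasGDeriv_transgressionForm hU hL hb hτ k hx t
  -- Joint smoothness in `(y, t)` lets the spatial derivative pass under the integral over the path.
  have key : ∀ w u, IntegrableOn (fun t => Ω' t u p w) (Set.Icc (0 : ℝ) 1) ∧
      fderiv ℝ (fun y => η y w) x u = ∫ t in Set.Icc (0 : ℝ) 1, Ω' t u p w := by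
    intro w u
    have h1 := hasFDerivAt_setIntegral_compact (μ := volume) hU (hsm p w)
      (isCompact_Icc (a := (0 : ℝ)) (b := 1)) hx
    have h2 : (fun y => η y w) =ᶠ[𝓝 x] fun y => ∫ t in Set.Icc (0 : ℝ) 1,
        transgressionForm τ L b k t y p w :=
      Filter.mem_of_superset (hU.mem_nhds hx) fun y hy => hη y hy w
    have h3 : Continuous fun t => fderivFst (fun z : V × ℝ =>
        transgressionForm τ L b k z.2 z.1 p w) (x, t) :=
      (contDiffOn_fderivFst hU (hsm p w)).continuousOn.comp_continuous (by fun_prop)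
        fun t => ⟨hx, trivial⟩
    have h4 : IntegrableOn (fun t => fderivFst (fun z : V × ℝ =>
        transgressionForm τ L b k z.2 z.1 p w) (x, t)) (Set.Icc (0 : ℝ) 1) :=
      h3.continuousOn.integrableOn_compact isCompact_Icc
    have h5 : ∀ t, fderivFst (fun z : V × ℝ => transgressionForm τ L b k z.2 z.1 p w) (x, t) u =
        Ω' t u p w := by
      intro t
      obtain ⟨l, hl, hd⟩ := hΩ t p w
      exact (congrArg (fun L => L u) ((hasFDerivAt_fst hU (hsm p w) hx t).unique hd)).trans (hl u)
    refine ⟨(h4.apply_continuousLinearMap u).congr (Filter.Eventually.of_forall h5), ?_⟩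
    rw [(h1.congr_of_eventuallyEq h2).fderiv, ContinuousLinearMap.integral_apply h4]
    exact integral_congr_ae (Filter.Eventually.of_forall h5)
  have hsum : ∀ t, altDer (Ω' t) (p + 1) v =
      ∑ i : Fin (p + 1), (-1 : ℤ) ^ i.val • Ω' t (v i) p (i.removeNth v) := by
    intro t
    change AlternatingMap.alternatizeUncurryFin _ v = _
    rw [AlternatingMap.alternatizeUncurryFin_apply]
    rfl
  have hint : ∀ i ∈ (Finset.univ : Finset (Fin (p + 1))), IntegrableOn
      (fun t => (-1 : ℤ) ^ i.val • Ω' t (v i) p (i.removeNth v)) (Set.Icc (0 : ℝ) 1) := by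
    intro i _
    simp only [← Int.cast_smul_eq_zsmul ℝ]
    exact (key _ _).1.smul _
  have hIcc : IntegrableOn (fun t => altDer (Ω' t) (p + 1) v) (Set.Icc (0 : ℝ) 1) := by
    simp only [hsum]
    exact integrable_finsetSum _ hint
  rw [extDeriv_apply (differentiableAt_of_contDiffOn hU hsmooth hx)]
  -- The difference of the endpoint values becomes, by the fundamental theorem of calculus, the
  -- integral over `t` of the spatial differentials.
  rw [← intervalIntegral.integral_eq_sub_of_hasDerivAt (fun t _ => hD t (p + 1) v)
    ((intervalIntegrable_iff_integrableOn_Icc_of_le zero_le_one).2 hIcc),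
    intervalIntegral.integral_of_le zero_le_one, ← integral_Icc_eq_integral_Ioc]
  simp only [hsum]
  rw [integral_finsetSum _ hint]
  refine Finset.sum_congr rfl fun i _ => ?_
  rw [(key _ _).2]
  simp only [← Int.cast_smul_eq_zsmul ℝ]
  rw [integral_smul]

end LocalTransgression
end FamiliesChernWeil

end

noncomputable section
namespace FamiliesChernWeil
-- Extending local sections and writing sections in coordinates
section LocalSections

variable {d : ℕ} {M : Type*} [TopologicalSpace M] [ChartedSpace (Euc d) M]

theorem exists_bump [IsManifold (𝓡 d) ∞ M] [T2Space M] {x : M} {U : Set M} (hU : U ∈ 𝓝 x) :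
    ∃ f : M → ℝ, ContMDiff (𝓡 d) 𝓘(ℝ, ℝ) ∞ f ∧ tsupport f ⊆ U ∧ f =ᶠ[𝓝 x] 1 := by
  obtain ⟨f, _, hf⟩ := (SmoothBumpFunction.nhds_basis_tsupport (I := 𝓡 d) x).mem_iff.1 hU
  exact ⟨f, f.contMDiff, hf, f.eventuallyEq_one⟩

variable [IsManifold (𝓡 d) ∞ M] {F : Type*} [NormedAddCommGroup F] [NormedSpace ℝ F]
  {V : M → Type*} [TopologicalSpace (TotalSpace F V)] [∀ x, AddCommGroup (V x)]
  [∀ x, Module ℝ (V x)] [∀ x, TopologicalSpace (V x)] [FiberBundle F V] [VectorBundle ℝ F V]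

/-- A bump function equal to `1` near the point extends `s` by zero. Local frames and chart fields
thus become inputs for properties stated only for global smooth sections. -/
theorem exists_contMDiff_section [T2Space M] {s : ∀ x, V x} {U : Set M} (hU : IsOpen U) {x : M}
    (hx : x ∈ U)
    (hs : ContMDiffOn (𝓡 d) ((𝓡 d).prod 𝓘(ℝ, F)) ∞ (fun x => (⟨x, s x⟩ : TotalSpace F V)) U) :
    ∃ s' : ∀ x, V x, ContMDiff (𝓡 d) ((𝓡 d).prod 𝓘(ℝ, F)) ∞
      (fun x => (⟨x, s' x⟩ : TotalSpace F V)) ∧ ∀ᶠ y in 𝓝 x, s' y = s y := by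
  obtain ⟨f, hf, hfU, hf1⟩ := exists_bump (d := d) (hU.mem_nhds hx)
  refine ⟨f • s, ContMDiffOn.smul_section_of_tsupport hf.contMDiffOn hU hfU hs, ?_⟩
  filter_upwards [hf1] with y hy
  simp [hy]

/-- The section with constant coordinate `v` in the trivialization `e`. -/
def frameSec (e : Trivialization F (TotalSpace.proj : TotalSpace F V → M)) [e.IsLinear ℝ] (v : F)
    (x : M) : V x := e.symmₗ ℝ x v

variable (e : Trivialization F (TotalSpace.proj : TotalSpace F V → M)) [MemTrivializationAtlas e]

theorem trivialization_apply_frameSec {x : M} (hx : x ∈ e.baseSet) (v : F) :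
    (e ⟨x, frameSec e v x⟩).2 = v := by
  rw [frameSec, e.symmₗ_apply hx, e.apply_mk_symm hx]

theorem contMDiffOn_frameSec [ContMDiffVectorBundle ∞ F V (𝓡 d)] (v : F) :
    ContMDiffOn (𝓡 d) ((𝓡 d).prod 𝓘(ℝ, F)) ∞
      (fun x => (⟨x, frameSec e v x⟩ : TotalSpace F V)) e.baseSet := by
  rw [e.contMDiffOn_section_baseSet_iff]
  exact (contMDiffOn_const (c := v)).congr fun x hx => trivialization_apply_frameSec e hx v

/-- The domain in the chart at `x₀` over which the trivialization `e` is defined. -/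
def chartDomain (x₀ : M) (e : Trivialization F (TotalSpace.proj : TotalSpace F V → M)) :
    Set (Euc d) := (extChartAt (𝓡 d) x₀).target ∩ (extChartAt (𝓡 d) x₀).symm ⁻¹' e.baseSet

/-- The coordinate expression of a section. -/
def secCoord (x₀ : M) (e : Trivialization F (TotalSpace.proj : TotalSpace F V → M)) (s : ∀ x, V x)
    (y : Euc d) : F :=
  (e ⟨(extChartAt (𝓡 d) x₀).symm y, s ((extChartAt (𝓡 d) x₀).symm y)⟩).2

theorem isOpen_chartDomain (x₀ : M) : IsOpen (chartDomain (d := d) x₀ e) :=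
  (continuousOn_extChartAt_symm x₀).isOpen_inter_preimage (isOpen_extChartAt_target x₀)
    e.open_baseSet

theorem contDiffOn_secCoord [ContMDiffVectorBundle ∞ F V (𝓡 d)] (x₀ : M) {s : ∀ x, V x} {U : Set M}
    (hs : ContMDiffOn (𝓡 d) ((𝓡 d).prod 𝓘(ℝ, F)) ∞ (fun x => (⟨x, s x⟩ : TotalSpace F V)) U)
    (hU : IsOpen U) :
    ContDiffOn ℝ ∞ (secCoord (d := d) x₀ e s) (chartDomain (d := d) x₀ e ∩ (extChartAt (𝓡 d) x₀).symm ⁻¹' U) := by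
  have h1 := (e.contMDiffOn_section_iff (IB := 𝓡 d) (n := ∞) (a := e.baseSet ∩ U) (s := s)
    (e.open_baseSet.inter hU) Set.inter_subset_left).1
    (hs.mono Set.inter_subset_right)
  have h2 := contMDiffOn_extChartAt_symm (I := 𝓡 d) (n := ∞) x₀
  rw [← contMDiffOn_iff_contDiffOn]
  exact h1.comp (h2.mono fun y hy => hy.1.1) fun y hy => ⟨hy.1.2, hy.2⟩

theorem contDiffOn_secCoord_of_contMDiff [ContMDiffVectorBundle ∞ F V (𝓡 d)] (x₀ : M)
    {s : ∀ x, V x}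
    (hs : ContMDiff (𝓡 d) ((𝓡 d).prod 𝓘(ℝ, F)) ∞ (fun x => (⟨x, s x⟩ : TotalSpace F V))) :
    ContDiffOn ℝ ∞ (secCoord (d := d) x₀ e s) (chartDomain (d := d) x₀ e) := by
  simpa using contDiffOn_secCoord e x₀ hs.contMDiffOn isOpen_univ

end LocalSections

/-! ### The differential of a chart -/

section ChartDifferential

variable {d : ℕ} {M : Type*} [TopologicalSpace M] [ChartedSpace (Euc d) M] [IsManifold (𝓡 d) ∞ M]

/-- The differential of the inverse of the chart at `x₀`. -/
def dChartSymm (x₀ : M) (y : Euc d) : Euc d →L[ℝ] Euc d :=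
  mfderiv 𝓘(ℝ, Euc d) (𝓡 d) (extChartAt (𝓡 d) x₀).symm y

/-- The differential of the chart at `x₀`. -/
def dChart (x₀ x : M) : Euc d →L[ℝ] Euc d :=
  mfderiv (𝓡 d) 𝓘(ℝ, Euc d) (extChartAt (𝓡 d) x₀) x

theorem dChart_eq {x₀ x : M} (hx : x ∈ (chartAt (Euc d) x₀).source) :
    dChart x₀ x =
      (trivializationAt (Euc d) (TangentSpace (𝓡 d)) x₀).continuousLinearMapAt ℝ x := by
  have : IsManifold (𝓡 d) 1 M := IsManifold.of_le (n := ∞) (by simp)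
  exact (TangentBundle.continuousLinearMapAt_trivializationAt hx).symm

theorem dChartSymm_eq {x₀ : M} {y : Euc d} (hy : y ∈ (extChartAt (𝓡 d) x₀).target) :
    dChartSymm x₀ y = (trivializationAt (Euc d) (TangentSpace (𝓡 d)) x₀).symmL ℝ
      ((extChartAt (𝓡 d) x₀).symm y) := by
  have : IsManifold (𝓡 d) 1 M := IsManifold.of_le (n := ∞) (by simp)
  have hx : (extChartAt (𝓡 d) x₀).symm y ∈ (chartAt (Euc d) x₀).source := by
    rw [← extChartAt_source (𝓡 d)]
    exact (extChartAt (𝓡 d) x₀).map_target hy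
  rw [TangentBundle.symmL_trivializationAt hx, (extChartAt (𝓡 d) x₀).right_inv hy]
  simp only [modelWithCornersSelf_coe, Set.range_id, mfderivWithin_univ]
  rfl

theorem symm_mem_baseSet {x₀ : M} {y : Euc d} (hy : y ∈ (extChartAt (𝓡 d) x₀).target) :
    (extChartAt (𝓡 d) x₀).symm y ∈
      (trivializationAt (Euc d) (TangentSpace (𝓡 d)) x₀).baseSet := by
  rw [TangentBundle.trivializationAt_baseSet, ← extChartAt_source (𝓡 d)]
  exact (extChartAt (𝓡 d) x₀).map_target hy

theorem dChart_dChartSymm {x₀ : M} {y : Euc d} (hy : y ∈ (extChartAt (𝓡 d) x₀).target)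
    (u : Euc d) : dChart x₀ ((extChartAt (𝓡 d) x₀).symm y) (dChartSymm x₀ y u) = u := by
  have h := symm_mem_baseSet hy
  rw [dChart_eq (by simpa using h), dChartSymm_eq hy]
  exact Trivialization.continuousLinearMapAt_symmL _ h u

theorem dChartSymm_dChart {x₀ : M} {y : Euc d} (hy : y ∈ (extChartAt (𝓡 d) x₀).target)
    (u : Euc d) : dChartSymm x₀ y (dChart x₀ ((extChartAt (𝓡 d) x₀).symm y) u) = u := by
  have h := symm_mem_baseSet hy
  rw [dChart_eq (by simpa using h), dChartSymm_eq hy]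
  exact Trivialization.symmL_continuousLinearMapAt _ h u

/-- The differential of the inverse chart as a linear equivalence. -/
def dChartEquiv (x₀ : M) {y : Euc d} (hy : y ∈ (extChartAt (𝓡 d) x₀).target) : Euc d ≃L[ℝ] Euc d :=
  ContinuousLinearEquiv.equivOfInverse (dChartSymm x₀ y)
    (dChart x₀ ((extChartAt (𝓡 d) x₀).symm y)) (dChart_dChartSymm hy) (dChartSymm_dChart hy)

/-- At the center of its own chart the differential is the identity, because tangent vectors at `x`
are recorded in the preferred chart at `x`. -/
theorem dChartSymm_self (x : M) (u : Euc d) : dChartSymm x (extChartAt (𝓡 d) x x) u = u := by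
  have hy := mem_extChartAt_target (I := 𝓡 d) x
  have : dChart x x u = u := by
    have : IsManifold (𝓡 d) 1 M := IsManifold.of_le (n := ∞) (by simp)
    rw [dChart_eq (mem_chart_source _ _), TangentBundle.continuousLinearMapAt_trivializationAt_eq_core
      (mem_chart_source _ _)]
    exact (tangentBundleCore (𝓡 d) M).coordChange_self _ _ (mem_achart_source _ _) _
  conv_rhs => rw [← dChartSymm_dChart hy u, extChartAt_to_inv, this]

end ChartDifferential
end FamiliesChernWeil

end

noncomputable section
namespace FamiliesChernWeil
-- The commutator of `d + L_X` and `d + L_Y`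
section LocalCommutator

variable {V : Type} {N : Type*} [NormedAddCommGroup V] [NormedSpace ℝ V] [FiniteDimensional ℝ V]
  [NormedAddCommGroup N] [NormedSpace ℂ N] [FiniteDimensional ℂ N]

/-- The covariant derivative `d + L` in a local frame. -/
def locCov (L : V → V →L[ℝ] N →L[ℂ] N) (X : V → V) (s : V → N) (y : V) : N :=
  fderiv ℝ s y (X y) + L y (X y) (s y)

theorem hasFDerivAt_locCov {L : V → V →L[ℝ] N →L[ℂ] N} {X : V → V} {s : V → N} {U : Set V}
    (hU : IsOpen U) (hL : ContDiffOn ℝ ∞ L U) (hX : ContDiffOn ℝ ∞ X U) (hs : ContDiffOn ℝ ∞ s U)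
    {y : V} (hy : y ∈ U) (u : V) :
    fderiv ℝ (locCov L X s) y u =
      fderiv ℝ (fderiv ℝ s) y u (X y) + fderiv ℝ s y (fderiv ℝ X y u) +
        (fderiv ℝ L y u (X y) (s y) + L y (fderiv ℝ X y u) (s y) + L y (X y) (fderiv ℝ s y u)) := by
  have hd := (differentiableAt_of_contDiffOn hU (contDiffOn_fderiv_of_isOpen hU hs) hy).hasFDerivAt
  have hLd := (differentiableAt_of_contDiffOn hU hL hy).hasFDerivAt
  have hXd := (differentiableAt_of_contDiffOn hU hX hy).hasFDerivAt
  have hsd := (differentiableAt_of_contDiffOn hU hs hy).hasFDerivAt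
  let ρ : (N →L[ℂ] N) →L[ℝ] N →L[ℝ] N := ContinuousLinearMap.restrictScalarsL ℂ N N ℝ ℝ
  have h1 := hd.clm_apply hXd
  have h2 := (ρ.hasFDerivAt.comp y (hLd.clm_apply hXd)).clm_apply hsd
  have h3 : HasFDerivAt (locCov L X s) _ y := h1.add h2
  rw [h3.fderiv]
  simp only [_root_.add_apply, ContinuousLinearMap.comp_apply,
    ContinuousLinearMap.flip_apply, Function.comp_apply]
  rw [map_add]
  simp [ρ]
  abel

/-- The second derivatives of `s` cancel by symmetry, its first derivatives are absorbed by the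
bracket and the cross terms, and the terms of order zero in `s` form `dL + L ∧ L`. -/
theorem locCov_commutator {L : V → V →L[ℝ] N →L[ℂ] N} {X Y : V → V} {s : V → N} {U : Set V}
    (hU : IsOpen U) (hL : ContDiffOn ℝ ∞ L U) (hX : ContDiffOn ℝ ∞ X U) (hY : ContDiffOn ℝ ∞ Y U)
    (hs : ContDiffOn ℝ ∞ s U) {y : V} (hy : y ∈ U) :
    locCov L X (locCov L Y s) y - locCov L Y (locCov L X s) y -
        locCov L (VectorField.lieBracket ℝ X Y) s y =
      locCurv L y 2 ![X y, Y y] (s y) := by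
  have hsymm : IsSymmSndFDerivAt ℝ s y :=
    ((hs y hy).contDiffAt (hU.mem_nhds hy)).isSymmSndFDerivAt
      (by simpa using WithTop.coe_le_coe.2 (le_top (a := (2 : ℕ∞))))
  rw [locCurv, curvForm_apply_two, locCov, locCov, locCov, hasFDerivAt_locCov hU hL hY hs hy,
    hasFDerivAt_locCov hU hL hX hs hy, VectorField.lieBracket_eq, hsymm (X y) (Y y)]
  have hm : ∀ S T : N →L[ℂ] N, (S * T) (s y) = S (T (s y)) := fun _ _ => rfl
  simp only [locCov, map_sub, map_add, _root_.sub_apply, _root_.add_apply, hm]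
  abel

end LocalCommutator
-- Connections in charts and trivializations
section ConnectionLocal

variable {d : ℕ} {M : Type*} [TopologicalSpace M] [ChartedSpace (Euc d) M] [IsManifold (𝓡 d) ∞ M]
  {E : ComplexBundle d M}

instance (E : ComplexBundle d M) : ContMDiffVectorBundle 1 E.Model E.Fiber (𝓡 d) :=
  ContMDiffVectorBundle.of_le (n := ∞) (by simp)

theorem ComplexBundle.IsSmooth.mdifferentiableAt {σ : ∀ x, E.Fiber x} (h : E.IsSmooth σ) (x : M) :
    MDifferentiableAt (𝓡 d) ((𝓡 d).prod 𝓘(ℝ, E.Model))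
      (fun x => (⟨x, σ x⟩ : TotalSpace E.Model E.Fiber)) x :=
  (h x).mdifferentiableAt (by simp)

theorem Connection.cov_smooth (D : Connection E) {σ : ∀ x, E.Fiber x} (hσ : E.IsSmooth σ)
    {X : ∀ x : M, TangentSpace (𝓡 d) x} (hX : IsSmoothField X) :
    E.IsSmooth fun x => D.cov σ x (X x) := by
  have h := D.smooth.contMDiff.contMDiff (σ := σ) (hσ.contMDiffOn)
  exact ContMDiff.clm_bundle_apply (contMDiffOn_univ.1 h) hX

theorem Connection.cov_congr (D : Connection E) {σ τ : ∀ x, E.Fiber x} {x : M}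
    (hσ : MDifferentiableAt (𝓡 d) ((𝓡 d).prod 𝓘(ℝ, E.Model))
      (fun x => (⟨x, σ x⟩ : TotalSpace E.Model E.Fiber)) x)
    (hτ : MDifferentiableAt (𝓡 d) ((𝓡 d).prod 𝓘(ℝ, E.Model))
      (fun x => (⟨x, τ x⟩ : TotalSpace E.Model E.Fiber)) x)
    (h : ∀ᶠ y in 𝓝 x, σ y = τ y) : D.cov σ x = D.cov τ x :=
  D.cov.isCovariantDerivativeOnUniv.congr_of_eventuallyEq hσ hτ Filter.univ_mem h

variable (e : Trivialization E.Model (TotalSpace.proj : TotalSpace E.Model E.Fiber → M))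
  [MemTrivializationAtlas e]

theorem frameSec_add (v w : E.Model) : frameSec e (v + w) = frameSec e v + frameSec e w :=
  funext fun x => map_add (e.symmₗ ℝ x) v w

theorem frameSec_smul (c : ℂ) (v : E.Model) : frameSec e (c • v) = c • frameSec e v :=
  funext fun x => by
    by_cases hx : x ∈ e.baseSet
    · simp only [frameSec, Pi.smul_apply, e.symmₗ_apply hx]
      rw [← e.symmₗ_apply (R := ℂ) hx, ← e.symmₗ_apply (R := ℂ) hx, map_smul]
    · simp [frameSec, e.symmₗ_apply_of_notMem hx]

theorem mdifferentiableAt_frameSec (v : E.Model) {x : M} (hx : x ∈ e.baseSet) :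
    MDifferentiableAt (𝓡 d) ((𝓡 d).prod 𝓘(ℝ, E.Model))
      (fun x => (⟨x, frameSec e v x⟩ : TotalSpace E.Model E.Fiber)) x :=
  ((contMDiffOn_frameSec e v).contMDiffAt (e.open_baseSet.mem_nhds hx)).mdifferentiableAt (by simp)

theorem exists_smooth_frameSec [T2Space M] (v : E.Model) {x : M} (hx : x ∈ e.baseSet) :
    ∃ s, E.IsSmooth s ∧ ∀ᶠ y in 𝓝 x, s y = frameSec e v y :=
  exists_contMDiff_section e.open_baseSet hx (contMDiffOn_frameSec e v)

/-- The covariant derivative of a frame section, in coordinates. -/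
def frameCov (D : Connection E) (v : E.Model) (x : M) : Euc d →L[ℝ] E.Model :=
  (e.continuousLinearMapAt ℝ x).comp (D.cov (frameSec e v) x)

theorem frameCov_add (D : Connection E) {x : M} (hx : x ∈ e.baseSet) (v w : E.Model) :
    frameCov e D (v + w) x = frameCov e D v x + frameCov e D w x := by
  have := D.cov.isCovariantDerivativeOnUniv.add (mdifferentiableAt_frameSec e v hx)
    (mdifferentiableAt_frameSec e w hx)
  rw [← frameSec_add] at this
  refine ContinuousLinearMap.ext fun u => ?_
  exact (congrArg (fun T => e.continuousLinearMapAt ℝ x (T u)) this).trans (map_add _ _ _)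

theorem frameCov_real_smul (D : Connection E) {x : M} (hx : x ∈ e.baseSet) (c : ℝ) (v : E.Model) :
    frameCov e D (c • v) x = c • frameCov e D v x := by
  have h1 : frameSec e (c • v) = c • frameSec e v := 
    funext fun x => map_smul (e.symmₗ ℝ x) c v
  have h2 := D.cov.isCovariantDerivativeOnUniv.smul_const c (mdifferentiableAt_frameSec e v hx)
  rw [← h1] at h2
  refine ContinuousLinearMap.ext fun u => ?_
  exact (congrArg (fun T => e.continuousLinearMapAt ℝ x (T u)) h2).trans
    ((e.continuousLinearMapAt ℝ x).map_smul c _)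

theorem continuousLinearMapAt_smul {x : M} (c : ℂ) (w : E.Fiber x) :
    e.continuousLinearMapAt ℝ x (c • w) = c • e.continuousLinearMapAt ℝ x w := by
  have h : ∀ w, e.continuousLinearMapAt ℝ x w = e.linearMapAt ℂ x w := fun w => by
    rw [e.continuousLinearMapAt_apply (R := ℝ), e.linearMapAt_apply, e.linearMapAt_apply]
  rw [h, h, map_smul]

/-- Complex linearity is part of a connection only for global smooth sections, so the frame section
is replaced by a global one with the same germ at `x`. -/
theorem frameCov_I_smul [T2Space M] (D : Connection E) {x : M} (hx : x ∈ e.baseSet) (v : E.Model)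
    (u : Euc d) : frameCov e D (Complex.I • v) x u = Complex.I • frameCov e D v x u := by
  obtain ⟨s, hs, hsv⟩ := exists_smooth_frameSec e v hx
  have h1 : D.cov (frameSec e v) x = D.cov s x :=
    D.cov_congr (mdifferentiableAt_frameSec e v hx) (hs.mdifferentiableAt x)
      (hsv.mono fun y hy => hy.symm)
  have h2 : D.cov (frameSec e (Complex.I • v)) x = D.cov (Complex.I • s) x :=
    D.cov_congr (mdifferentiableAt_frameSec e _ hx) ((hs.smul _).mdifferentiableAt x)
      (hsv.mono fun y hy => by rw [frameSec_smul, Pi.smul_apply, Pi.smul_apply, hy])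
  calc frameCov e D (Complex.I • v) x u
      = e.continuousLinearMapAt ℝ x (D.cov (Complex.I • s) x u) :=
        congrArg (fun T => e.continuousLinearMapAt ℝ x (T u)) h2
    _ = Complex.I • e.continuousLinearMapAt ℝ x (D.cov s x u) :=
        (congrArg _ (D.complex_linear s hs x u)).trans (continuousLinearMapAt_smul e _ _)
    _ = Complex.I • frameCov e D v x u :=
        congrArg (fun T => Complex.I • e.continuousLinearMapAt ℝ x (T u)) h1.symm

theorem frameCov_smul [T2Space M] (D : Connection E) {x : M} (hx : x ∈ e.baseSet) (c : ℂ)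
    (v : E.Model) (u : Euc d) : frameCov e D (c • v) x u = c • frameCov e D v x u := by
  have hc : ∀ w : E.Model, c • w = c.re • w + c.im • Complex.I • w := by
    intro w
    conv_lhs => rw [← Complex.re_add_im c, add_smul, mul_smul]
    rfl
  rw [hc, frameCov_add e D hx, frameCov_real_smul e D hx, frameCov_real_smul e D hx,
    _root_.add_apply, _root_.smul_apply, _root_.smul_apply,
    frameCov_I_smul e D hx, ← hc]

/-- The connection form in the chart at `x₀` and the trivialization `e`. -/
def connForm (D : Connection E) (x₀ : M) (y : Euc d) : Euc d →L[ℝ] E.Model →L[ℂ] E.Model :=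
  -- Assembled column by column over a complex basis: the values are complex linear by construction,
  -- and smoothness concerns only finitely many covariant derivatives.
  ∑ i, ((ContinuousLinearMap.smulRightL ℂ E.Model E.Model
      (LinearMap.toContinuousLinearMap ((Module.finBasis ℂ E.Model).coord i))).restrictScalars ℝ).comp
    ((frameCov e D (Module.finBasis ℂ E.Model i) ((extChartAt (𝓡 d) x₀).symm y)).comp
      (dChartSymm x₀ y))

theorem connForm_apply [T2Space M] (D : Connection E) (x₀ : M) {y : Euc d}
    (hy : y ∈ chartDomain x₀ e) (u : Euc d) (v : E.Model) :
    connForm e D x₀ y u v =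
      frameCov e D v ((extChartAt (𝓡 d) x₀).symm y) (dChartSymm x₀ y u) := by
  let Λ : E.Model →ₗ[ℂ] E.Model :=
    { toFun := fun v => frameCov e D v ((extChartAt (𝓡 d) x₀).symm y) (dChartSymm x₀ y u)
      map_add' := fun v w => by rw [frameCov_add e D hy.2]; rfl
      map_smul' := fun c v => frameCov_smul e D hy.2 c v _ }
  change _ = Λ v
  conv_rhs => rw [← (Module.finBasis ℂ E.Model).sum_repr v, map_sum]
  rw [connForm, _root_.sum_apply, _root_.sum_apply]
  refine Finset.sum_congr rfl fun i _ => ?_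
  rw [map_smul]
  rfl

theorem continuousLinearMapAt_eq_snd {x : M} (hx : x ∈ e.baseSet) (w : E.Fiber x) :
    e.continuousLinearMapAt ℝ x w = (e ⟨x, w⟩).2 := by
  rw [e.continuousLinearMapAt_apply (R := ℝ), e.linearMapAt_apply, if_pos hx]

theorem dChartSymm_eq_frameSec {x₀ : M} {y : Euc d} (hy : y ∈ (extChartAt (𝓡 d) x₀).target)
    (u : Euc d) : dChartSymm x₀ y u =
      frameSec (trivializationAt (Euc d) (TangentSpace (𝓡 d)) x₀) u
        ((extChartAt (𝓡 d) x₀).symm y) := by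
  rw [dChartSymm_eq hy]
  rfl

theorem eventually_chart_symm {x₀ : M} {y : Euc d} (hy : y ∈ (extChartAt (𝓡 d) x₀).target)
    {p : M → Prop} (h : ∀ᶠ x in 𝓝 ((extChartAt (𝓡 d) x₀).symm y), p x) :
    ∀ᶠ y' in 𝓝 y, p ((extChartAt (𝓡 d) x₀).symm y') :=
  (continuousAt_extChartAt_symm'' hy).eventually h

theorem exists_chart_field [T2Space M] {x₀ : M} {y : Euc d}
    (hy : y ∈ (extChartAt (𝓡 d) x₀).target) (u : Euc d) :
    ∃ X : ∀ x : M, TangentSpace (𝓡 d) x, IsSmoothField X ∧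
      ∀ᶠ y' in 𝓝 y, X ((extChartAt (𝓡 d) x₀).symm y') = dChartSymm x₀ y' u := by
  obtain ⟨X, hX, hXu⟩ := exists_contMDiff_section (V := TangentSpace (𝓡 d))
    (trivializationAt (Euc d) (TangentSpace (𝓡 d)) x₀).open_baseSet (symm_mem_baseSet hy)
    (contMDiffOn_frameSec (d := d) (trivializationAt (Euc d) (TangentSpace (𝓡 d)) x₀) u)
  refine ⟨X, hX, ?_⟩
  filter_upwards [eventually_chart_symm hy hXu, extChartAt_target_mem_nhds' hy] with y' h1 h2
  rw [h1, dChartSymm_eq_frameSec h2]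

/-- Near each point a matrix column applied to `u` is the coordinate of `∇_X s`, with `s` and `X`
global extensions of a frame section and of a coordinate field; such a section is smooth. -/
theorem contDiffOn_connForm [T2Space M] (D : Connection E) (x₀ : M) :
    ContDiffOn ℝ ∞ (connForm e D x₀) (chartDomain x₀ e) := by
  refine ContDiffOn.sum fun i _ => contDiffOn_const.clm_comp ?_
  rw [contDiffOn_clm_apply]
  intro u y hy
  set v := Module.finBasis ℂ E.Model i
  set x := (extChartAt (𝓡 d) x₀).symm y with hxdef
  obtain ⟨s, hs, hsv⟩ := exists_smooth_frameSec e v hy.2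
  obtain ⟨X, hX, hXu⟩ := exists_chart_field hy.1 u
  have h1 := contDiffOn_secCoord_of_contMDiff (d := d) e x₀ (D.cov_smooth hs hX)
  have key : ∀ᶠ y' in 𝓝[chartDomain x₀ e] y,
      (frameCov e D v ((extChartAt (𝓡 d) x₀).symm y')).comp (dChartSymm x₀ y') u =
        secCoord x₀ e (fun x => D.cov s x (X x)) y' := by
    filter_upwards [self_mem_nhdsWithin, nhdsWithin_le_nhds hXu,
      nhdsWithin_le_nhds (eventually_chart_symm hy.1 hsv.eventually_nhds)] with y' h2 h3 h4
    have h5 : D.cov (frameSec e v) ((extChartAt (𝓡 d) x₀).symm y') =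
        D.cov s ((extChartAt (𝓡 d) x₀).symm y') :=
      D.cov_congr (mdifferentiableAt_frameSec e v h2.2) (hs.mdifferentiableAt _)
        (h4.mono fun z hz => hz.symm)
    rw [secCoord, ← continuousLinearMapAt_eq_snd e h2.2, h3, ← h5]
    rfl
  exact (h1 y hy).congr_of_eventuallyEq key (key.self_of_nhdsWithin hy)

/-- A connection is `d + L` in coordinates. -/
theorem cov_eq_locCov [T2Space M] (D : Connection E) (x₀ : M) {y : Euc d}
    (hy : y ∈ chartDomain x₀ e) {σ : ∀ x, E.Fiber x} (hσ : E.IsSmooth σ) (u : Euc d) :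
    (e ⟨(extChartAt (𝓡 d) x₀).symm y,
      D.cov σ ((extChartAt (𝓡 d) x₀).symm y) (dChartSymm x₀ y u)⟩).2 =
      fderiv ℝ (secCoord x₀ e σ) y u + connForm e D x₀ y u (secCoord x₀ e σ y) := by
  set x := (extChartAt (𝓡 d) x₀).symm y with hx
  let w : TangentSpace (𝓡 d) x := dChartSymm x₀ y u
  have hsymm : MDifferentiableAt 𝓘(ℝ, Euc d) (𝓡 d) (extChartAt (𝓡 d) x₀).symm y :=
    ((contMDiffOn_extChartAt_symm (I := 𝓡 d) (n := ∞) x₀).contMDiffAt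
      (extChartAt_target_mem_nhds' hy.1)).mdifferentiableAt (by simp)
  have hcd : ∀ τ : ∀ x, E.Fiber x, MDifferentiableAt (𝓡 d) ((𝓡 d).prod 𝓘(ℝ, E.Model))
      (fun x => (⟨x, τ x⟩ : TotalSpace E.Model E.Fiber)) x →
      DifferentiableAt ℝ (secCoord x₀ e τ) y := by
    intro τ hτ
    have h1 : MDifferentiableAt (𝓡 d) 𝓘(ℝ, E.Model) (fun x => (e ⟨x, τ x⟩).2) x :=
      (e.mdifferentiableAt_section_iff (𝓡 d) τ hy.2).1 hτ
    exact (h1.comp y hsymm).differentiableAt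
  have hsnd : ∀ τ : ∀ x, E.Fiber x, ∀ᶠ y' in 𝓝 y, secCoord x₀ e τ y' =
      e.continuousLinearMapAt ℝ ((extChartAt (𝓡 d) x₀).symm y')
        (τ ((extChartAt (𝓡 d) x₀).symm y')) := by
    intro τ
    filter_upwards [(isOpen_chartDomain (d := d) e x₀).mem_nhds hy] with y' h2
    rw [secCoord, ← continuousLinearMapAt_eq_snd e h2.2]
  -- The derivative terms of the Leibniz rules cancel, so `∇ - d` depends only on the value of the
  -- section at `x`. It may then be computed on the frame section with that value, whose coordinates
  -- are constant.
  have hT : TensorialAt (𝓡 d) E.Model (fun τ : ∀ x, E.Fiber x =>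
      e.continuousLinearMapAt ℝ x (D.cov τ x w) - fderiv ℝ (secCoord x₀ e τ) y u) x := by
    refine ⟨fun {f τ} hf hτ => ?_, fun {τ τ'} hτ hτ' => ?_⟩
    · have hfd : DifferentiableAt ℝ (fun y' => f ((extChartAt (𝓡 d) x₀).symm y')) y :=
        (hf.comp y hsymm).differentiableAt
      have h1 : secCoord x₀ e (f • τ) =ᶠ[𝓝 y]
          (fun y' => f ((extChartAt (𝓡 d) x₀).symm y') • secCoord x₀ e τ y') := by
        filter_upwards [hsnd (f • τ), hsnd τ] with y' h2 h3
        rw [h2, h3]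
        exact map_smul (e.continuousLinearMapAt ℝ _) _ _
      have h2 := D.cov.isCovariantDerivativeOnUniv.leibniz hτ hf
      have h3 : mvfderiv (𝓡 d) f x w = fderiv ℝ (fun y' => f ((extChartAt (𝓡 d) x₀).symm y')) y u := by
        have := mfderiv_comp y hf hsymm
        rw [mfderiv_eq_fderiv] at this
        exact (congrArg (fun T => T u) this).symm
      have h4 : e.continuousLinearMapAt ℝ x (D.cov (f • τ) x w) =
          f x • e.continuousLinearMapAt ℝ x (D.cov τ x w) +
            mvfderiv (𝓡 d) f x w • e.continuousLinearMapAt ℝ x (τ x) := by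
        refine (congrArg (fun T => e.continuousLinearMapAt ℝ x (T w)) h2).trans ?_
        refine (map_add (e.continuousLinearMapAt ℝ x) _ _).trans ?_
        exact congrArg₂ _ (map_smul (e.continuousLinearMapAt ℝ x) _ _)
          (map_smul (e.continuousLinearMapAt ℝ x) _ _)
      rw [h1.fderiv_eq, fderiv_fun_smul hfd (hcd τ hτ), h4, h3, (hsnd τ).self_of_nhds]
      simp only [_root_.add_apply, _root_.smul_apply, ContinuousLinearMap.smulRight_apply, ← hx]
      module
    · have h1 : secCoord x₀ e (τ + τ') =ᶠ[𝓝 y] secCoord x₀ e τ + secCoord x₀ e τ' := by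
        filter_upwards [hsnd (τ + τ'), hsnd τ, hsnd τ'] with y' h2 h3 h4
        rw [Pi.add_apply, h2, h3, h4]
        exact map_add _ _ _
      have h2 := D.cov.isCovariantDerivativeOnUniv.add hτ hτ'
      rw [h1.fderiv_eq, fderiv_add (hcd τ hτ) (hcd τ' hτ')]
      have h3 : e.continuousLinearMapAt ℝ x (D.cov (τ + τ') x w) =
        e.continuousLinearMapAt ℝ x (D.cov τ x w) + e.continuousLinearMapAt ℝ x (D.cov τ' x w) :=
        (congrArg (fun T => e.continuousLinearMapAt ℝ x (T w)) h2).trans (map_add _ _ _)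
      rw [h3, _root_.add_apply]
      abel
  have h0 : σ x = frameSec e (secCoord x₀ e σ y) x := by
    rw [frameSec, e.symmₗ_apply hy.2, secCoord, e.symm_apply_apply_mk hy.2]
  have h1 := hT.pointwise (hσ.mdifferentiableAt x) (mdifferentiableAt_frameSec e _ hy.2) h0
  have h2 : secCoord x₀ e (frameSec e (secCoord x₀ e σ y)) =ᶠ[𝓝 y] fun _ => secCoord x₀ e σ y := by
    filter_upwards [(isOpen_chartDomain (d := d) e x₀).mem_nhds hy] with y' h2
    exact trivialization_apply_frameSec e h2.2 _
  rw [h2.fderiv_eq, fderiv_fun_const, sub_eq_iff_eq_add] at h1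
  rw [← continuousLinearMapAt_eq_snd e hy.2]
  refine h1.trans ?_
  rw [connForm_apply e D x₀ hy]
  rw [add_comm]
  exact congrArg _ (sub_zero _)

end ConnectionLocal
end FamiliesChernWeil

end

noncomputable section
namespace FamiliesChernWeil
-- The curvature tensor, and closedness of `tr R^k`
section CurvatureLocal

variable {d : ℕ} {M : Type*} [TopologicalSpace M] [ChartedSpace (Euc d) M] [IsManifold (𝓡 d) ∞ M]
  {E : ComplexBundle d M}

/-- The coordinate expression of a vector field. -/
def fieldCoord (x₀ : M) (X : ∀ x : M, TangentSpace (𝓡 d) x) : Euc d → Euc d :=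
  secCoord x₀ (trivializationAt (Euc d) (TangentSpace (𝓡 d)) x₀) X

theorem dChartSymm_fieldCoord {x₀ : M} {y : Euc d} (hy : y ∈ (extChartAt (𝓡 d) x₀).target)
    (X : ∀ x : M, TangentSpace (𝓡 d) x) :
    dChartSymm x₀ y (fieldCoord x₀ X y) = X ((extChartAt (𝓡 d) x₀).symm y) := by
  rw [dChartSymm_eq_frameSec hy, frameSec, Trivialization.symmₗ_apply _ (symm_mem_baseSet hy),
    fieldCoord, secCoord, Trivialization.symm_apply_apply_mk _ (symm_mem_baseSet hy)]

theorem chartDomain_tangent (x₀ : M) :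
    chartDomain x₀ (trivializationAt (Euc d) (TangentSpace (𝓡 d)) x₀) =
      (extChartAt (𝓡 d) x₀).target :=
  Set.inter_eq_left.2 fun _ hy => symm_mem_baseSet hy

theorem contDiffOn_fieldCoord (x₀ : M) {X : ∀ x : M, TangentSpace (𝓡 d) x} (hX : IsSmoothField X) :
    ContDiffOn ℝ ∞ (fieldCoord x₀ X) (extChartAt (𝓡 d) x₀).target := by
  rw [← chartDomain_tangent]
  exact contDiffOn_secCoord_of_contMDiff _ x₀ hX

theorem mpullback_chart_symm {x₀ : M} {y : Euc d} (hy : y ∈ (extChartAt (𝓡 d) x₀).target)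
    (X : ∀ x : M, TangentSpace (𝓡 d) x) :
    VectorField.mpullback 𝓘(ℝ, Euc d) (𝓡 d) (extChartAt (𝓡 d) x₀).symm X y = fieldCoord x₀ X y := by
  have h1 : VectorField.mpullback 𝓘(ℝ, Euc d) (𝓡 d) (extChartAt (𝓡 d) x₀).symm X y =
      (dChartEquiv x₀ hy : Euc d →L[ℝ] Euc d).inverse (X ((extChartAt (𝓡 d) x₀).symm y)) := rfl
  rw [h1, ContinuousLinearMap.inverse_equiv]
  refine (congrArg (dChartEquiv x₀ hy).symm (dChartSymm_fieldCoord hy X).symm).trans ?_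
  exact (dChartEquiv x₀ hy).symm_apply_apply _

theorem mlieBracket_eq_lieBracket (V W : ∀ y : Euc d, TangentSpace 𝓘(ℝ, Euc d) y) :
    VectorField.mlieBracket 𝓘(ℝ, Euc d) V W = VectorField.lieBracket ℝ V W := by
  rw [← VectorField.mlieBracketWithin_univ, VectorField.mlieBracketWithin_eq_lieBracketWithin]
  exact VectorField.lieBracketWithin_univ (𝕜 := ℝ) (V := (V : Euc d → Euc d)) (W := W)

/-- Naturality of the Lie bracket under the inverse chart, whose pullback of a field is its
coordinate expression. -/
theorem mlieBracket_chart {x₀ : M} {y : Euc d} (hy : y ∈ (extChartAt (𝓡 d) x₀).target)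
    {X Y : ∀ x : M, TangentSpace (𝓡 d) x} (hX : IsSmoothField X) (hY : IsSmoothField Y) :
    VectorField.mlieBracket (𝓡 d) X Y ((extChartAt (𝓡 d) x₀).symm y) =
      dChartSymm x₀ y (VectorField.lieBracket ℝ (fieldCoord x₀ X) (fieldCoord x₀ Y) y) := by
  have hc : ContMDiffAt 𝓘(ℝ, Euc d) (𝓡 d) ∞ (extChartAt (𝓡 d) x₀).symm y :=
    (contMDiffOn_extChartAt_symm (I := 𝓡 d) (n := ∞) x₀).contMDiffAt
      (extChartAt_target_mem_nhds' hy)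
  have : IsManifold (𝓡 d) (minSmoothness ℝ 3) M := IsManifold.of_le (n := ∞)
    (by simpa using WithTop.coe_le_coe.2 (le_top (a := (3 : ℕ∞))))
  have h := VectorField.mpullback_mlieBracket (V := X) (W := Y)
    ((hX _).mdifferentiableAt (by simp)) ((hY _).mdifferentiableAt (by simp)) hc
    (by simpa using WithTop.coe_le_coe.2 (le_top (a := (2 : ℕ∞))))
  have h2 : ∀ X : ∀ x : M, TangentSpace (𝓡 d) x,
      VectorField.mpullback 𝓘(ℝ, Euc d) (𝓡 d) (extChartAt (𝓡 d) x₀).symm X =ᶠ[𝓝 y]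
        fieldCoord x₀ X := fun X =>
    Filter.mem_of_superset (extChartAt_target_mem_nhds' hy) fun y' hy' =>
      mpullback_chart_symm hy' X
  rw [mpullback_chart_symm hy, (h2 X).mlieBracket_vectorField_eq (h2 Y)] at h
  have h3 : VectorField.mlieBracket 𝓘(ℝ, Euc d) (fieldCoord x₀ X) (fieldCoord x₀ Y) y =
      VectorField.lieBracket ℝ (fieldCoord x₀ X) (fieldCoord x₀ Y) y := 
    congrFun (mlieBracket_eq_lieBracket _ _) y
  exact (dChartSymm_fieldCoord hy _).symm.trans (congrArg (dChartSymm x₀ y) (h.trans h3))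

theorem secCoord_center (x : M)
    (e : Trivialization E.Model (TotalSpace.proj : TotalSpace E.Model E.Fiber → M))
    (s : ∀ x, E.Fiber x) :
    secCoord x e s (extChartAt (𝓡 d) x x) = (e ⟨x, s x⟩).2 :=
  congrArg (fun x' => (e ⟨x', s x'⟩).2) (extChartAt_to_inv x)

variable (e : Trivialization E.Model (TotalSpace.proj : TotalSpace E.Model E.Fiber → M))
  [MemTrivializationAtlas e] [T2Space M]

theorem chartDomain_subset (x₀ : M) : chartDomain x₀ e ⊆ (extChartAt (𝓡 d) x₀).target :=
  Set.inter_subset_left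

theorem secCoord_cov (D : Connection E) (x₀ : M) {y : Euc d} (hy : y ∈ chartDomain x₀ e)
    {σ : ∀ x, E.Fiber x} (hσ : E.IsSmooth σ) (X : ∀ x : M, TangentSpace (𝓡 d) x) :
    secCoord x₀ e (fun x => D.cov σ x (X x)) y =
      locCov (connForm e D x₀) (fieldCoord x₀ X) (secCoord x₀ e σ) y := by
  rw [locCov, ← cov_eq_locCov e D x₀ hy hσ, dChartSymm_fieldCoord hy.1]
  rfl

/-- The commutator of covariant derivatives in coordinates. -/
theorem commutator_coord (D : Connection E) (x₀ : M) {y : Euc d} (hy : y ∈ chartDomain x₀ e)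
    {σ : ∀ x, E.Fiber x} (hσ : E.IsSmooth σ) {X Y : ∀ x : M, TangentSpace (𝓡 d) x}
    (hX : IsSmoothField X) (hY : IsSmoothField Y) :
    secCoord x₀ e (fun x => D.cov (fun y => D.cov σ y (Y y)) x (X x)
        - D.cov (fun y => D.cov σ y (X y)) x (Y x)
          - D.cov σ x (VectorField.mlieBracket (𝓡 d) X Y x)) y =
      locCurv (connForm e D x₀) y 2 ![fieldCoord x₀ X y, fieldCoord x₀ Y y]
        (secCoord x₀ e σ y) := by
  have hU := isOpen_chartDomain (d := d) e x₀
  have hsub := chartDomain_subset e x₀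
  rw [← locCov_commutator hU (contDiffOn_connForm e D x₀)
    ((contDiffOn_fieldCoord x₀ hX).mono hsub) ((contDiffOn_fieldCoord x₀ hY).mono hsub)
    (contDiffOn_secCoord_of_contMDiff e x₀ hσ) hy]
  have h1 : ∀ {X Y : ∀ x : M, TangentSpace (𝓡 d) x}, IsSmoothField Y →
      secCoord x₀ e (fun x => D.cov (fun y => D.cov σ y (Y y)) x (X x)) y =
      locCov (connForm e D x₀) (fieldCoord x₀ X)
        (locCov (connForm e D x₀) (fieldCoord x₀ Y) (secCoord x₀ e σ)) y := by
    intro X Y hY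
    rw [secCoord_cov e D x₀ hy (D.cov_smooth hσ hY)]
    have h2 : secCoord x₀ e (fun x => D.cov σ x (Y x)) =ᶠ[𝓝 y]
        locCov (connForm e D x₀) (fieldCoord x₀ Y) (secCoord x₀ e σ) :=
      Filter.mem_of_superset (hU.mem_nhds hy) fun y' hy' => secCoord_cov e D x₀ hy' hσ Y
    rw [locCov, h2.fderiv_eq, h2.eq_of_nhds]
    rfl
  have h3 : secCoord x₀ e (fun x => D.cov σ x (VectorField.mlieBracket (𝓡 d) X Y x)) y =
      locCov (connForm e D x₀) (VectorField.lieBracket ℝ (fieldCoord x₀ X) (fieldCoord x₀ Y))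
        (secCoord x₀ e σ) y := by
    rw [locCov, ← cov_eq_locCov e D x₀ hy hσ, ← mlieBracket_chart hy.1 hX hY]
    rfl
  rw [← h1 hX, ← h1 hY, ← h3]
  simp only [secCoord, ← continuousLinearMapAt_eq_snd e hy.2]
  rw [map_sub, map_sub]


/-- Endomorphisms of a fiber in a trivialization. -/
def fiberEnd {x : M} (hx : x ∈ e.baseSet) :
    Module.End ℂ (E.Fiber x) ≃ₐ[ℂ] (E.Model →L[ℂ] E.Model) :=
  (e.linearEquivAt ℂ x hx).conjAlgEquiv ℂ |>.trans (Module.End.toContinuousLinearMap E.Model)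

theorem fiberEnd_apply {x : M} (hx : x ∈ e.baseSet) (T : Module.End ℂ (E.Fiber x))
    (v : E.Model) : fiberEnd e hx T v = (e ⟨x, T (e.symm x v)⟩).2 := rfl

theorem fiberEnd_symm_apply {x : M} (hx : x ∈ e.baseSet) (T : E.Model →L[ℂ] E.Model)
    (w : E.Fiber x) : (fiberEnd e hx).symm T w = e.symm x (T (e ⟨x, w⟩).2) := rfl

/-- At each point the local curvature in the preferred chart and trivialization at that point is
used; the chart differential is the identity there, so no change of coordinates enters. -/
theorem exists_isCurvature (D : Connection E) : ∃ R, D.IsCurvature R := by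
  let e : ∀ x : M, Trivialization E.Model (TotalSpace.proj : TotalSpace E.Model E.Fiber → M) :=
    fun x => trivializationAt E.Model E.Fiber x
  have hx : ∀ x, x ∈ (e x).baseSet := fun x => FiberBundle.mem_baseSet_trivializationAt' x
  refine ⟨fun x => (((fiberEnd (e x) (hx x)).symm.toLinearMap.restrictScalars ℝ)).compAlternatingMap
    (locCurv (connForm (e x) D x) (extChartAt (𝓡 d) x x) 2), ?_⟩
  intro X Y hX hY σ hσ x
  have hy : extChartAt (𝓡 d) x x ∈ chartDomain x (e x) :=
    ⟨mem_extChartAt_target x, by simpa using hx x⟩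
  have h := commutator_coord (e x) D x hy hσ hX hY
  have hself : ∀ X : ∀ x : M, TangentSpace (𝓡 d) x,
      fieldCoord x X (extChartAt (𝓡 d) x x) = X x := fun X => by
    rw [← dChartSymm_self x (fieldCoord x X (extChartAt (𝓡 d) x x)),
      dChartSymm_fieldCoord hy.1, extChartAt_to_inv]
  rw [hself, hself] at h
  rw [secCoord_center, secCoord_center] at h
  rw [LinearMap.compAlternatingMap_apply]
  change (fiberEnd (e x) (hx x)).symm _ (σ x) = _
  rw [fiberEnd_symm_apply, ← h, (e x).symm_apply_apply_mk (hx x)]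

/-- Rules out the default value `0` in the definition of `Connection.curvature`. -/
theorem isCurvature_curvature (D : Connection E) : D.IsCurvature D.curvature := by
  have h := exists_isCurvature D
  rw [Connection.curvature, dif_pos h]
  exact h.choose_spec

/-- Coordinate vectors and fiber values extend to global smooth fields and sections, and the
commutator evaluated on these extensions determines the curvature in any chart and trivialization.
-/
theorem fiberEnd_curvature (D : Connection E) (x₀ : M) {y : Euc d} (hy : y ∈ chartDomain x₀ e)
    (u w : Euc d) :
    fiberEnd e hy.2 (D.curvature ((extChartAt (𝓡 d) x₀).symm y)
      ![dChartSymm x₀ y u, dChartSymm x₀ y w]) = locCurv (connForm e D x₀) y 2 ![u, w] := by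
  ext v
  obtain ⟨X, hX, hXu⟩ := exists_chart_field hy.1 u
  obtain ⟨Y, hY, hYw⟩ := exists_chart_field hy.1 w
  obtain ⟨s, hs, hsv⟩ := exists_smooth_frameSec e v hy.2
  have h := isCurvature_curvature D X Y hX hY s hs ((extChartAt (𝓡 d) x₀).symm y)
  have h1 := commutator_coord e D x₀ hy hs hX hY
  have h2 : ∀ {X : ∀ x : M, TangentSpace (𝓡 d) x} {u},
      (∀ᶠ y' in 𝓝 y, X ((extChartAt (𝓡 d) x₀).symm y') = dChartSymm x₀ y' u) →
      fieldCoord x₀ X y = u := fun {X u} hXu =>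
    (dChartEquiv x₀ hy.1).injective ((dChartSymm_fieldCoord hy.1 X).trans hXu.self_of_nhds)
  have h3 : secCoord x₀ e s y = v := by
    rw [secCoord, hsv.self_of_nhds, trivialization_apply_frameSec e hy.2]
  rw [h2 hXu, h2 hYw, h3, secCoord, ← h, hXu.self_of_nhds, hYw.self_of_nhds, hsv.self_of_nhds,
    frameSec, e.symmₗ_apply hy.2] at h1
  rw [← h1]
  rfl

/-- The curvature in coordinates, as a family of forms. -/
theorem of_curvature_coord (D : Connection E) (x₀ : M) {y : Euc d} (hy : y ∈ chartDomain x₀ e) :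
    GForm.of 2 (((fiberEnd e hy.2).toLinearMap.restrictScalars ℝ).compAlternatingMap
      ((D.curvature ((extChartAt (𝓡 d) x₀).symm y)).compLinearMap (dChartSymm x₀ y).toLinearMap)) =
      locCurv (connForm e D x₀) y := by
  rw [locCurv, curvForm_eq_of]
  congr 1
  ext1 v
  have hv : v = ![v 0, v 1] := by ext1 i; fin_cases i <;> rfl
  rw [hv]
  refine Eq.trans ?_ (fiberEnd_curvature e D x₀ hy (v 0) (v 1))
  rw [LinearMap.compAlternatingMap_apply, AlternatingMap.compLinearMap_apply]
  refine congrArg (fun z => fiberEnd e hy.2 (D.curvature ((extChartAt (𝓡 d) x₀).symm y) z)) ?_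
  ext1 i
  fin_cases i <;> rfl

/-- The trace on the endomorphisms of the model fiber. -/
def modelTrace (E : ComplexBundle d M) : (E.Model →L[ℂ] E.Model) →L[ℝ] ℂ :=
  (LinearMap.toContinuousLinearMap (LinearMap.trace ℂ E.Model ∘ₗ
    (Module.End.toContinuousLinearMap E.Model).symm.toLinearMap)).restrictScalars ℝ

theorem modelTrace_mul_comm (S T : E.Model →L[ℂ] E.Model) :
    modelTrace E (S * T) = modelTrace E (T * S) := by
  change LinearMap.trace ℂ E.Model ((Module.End.toContinuousLinearMap E.Model).symm (S * T)) =
    LinearMap.trace ℂ E.Model ((Module.End.toContinuousLinearMap E.Model).symm (T * S))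
  rw [map_mul (Module.End.toContinuousLinearMap E.Model).symm,
    map_mul (Module.End.toContinuousLinearMap E.Model).symm, LinearMap.trace_mul_comm]

theorem modelTrace_fiberEnd {x : M} (hx : x ∈ e.baseSet) (T : Module.End ℂ (E.Fiber x)) :
    modelTrace E (fiberEnd e hx T) = LinearMap.trace ℂ _ T := by
  have h : (Module.End.toContinuousLinearMap E.Model).symm (fiberEnd e hx T) =
      (e.linearEquivAt ℂ x hx).conj T :=
    AlgEquiv.symm_apply_apply _ _
  refine Eq.trans (congrArg (LinearMap.trace ℂ E.Model) h) (LinearMap.trace_conj' _ _)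

/-- A trivialization identifies fiber endomorphisms with matrices as algebras, compatibly with the
trace, so wedge powers and their traces can be computed locally. -/
theorem trPow_coord (D : Connection E) (k : ℕ) (x₀ : M) {y : Euc d} (hy : y ∈ chartDomain x₀ e)
    (v : Fin (2 * k) → Euc d) : chartForm (D.trPow k) x₀ y v =
      GForm.mapVal (modelTrace E : (E.Model →L[ℂ] E.Model) →ₗ[ℝ] ℂ)
        (locCurv (connForm e D x₀) y ^ k) (2 * k) v := by
  have h1 := wedgePow_map ((fiberEnd e hy.2).restrictScalars ℝ).toAlgHom
    ((D.curvature ((extChartAt (𝓡 d) x₀).symm y)).compLinearMap (dChartSymm x₀ y).toLinearMap) k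
  rw [← of_curvature_coord e D x₀ hy, GForm.of_pow, GForm.mapVal_apply, GForm.of_same]
  refine Eq.trans ?_ (congrArg (fun α => modelTrace E (α v)) h1).symm
  rw [wedgePow_compLinearMap]
  exact (modelTrace_fiberEnd e hy.2 _).symm

theorem exists_trivialization_chart (x₀ : M) {y : Euc d} (hy : y ∈ (extChartAt (𝓡 d) x₀).target) :
    y ∈ chartDomain x₀ (trivializationAt E.Model E.Fiber ((extChartAt (𝓡 d) x₀).symm y)) :=
  ⟨hy, FiberBundle.mem_baseSet_trivializationAt' _⟩

theorem isSmoothForm_trPow (D : Connection E) (k : ℕ) : IsSmoothForm (D.trPow k) := by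
  intro x₀ y hy
  have hy' := exists_trivialization_chart (E := E) x₀ hy
  set e := trivializationAt E.Model E.Fiber ((extChartAt (𝓡 d) x₀).symm y)
  exact ((contDiffOn_trace_pow (isOpen_chartDomain e x₀) (contDiffOn_connForm e D x₀)
    fun z hz => trPow_coord e D k x₀ hz).contDiffAt
      ((isOpen_chartDomain e x₀).mem_nhds hy')).contDiffWithinAt

theorem extDeriv_trPow (D : Connection E) (k : ℕ) (x₀ : M) {y : Euc d}
    (hy : y ∈ (extChartAt (𝓡 d) x₀).target) : extDeriv (chartForm (D.trPow k) x₀) y = 0 := by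
  have hy' := exists_trivialization_chart (E := E) x₀ hy
  set e := trivializationAt E.Model E.Fiber ((extChartAt (𝓡 d) x₀).symm y)
  exact extDeriv_trace_pow (isOpen_chartDomain e x₀) (contDiffOn_connForm e D x₀)
    modelTrace_mul_comm (fun z hz => trPow_coord e D k x₀ hz) hy'

theorem dForm_trPow (D : Connection E) (k : ℕ) : dForm (D.trPow k) = 0 :=
  funext fun x => extDeriv_trPow D k x (mem_extChartAt_target x)

end CurvatureLocal
end FamiliesChernWeil

end

noncomputable section
namespace FamiliesChernWeil
-- The global transgression form
section Transgression

variable {d : ℕ} {M : Type*} [TopologicalSpace M] [ChartedSpace (Euc d) M] [IsManifold (𝓡 d) ∞ M]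
  {E : ComplexBundle d M} [T2Space M]

/-- The affine path between two connections. -/
def Connection.path (D₀ D₁ : Connection E) (t : ℝ) : Connection E where
  -- The weight `t` belongs to `D₁`, so the path runs from `D₀` at `t = 0` to `D₁` at `t = 1`.
  cov := CovariantDerivative.affineCombination D₁.cov D₀.cov fun _ => t
  smooth := CovariantDerivative.ContMDiffCovariantDerivative.affineCombination D₁.cov D₀.cov
    contMDiff_const D₁.smooth D₀.smooth
  complex_linear := by
    intro σ hσ x u
    change t • D₁.cov (Complex.I • σ) x u + (1 - t) • D₀.cov (Complex.I • σ) x u =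
      Complex.I • (t • D₁.cov σ x u + (1 - t) • D₀.cov σ x u)
    rw [D₁.complex_linear σ hσ, D₀.complex_linear σ hσ, smul_add, smul_comm t, smul_comm (1 - t)]

variable (e : Trivialization E.Model (TotalSpace.proj : TotalSpace E.Model E.Fiber → M))
  [MemTrivializationAtlas e]

theorem frameCov_path (D₀ D₁ : Connection E) (t : ℝ) (v : E.Model) (x : M) :
    frameCov e (D₀.path D₁ t) v x =
      frameCov e D₀ v x + t • (frameCov e D₁ v x - frameCov e D₀ v x) := by
  refine ContinuousLinearMap.ext fun u => ?_
  have h : (D₀.path D₁ t).cov (frameSec e v) x u =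
    t • D₁.cov (frameSec e v) x u + (1 - t) • D₀.cov (frameSec e v) x u := rfl
  have h2 : frameCov e (D₀.path D₁ t) v x u = t • frameCov e D₁ v x u +
      (1 - t) • frameCov e D₀ v x u := by
    refine (congrArg (e.continuousLinearMapAt ℝ x) h).trans ?_
    refine (map_add (e.continuousLinearMapAt ℝ x) _ _).trans ?_
    exact congrArg₂ _ (map_smul (e.continuousLinearMapAt ℝ x) _ _)
      (map_smul (e.continuousLinearMapAt ℝ x) _ _)
  rw [h2, _root_.add_apply, _root_.smul_apply, _root_.sub_apply]
  module

theorem connForm_path (D₀ D₁ : Connection E) (x₀ : M) (t : ℝ) :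
    connForm e (D₀.path D₁ t) x₀ =
      pathForm (connForm e D₀ x₀) (connForm e D₁ x₀ - connForm e D₀ x₀) t := by
  funext y
  refine ContinuousLinearMap.ext fun u => ?_
  simp only [pathForm, connForm, _root_.add_apply, _root_.smul_apply, _root_.sub_apply,
    Pi.sub_apply, _root_.sum_apply, ContinuousLinearMap.comp_apply, frameCov_path, map_add,
    map_smul, map_sub, Finset.sum_add_distrib, Finset.smul_sum, Finset.sum_sub_distrib, smul_sub]

/-- The difference of two connections, an `End(E)`-valued `1`-form. -/
def connDiff (D₀ D₁ : Connection E) (x : M) : Euc d →ₗ[ℝ] Module.End ℂ (E.Fiber x) :=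
  (((fiberEnd (trivializationAt E.Model E.Fiber x)
    (FiberBundle.mem_baseSet_trivializationAt' x)).symm.toLinearMap.restrictScalars ℝ)) ∘ₗ
  (connForm (trivializationAt E.Model E.Fiber x) D₁ x (extChartAt (𝓡 d) x x) -
    connForm (trivializationAt E.Model E.Fiber x) D₀ x (extChartAt (𝓡 d) x x)).toLinearMap

/-- Relates the local difference of connection forms to the invariant difference tensor, so that
`connDiff`, defined with a preferred trivialization at each point, has the expected expression in
every trivialization. -/
theorem connForm_sub_apply (D₀ D₁ : Connection E) (x₀ : M) {y : Euc d} (hy : y ∈ chartDomain x₀ e)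
    (u : Euc d) (v : E.Model) :
    (connForm e D₁ x₀ y - connForm e D₀ x₀ y) u v =
      (e ⟨(extChartAt (𝓡 d) x₀).symm y, CovariantDerivative.difference D₁.cov D₀.cov
        ((extChartAt (𝓡 d) x₀).symm y) (e.symm ((extChartAt (𝓡 d) x₀).symm y) v)
          (dChartSymm x₀ y u)⟩).2 := by
  rw [_root_.sub_apply, _root_.sub_apply, connForm_apply e D₁ x₀ hy, connForm_apply e D₀ x₀ hy,
    ← continuousLinearMapAt_eq_snd e hy.2]
  have h := IsCovariantDerivativeOn.difference_apply D₁.cov.isCovariantDerivativeOnUniv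
    D₀.cov.isCovariantDerivativeOnUniv trivial (mdifferentiableAt_frameSec e v hy.2)
  rw [frameSec, e.symmₗ_apply hy.2] at h
  refine Eq.trans ?_ (congrArg (fun T => e.continuousLinearMapAt ℝ _ (T (dChartSymm x₀ y u))) h).symm
  exact (map_sub (e.continuousLinearMapAt ℝ _) _ _).symm

theorem connDiff_apply (D₀ D₁ : Connection E) (x : M) (u : Euc d) (w : E.Fiber x) :
    connDiff D₀ D₁ x u w = CovariantDerivative.difference D₁.cov D₀.cov x w u := by
  set e := trivializationAt E.Model E.Fiber x
  have hx : x ∈ e.baseSet := FiberBundle.mem_baseSet_trivializationAt' x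
  have hy : extChartAt (𝓡 d) x x ∈ chartDomain x e :=
    ⟨mem_extChartAt_target x, by simpa using hx⟩
  have h := connForm_sub_apply e D₀ D₁ x hy u (e ⟨x, w⟩).2
  have h2 : connDiff D₀ D₁ x u w = e.symm x ((connForm e D₁ x (extChartAt (𝓡 d) x x) -
    connForm e D₀ x (extChartAt (𝓡 d) x x)) u (e ⟨x, w⟩).2) := rfl
  rw [h2, h, dChartSymm_self]
  have key : ∀ x', x' = x → ∀ u : Euc d, (e ⟨x', CovariantDerivative.difference D₁.cov D₀.cov x'
      (e.symm x' (e ⟨x, w⟩).2) u⟩).2 =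
      (e ⟨x, CovariantDerivative.difference D₁.cov D₀.cov x w u⟩).2 := by
    rintro x' rfl u
    rw [e.symm_apply_apply_mk hx]
  exact (congrArg (e.symm x) (key _ (extChartAt_to_inv x) u)).trans (e.symm_apply_apply_mk hx _)

theorem fiberEnd_connDiff (D₀ D₁ : Connection E) (x₀ : M) {y : Euc d} (hy : y ∈ chartDomain x₀ e)
    (u : Euc d) :
    fiberEnd e hy.2 (connDiff D₀ D₁ ((extChartAt (𝓡 d) x₀).symm y) (dChartSymm x₀ y u)) =
      (connForm e D₁ x₀ y - connForm e D₀ x₀ y) u := by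
  ext v
  rw [connForm_sub_apply e D₀ D₁ x₀ hy, fiberEnd_apply, connDiff_apply]

/-- The transgression form at time `t`. -/
def Connection.transgressionAt (D₀ D₁ : Connection E) (k : ℕ) (t : ℝ) : DForm d M (2 * k + 1) ℂ :=
  fun x => toContinuous ((k + 1 : ℝ) •
    ((LinearMap.trace ℂ (E.Fiber x)).restrictScalars ℝ).compAlternatingMap
      (wedge (add_comm _ _) (AlternatingMap.ofSubsingleton ℝ _ _ (0 : Fin 1) (connDiff D₀ D₁ x))
        (wedgePow ((D₀.path D₁ t).curvature x) k)))

/-- The transgression form. -/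
def Connection.transgression (D₀ D₁ : Connection E) (k : ℕ) : DForm d M (2 * k + 1) ℂ :=
  fun x => ∫ t in Set.Icc (0 : ℝ) 1, D₀.transgressionAt D₁ k t x

theorem transgressionAt_coord (D₀ D₁ : Connection E) (k : ℕ) (t : ℝ) (x₀ : M) {y : Euc d}
    (hy : y ∈ chartDomain x₀ e) (v : Fin (2 * k + 1) → Euc d) :
    D₀.transgressionAt D₁ k t ((extChartAt (𝓡 d) x₀).symm y) (fun i => dChartSymm x₀ y (v i)) =
      transgressionForm (modelTrace E) (connForm e D₀ x₀) (connForm e D₁ x₀ - connForm e D₀ x₀) k t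
        y (2 * k + 1) v := by
  set x := (extChartAt (𝓡 d) x₀).symm y with hx
  let φ := ((fiberEnd e hy.2).restrictScalars ℝ).toAlgHom
  let δ := dChartSymm x₀ y
  let a := AlternatingMap.ofSubsingleton ℝ (Euc d) (Module.End ℂ (E.Fiber x)) (0 : Fin 1)
    (connDiff D₀ D₁ x)
  have h1 := wedgePow_map φ (((D₀.path D₁ t).curvature x).compLinearMap δ.toLinearMap) k
  have h2 : oneFormLM (Euc d) _ ((connForm e D₁ x₀ - connForm e D₀ x₀) y) =
      GForm.of 1 (φ.toLinearMap.compAlternatingMap (a.compLinearMap δ.toLinearMap)) := by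
    refine congrArg (GForm.of 1) (AlternatingMap.ext fun v => ?_)
    exact (fiberEnd_connDiff e D₀ D₁ x₀ hy (v 0)).symm
  rw [transgressionForm, ← connForm_path, ← of_curvature_coord e _ x₀ hy, GForm.of_pow, h2,
    GForm.of_mul_of (r := 2 * k + 1) (add_comm _ _), GForm.smul_apply, GForm.mapVal_apply, GForm.of_same]
  have h3 := wedge_map (V := Euc d) φ.toLinearMap LinearMap.id LinearMap.id φ.toLinearMap φ.toLinearMap
    (fun a b => map_mul φ a b) (add_comm 1 (2 * k)) (a.compLinearMap δ.toLinearMap)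
    (wedgePow (((D₀.path D₁ t).curvature x).compLinearMap δ.toLinearMap) k)
  rw [← h1, wedgePow_compLinearMap] at h3
  have h4 := wedge_compLinearMap (add_comm 1 (2 * k)) a
    (wedgePow ((D₀.path D₁ t).curvature x) k) δ.toLinearMap
  have h5 : wedge (add_comm 1 (2 * k)) (φ.toLinearMap.compAlternatingMap
        (a.compLinearMap δ.toLinearMap))
      (wedgePow (φ.toLinearMap.compAlternatingMap
        (((D₀.path D₁ t).curvature x).compLinearMap δ.toLinearMap)) k) v =
      fiberEnd e hy.2 (wedge (add_comm 1 (2 * k)) a (wedgePow ((D₀.path D₁ t).curvature x) k)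
        (fun i => δ (v i))) := by
    rw [← wedgePow_compLinearMap] at h3
    refine (congrArg (fun α => α v) h3).symm.trans ?_
    rw [wedgePow_compLinearMap]
    exact congrArg (fun α => fiberEnd e hy.2 (α v)) h4
  refine Eq.trans ?_ (congrArg (fun z => (k + 1 : ℝ) • modelTrace E z) h5).symm
  exact congrArg (fun z => (k + 1 : ℝ) • z) (modelTrace_fiberEnd e hy.2 _).symm

theorem continuous_transgressionAt (D₀ D₁ : Connection E) (k : ℕ) (x : M) :
    Continuous fun t => D₀.transgressionAt D₁ k t x := by
  set e := trivializationAt E.Model E.Fiber x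
  have hy : extChartAt (𝓡 d) x x ∈ chartDomain x e :=
    ⟨mem_extChartAt_target x, by simpa using FiberBundle.mem_baseSet_trivializationAt' x⟩
  have hU := isOpen_chartDomain (d := d) e x
  refine continuous_alternating_iff fun v => ?_
  have h : ∀ t, D₀.transgressionAt D₁ k t x v = transgressionForm (modelTrace E) (connForm e D₀ x)
      (connForm e D₁ x - connForm e D₀ x) k t (extChartAt (𝓡 d) x x) (2 * k + 1) v := by
    intro t
    rw [← transgressionAt_coord e D₀ D₁ k t x hy]
    simp only [dChartSymm_self]
    rw [extChartAt_to_inv]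
  simp only [h]
  exact (gSmoothOn_transgressionForm hU (contDiffOn_connForm e D₀ x)
    ((contDiffOn_connForm e D₁ x).sub (contDiffOn_connForm e D₀ x)) k _ v).continuousOn.comp_continuous
    (f := fun t : ℝ => (extChartAt (𝓡 d) x x, t)) (by fun_prop) fun t => ⟨hy, trivial⟩

/-- Evaluation is continuous and linear, so it passes under the integral; continuity in `t` provides
integrability. -/
theorem transgression_apply (D₀ D₁ : Connection E) (k : ℕ) (x : M) (v : Fin (2 * k + 1) → Euc d) :
    D₀.transgression D₁ k x v = ∫ t in Set.Icc (0 : ℝ) 1, D₀.transgressionAt D₁ k t x v :=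
  ((ContinuousAlternatingMap.apply ℝ (Euc d) ℂ v).integral_comp_comm
    ((continuous_transgressionAt D₀ D₁ k x).continuousOn.integrableOn_compact isCompact_Icc)).symm

/-- Affinity of connection forms identifies the global path with `pathForm` in coordinates; the
local transgression formula then applies, with endpoints `t = 0` and `t = 1`. -/
theorem chartForm_transgression (D₀ D₁ : Connection E) (k : ℕ) (x₀ : M) :
    ContDiffOn ℝ ∞ (chartForm (D₀.transgression D₁ k) x₀) (chartDomain x₀ e) ∧
    ∀ y ∈ chartDomain x₀ e, extDeriv (chartForm (D₀.transgression D₁ k) x₀) y =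
      chartForm (D₁.trPow (k + 1)) x₀ y - chartForm (D₀.trPow (k + 1)) x₀ y := by
  have hU := isOpen_chartDomain (d := d) e x₀
  have h := extDeriv_transgression (τ := modelTrace E)
    (b := connForm e D₁ x₀ - connForm e D₀ x₀) hU (contDiffOn_connForm e D₀ x₀)
    ((contDiffOn_connForm e D₁ x₀).sub (contDiffOn_connForm e D₀ x₀)) modelTrace_mul_comm k
    (η := chartForm (D₀.transgression D₁ k) x₀) ?_
  · refine ⟨h.1, fun y hy => ?_⟩
    ext v
    have h1 := trPow_coord e D₁ (k + 1) x₀ hy v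
    have h0 := trPow_coord e D₀ (k + 1) x₀ hy v
    have e1 : connForm e D₁ x₀ = pathForm (connForm e D₀ x₀)
        (connForm e D₁ x₀ - connForm e D₀ x₀) 1 := by
      funext y
      refine ContinuousLinearMap.ext fun u => ?_
      change _ = connForm e D₀ x₀ y u + (1:ℝ) • (connForm e D₁ x₀ y u - connForm e D₀ x₀ y u)
      rw [one_smul, add_sub_cancel]
    have e0 : connForm e D₀ x₀ = pathForm (connForm e D₀ x₀)
        (connForm e D₁ x₀ - connForm e D₀ x₀) 0 := by
      funext y
      refine ContinuousLinearMap.ext fun u => ?_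
      change _ = connForm e D₀ x₀ y u + (0:ℝ) • (connForm e D₁ x₀ y u - connForm e D₀ x₀ y u)
      rw [zero_smul, add_zero]
    rw [e1] at h1
    rw [e0] at h0
    exact (h.2 y hy v).trans (congrArg₂ (· - ·) h1.symm h0.symm)
  · intro y hy v
    rw [← setIntegral_congr_fun measurableSet_Icc
      fun t _ => transgressionAt_coord e D₀ D₁ k t x₀ hy v]
    exact transgression_apply D₀ D₁ k _ _

theorem isSmoothForm_transgression (D₀ D₁ : Connection E) (k : ℕ) :
    IsSmoothForm (D₀.transgression D₁ k) := by
  intro x₀ y hy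
  have hy' := exists_trivialization_chart (E := E) x₀ hy
  exact ((chartForm_transgression _ D₀ D₁ k x₀).1.contDiffAt
    ((isOpen_chartDomain _ x₀).mem_nhds hy')).contDiffWithinAt

theorem chartForm_self {G : Type*} [NormedAddCommGroup G] [NormedSpace ℝ G] {p : ℕ}
    (θ : DForm d M p G) (x : M) : chartForm θ x (extChartAt (𝓡 d) x x) = θ x := by
  ext v
  change θ _ (fun i => dChartSymm x (extChartAt (𝓡 d) x x) (v i)) = θ x v
  simp only [dChartSymm_self]
  rw [extChartAt_to_inv]

theorem dForm_transgression (D₀ D₁ : Connection E) (k : ℕ) :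
    dForm (D₀.transgression D₁ k) = D₁.trPow (k + 1) - D₀.trPow (k + 1) := by
  funext x
  have h := (chartForm_transgression (trivializationAt E.Model E.Fiber _) D₀ D₁ k x).2 _
    (exists_trivialization_chart (E := E) x (mem_extChartAt_target x))
  exact h.trans (congrArg₂ (· - ·) (chartForm_self _ x) (chartForm_self _ x))

/-- The zeroth wedge power ignores the curvature; its trace is the rank of `E`. -/
theorem trPow_zero_eq (D₀ D₁ : Connection E) : D₁.trPow 0 = D₀.trPow 0 := rfl

end Transgression
end FamiliesChernWeil

end

noncomputable section
namespace FamiliesChernWeil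
-- Pullback of forms and naturality of `d`
section Pullback

theorem alternating_apply_eq_sum {d p : ℕ} {G : Type*} [NormedAddCommGroup G] [NormedSpace ℝ G]
    (α : Euc d [⋀^Fin p]→L[ℝ] G) (v : Fin p → Euc d) :
    α v = ∑ r : Fin p → Fin d, (∏ i, v i (r i)) • α (fun i => EuclideanSpace.single (r i) 1) := by
  classical
  have h : v = fun i => ∑ j, v i j • EuclideanSpace.single j (1 : ℝ) := by
    funext i
    simpa using ((EuclideanSpace.basisFun (Fin d) ℝ).sum_repr (v i)).symm
  conv_lhs => rw [h]
  have h2 := α.toAlternatingMap.toMultilinearMap.map_sum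
    (fun i j => v i j • (EuclideanSpace.single j (1 : ℝ) : Euc d))
  refine h2.trans (Finset.sum_congr rfl fun r _ => ?_)
  exact α.toAlternatingMap.toMultilinearMap.map_smul_univ _ _

/-- In a basis the evaluation is a finite sum, polynomial in the coordinates of the vectors and
linear in the form. -/
theorem contDiffOn_alternating_apply {d p : ℕ} {G P : Type*} [NormedAddCommGroup G]
    [NormedSpace ℝ G] [NormedAddCommGroup P] [NormedSpace ℝ P] {N : WithTop ℕ∞}
    {A : P → Euc d [⋀^Fin p]→L[ℝ] G} {u : P → Fin p → Euc d} {U : Set P}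
    (hA : ContDiffOn ℝ N A U) (hu : ∀ i, ContDiffOn ℝ N (fun y => u y i) U) :
    ContDiffOn ℝ N (fun y => A y (u y)) U := by
  simp only [fun y => alternating_apply_eq_sum (A y) (u y)]
  refine ContDiffOn.sum fun r _ => ContDiffOn.smul (contDiffOn_prod fun i _ => ?_) ?_
  · exact (EuclideanSpace.proj (r i) : Euc d →L[ℝ] ℝ).contDiff.comp_contDiffOn
      (hu i)
  · exact (ContinuousAlternatingMap.apply ℝ (Euc d) G _).contDiff.comp_contDiffOn hA

variable {d : ℕ} {M : Type*} [TopologicalSpace M] [ChartedSpace (Euc d) M]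
  [IsManifold (𝓡 d) ∞ M] {p : ℕ}

theorem dChartSymm_dChart_of_mem {x₀ x : M} (hx : x ∈ (extChartAt (𝓡 d) x₀).source) (u : Euc d) :
    dChartSymm x₀ (extChartAt (𝓡 d) x₀ x) (dChart x₀ x u) = u := by
  have h := dChartSymm_dChart ((extChartAt (𝓡 d) x₀).map_source hx) u
  rwa [(extChartAt (𝓡 d) x₀).left_inv hx] at h

theorem dChart_self (x : M) (u : Euc d) : dChart x x u = u := by
  have h := dChartSymm_dChart_of_mem (mem_extChartAt_source (I := 𝓡 d) x) u
  rwa [dChartSymm_self] at h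

variable {W : Type*} [NormedAddCommGroup W] [NormedSpace ℝ W] 
  {G : Type*} [NormedAddCommGroup G] [NormedSpace ℝ G] 

/-- The pullback of a form under a parametrization. -/
def pull (Ψ : W → M) (θ : DForm d M p G) (y : W) : W [⋀^Fin p]→L[ℝ] G :=
  (θ (Ψ y)).compContinuousLinearMap (mfderiv 𝓘(ℝ, W) (𝓡 d) Ψ y : W →L[ℝ] Euc d)

theorem pull_apply (Ψ : W → M) (θ : DForm d M p G) (y : W) (v : Fin p → W) :
    pull Ψ θ y v = θ (Ψ y) (fun i => (mfderiv 𝓘(ℝ, W) (𝓡 d) Ψ y : W →L[ℝ] Euc d) (v i)) := rfl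

theorem eventually_contMDiffAt {Ψ : W → M} {y : W} (hΨ : ContMDiffAt 𝓘(ℝ, W) (𝓡 d) ∞ Ψ y) (x₀ : M)
    (hx : Ψ y ∈ (extChartAt (𝓡 d) x₀).source) :
    ∀ᶠ y' in 𝓝 y, MDifferentiableAt 𝓘(ℝ, W) (𝓡 d) Ψ y' ∧
      Ψ y' ∈ (extChartAt (𝓡 d) x₀).source := by
  have h1 : ∀ᶠ y' in 𝓝 y, ContMDiffAt 𝓘(ℝ, W) (𝓡 d) 1 Ψ y' :=
    (contMDiffAt_iff_contMDiffAt_nhds (by simp)).1 (hΨ.of_le (by simp))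
  have h2 := hΨ.continuousAt.preimage_mem_nhds
    ((isOpen_extChartAt_source (I := 𝓡 d) x₀).mem_nhds hx)
  filter_upwards [h1, h2] with y' a b
  exact ⟨a.mdifferentiableAt (by simp), b⟩

theorem dChart_mfderiv {Ψ : W → M} {y : W} (hΨ : MDifferentiableAt 𝓘(ℝ, W) (𝓡 d) Ψ y) (x₀ : M)
    (hx : Ψ y ∈ (extChartAt (𝓡 d) x₀).source) (u : W) :
    fderiv ℝ (fun y => extChartAt (𝓡 d) x₀ (Ψ y)) y u =
      dChart x₀ (Ψ y) ((mfderiv 𝓘(ℝ, W) (𝓡 d) Ψ y : W →L[ℝ] Euc d) u) := by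
  have h1 : MDifferentiableAt (𝓡 d) 𝓘(ℝ, Euc d) (extChartAt (𝓡 d) x₀) (Ψ y) :=
    mdifferentiableAt_extChartAt (by simpa using hx)
  have h := mfderiv_comp y h1 hΨ
  rw [mfderiv_eq_fderiv] at h
  exact congrArg (fun T => (T : W →L[ℝ] Euc d) u) h

/-- Composing `Ψ` with a chart reduces pullback from a manifold to pullback between vector spaces.
-/
theorem pull_eq_chart {Ψ : W → M} {y : W} (hΨ : MDifferentiableAt 𝓘(ℝ, W) (𝓡 d) Ψ y) (x₀ : M)
    (hx : Ψ y ∈ (extChartAt (𝓡 d) x₀).source) (θ : DForm d M p G) :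
    pull Ψ θ y = (chartForm θ x₀ (extChartAt (𝓡 d) x₀ (Ψ y))).compContinuousLinearMap
      (fderiv ℝ (fun y => extChartAt (𝓡 d) x₀ (Ψ y)) y) := by
  ext v
  have h1 : ∀ x, x = Ψ y → θ (Ψ y) (fun i => (mfderiv 𝓘(ℝ, W) (𝓡 d) Ψ y : W →L[ℝ] Euc d) (v i)) =
      θ x (fun i => dChartSymm x₀ (extChartAt (𝓡 d) x₀ (Ψ y))
        (fderiv ℝ (fun y => extChartAt (𝓡 d) x₀ (Ψ y)) y (v i))) := by
    rintro x rfl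
    congr 1
    funext i
    rw [dChart_mfderiv hΨ x₀ hx]
    exact (dChartSymm_dChart_of_mem hx _).symm
  exact h1 _ ((extChartAt (𝓡 d) x₀).left_inv hx)

theorem eventually_pull_eq {Ψ : W → M} {y : W} (hΨ : ContMDiffAt 𝓘(ℝ, W) (𝓡 d) ∞ Ψ y)
    (θ : DForm d M p G) (x₀ : M) (hx : Ψ y ∈ (extChartAt (𝓡 d) x₀).source) :
    pull Ψ θ =ᶠ[𝓝 y] fun y' => (chartForm θ x₀ (extChartAt (𝓡 d) x₀ (Ψ y'))).compContinuousLinearMap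
      (fderiv ℝ (fun y => extChartAt (𝓡 d) x₀ (Ψ y)) y') :=
  (eventually_contMDiffAt hΨ x₀ hx).mono fun _ h =>
    pull_eq_chart h.1 _ h.2 θ

theorem contDiffAt_chart_comp {Ψ : W → M} {y : W} (hΨ : ContMDiffAt 𝓘(ℝ, W) (𝓡 d) ∞ Ψ y) (x₀ : M)
    (hx : Ψ y ∈ (extChartAt (𝓡 d) x₀).source) :
    ContDiffAt ℝ ∞ (fun y => extChartAt (𝓡 d) x₀ (Ψ y)) y :=
  ((contMDiffAt_extChartAt' (by simpa using hx)).comp y hΨ).contDiffAt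

theorem IsSmoothForm.contDiffAt {θ : DForm d M p G} (hθ : IsSmoothForm θ) {x₀ : M} {y : Euc d}
    (hy : y ∈ (extChartAt (𝓡 d) x₀).target) : ContDiffAt ℝ ∞ (chartForm θ x₀) y :=
  (hθ x₀).contDiffAt ((isOpen_extChartAt_target x₀).mem_nhds hy)

theorem contDiffAt_pull [FiniteDimensional ℝ W] [FiniteDimensional ℝ G] {Ψ : W → M} {y : W}
    (hΨ : ContMDiffAt 𝓘(ℝ, W) (𝓡 d) ∞ Ψ y)
    {θ : DForm d M p G} (hθ : IsSmoothForm θ) : ContDiffAt ℝ ∞ (pull Ψ θ) y := by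
  have hx := mem_extChartAt_source (I := 𝓡 d) (Ψ y)
  refine ContDiffAt.congr_of_eventuallyEq ?_ (eventually_pull_eq hΨ θ _ hx)
  have hc := contDiffAt_chart_comp hΨ _ hx
  have h1 := (hθ.contDiffAt ((extChartAt (𝓡 d) (Ψ y)).map_source hx)).comp y hc
  have h2 := hc.fderiv_right (m := ∞) (by simp)
  -- Smoothness at a point gives a neighborhood of class `C^N` for each finite `N` separately, and
  -- the evaluation lemma needs a set; hence the argument one order at a time.
  rw [← contDiffWithinAt_univ] at h1 h2 ⊢
  rw [contDiffWithinAt_infty] at h1 h2 ⊢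
  intro N
  obtain ⟨U, hU, -, h1⟩ := (h1 N).contDiffOn (m := N) le_rfl (by simp)
  obtain ⟨U', hU', -, h2⟩ := (h2 N).contDiffOn (m := N) le_rfl (by simp)
  have hmem : U ∩ U' ∈ 𝓝 y := by simpa using Filter.inter_mem hU hU'
  refine ContDiffAt.contDiffWithinAt (ContDiffOn.contDiffAt (s := U ∩ U') ?_ hmem)
  refine contDiffOn_alternating fun v => ?_
  exact contDiffOn_alternating_apply
    (A := fun y' => chartForm θ (Ψ y) (extChartAt (𝓡 d) (Ψ y) (Ψ y')))
    (u := fun y' i => fderiv ℝ (fun y' => extChartAt (𝓡 d) (Ψ y) (Ψ y')) y' (v i))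
    (ContDiffOn.mono h1 Set.inter_subset_left) fun i => (ContDiffOn.mono h2 Set.inter_subset_right).clm_apply contDiffOn_const

/-- Naturality in vector spaces, applied in the chart at `Ψ y`: this is the chart that defines
`dForm` at `Ψ y`, and its differential there is the identity. -/
theorem extDeriv_pull {Ψ : W → M} {y : W} (hΨ : ContMDiffAt 𝓘(ℝ, W) (𝓡 d) ∞ Ψ y)
    {θ : DForm d M p G} (hθ : IsSmoothForm θ) :
    extDeriv (pull Ψ θ) y = pull Ψ (dForm θ) y := by
  have hx := mem_extChartAt_source (I := 𝓡 d) (Ψ y)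
  rw [(eventually_pull_eq hΨ θ _ hx).extDeriv_eq]
  have hc := contDiffAt_chart_comp hΨ _ hx
  have hd := eventually_contMDiffAt hΨ _ hx |>.self_of_nhds.1
  have h1 := (hθ.contDiffAt ((extChartAt (𝓡 d) (Ψ y)).map_source hx)).differentiableAt (by simp)
  rw [extDeriv_pullback (f := fun y' => extChartAt (𝓡 d) (Ψ y) (Ψ y')) h1 hc
    (by simpa using WithTop.coe_le_coe.2 (le_top (a := (2 : ℕ∞))))]
  ext v
  change extDeriv (chartForm θ (Ψ y)) (extChartAt (𝓡 d) (Ψ y) (Ψ y)) _ =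
    extDeriv (chartForm θ (Ψ y)) (extChartAt (𝓡 d) (Ψ y) (Ψ y)) _
  congr 1
  funext i
  exact (dChart_mfderiv hd _ hx (v i)).trans (dChart_self _ _)

theorem contMDiffAt_chart_symm {x₀ : M} {y : Euc d} (hy : y ∈ (extChartAt (𝓡 d) x₀).target) :
    ContMDiffAt 𝓘(ℝ, Euc d) (𝓡 d) ∞ (extChartAt (𝓡 d) x₀).symm y :=
  (contMDiffOn_extChartAt_symm (I := 𝓡 d) (n := ∞) x₀).contMDiffAt (extChartAt_target_mem_nhds' hy)

/-- Chart independence of `dForm`, obtained by taking the inverse chart as the parametrization. -/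
theorem extDeriv_chartForm {θ : DForm d M p G} (hθ : IsSmoothForm θ) {x₀ : M} {y : Euc d}
    (hy : y ∈ (extChartAt (𝓡 d) x₀).target) :
    extDeriv (chartForm θ x₀) y = chartForm (dForm θ) x₀ y :=
  extDeriv_pull (contMDiffAt_chart_symm hy) hθ

set_option synthInstance.maxHeartbeats 200000 in
theorem contDiffAt_extDeriv {V : Type*} [NormedAddCommGroup V] [NormedSpace ℝ V]
    {θ : V → V [⋀^Fin p]→L[ℝ] G} {y : V} (hθ : ContDiffAt ℝ ∞ θ y) :
    ContDiffAt ℝ ∞ (extDeriv θ) y :=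
  ((ContinuousAlternatingMap.alternatizeUncurryFinCLM ℝ V G (n := p)).contDiff.contDiffAt.comp y
    (hθ.fderiv_right (m := ∞) (by simp))).congr_of_eventuallyEq
    (Filter.Eventually.of_forall fun _ => rfl)

theorem IsSmoothForm.dForm {θ : DForm d M p G} (hθ : IsSmoothForm θ) : IsSmoothForm (dForm θ) := by
  intro x₀ y hy
  refine ((contDiffAt_extDeriv (hθ.contDiffAt hy)).congr_of_eventuallyEq ?_).contDiffWithinAt
  exact Filter.mem_of_superset (extChartAt_target_mem_nhds' hy) fun y' hy' =>
    (extDeriv_chartForm hθ hy').symm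

theorem IsSmoothForm.add {θ η : DForm d M p G} (hθ : IsSmoothForm θ) (hη : IsSmoothForm η) :
    IsSmoothForm (θ + η) := fun x₀ => (hθ x₀).add (hη x₀)

theorem IsSmoothForm.sub {θ η : DForm d M p G} (hθ : IsSmoothForm θ) (hη : IsSmoothForm η) :
    IsSmoothForm (θ - η) := fun x₀ => (hθ x₀).sub (hη x₀)

theorem isSmoothForm_zero : IsSmoothForm (0 : DForm d M p G) := fun _ => contDiffOn_const (c := 0)

theorem IsSmoothForm.const_smul {θ : DForm d M p ℂ} (hθ : IsSmoothForm θ) (c : ℂ) :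
    IsSmoothForm (c • θ) := fun x₀ => (hθ x₀).const_smul c

theorem IsSmoothForm.sum {ι : Type*} {s : Finset ι} {θ : ι → DForm d M p G}
    (hθ : ∀ i ∈ s, IsSmoothForm (θ i)) : IsSmoothForm (∑ i ∈ s, θ i) := by
  classical
  induction s using Finset.induction_on with
  | empty => simpa using isSmoothForm_zero
  | insert i s hi ih =>
    rw [Finset.sum_insert hi]
    exact (hθ i (Finset.mem_insert_self _ _)).add
      (ih fun j hj => hθ j (Finset.mem_insert_of_mem hj))

/-- The product of a function and a form. -/
def mulForm (f : M → ℝ) (θ : DForm d M p G) : DForm d M p G := fun x => f x • θ x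

theorem IsSmoothForm.mulForm {f : M → ℝ} (hf : ContMDiff (𝓡 d) 𝓘(ℝ, ℝ) ∞ f) {θ : DForm d M p G}
    (hθ : IsSmoothForm θ) : IsSmoothForm (mulForm f θ) := by
  intro x₀
  have h : ContDiffOn ℝ ∞ (fun y => f ((extChartAt (𝓡 d) x₀).symm y))
      (extChartAt (𝓡 d) x₀).target := fun y hy =>
    ((hf.contMDiffAt.comp y (contMDiffAt_chart_symm hy)).contDiffAt).contDiffWithinAt
  exact h.smul (hθ x₀)

theorem dForm_congr {θ η : DForm d M p G} {x : M} (h : θ =ᶠ[𝓝 x] η) : dForm θ x = dForm η x := by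
  refine Filter.EventuallyEq.extDeriv_eq ?_
  have hc := continuousAt_extChartAt_symm (I := 𝓡 d) x
  have h' : ∀ᶠ x' in 𝓝 ((extChartAt (𝓡 d) x).symm (extChartAt (𝓡 d) x x)), θ x' = η x' := by
    rwa [extChartAt_to_inv]
  filter_upwards [hc.eventually h'] with y hy
  simp only [chartForm, hy]

theorem dForm_zero : dForm (0 : DForm d M p G) = 0 := by
  funext x
  have : chartForm (0 : DForm d M p G) x = 0 := rfl
  change extDeriv (chartForm 0 x) _ = 0
  rw [this]
  have := extDeriv_smul (𝕜 := ℝ) (x := extChartAt (𝓡 d) x x) (0:ℝ) (0 : Euc d → Euc d [⋀^Fin p]→L[ℝ] G)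
  simpa using this

theorem dForm_add {θ η : DForm d M p G} (hθ : IsSmoothForm θ) (hη : IsSmoothForm η) :
    dForm (θ + η) = dForm θ + dForm η := by
  funext x
  have hx := mem_extChartAt_target (I := 𝓡 d) x
  exact extDeriv_add ((hθ.contDiffAt hx).differentiableAt (by simp))
    ((hη.contDiffAt hx).differentiableAt (by simp))

theorem dForm_sum {ι : Type*} {s : Finset ι} {θ : ι → DForm d M p G}
    (hθ : ∀ i ∈ s, IsSmoothForm (θ i)) : dForm (∑ i ∈ s, θ i) = ∑ i ∈ s, dForm (θ i) := by
  classical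
  induction s using Finset.induction_on with
  | empty => simpa using dForm_zero
  | insert i s hi ih =>
    rw [Finset.sum_insert hi, Finset.sum_insert hi,
      dForm_add (hθ i (Finset.mem_insert_self _ _))
        (IsSmoothForm.sum fun j hj => hθ j (Finset.mem_insert_of_mem hj)),
      ih fun j hj => hθ j (Finset.mem_insert_of_mem hj)]

end Pullback
end FamiliesChernWeil

end

noncomputable section
namespace FamiliesChernWeil
-- Integration of densities over a closed manifold
section Densities

variable {n : ℕ} {Z : Type*} [TopologicalSpace Z] [ChartedSpace (Euc n) Z]
  {W : Type*} [NormedAddCommGroup W] [NormedSpace ℝ W]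

/-- A smooth local coordinate system. -/
structure IsSmoothChart (κ : PartialEquiv Z (Euc n)) : Prop where
  open_source : IsOpen κ.source
  open_target : IsOpen κ.target
  smooth : ContMDiffOn (𝓡 n) 𝓘(ℝ, Euc n) ∞ κ κ.source
  smooth_symm : ContMDiffOn 𝓘(ℝ, Euc n) (𝓡 n) ∞ κ.symm κ.target

theorem isSmoothChart_extChartAt [IsManifold (𝓡 n) ∞ Z] (z : Z) :
    IsSmoothChart (extChartAt (𝓡 n) z) where
  open_source := isOpen_extChartAt_source z
  open_target := isOpen_extChartAt_target z
  smooth := by simpa using contMDiffOn_extChartAt (I := 𝓡 n) (n := ∞) (x := z)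
  smooth_symm := contMDiffOn_extChartAt_symm z

/-- The transformation rule of a density. -/
def IsDensity (δ : ∀ z : Z, (Fin n → TangentSpace (𝓡 n) z) → W) : Prop :=
  ∀ (z : Z) (A T : Euc n →L[ℝ] Euc n),
    δ z (fun j => A (T (EuclideanSpace.single j 1))) =
      |T.det| • δ z (fun j => A (EuclideanSpace.single j 1))

/-- The coordinate expression of a density. -/
def coordDensity (κ : PartialEquiv Z (Euc n)) (δ : ∀ z : Z, (Fin n → TangentSpace (𝓡 n) z) → W)
    (y : Euc n) : W :=
  δ (κ.symm y) fun j => mfderiv 𝓘(ℝ, Euc n) (𝓡 n) κ.symm y (EuclideanSpace.single j (1 : ℝ))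

variable {κ κ' : PartialEquiv Z (Euc n)} {δ : ∀ z : Z, (Fin n → TangentSpace (𝓡 n) z) → W}

/-- The domain of a change of coordinates. -/
def overlap (κ κ' : PartialEquiv Z (Euc n)) : Set (Euc n) := κ.target ∩ κ.symm ⁻¹' κ'.source

theorem isOpen_overlap (hκ : IsSmoothChart κ) (hκ' : IsSmoothChart κ') : IsOpen (overlap κ κ') :=
  hκ.smooth_symm.continuousOn.isOpen_inter_preimage hκ.open_target hκ'.open_source

theorem contDiffAt_transition (hκ : IsSmoothChart κ) (hκ' : IsSmoothChart κ') {y : Euc n}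
    (hy : y ∈ overlap κ κ') : ContDiffAt ℝ ∞ (fun y => κ' (κ.symm y)) y :=
  ((hκ'.smooth.contMDiffAt (hκ'.open_source.mem_nhds hy.2)).comp y
    (hκ.smooth_symm.contMDiffAt (hκ.open_target.mem_nhds hy.1))).contDiffAt

theorem coordDensity_change (hδ : IsDensity δ) (hκ : IsSmoothChart κ) (hκ' : IsSmoothChart κ')
    {y : Euc n} (hy : y ∈ overlap κ κ') :
    coordDensity κ δ y =
      |(fderiv ℝ (fun y => κ' (κ.symm y)) y).det| • coordDensity κ' δ (κ' (κ.symm y)) := by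
  have ht : κ' (κ.symm y) ∈ κ'.target := κ'.map_source hy.2
  have hA : MDifferentiableAt 𝓘(ℝ, Euc n) (𝓡 n) κ'.symm (κ' (κ.symm y)) :=
    (hκ'.smooth_symm.contMDiffAt (hκ'.open_target.mem_nhds ht)).mdifferentiableAt (by simp)
  have hT : MDifferentiableAt 𝓘(ℝ, Euc n) 𝓘(ℝ, Euc n) (fun y => κ' (κ.symm y)) y :=
    ((contDiffAt_transition hκ hκ' hy).differentiableAt (by simp)).mdifferentiableAt
  have h1 := mfderiv_comp y hA hT
  rw [mfderiv_eq_fderiv] at h1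
  have h2 : κ.symm =ᶠ[𝓝 y] κ'.symm ∘ fun y => κ' (κ.symm y) :=
    Filter.mem_of_superset ((isOpen_overlap hκ hκ').mem_nhds hy) fun y' hy' =>
      (κ'.left_inv hy'.2).symm
  have h3 := h2.mfderiv_eq (I := 𝓘(ℝ, Euc n)) (I' := 𝓡 n)
  have h4 : ∀ u : Euc n, (mfderiv 𝓘(ℝ, Euc n) (𝓡 n) κ.symm y : Euc n →L[ℝ] Euc n) u =
      (mfderiv 𝓘(ℝ, Euc n) (𝓡 n) κ'.symm (κ' (κ.symm y)) : Euc n →L[ℝ] Euc n)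
        (fderiv ℝ (fun y => κ' (κ.symm y)) y u) := fun u =>
    (congrArg (fun T => (T : Euc n →L[ℝ] Euc n) u) h3).trans
      (congrArg (fun T => (T : Euc n →L[ℝ] Euc n) u) h1)
  have h5 : ∀ z, z = κ.symm y → δ (κ.symm y) (fun j =>
      (mfderiv 𝓘(ℝ, Euc n) (𝓡 n) κ.symm y : Euc n →L[ℝ] Euc n) (EuclideanSpace.single j (1 : ℝ))) =
      |(fderiv ℝ (fun y => κ' (κ.symm y)) y).det| • δ z (fun j =>
      (mfderiv 𝓘(ℝ, Euc n) (𝓡 n) κ'.symm (κ' (κ.symm y)) : Euc n →L[ℝ] Euc n)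
        (EuclideanSpace.single j (1 : ℝ))) := by
    rintro z rfl
    simp only [h4]
    exact hδ _ _ _
  exact h5 _ (κ'.left_inv hy.2)

/-- The change of variables formula: the absolute Jacobian is exactly the factor by which a density
transforms. -/
theorem setIntegral_overlap (hδ : IsDensity δ) (hκ : IsSmoothChart κ) (hκ' : IsSmoothChart κ') :
    ∫ y in overlap κ κ', coordDensity κ δ y = ∫ y in overlap κ' κ, coordDensity κ' δ y := by
  have himg : (fun y => κ' (κ.symm y)) '' overlap κ κ' = overlap κ' κ := by
    ext y
    constructor
    · rintro ⟨y, hy, rfl⟩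
      refine ⟨κ'.map_source hy.2, ?_⟩
      simp only [Set.mem_preimage, κ'.left_inv hy.2]
      exact κ.map_target hy.1
    · intro hy
      refine ⟨κ (κ'.symm y), ⟨κ.map_source hy.2, ?_⟩, ?_⟩
      · simp only [Set.mem_preimage, κ.left_inv hy.2]
        exact κ'.map_target hy.1
      · simp only [κ.left_inv hy.2, κ'.right_inv hy.1]
  have hinj : Set.InjOn (fun y => κ' (κ.symm y)) (overlap κ κ') := by
    intro y hy y' hy' h
    exact κ.symm.injOn hy.1 hy'.1 (κ'.injOn hy.2 hy'.2 h)
  rw [← himg, integral_image_eq_integral_abs_det_fderiv_smul volume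
    (isOpen_overlap hκ hκ').measurableSet
    (fun y hy => ((contDiffAt_transition hκ hκ' hy).differentiableAt
      (by simp)).hasFDerivAt.hasFDerivWithinAt) hinj]
  exact setIntegral_congr_fun (isOpen_overlap hκ hκ').measurableSet
    fun y hy => coordDensity_change hδ hκ hκ' hy

theorem integrableOn_of_compact {K T : Set (Euc n)} (hK : IsCompact K) (hT : MeasurableSet T)
    {φ : Euc n → W} (hφ : ContinuousOn φ T) (hKT : K ⊆ T) (h0 : ∀ y ∈ T \ K, φ y = 0) :
    IntegrableOn φ T :=
  IntegrableOn.of_forall_sdiff_eq_zero ((hφ.mono hKT).integrableOn_compact hK) hT h0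

variable [T2Space Z] [CompactSpace Z] [IsManifold (𝓡 n) ∞ Z]

theorem exists_finset_chartPartition (n : ℕ) (Z : Type*) [TopologicalSpace Z] [T2Space Z]
    [CompactSpace Z] [ChartedSpace (Euc n) Z] [IsManifold (𝓡 n) ∞ Z] :
    ∃ s : Finset Z, (∀ z ∉ s, chartPartition n Z z = 0) ∧
      ∀ x, ∑ z ∈ s, chartPartition n Z z x = 1 := by
  have hf := (chartPartition n Z).locallyFinite.finite_nonempty_of_compact
  have h0 : ∀ z ∉ hf.toFinset, chartPartition n Z z = 0 := by
    intro z hz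
    ext x
    by_contra hx
    exact hz (hf.mem_toFinset.2 ⟨x, hx⟩)
  refine ⟨hf.toFinset, h0, fun x => ?_⟩
  rw [← (chartPartition n Z).sum_eq_one (Set.mem_univ x)]
  refine (finsum_eq_sum_of_support_subset _ fun z hz => ?_).symm
  by_contra h
  exact hz (by simp [h0 z h])

theorem chartPartition_tsupport (z : Z) :
    tsupport (chartPartition n Z z) ⊆ (extChartAt (𝓡 n) z).source := by
  rw [extChartAt_source]
  exact (SmoothPartitionOfUnity.exists_isSubordinate_chartAt_source (𝓡 n) Z).choose_spec z

theorem integrateDensity_eq_sum {s : Finset Z} (hs : ∀ z ∉ s, chartPartition n Z z = 0)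
    (δ : ∀ z : Z, (Fin n → TangentSpace (𝓡 n) z) → W) :
    integrateDensity δ = ∑ z ∈ s, ∫ y in (extChartAt (𝓡 n) z).target,
      coordDensity (extChartAt (𝓡 n) z) (fun z' v => chartPartition n Z z z' • δ z' v) y := by
  refine finsum_eq_sum_of_support_subset _ fun z hz => ?_
  by_contra h
  refine hz ?_
  simp [hs z h]

theorem integrableOn_chartPartition {φ : Euc n → W} (z : Z)
    (hφ : ContinuousOn φ (extChartAt (𝓡 n) z).target) :
    IntegrableOn (fun y => chartPartition n Z z ((extChartAt (𝓡 n) z).symm y) • φ y)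
      (extChartAt (𝓡 n) z).target := by
  have hc : IsCompact (tsupport (chartPartition n Z z)) := (isClosed_tsupport _).isCompact
  have hsub := chartPartition_tsupport (n := n) z
  refine integrableOn_of_compact
    (hc.image_of_continuousOn ((continuousOn_extChartAt (I := 𝓡 n) z).mono hsub))
    (isOpen_extChartAt_target z).measurableSet
    (((chartPartition n Z z).contMDiff.continuous.comp_continuousOn
      (continuousOn_extChartAt_symm z)).smul hφ) ?_ ?_
  · rintro _ ⟨x, hx, rfl⟩
    exact (extChartAt (𝓡 n) z).map_source (hsub hx)
  · rintro y ⟨hy, hyK⟩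
    have : (extChartAt (𝓡 n) z).symm y ∉ tsupport (chartPartition n Z z) := fun h =>
      hyK ⟨_, h, (extChartAt (𝓡 n) z).right_inv hy⟩
    rw [image_eq_zero_of_notMem_tsupport this, zero_smul]

theorem integrateDensity_add {δ₁ δ₂ : ∀ z : Z, (Fin n → TangentSpace (𝓡 n) z) → W}
    (h₁ : ∀ z, ContinuousOn (coordDensity (extChartAt (𝓡 n) z) δ₁) (extChartAt (𝓡 n) z).target)
    (h₂ : ∀ z, ContinuousOn (coordDensity (extChartAt (𝓡 n) z) δ₂) (extChartAt (𝓡 n) z).target) :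
    integrateDensity (fun z v => δ₁ z v + δ₂ z v) = integrateDensity δ₁ + integrateDensity δ₂ := by
  obtain ⟨s, hs, -⟩ := exists_finset_chartPartition n Z
  simp only [integrateDensity_eq_sum hs]
  rw [← Finset.sum_add_distrib]
  refine Finset.sum_congr rfl fun z _ => ?_
  refine Eq.trans ?_
    (integral_add (integrableOn_chartPartition z (h₁ z)) (integrableOn_chartPartition z (h₂ z)))
  congr 1
  funext y
  exact smul_add _ _ _

theorem integrateDensity_const_smul {𝕂 : Type*} [RCLike 𝕂] [NormedSpace 𝕂 W]
    (c : 𝕂) [SMulCommClass ℝ 𝕂 W]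
    (δ : ∀ z : Z, (Fin n → TangentSpace (𝓡 n) z) → W) :
    integrateDensity (fun z v => c • δ z v) = c • integrateDensity δ := by
  obtain ⟨s, hs, -⟩ := exists_finset_chartPartition n Z
  simp only [integrateDensity_eq_sum hs]
  rw [Finset.smul_sum]
  refine Finset.sum_congr rfl fun z _ => ?_
  rw [← integral_smul]
  congr 1
  funext y
  exact smul_comm _ _ _

/-- A density with compact support in one coordinate domain is integrated there: each summand of the
partition of unity is moved to `κ` through the overlap, and the partition functions add up to `1`.
-/
theorem integrateDensity_eq_setIntegral (hδ : IsDensity δ) (hκ : IsSmoothChart κ) {C : Set Z}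
    (hC : IsCompact C) (hCκ : C ⊆ κ.source) (h0 : ∀ z ∉ C, ∀ v, δ z v = 0)
    (hc : ContinuousOn (coordDensity κ δ) κ.target) :
    integrateDensity δ = ∫ y in κ.target, coordDensity κ δ y := by
  obtain ⟨s, hs, hsum⟩ := exists_finset_chartPartition n Z
  rw [integrateDensity_eq_sum hs]
  -- On the preferred chart the support of `δ` cuts the domain down to the overlap; on `κ` the
  -- support of the partition function does.
  have key : ∀ z, ∫ y in (extChartAt (𝓡 n) z).target, coordDensity (extChartAt (𝓡 n) z)
      (fun z' v => chartPartition n Z z z' • δ z' v) y =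
      ∫ y in κ.target, chartPartition n Z z (κ.symm y) • coordDensity κ δ y := by
    intro z
    have hz := isSmoothChart_extChartAt (n := n) z
    have hδ' : IsDensity (fun z' v => chartPartition n Z z z' • δ z' v) := by
      intro z' A T
      simp only [hδ z' A T]
      exact smul_comm _ _ _
    refine (setIntegral_eq_of_subset_of_forall_sdiff_eq_zero (s := overlap (extChartAt (𝓡 n) z) κ)
      hz.open_target.measurableSet Set.inter_subset_left ?_).trans
        ((setIntegral_overlap hδ' hz hκ).trans ?_)
    rotate_left
    · refine (setIntegral_eq_of_subset_of_forall_sdiff_eq_zero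
        hκ.open_target.measurableSet Set.inter_subset_left ?_).symm
      rintro y ⟨hy, hyn⟩
      have : κ.symm y ∉ tsupport (chartPartition n Z z) := fun h =>
        hyn ⟨hy, chartPartition_tsupport z h⟩
      simp only [coordDensity, image_eq_zero_of_notMem_tsupport this, zero_smul]
    · rintro y ⟨hy, hyn⟩
      have : (extChartAt (𝓡 n) z).symm y ∉ C := fun h => hyn ⟨hy, hCκ h⟩
      simp only [coordDensity, h0 _ this, smul_zero]
  have hK : IsCompact (κ '' C) := hC.image_of_continuousOn (hκ.smooth.continuousOn.mono hCκ)
  have hint : ∀ z ∈ s, IntegrableOn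
      (fun y => chartPartition n Z z (κ.symm y) • coordDensity κ δ y) κ.target := by
    intro z _
    refine integrableOn_of_compact hK hκ.open_target.measurableSet
      (((chartPartition n Z z).contMDiff.continuous.comp_continuousOn
        hκ.smooth_symm.continuousOn).smul hc) ?_ ?_
    · rintro _ ⟨x, hx, rfl⟩
      exact κ.map_source (hCκ hx)
    · rintro y ⟨hy, hyn⟩
      have : κ.symm y ∉ C := fun h => hyn ⟨_, h, κ.right_inv hy⟩
      simp only [coordDensity, h0 _ this, smul_zero]
  simp only [key]
  rw [← integral_finsetSum s hint]
  congr 1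
  funext y
  rw [← Finset.sum_smul, hsum, one_smul]

end Densities
end FamiliesChernWeil

end

noncomputable section
namespace FamiliesChernWeil
-- Fiber integration in a product of vector spaces
section FubiniForms

variable {P : Type} [NormedAddCommGroup P] [NormedSpace ℝ P] [FiniteDimensional ℝ P] {n : ℕ}

theorem integral_neg_one_pow_smul {α : Type*} [MeasurableSpace α] (μ : Measure α) (k : ℕ)
    (f : α → ℂ) : ∫ y, (-1 : ℤ) ^ k • f y ∂μ = (-1 : ℤ) ^ k • ∫ y, f y ∂μ := by
  rcases neg_one_pow_eq_or ℤ k with h | h <;> simp [h, integral_neg]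

theorem setIntegral_fderiv_eq_zero {g : Euc n → ℂ} (hg : ContDiff ℝ ∞ g) {K : Set (Euc n)}
    (hK : IsCompact K) (h0 : ∀ y ∉ K, g y = 0) (w : Euc n) : ∫ y in K, fderiv ℝ g y w = 0 := by
  have h0' : ∀ y ∉ K, fderiv ℝ g y w = 0 := by
    intro y hy
    have : g =ᶠ[𝓝 y] fun _ => 0 :=
      Filter.mem_of_superset (hK.isClosed.isOpen_compl.mem_nhds hy) fun y' hy' => h0 y' hy'
    rw [this.fderiv_eq]
    simp
  have hd : Continuous fun y => fderiv ℝ g y w :=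
    (hg.continuous_fderiv (by simp)).clm_apply continuous_const
  have hgi : Integrable g := hg.continuous.integrable_of_hasCompactSupport
    (HasCompactSupport.intro hK h0)
  have hdi : Integrable fun y => fderiv ℝ g y w := hd.integrable_of_hasCompactSupport
    (HasCompactSupport.intro hK h0')
  rw [setIntegral_eq_integral_of_forall_compl_eq_zero h0']
  -- Integration by parts against the constant function `1`.
  have h := integral_bilinear_hasLineDerivAt_right_eq_neg_left_of_integrable
    (μ := (volume : Measure (Euc n))) (f := fun _ => (1 : ℝ)) (f' := fun _ => 0) (g := g)
    (g' := fun y => fderiv ℝ g y w) (v := w) (B := ContinuousLinearMap.lsmul ℝ ℝ)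
    (by simp) (by simpa using hdi) (by simpa using hgi)
    (fun y _ => (hasFDerivAt_const (1 : ℝ) y).hasLineDerivAt w)
    (fun y _ => ((hg.differentiable (by simp)) y).hasFDerivAt.hasLineDerivAt w)
  simpa using h

/-- The tuple `(v₁, 0), …, (vₚ, 0), (0, w₁), …, (0, wₙ)`. -/
def prodTuple {Y : Type*} [Zero Y] {p r : ℕ} (h : p + n = r) (v : Fin p → P) (w : Fin n → Y)
    (i : Fin r) : P × Y :=
  Fin.append (fun j => (v j, (0 : Y))) (fun j => ((0 : P), w j)) (Fin.cast h.symm i)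

theorem prodTuple_castAdd {Y : Type*} [Zero Y] {p r : ℕ} (h : p + n = r) (v : Fin p → P)
    (w : Fin n → Y) (j : Fin p) : prodTuple h v w (Fin.cast h (Fin.castAdd n j)) = (v j, 0) := by
  simp [prodTuple]

theorem prodTuple_natAdd {Y : Type*} [Zero Y] {p r : ℕ} (h : p + n = r) (v : Fin p → P)
    (w : Fin n → Y) (j : Fin n) : prodTuple h v w (Fin.cast h (Fin.natAdd p j)) = (0, w j) := by
  simp [prodTuple]

/-- Base vectors come before fiber vectors, so deleting the `j`-th base vector keeps the index `j`:
fiber integration will commute with `d` without any sign. -/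
theorem removeNth_prodTuple {Y : Type*} [Zero Y] {p r : ℕ} (h : p + n = r)
    (h' : p + 1 + n = r + 1) (v : Fin (p + 1) → P) (w : Fin n → Y) (j : Fin (p + 1)) :
    (Fin.cast h' (Fin.castAdd n j)).removeNth (prodTuple h' v w) =
      prodTuple h (j.removeNth v) w := by
  subst h
  funext i
  refine Fin.addCases (fun k => ?_) (fun k => ?_) i
  · have e1 : (Fin.cast h' (Fin.castAdd n j)).succAbove (Fin.castAdd n k) =
        Fin.cast h' (Fin.castAdd n (j.succAbove k)) := by
      ext
      simp only [Fin.succAbove, Fin.lt_def, Fin.val_castSucc, Fin.val_cast, Fin.val_castAdd]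
      split_ifs <;> simp
    have e2 := prodTuple_castAdd rfl (j.removeNth v) w k
    rw [Fin.removeNth_apply, e1, prodTuple_castAdd]
    exact e2.symm
  · have e1 : (Fin.cast h' (Fin.castAdd n j)).succAbove (Fin.natAdd p k) =
        Fin.cast h' (Fin.natAdd (p + 1) k) := by
      ext
      have := j.isLt
      simp only [Fin.succAbove, Fin.lt_def, Fin.val_castSucc, Fin.val_cast, Fin.val_castAdd,
        Fin.val_natAdd]
      rw [if_neg (by omega)]
      simp
      omega
    have e2 := prodTuple_natAdd rfl (j.removeNth v) w k
    rw [Fin.removeNth_apply, e1, prodTuple_natAdd]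
    exact e2.symm

variable {U : Set P} {K : Set (Euc n)} {r : ℕ} {Θ : P × Euc n → (P × Euc n) [⋀^Fin r]→L[ℝ] ℂ}

theorem contDiffOn_eval (hΘ : ContDiffOn ℝ ∞ Θ (U ×ˢ Set.univ)) (t : Fin r → P × Euc n) :
    ContDiffOn ℝ ∞ (fun z => Θ z t) (U ×ˢ Set.univ) :=
  (ContinuousAlternatingMap.apply ℝ (P × Euc n) ℂ t).contDiff.comp_contDiffOn hΘ

theorem contDiff_slice {g : P × Euc n → ℂ} (hg : ContDiffOn ℝ ∞ g (U ×ˢ Set.univ)) {x : P}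
    (hx : x ∈ U) : ContDiff ℝ ∞ fun y => g (x, y) := by
  rw [← contDiffOn_univ]
  exact hg.comp (contDiff_prodMk_right x).contDiffOn fun y _ => ⟨hx, trivial⟩

theorem fderiv_slice (hU : IsOpen U) {g : P × Euc n → ℂ} (hg : ContDiffOn ℝ ∞ g (U ×ˢ Set.univ))
    {x : P} (hx : x ∈ U) (y w : Euc n) :
    fderiv ℝ g (x, y) (0, w) = fderiv ℝ (fun y => g (x, y)) y w := by
  have h1 : HasFDerivAt g (fderiv ℝ g (x, y)) (x, y) :=
    (differentiableAt_of_contDiffOn (hU.prod isOpen_univ) hg ⟨hx, trivial⟩).hasFDerivAt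
  have h2 := h1.comp y (hasFDerivAt_prodMk_right x y)
  exact (congrArg (fun T => T w) h2.fderiv).symm

/-- Of the alternating sum, the terms differentiating along the fiber are integrals of derivatives
of compactly supported functions and vanish; those along the base come out of the integral. -/
theorem setIntegral_extDeriv (hU : IsOpen U) (hK : IsCompact K)
    (hΘ : ContDiffOn ℝ ∞ Θ (U ×ˢ Set.univ)) (h0 : ∀ x ∈ U, ∀ y ∉ K, Θ (x, y) = 0)
    {p : ℕ} (h : p + n = r + 1) (v : Fin p → P) (w : Fin n → Euc n) {x : P} (hx : x ∈ U) :
    ∫ y in K, extDeriv Θ (x, y) (prodTuple h v w) =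
      ∑ j : Fin p, (-1 : ℤ) ^ (j : ℕ) • fderiv ℝ (fun x => ∫ y in K,
        Θ (x, y) ((Fin.cast h (Fin.castAdd n j)).removeNth (prodTuple h v w))) x (v j) := by
  set t := prodTuple h v w with ht
  have hev := fun i : Fin (r + 1) => contDiffOn_eval hΘ (i.removeNth t)
  have hcont : ∀ (i : Fin (r + 1)), Continuous fun y =>
      (-1 : ℤ) ^ (i : ℕ) • fderiv ℝ (fun z => Θ z (i.removeNth t)) (x, y) (t i) := by
    intro i
    have h1 := (contDiffOn_fderiv_of_isOpen (hU.prod isOpen_univ) (hev i)).continuousOn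
    have h2 : Continuous fun y => fderiv ℝ (fun z => Θ z (i.removeNth t)) (x, y) :=
      h1.comp_continuous (Continuous.prodMk_right x) fun y => ⟨hx, trivial⟩
    exact (h2.clm_apply continuous_const).const_smul _
  have h1 : ∀ y, extDeriv Θ (x, y) t = ∑ i : Fin (r + 1),
      (-1 : ℤ) ^ (i : ℕ) • fderiv ℝ (fun z => Θ z (i.removeNth t)) (x, y) (t i) := fun y =>
    extDeriv_apply (differentiableAt_of_contDiffOn (hU.prod isOpen_univ) hΘ ⟨hx, trivial⟩) t
  simp only [h1]
  rw [integral_finsetSum _ fun i _ => (hcont i).continuousOn.integrableOn_compact hK,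
    ← Equiv.sum_comp (finCongr h), Fin.sum_univ_add]
  have hv : ∀ j : Fin n, ∫ y in K, (-1 : ℤ) ^ ((finCongr h (Fin.natAdd p j) : Fin (r + 1)) : ℕ) •
      fderiv ℝ (fun z => Θ z ((finCongr h (Fin.natAdd p j)).removeNth t)) (x, y)
        (t (finCongr h (Fin.natAdd p j))) = 0 := by
    intro j
    rw [integral_neg_one_pow_smul]
    have e1 : t (finCongr h (Fin.natAdd p j)) = (0, w j) := prodTuple_natAdd h v w j
    simp only [e1, fun y => fderiv_slice hU (hev (finCongr h (Fin.natAdd p j))) hx y (w j)]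
    rw [setIntegral_fderiv_eq_zero (contDiff_slice (hev _) hx) hK, smul_zero]
    intro y hy
    simp [h0 x hx y hy]
  rw [Finset.sum_eq_zero fun j _ => hv j, add_zero]
  refine Finset.sum_congr rfl fun j _ => ?_
  rw [integral_neg_one_pow_smul]
  have e1 : t (finCongr h (Fin.castAdd n j)) = (v j, 0) := prodTuple_castAdd h v w j
  rw [(hasFDerivAt_setIntegral_compact (μ := volume) hU (hev (Fin.cast h (Fin.castAdd n j))) hK
    hx).fderiv, ContinuousLinearMap.integral_apply]
  · congr 1
    refine integral_congr_ae (Filter.Eventually.of_forall fun y => ?_)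
    change fderiv ℝ _ (x, y) (t (finCongr h (Fin.castAdd n j))) = _
    rw [e1]
    rfl
  · have h2 := (contDiffOn_fderivFst hU (hev (Fin.cast h (Fin.castAdd n j)))).continuousOn
    exact (h2.comp_continuous (Continuous.prodMk_right x)
      fun y => ⟨hx, trivial⟩).continuousOn.integrableOn_compact hK

theorem contDiffOn_of_setIntegral (hU : IsOpen U) (hK : IsCompact K)
    (hΘ : ContDiffOn ℝ ∞ Θ (U ×ˢ Set.univ)) {p : ℕ} (h : p + n = r) (w : Fin n → Euc n)
    {η : P → P [⋀^Fin p]→L[ℝ] ℂ}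
    (hη : ∀ x ∈ U, ∀ v, η x v = ∫ y in K, Θ (x, y) (prodTuple h v w)) : ContDiffOn ℝ ∞ η U :=
  contDiffOn_alternating fun v => (contDiffOn_setIntegral_compact (μ := volume) hU hK
    (contDiffOn_eval hΘ (prodTuple h v w))).congr fun x hx => hη x hx v

theorem extDeriv_of_setIntegral (hU : IsOpen U) (hK : IsCompact K)
    (hΘ : ContDiffOn ℝ ∞ Θ (U ×ˢ Set.univ)) (h0 : ∀ x ∈ U, ∀ y ∉ K, Θ (x, y) = 0)
    {p : ℕ} (h : p + n = r) (h' : p + 1 + n = r + 1) (w : Fin n → Euc n)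
    {η : P → P [⋀^Fin p]→L[ℝ] ℂ}
    (hη : ∀ x ∈ U, ∀ v, η x v = ∫ y in K, Θ (x, y) (prodTuple h v w)) {x : P} (hx : x ∈ U)
    (v : Fin (p + 1) → P) :
    extDeriv η x v = ∫ y in K, extDeriv Θ (x, y) (prodTuple h' v w) := by
  rw [setIntegral_extDeriv hU hK hΘ h0 h' v w hx, extDeriv_apply
    (differentiableAt_of_contDiffOn hU (contDiffOn_of_setIntegral hU hK hΘ h w hη) hx)]
  refine Finset.sum_congr rfl fun j _ => ?_
  congr 2
  refine Filter.EventuallyEq.fderiv_eq (Filter.mem_of_superset (hU.mem_nhds hx) fun x' hx' => ?_)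
  rw [removeNth_prodTuple h h']
  exact hη x' hx' _

end FubiniForms
end FamiliesChernWeil

end

noncomputable section
namespace FamiliesChernWeil
-- Contracting with a vertical frame
section Contraction

theorem alternating_det {n : ℕ} (ψ : Euc n [⋀^Fin n]→ₗ[ℝ] ℝ) (T : Euc n →L[ℝ] Euc n) :
    ψ (fun j => T (EuclideanSpace.single j 1)) =
      T.det * ψ (fun j => EuclideanSpace.single j 1) := by
  let b := (EuclideanSpace.basisFun (Fin n) ℝ).toBasis
  have hb : ⇑b = fun j => EuclideanSpace.single j (1 : ℝ) := by
    funext j; simp [b]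
  have h1 := ψ.eq_smul_basis_det b
  have h2 : b.det (fun j => T (EuclideanSpace.single j 1)) = T.det := by
    have := b.det_comp T.toLinearMap b
    rw [b.det_self, mul_one, hb] at this
    exact this
  conv_lhs => rw [h1]
  rw [AlternatingMap.smul_apply, h2, smul_eq_mul, mul_comm, hb]

theorem alternating_det_complex {n : ℕ} (ψ : Euc n [⋀^Fin n]→ₗ[ℝ] ℂ) (T : Euc n →L[ℝ] Euc n) :
    ψ (fun j => T (EuclideanSpace.single j 1)) =
      T.det • ψ (fun j => EuclideanSpace.single j 1) := by
  have hre := alternating_det (Complex.reLm.compAlternatingMap ψ) T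
  have him := alternating_det (Complex.imLm.compAlternatingMap ψ) T
  refine Complex.ext (hre.trans ?_) (him.trans ?_) <;> simp

variable {U W : Type*} [NormedAddCommGroup U] [NormedSpace ℝ U]
  [NormedAddCommGroup W] [NormedSpace ℝ W] {p n r : ℕ}

theorem append_update_right {α : Type*} (u : Fin p → α) (w : Fin n → α) [DecidableEq (Fin n)]
    (j : Fin n) (c : α) :
    Fin.append u (Function.update w j c) =
      Function.update (Fin.append u w) (Fin.natAdd p j) c := by
  funext i
  refine Fin.addCases (fun k => ?_) (fun k => ?_) i
  · have : Fin.castAdd n k ≠ Fin.natAdd p j := by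
      intro h
      have := congrArg Fin.val h
      simp at this
      omega
    simp [this]
  · rcases eq_or_ne k j with rfl | hk
    · simp
    · have : Fin.natAdd p k ≠ Fin.natAdd p j := fun h => hk (Fin.natAdd_injective _ _ h)
      simp [hk]

/-- The `n`-form `w ↦ θ(u₁, …, uₚ, w₁, …, wₙ)`. -/
def contractFirst (h : p + n = r) (θ : W [⋀^Fin r]→L[ℝ] ℂ) (u : Fin p → W) :
    W [⋀^Fin n]→ₗ[ℝ] ℂ where
  toFun w := θ fun i => Fin.append u w (Fin.cast h.symm i)
  map_update_add' := by
    intro _ w j a b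
    subst h
    simp only [Fin.cast_eq_self, append_update_right]
    exact θ.map_update_add _ _ _ _
  map_update_smul' := by
    intro _ w j a b
    subst h
    simp only [Fin.cast_eq_self, append_update_right]
    exact θ.map_update_smul _ _ _ _
  map_eq_zero_of_eq' := by
    intro w i j hij hne
    subst h
    refine θ.map_eq_zero_of_eq _ (i := Fin.natAdd p i) (j := Fin.natAdd p j) ?_ ?_
    · simp [hij]
    · exact fun h => hne (Fin.natAdd_injective _ _ h)

theorem contractLast_det (h : p + n = r) (θ : W [⋀^Fin r]→L[ℝ] ℂ) (L : U →L[ℝ] W)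
    (A : Euc n →L[ℝ] W) (T : Euc n →L[ℝ] Euc n) :
    contractLast h θ L (fun j => A (T (EuclideanSpace.single j 1))) =
      T.det • contractLast h θ L (fun j => A (EuclideanSpace.single j 1)) := by
  ext ξ
  exact alternating_det_complex
    ((contractFirst h θ fun j => L (ξ j)).compLinearMap A.toLinearMap) T

theorem contractLast_eq_zero (h : p + n = r) (θ : W [⋀^Fin r]→L[ℝ] ℂ) {L : U →L[ℝ] W}
    {w : Fin n → W} {ξ : Fin p → U} {i : Fin p} (hi : L (ξ i) ∈ Submodule.span ℝ (Set.range w)) :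
    contractLast h θ L w ξ = 0 := by
  subst h
  refine θ.toAlternatingMap.map_linearDependent _ fun hli => ?_
  have h1 : Submodule.span ℝ (Set.range w) ≤
      Submodule.span ℝ (Fin.append (fun j => L (ξ j)) w '' Set.range (Fin.natAdd p)) := by
    refine Submodule.span_mono ?_
    rintro _ ⟨j, rfl⟩
    exact ⟨_, ⟨j, rfl⟩, by simp⟩
  have h2 := hli.notMem_span_image (s := Set.range (Fin.natAdd p)) (x := Fin.castAdd n i) ?_
  · refine h2 (h1 ?_)
    simpa using hi
  · rintro ⟨j, hj⟩
    have := congrArg Fin.val hj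
    simp at this
    omega

/-- The arguments are exchanged one at a time; each exchange changes the value by a term with an
argument in `S`. -/
theorem multilinear_congr_of_sub_mem {G : Type*} [AddCommGroup G] [Module ℝ G] {V : Type*}
    [AddCommGroup V] [Module ℝ V]
    (f : MultilinearMap ℝ (fun _ : Fin p => V) G) (S : Set V)
    (hf : ∀ v i, v i ∈ S → f v = 0) {u u' : Fin p → V} (huu : ∀ i, u i - u' i ∈ S) : f u = f u' := by
  classical
  have key : ∀ s : Finset (Fin p), f (s.piecewise u u') = f u' := by
    intro s
    induction s using Finset.induction_on with
    | empty => simp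
    | insert i s hi ih =>
      rw [← ih, Finset.piecewise_insert, ← sub_eq_zero]
      have h1 : s.piecewise u u' = Function.update (s.piecewise u u') i (u' i) := by
        rw [eq_comm, Function.update_eq_self_iff]
        simp [hi]
      conv_lhs => rw [h1]
      rw [Function.update_idem, ← f.map_update_sub]
      exact hf _ i (by simpa using huu i)
  simpa using key Finset.univ

/-- Independence of the lifts: a lift in the span of the frame makes the tuple linearly dependent.
-/
theorem contractLast_congr (h : p + n = r) (θ : W [⋀^Fin r]→L[ℝ] ℂ) {L L' : U →L[ℝ] W}
    {w : Fin n → W} (hL : ∀ ξ, L ξ - L' ξ ∈ Submodule.span ℝ (Set.range w)) :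
    contractLast h θ L w = contractLast h θ L' w := by
  ext ξ
  exact multilinear_congr_of_sub_mem
    (contractLast h θ (ContinuousLinearMap.id ℝ W) w).toAlternatingMap.toMultilinearMap
    (Submodule.span ℝ (Set.range w)) (fun v i hi => contractLast_eq_zero h θ
      (L := ContinuousLinearMap.id ℝ W) hi) (u := fun j => L (ξ j)) (u' := fun j => L' (ξ j))
    fun i => hL _

/-- The contraction scales by `det T` and the sign of the orientation form by `sign (det T)`. Their
product is the absolute value a density requires. -/
theorem sign_smul_contractLast_det (h : p + n = r) (α : W [⋀^Fin n]→L[ℝ] ℝ)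
    (θ : W [⋀^Fin r]→L[ℝ] ℂ) (L : U →L[ℝ] W) (A : Euc n →L[ℝ] W) (T : Euc n →L[ℝ] Euc n) :
    (SignType.sign (α fun j => A (T (EuclideanSpace.single j 1))) : ℝ) •
        contractLast h θ L (fun j => A (T (EuclideanSpace.single j 1))) =
      |T.det| • ((SignType.sign (α fun j => A (EuclideanSpace.single j 1)) : ℝ) •
        contractLast h θ L (fun j => A (EuclideanSpace.single j 1))) := by
  have h1 : (α fun j => A (T (EuclideanSpace.single j 1))) =
      T.det * α fun j => A (EuclideanSpace.single j 1) :=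
    alternating_det (α.toAlternatingMap.compLinearMap A.toLinearMap) T
  rw [contractLast_det, h1, sign_mul, smul_smul, smul_smul]
  congr 1
  push_cast
  rw [mul_right_comm, sign_mul_self]

end Contraction
end FamiliesChernWeil

end

noncomputable section
namespace FamiliesChernWeil
-- Fibered coordinates on the total space
section FiberCharts

variable {q m n : ℕ}
  {B : Type*} [TopologicalSpace B] [ChartedSpace (Euc q) B] [IsManifold (𝓡 q) ∞ B]
  {M : Type*} [TopologicalSpace M] [ChartedSpace (Euc m) M] [IsManifold (𝓡 m) ∞ M]
  {Z : Type*} [TopologicalSpace Z] [ChartedSpace (Euc n) Z]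
  {pr : M → B}

/-- A local trivialization that is a diffeomorphism. -/
structure IsSmoothTriv (q m n : ℕ) {B : Type*} [TopologicalSpace B] [ChartedSpace (Euc q) B]
    {M : Type*} [TopologicalSpace M] [ChartedSpace (Euc m) M] {Z : Type*} [TopologicalSpace Z]
    [ChartedSpace (Euc n) Z] {pr : M → B} (e : Trivialization Z pr) : Prop where
  smooth : ContMDiffOn (𝓡 m) ((𝓡 q).prod (𝓡 n)) ∞ e e.source
  smooth_symm : ContMDiffOn ((𝓡 q).prod (𝓡 n)) (𝓡 m) ∞ e.toOpenPartialHomeomorph.symm e.target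

/-- The parametrization of the total space by a trivialization. -/
def trivParam (e : Trivialization Z pr) (b : B) (z : Z) : M := e.toOpenPartialHomeomorph.symm (b, z)

theorem mem_target (e : Trivialization Z pr) {b : B} (hb : b ∈ e.baseSet) (z : Z) :
    (b, z) ∈ e.target := e.mem_target.2 hb

theorem trivParam_mem_source (e : Trivialization Z pr) {b : B} (hb : b ∈ e.baseSet) (z : Z) :
    trivParam e b z ∈ e.source :=
  e.toOpenPartialHomeomorph.map_target (mem_target e hb z)

theorem proj_trivParam (e : Trivialization Z pr) {b : B} (hb : b ∈ e.baseSet) (z : Z) :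
    pr (trivParam e b z) = b := e.proj_symm_apply (mem_target e hb z)

theorem apply_trivParam (e : Trivialization Z pr) {b : B} (hb : b ∈ e.baseSet) (z : Z) :
    e (trivParam e b z) = (b, z) :=
  e.toOpenPartialHomeomorph.right_inv (mem_target e hb z)

variable {e : Trivialization Z pr} {κ : PartialEquiv Z (Euc n)}

theorem IsSmoothTriv.contMDiffAt (he : IsSmoothTriv q m n e) {b : B}
    (hb : b ∈ e.baseSet) (z : Z) :
    ContMDiffAt ((𝓡 q).prod (𝓡 n)) (𝓡 m) ∞ (fun w : B × Z => trivParam e w.1 w.2) (b, z) :=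
  he.smooth_symm.contMDiffAt (e.open_target.mem_nhds (mem_target e hb z))

theorem IsSmoothTriv.contMDiffAt_snd (he : IsSmoothTriv q m n e) {x : M}
    (hx : x ∈ e.source) : ContMDiffAt (𝓡 m) (𝓡 n) ∞ (fun x => (e x).2) x :=
  (_root_.contMDiffAt_snd).comp x (he.smooth.contMDiffAt (e.open_source.mem_nhds hx))

/-- The parametrization of the total space in coordinates. -/
def fiberChart (e : Trivialization Z pr) (b₀ : B) (κ : PartialEquiv Z (Euc n))
    (z : Euc q × Euc n) : M := trivParam e ((extChartAt (𝓡 q) b₀).symm z.1) (κ.symm z.2)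

/-- The domain of the base coordinates over which a trivialization is defined. -/
def baseDomain (e : Trivialization Z pr) (b₀ : B) : Set (Euc q) :=
  (extChartAt (𝓡 q) b₀).target ∩ (extChartAt (𝓡 q) b₀).symm ⁻¹' e.baseSet

theorem isOpen_baseDomain (b₀ : B) : IsOpen (baseDomain (q := q) e b₀) :=
  (continuousOn_extChartAt_symm b₀).isOpen_inter_preimage (isOpen_extChartAt_target b₀)
    e.open_baseSet

theorem contMDiffAt_fiberChart (he : IsSmoothTriv q m n e) (hκ : IsSmoothChart κ)
    {b₀ : B} {β : Euc q} (hβ : β ∈ baseDomain e b₀) {y : Euc n} (hy : y ∈ κ.target) :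
    ContMDiffAt 𝓘(ℝ, Euc q × Euc n) (𝓡 m) ∞ (fiberChart e b₀ κ) (β, y) := by
  have h1 : ContMDiffAt 𝓘(ℝ, Euc q × Euc n) (𝓡 q) ∞
      (fun z : Euc q × Euc n => (extChartAt (𝓡 q) b₀).symm z.1) (β, y) :=
    ContMDiffAt.comp (g := (extChartAt (𝓡 q) b₀).symm) (f := Prod.fst) (β, y)
      (contMDiffAt_chart_symm hβ.1) contDiff_fst.contMDiff.contMDiffAt
  have h2 : ContMDiffAt 𝓘(ℝ, Euc q × Euc n) (𝓡 n) ∞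
      (fun z : Euc q × Euc n => κ.symm z.2) (β, y) :=
    ContMDiffAt.comp (g := κ.symm) (f := Prod.snd) (β, y)
      (hκ.smooth_symm.contMDiffAt (hκ.open_target.mem_nhds hy)) contDiff_snd.contMDiff.contMDiffAt
  exact (he.contMDiffAt hβ.2 _).comp (β, y) (h1.prodMk h2)

theorem contMDiffAt_trivParam_left (he : IsSmoothTriv q m n e) {b : B}
    (hb : b ∈ e.baseSet) (z : Z) :
    ContMDiffAt (𝓡 q) (𝓡 m) ∞ (fun b' => trivParam e b' z) b :=
  ContMDiffAt.comp (g := fun w : B × Z => trivParam e w.1 w.2) (f := fun b' => (b', z)) b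
    (he.contMDiffAt hb z) (contMDiffAt_id.prodMk contMDiffAt_const)

theorem contMDiff_trivParam_right (he : IsSmoothTriv q m n e) {b : B}
    (hb : b ∈ e.baseSet) : ContMDiff (𝓡 n) (𝓡 m) ∞ (trivParam e b) := fun z =>
  ContMDiffAt.comp (g := fun w : B × Z => trivParam e w.1 w.2) (f := fun z' => (b, z')) z
    (he.contMDiffAt hb z) (contMDiffAt_const.prodMk contMDiffAt_id)

/-- The derivative of a fiber of `fiberChart`. -/
def fiberDeriv (e : Trivialization Z pr) (b : B) (κ : PartialEquiv Z (Euc n)) (y : Euc n) :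
    Euc n →L[ℝ] Euc m :=
  mfderiv 𝓘(ℝ, Euc n) (𝓡 m) (fun y => trivParam e b (κ.symm y)) y

/-- The derivative of the parametrization in the direction of the base. -/
def liftDeriv (q m : ℕ) {B : Type*} [TopologicalSpace B] [ChartedSpace (Euc q) B] {M : Type*} 
    [TopologicalSpace M] [ChartedSpace (Euc m) M] {Z : Type*} [TopologicalSpace Z]
    {pr : M → B} (e : Trivialization Z pr) (b : B) (z : Z) : Euc q →L[ℝ] Euc m :=
  mfderiv (𝓡 q) (𝓡 m) (fun b' => trivParam e b' z) b

theorem fiberDeriv_apply (he : IsSmoothTriv q m n e) (hκ : IsSmoothChart κ) {b : B}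
    (hb : b ∈ e.baseSet) {y : Euc n} (hy : y ∈ κ.target) (u : Euc n) :
    fiberDeriv (m := m) e b κ y u =
      (mfderiv (𝓡 n) (𝓡 m) (trivParam e b) (κ.symm y) : Euc n →L[ℝ] Euc m)
        ((mfderiv 𝓘(ℝ, Euc n) (𝓡 n) κ.symm y : Euc n →L[ℝ] Euc n) u) := by
  have h1 : MDifferentiableAt (𝓡 n) (𝓡 m) (trivParam e b) (κ.symm y) :=
    (contMDiff_trivParam_right he hb _).mdifferentiableAt (by simp)
  have h2 : MDifferentiableAt 𝓘(ℝ, Euc n) (𝓡 n) κ.symm y :=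
    (hκ.smooth_symm.contMDiffAt (hκ.open_target.mem_nhds hy)).mdifferentiableAt (by simp)
  exact congrArg (fun T => (T : Euc n →L[ℝ] Euc m) u) (mfderiv_comp y h1 h2)

theorem mfderiv_fiberChart_left (he : IsSmoothTriv q m n e) (hκ : IsSmoothChart κ)
    {b₀ : B} {β : Euc q} (hβ : β ∈ baseDomain e b₀) {y : Euc n} (hy : y ∈ κ.target) (v : Euc q) :
    (mfderiv 𝓘(ℝ, Euc q × Euc n) (𝓡 m) (fiberChart e b₀ κ) (β, y) :
      Euc q × Euc n →L[ℝ] Euc m) (v, 0) =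
      liftDeriv q m e ((extChartAt (𝓡 q) b₀).symm β) (κ.symm y) (dChartSymm b₀ β v) := by
  have h0 := (contMDiffAt_fiberChart he hκ hβ hy).mdifferentiableAt (by simp)
  have hi : HasFDerivAt (fun β : Euc q => (β, y)) (ContinuousLinearMap.inl ℝ (Euc q) (Euc n)) β :=
    hasFDerivAt_prodMk_left β y
  have h1 := mfderiv_comp (I := 𝓘(ℝ, Euc q)) (I' := 𝓘(ℝ, Euc q × Euc n)) (I'' := 𝓡 m)
    (g := fiberChart e b₀ κ) (f := fun β : Euc q => (β, y)) β h0
    hi.differentiableAt.mdifferentiableAt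
  have h2 := mfderiv_comp (I := 𝓘(ℝ, Euc q)) (I' := 𝓡 q) (I'' := 𝓡 m)
    (g := fun b' => trivParam e b' (κ.symm y)) (f := (extChartAt (𝓡 q) b₀).symm) β
    ((contMDiffAt_trivParam_left he hβ.2 _).mdifferentiableAt (by simp))
    ((contMDiffAt_chart_symm hβ.1).mdifferentiableAt (by simp))
  rw [mfderiv_eq_fderiv, hi.fderiv] at h1
  exact (congrArg (fun T => (T : Euc q →L[ℝ] Euc m) v) h1).symm.trans
    (congrArg (fun T => (T : Euc q →L[ℝ] Euc m) v) h2)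

theorem mfderiv_fiberChart_right (he : IsSmoothTriv q m n e) (hκ : IsSmoothChart κ)
    {b₀ : B} {β : Euc q} (hβ : β ∈ baseDomain e b₀) {y : Euc n} (hy : y ∈ κ.target) (u : Euc n) :
    (mfderiv 𝓘(ℝ, Euc q × Euc n) (𝓡 m) (fiberChart e b₀ κ) (β, y) :
      Euc q × Euc n →L[ℝ] Euc m) (0, u) =
      fiberDeriv e ((extChartAt (𝓡 q) b₀).symm β) κ y u := by
  have h0 := (contMDiffAt_fiberChart he hκ hβ hy).mdifferentiableAt (by simp)
  have hi : HasFDerivAt (fun y : Euc n => (β, y)) (ContinuousLinearMap.inr ℝ (Euc q) (Euc n)) y :=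
    hasFDerivAt_prodMk_right β y
  have h1 := mfderiv_comp (I := 𝓘(ℝ, Euc n)) (I' := 𝓘(ℝ, Euc q × Euc n)) (I'' := 𝓡 m)
    (g := fiberChart e b₀ κ) (f := fun y : Euc n => (β, y)) y h0
    hi.differentiableAt.mdifferentiableAt
  rw [mfderiv_eq_fderiv, hi.fderiv] at h1
  exact (congrArg (fun T => (T : Euc n →L[ℝ] Euc m) u) h1).symm

theorem mfderiv_pr_fiberDeriv (hpr : ContMDiff (𝓡 m) (𝓡 q) ∞ pr)
    (he : IsSmoothTriv q m n e) (hκ : IsSmoothChart κ) {b : B}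
    (hb : b ∈ e.baseSet) {y : Euc n} (hy : y ∈ κ.target) (u : Euc n) :
    (mfderiv (𝓡 m) (𝓡 q) pr (trivParam e b (κ.symm y)) : Euc m →L[ℝ] Euc q)
      (fiberDeriv e b κ y u) = 0 := by
  have h1 : MDifferentiableAt (𝓡 n) (𝓡 m) (trivParam e b) (κ.symm y) :=
    (contMDiff_trivParam_right he hb _).mdifferentiableAt (by simp)
  have h2 : MDifferentiableAt 𝓘(ℝ, Euc n) (𝓡 n) κ.symm y :=
    (hκ.smooth_symm.contMDiffAt (hκ.open_target.mem_nhds hy)).mdifferentiableAt (by simp)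
  have h3 := mfderiv_comp (I := 𝓘(ℝ, Euc n)) (I' := 𝓡 m) (I'' := 𝓡 q) (g := pr)
    (f := fun y => trivParam e b (κ.symm y)) y ((hpr _).mdifferentiableAt (by simp)) (h1.comp y h2)
  have h4 : pr ∘ (fun y => trivParam e b (κ.symm y)) = fun _ => b :=
    funext fun y => proj_trivParam e hb _
  rw [h4, mfderiv_const] at h3
  exact (congrArg (fun T => (T : Euc n →L[ℝ] Euc q) u) h3).symm

theorem mfderiv_pr_liftDeriv (hpr : ContMDiff (𝓡 m) (𝓡 q) ∞ pr)
    (he : IsSmoothTriv q m n e) {b : B} (hb : b ∈ e.baseSet) (z : Z) (v : Euc q) :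
    (mfderiv (𝓡 m) (𝓡 q) pr (trivParam e b z) : Euc m →L[ℝ] Euc q)
      (liftDeriv q m e b z v) = v := by
  have h3 := mfderiv_comp (I := 𝓡 q) (I' := 𝓡 m) (I'' := 𝓡 q) (g := pr)
    (f := fun b' => trivParam e b' z) b ((hpr _).mdifferentiableAt (by simp))
    ((contMDiffAt_trivParam_left he hb z).mdifferentiableAt (by simp))
  have h4 : pr ∘ (fun b' => trivParam e b' z) =ᶠ[𝓝 b] id :=
    Filter.mem_of_superset (e.open_baseSet.mem_nhds hb) fun b' hb' => proj_trivParam e hb' z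
  rw [h4.mfderiv_eq, mfderiv_id] at h3
  exact (congrArg (fun T => (T : Euc q →L[ℝ] Euc q) v) h3).symm

/-- The fiber coordinates of a point. -/
def fiberCoord (e : Trivialization Z pr) (κ : PartialEquiv Z (Euc n)) (x : M) : Euc n := κ (e x).2

theorem mdifferentiableAt_fiberCoord (he : IsSmoothTriv q m n e) (hκ : IsSmoothChart κ)
    {b : B} (hb : b ∈ e.baseSet) {y : Euc n} (hy : y ∈ κ.target) :
    MDifferentiableAt (𝓡 m) 𝓘(ℝ, Euc n) (fiberCoord e κ) (trivParam e b (κ.symm y)) := by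
  have h1 := he.contMDiffAt_snd (trivParam_mem_source e hb (κ.symm y))
  have h2 : (e (trivParam e b (κ.symm y))).2 ∈ κ.source := by
    rw [apply_trivParam e hb]
    exact κ.map_target hy
  exact (ContMDiffAt.comp (g := κ) (f := fun x => (e x).2) _
    (hκ.smooth.contMDiffAt (hκ.open_source.mem_nhds h2)) h1).mdifferentiableAt (by simp)

/-- The fiber coordinate map is a left inverse of the fiber parametrization, so the derivative of
the latter is injective. -/
theorem linearIndependent_fiberDeriv (he : IsSmoothTriv q m n e) (hκ : IsSmoothChart κ)
    {b : B} (hb : b ∈ e.baseSet) {y : Euc n} (hy : y ∈ κ.target) :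
    LinearIndependent ℝ fun j : Fin n =>
      fiberDeriv (m := m) e b κ y (EuclideanSpace.single j 1) := by
  have h1 : MDifferentiableAt (𝓡 n) (𝓡 m) (trivParam e b) (κ.symm y) :=
    (contMDiff_trivParam_right he hb _).mdifferentiableAt (by simp)
  have h2 : MDifferentiableAt 𝓘(ℝ, Euc n) (𝓡 n) κ.symm y :=
    (hκ.smooth_symm.contMDiffAt (hκ.open_target.mem_nhds hy)).mdifferentiableAt (by simp)
  have h3 := mfderiv_comp (I := 𝓘(ℝ, Euc n)) (I' := 𝓡 m) (I'' := 𝓘(ℝ, Euc n)) (g := fiberCoord e κ)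
    (f := fun y => trivParam e b (κ.symm y)) y (mdifferentiableAt_fiberCoord he hκ hb hy)
    (h1.comp y h2)
  have h4 : fiberCoord e κ ∘ (fun y => trivParam e b (κ.symm y)) =ᶠ[𝓝 y] id :=
    Filter.mem_of_superset (hκ.open_target.mem_nhds hy) fun y' hy' => by
      simp only [fiberCoord, Function.comp, apply_trivParam e hb, Set.mem_ofPred_eq, id]
      exact κ.right_inv hy'
  rw [h4.mfderiv_eq, mfderiv_id] at h3
  have hinj : LinearMap.ker (fiberDeriv (m := m) e b κ y).toLinearMap = ⊥ := by
    refine LinearMap.ker_eq_bot'.2 fun u hu => ?_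
    have h5 : u = (mfderiv (𝓡 m) 𝓘(ℝ, Euc n) (fiberCoord e κ) (trivParam e b (κ.symm y)) :
        Euc m →L[ℝ] Euc n) (fiberDeriv e b κ y u) :=
      congrArg (fun T => (T : Euc n →L[ℝ] Euc n) u) h3
    rw [h5]
    exact (congrArg _ hu).trans (map_zero _)
  have h6 := (EuclideanSpace.basisFun (Fin n) ℝ).toBasis.linearIndependent.map' _ hinj
  have h7 : (fun j : Fin n => fiberDeriv (m := m) e b κ y (EuclideanSpace.single j 1)) =
      (fiberDeriv (m := m) e b κ y).toLinearMap ∘ (EuclideanSpace.basisFun (Fin n) ℝ).toBasis := by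
    funext j
    simp [Function.comp]
  rw [h7]
  exact h6

/-- A fibered chart composed with its coordinate map is the identity. Differentiating along a
vertical `u` kills the base component, so `u` is the image of its fiber component. -/
theorem mem_span_fiberDeriv (hpr : ContMDiff (𝓡 m) (𝓡 q) ∞ pr)
    (he : IsSmoothTriv q m n e) (hκ : IsSmoothChart κ)
    {b : B} (hb : b ∈ e.baseSet) {y : Euc n} (hy : y ∈ κ.target) {u : Euc m}
    (hu : (mfderiv (𝓡 m) (𝓡 q) pr (trivParam e b (κ.symm y)) : Euc m →L[ℝ] Euc q) u = 0) :
    u ∈ Submodule.span ℝ (Set.range fun j : Fin n =>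
      fiberDeriv (m := m) e b κ y (EuclideanSpace.single j 1)) := by
  set x := trivParam e b (κ.symm y) with hx
  have hprx : pr x = b := proj_trivParam e hb _
  have hxs : x ∈ e.source := trivParam_mem_source e hb _
  have hβ : extChartAt (𝓡 q) b b ∈ baseDomain e b :=
    ⟨mem_extChartAt_target b, by simpa using hb⟩
  have hQ1 : MDifferentiableAt (𝓡 m) 𝓘(ℝ, Euc q) (fun x => extChartAt (𝓡 q) b (pr x)) x :=
    MDifferentiableAt.comp (g := extChartAt (𝓡 q) b) (f := pr) x
      (mdifferentiableAt_extChartAt (by rw [hprx]; exact mem_chart_source _ _))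
      ((hpr _).mdifferentiableAt (by simp))
  have hQ2 := mdifferentiableAt_fiberCoord he hκ hb hy
  have hQ1z : (mfderiv (𝓡 m) 𝓘(ℝ, Euc q) (fun x => extChartAt (𝓡 q) b (pr x)) x :
      Euc m →L[ℝ] Euc q) u = 0 := by
    have h := mfderiv_comp (I := 𝓡 m) (I' := 𝓡 q) (I'' := 𝓘(ℝ, Euc q)) (g := extChartAt (𝓡 q) b)
      (f := pr) x (mdifferentiableAt_extChartAt (by rw [hprx]; exact mem_chart_source _ _))
      ((hpr _).mdifferentiableAt (by simp))
    refine (congrArg (fun T => (T : Euc m →L[ℝ] Euc q) u) h).trans ?_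
    exact (congrArg (mfderiv (𝓡 q) 𝓘(ℝ, Euc q) (extChartAt (𝓡 q) b) (pr x) : Euc q →L[ℝ] Euc q)
      hu).trans (map_zero _)
  have hQ : HasMFDerivAt (𝓡 m) 𝓘(ℝ, Euc q × Euc n)
      (fun x => (extChartAt (𝓡 q) b (pr x), fiberCoord e κ x)) x
      ((mfderiv (𝓡 m) 𝓘(ℝ, Euc q) (fun x => extChartAt (𝓡 q) b (pr x)) x :
        Euc m →L[ℝ] Euc q).prod (mfderiv (𝓡 m) 𝓘(ℝ, Euc n) (fiberCoord e κ) x :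
        Euc m →L[ℝ] Euc n)) :=
    ⟨hQ1.continuousAt.prodMk hQ2.continuousAt, hQ1.hasMFDerivAt.2.prodMk hQ2.hasMFDerivAt.2⟩
  have hval : (extChartAt (𝓡 q) b (pr x), fiberCoord e κ x) = (extChartAt (𝓡 q) b b, y) := by
    rw [hprx, fiberCoord, hx, apply_trivParam e hb]
    exact congrArg _ (κ.right_inv hy)
  have hP : HasMFDerivAt 𝓘(ℝ, Euc q × Euc n) (𝓡 m) (fiberChart e b κ)
      (extChartAt (𝓡 q) b (pr x), fiberCoord e κ x) 
      (mfderiv 𝓘(ℝ, Euc q × Euc n) (𝓡 m) (fiberChart e b κ) (extChartAt (𝓡 q) b b, y)) := by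
    rw [hval]
    exact ((contMDiffAt_fiberChart he hκ hβ hy).mdifferentiableAt (by simp)).hasMFDerivAt
  have hPQ := hP.comp x hQ
  have hid : (fiberChart e b κ ∘ fun x => (extChartAt (𝓡 q) b (pr x), fiberCoord e κ x)) =ᶠ[𝓝 x]
      id := by
    have h1 : ∀ᶠ x' in 𝓝 x, x' ∈ e.source := e.open_source.mem_nhds hxs
    have h2 : ∀ᶠ x' in 𝓝 x, pr x' ∈ (extChartAt (𝓡 q) b).source :=
      hpr.continuous.continuousAt.preimage_mem_nhds (by
        rw [hprx]; exact extChartAt_source_mem_nhds b)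
    have h3 : ∀ᶠ x' in 𝓝 x, (e x').2 ∈ κ.source := by
      refine (he.contMDiffAt_snd hxs).continuousAt.preimage_mem_nhds ?_
      rw [hx, apply_trivParam e hb]
      exact hκ.open_source.mem_nhds (κ.map_target hy)
    filter_upwards [h1, h2, h3] with x' h1 h2 h3
    simp only [fiberChart, Function.comp, fiberCoord, (extChartAt (𝓡 q) b).left_inv h2,
      κ.left_inv h3, id, trivParam]
    have : (pr x', (e x').2) = e x' := by rw [← e.coe_fst h1]
    rw [this]
    exact e.toOpenPartialHomeomorph.left_inv h1
  have hd := (hPQ.congr_of_eventuallyEq hid.symm).mfderiv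
  rw [mfderiv_id] at hd
  have h7 : u = (mfderiv 𝓘(ℝ, Euc q × Euc n) (𝓡 m) (fiberChart e b κ) (extChartAt (𝓡 q) b b, y) :
      Euc q × Euc n →L[ℝ] Euc m)
      ((mfderiv (𝓡 m) 𝓘(ℝ, Euc q) (fun x => extChartAt (𝓡 q) b (pr x)) x : Euc m →L[ℝ] Euc q) u,
        (mfderiv (𝓡 m) 𝓘(ℝ, Euc n) (fiberCoord e κ) x : Euc m →L[ℝ] Euc n) u) :=
    congrArg (fun T => (T : Euc m →L[ℝ] Euc m) u) hd
  rw [hQ1z] at h7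
  set u' : Euc n := (mfderiv (𝓡 m) 𝓘(ℝ, Euc n) (fiberCoord e κ) x : Euc m →L[ℝ] Euc n) u
  rw [h7.trans (mfderiv_fiberChart_right he hκ hβ hy u')]
  have h8 : ∑ j, u' j • EuclideanSpace.single j (1 : ℝ) = u' := by
    simpa using (EuclideanSpace.basisFun (Fin n) ℝ).sum_repr u'
  rw [← h8, map_sum, extChartAt_to_inv]
  refine Submodule.sum_mem _ fun j _ => ?_
  rw [map_smul]
  exact Submodule.smul_mem _ _ (Submodule.subset_span ⟨j, rfl⟩)

end FiberCharts
end FamiliesChernWeil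

end

noncomputable section
namespace FamiliesChernWeil
-- The density integrated over a fiber
section FiberDensities

variable {q m n : ℕ}
  {B : Type*} [TopologicalSpace B] [ChartedSpace (Euc q) B] [IsManifold (𝓡 q) ∞ B]
  {M : Type*} [TopologicalSpace M] [ChartedSpace (Euc m) M] [IsManifold (𝓡 m) ∞ M]
  {Z : Type*} [TopologicalSpace Z] [ChartedSpace (Euc n) Z]
  {pr : M → B} (o : FiberOrientation (m := m) (q := q) pr n) {p r : ℕ} (h : p + n = r)
  (θ : DForm m M r ℂ)

/-- The density on the fiber whose integral is the fiber integral. -/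
def fiberDensity (e : Trivialization Z pr) (b : B) (z : Z) (v : Fin n → TangentSpace (𝓡 n) z) :
    Euc q [⋀^Fin p]→L[ℝ] ℂ :=
  (SignType.sign (o.form (trivParam e b z) fun j => 
    (mfderiv (𝓡 n) (𝓡 m) (trivParam e b) z : Euc n →L[ℝ] Euc m) (v j)) : ℝ) •
      contractLast h (θ (trivParam e b z)) (liftDeriv q m e b z)
        fun j => (mfderiv (𝓡 n) (𝓡 m) (trivParam e b) z : Euc n →L[ℝ] Euc m) (v j)

theorem fiberIntegral_eq [T2Space Z] [CompactSpace Z] [IsManifold (𝓡 n) ∞ Z]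
    (hp : IsSmoothFibration (m := m) (q := q) pr n Z) (b : B) :
    fiberIntegral hp o h θ b =
      integrateDensity (fiberDensity o h θ (hp.locally_trivial b).choose b) := rfl

theorem isDensity_fiberDensity (e : Trivialization Z pr) (b : B) :
    IsDensity (fiberDensity o h θ e b) := fun z A T =>
  sign_smul_contractLast_det h (o.form (trivParam e b z)) (θ (trivParam e b z))
    (liftDeriv q m e b z)
    ((mfderiv (𝓡 n) (𝓡 m) (trivParam e b) z : Euc n →L[ℝ] Euc m).comp A) T

variable {e e' : Trivialization Z pr} {κ : PartialEquiv Z (Euc n)} {θ}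

theorem coordDensity_fiberDensity (he : IsSmoothTriv q m n e) (hκ : IsSmoothChart κ) {b : B}
    (hb : b ∈ e.baseSet) {y : Euc n} (hy : y ∈ κ.target) :
    coordDensity κ (fiberDensity o h θ e b) y =
      (SignType.sign (o.form (trivParam e b (κ.symm y)) fun j => 
        fiberDeriv e b κ y (EuclideanSpace.single j 1)) : ℝ) •
      contractLast h (θ (trivParam e b (κ.symm y))) (liftDeriv q m e b (κ.symm y))
        fun j => fiberDeriv e b κ y (EuclideanSpace.single j 1) := by
  simp only [fiberDeriv_apply he hκ hb hy]
  rfl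

/-- When two trivializations with their charts trace out the same fiber parametrization, only the
lifts can differ. Both lifts project to the same base vector, so they differ by a vertical one,
which the contraction ignores. -/
theorem coordDensity_change_triv (hpr : ContMDiff (𝓡 m) (𝓡 q) ∞ pr) {κ' : PartialEquiv Z (Euc n)}
    (he : IsSmoothTriv q m n e) (he' : IsSmoothTriv q m n e') (hκ : IsSmoothChart κ)
    (hκ' : IsSmoothChart κ') {b : B} (hb : b ∈ e.baseSet) (hb' : b ∈ e'.baseSet)
    (hK : ∀ y, trivParam e b (κ.symm y) = trivParam e' b (κ'.symm y))
    {y : Euc n} (hy : y ∈ κ.target) (hy' : y ∈ κ'.target) :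
    coordDensity κ (fiberDensity o h θ e b) y = coordDensity κ' (fiberDensity o h θ e' b) y := by
  rw [coordDensity_fiberDensity o h he hκ hb hy, coordDensity_fiberDensity o h he' hκ' hb' hy']
  have h1 : fiberDeriv (m := m) e b κ y = fiberDeriv e' b κ' y := by
    simp only [fiberDeriv]
    rw [funext hK]
  rw [h1, hK]
  congr 1
  refine contractLast_congr h _ fun ξ => ?_
  refine mem_span_fiberDeriv hpr he' hκ' hb' hy' ?_
  have h2 := mfderiv_pr_liftDeriv hpr he hb (κ.symm y) ξ
  have h3 := mfderiv_pr_liftDeriv hpr he' hb' (κ'.symm y) ξ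
  have h4 : ∀ x, x = trivParam e' b (κ'.symm y) → 
      (mfderiv (𝓡 m) (𝓡 q) pr x : Euc m →L[ℝ] Euc q) (liftDeriv q m e b (κ.symm y) ξ) = ξ →
      (mfderiv (𝓡 m) (𝓡 q) pr (trivParam e' b (κ'.symm y)) : Euc m →L[ℝ] Euc q)
        (liftDeriv q m e b (κ.symm y) ξ) = ξ := by
    rintro x rfl hx
    exact hx
  exact (map_sub (mfderiv (𝓡 m) (𝓡 q) pr (trivParam e' b (κ'.symm y)) : Euc m →L[ℝ] Euc q)
    _ _).trans (sub_eq_zero.2 ((h4 _ (hK y) h2).trans h3.symm))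

/-- The sign of the orientation form in a fiber chart. -/
def chartSign (e : Trivialization Z pr) (b₀ : B) (κ : PartialEquiv Z (Euc n)) (z : Euc q × Euc n) :
    ℝ :=
  (SignType.sign (pull (fiberChart e b₀ κ) o.form z fun j => (0, EuclideanSpace.single j 1)) : ℝ)

theorem pull_orientation_ne_zero (hpr : ContMDiff (𝓡 m) (𝓡 q) ∞ pr) (he : IsSmoothTriv q m n e)
    (hκ : IsSmoothChart κ) {b₀ : B} {β : Euc q} (hβ : β ∈ baseDomain e b₀) {y : Euc n}
    (hy : y ∈ κ.target) :
    pull (fiberChart e b₀ κ) o.form (β, y) (fun j => (0, EuclideanSpace.single j 1)) ≠ 0 := by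
  rw [pull_apply]
  simp only [mfderiv_fiberChart_right he hκ hβ hy]
  exact o.nonvanishing _ _ (fun j => mfderiv_pr_fiberDeriv hpr he hκ hβ.2 hy _)
    (linearIndependent_fiberDeriv he hκ hβ.2 hy)

/-- The orientation form is continuous and nonzero on vertical frames, so its sign is locally
constant and does not spoil smoothness. -/
theorem eventually_chartSign (hpr : ContMDiff (𝓡 m) (𝓡 q) ∞ pr) (he : IsSmoothTriv q m n e)
    (hκ : IsSmoothChart κ) {b₀ : B} {β : Euc q} (hβ : β ∈ baseDomain e b₀) {y : Euc n}
    (hy : y ∈ κ.target) :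
    ∀ᶠ z in 𝓝 (β, y), chartSign o e b₀ κ z = chartSign o e b₀ κ (β, y) := by
  have h1 := (contDiffAt_pull (contMDiffAt_fiberChart he hκ hβ hy) o.smooth).continuousAt
  have h2 : ContinuousAt (fun z => pull (fiberChart e b₀ κ) o.form z
      fun j => (0, EuclideanSpace.single j 1)) (β, y) :=
    (ContinuousAlternatingMap.apply ℝ (Euc q × Euc n) ℝ _).continuous.continuousAt.comp h1
  have h0 := pull_orientation_ne_zero o hpr he hκ hβ hy
  have h3 : ContinuousAt (fun z => SignType.sign (pull (fiberChart e b₀ κ) o.form z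
      fun j => (0, EuclideanSpace.single j 1))) (β, y) :=
    ContinuousAt.comp (g := SignType.sign) (continuousAt_sign_of_ne_zero h0) h2
  have h4 := h3.preimage_mem_nhds ((isOpen_discrete
    ({SignType.sign (pull (fiberChart e b₀ κ) o.form (β, y)
      fun j => (0, EuclideanSpace.single j 1))} : Set SignType)).mem_nhds rfl)
  filter_upwards [h4] with z hz
  simp only [chartSign]
  exact congrArg (fun s : SignType => (s : ℝ)) hz

theorem coordDensity_apply (he : IsSmoothTriv q m n e) (hκ : IsSmoothChart κ) {b₀ : B} {β : Euc q}
    (hβ : β ∈ baseDomain e b₀) {y : Euc n} (hy : y ∈ κ.target) (v : Fin p → Euc q) :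
    coordDensity κ (fiberDensity o h θ e ((extChartAt (𝓡 q) b₀).symm β)) y
        (fun j => dChartSymm b₀ β (v j)) =
      chartSign o e b₀ κ (β, y) • pull (fiberChart e b₀ κ) θ (β, y)
        (prodTuple h v fun j => EuclideanSpace.single j 1) := by
  rw [coordDensity_fiberDensity o h he hκ hβ.2 hy, chartSign, pull_apply, pull_apply]
  simp only [mfderiv_fiberChart_right he hκ hβ hy]
  rw [ContinuousAlternatingMap.smul_apply]
  congr 1
  refine congrArg (θ (trivParam e ((extChartAt (𝓡 q) b₀).symm β) (κ.symm y))) (funext fun i => ?_)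
  subst h
  refine Fin.addCases (fun k => ?_) (fun k => ?_) i
  · have := prodTuple_castAdd rfl v (fun j : Fin n => (EuclideanSpace.single j (1 : ℝ) : Euc n)) k
    rw [Fin.cast_eq_self] at this
    rw [this, mfderiv_fiberChart_left he hκ hβ hy]
    simp
  · have := prodTuple_natAdd rfl v (fun j : Fin n => (EuclideanSpace.single j (1 : ℝ) : Euc n)) k
    rw [Fin.cast_eq_self] at this
    rw [this, mfderiv_fiberChart_right he hκ hβ hy]
    simp

theorem contDiffAt_chart_integrand (hpr : ContMDiff (𝓡 m) (𝓡 q) ∞ pr)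
    (he : IsSmoothTriv q m n e) (hκ : IsSmoothChart κ) {b₀ : B} {β : Euc q}
    (hβ : β ∈ baseDomain e b₀) {y : Euc n} (hy : y ∈ κ.target) (hθ : IsSmoothForm θ) :
    ContDiffAt ℝ ∞ (fun z => chartSign o e b₀ κ z • pull (fiberChart e b₀ κ) θ z) (β, y) := by
  refine ((contDiffAt_pull (contMDiffAt_fiberChart he hκ hβ hy) hθ).const_smul
    (chartSign o e b₀ κ (β, y))).congr_of_eventuallyEq ?_
  filter_upwards [eventually_chartSign o hpr he hκ hβ hy] with z hz
  rw [hz]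

theorem continuousOn_coordDensity (hpr : ContMDiff (𝓡 m) (𝓡 q) ∞ pr) (he : IsSmoothTriv q m n e)
    (hκ : IsSmoothChart κ) {b : B} (hb : b ∈ e.baseSet) (hθ : IsSmoothForm θ) :
    ContinuousOn (coordDensity κ (fiberDensity o h θ e b)) κ.target := by
  have hβ : extChartAt (𝓡 q) b b ∈ baseDomain e b :=
    ⟨mem_extChartAt_target b, by simpa using hb⟩
  obtain ⟨ι, _, v, g, hg⟩ := exists_alternating_of_values (Euc q) ℂ p
  have h1 : Set.EqOn (coordDensity κ (fiberDensity o h θ e b)) (fun y => g fun i =>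
      (chartSign o e b κ (extChartAt (𝓡 q) b b, y) •
        pull (fiberChart e b κ) θ (extChartAt (𝓡 q) b b, y))
          (prodTuple h (v i) fun j => EuclideanSpace.single j 1)) κ.target := by
    intro y hy
    rw [← hg (coordDensity κ (fiberDensity o h θ e b) y)]
    simp only
    congr 1
    funext i
    have h2 := coordDensity_apply o h (θ := θ) he hκ hβ hy (v i)
    simp only [dChartSymm_self, extChartAt_to_inv] at h2
    exact h2
  refine ContinuousOn.congr (fun y hy => ?_) h1
  refine (g.continuous.continuousAt.comp (continuousAt_pi.2 fun i => ?_)).continuousWithinAt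
  have h3 := (contDiffAt_chart_integrand o hpr he hκ hβ hy hθ).continuousAt
  have h4 := h3.comp (Continuous.prodMk_right (extChartAt (𝓡 q) b b)).continuousAt
  exact (ContinuousAlternatingMap.apply ℝ (Euc q × Euc n) ℂ
    (prodTuple h (v i) fun j => EuclideanSpace.single j 1)).continuous.continuousAt.comp h4

end FiberDensities
end FamiliesChernWeil

end

noncomputable section
namespace FamiliesChernWeil
-- Fiber integrals of forms supported in one fibered chart
section LocalizedFiberIntegral

variable {q m n : ℕ}
  {B : Type*} [TopologicalSpace B] [ChartedSpace (Euc q) B] [IsManifold (𝓡 q) ∞ B]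
  {M : Type*} [TopologicalSpace M] [ChartedSpace (Euc m) M] [IsManifold (𝓡 m) ∞ M]
  {Z : Type*} [TopologicalSpace Z] [ChartedSpace (Euc n) Z]
  {pr : M → B} (o : FiberOrientation (m := m) (q := q) pr n) {p r : ℕ} (h : p + n = r)
  {e : Trivialization Z pr} {κ : PartialEquiv Z (Euc n)} {η : DForm m M r ℂ} {C : Set Z}

open scoped Classical in
/-- The integrand of the fiber integral in coordinates, extended by zero. -/
def chartIntegrand (e : Trivialization Z pr) (b₀ : B) (κ : PartialEquiv Z (Euc n))
    (η : DForm m M r ℂ) (z : Euc q × Euc n) : (Euc q × Euc n) [⋀^Fin r]→L[ℝ] ℂ :=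
  if z.2 ∈ κ.target then chartSign o e b₀ κ z • pull (fiberChart e b₀ κ) η z else 0

/-- `η` vanishes outside the part of the total space where the fiber coordinate lies in `C`. -/
def VanishesOff (e : Trivialization Z pr) (C : Set Z) (η : DForm m M r ℂ) : Prop :=
  ∀ x ∈ e.source, (e x).2 ∉ C → η x = 0

theorem VanishesOff.dForm (he : IsSmoothTriv q m n e) (hC : IsClosed C) (hη : VanishesOff e C η) :
    VanishesOff e C (dForm η) := by
  intro x hx hxC
  have h1 : η =ᶠ[𝓝 x] 0 := by
    have h2 := (he.contMDiffAt_snd hx).continuousAt.preimage_mem_nhds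
      (hC.isOpen_compl.mem_nhds hxC)
    filter_upwards [e.open_source.mem_nhds hx, h2] with x' h3 h4
    exact hη x' h3 h4
  rw [dForm_congr h1, dForm_zero]
  rfl

theorem pull_eq_zero (hη : VanishesOff e C η) {b₀ : B} {β : Euc q} (hβ : β ∈ baseDomain e b₀)
    {y : Euc n} (hy : κ.symm y ∉ C) : pull (fiberChart e b₀ κ) η (β, y) = 0 := by
  have h1 : η (fiberChart e b₀ κ (β, y)) = 0 := by
    refine hη _ (trivParam_mem_source e hβ.2 _) ?_
    change (e (trivParam e _ _)).2 ∉ C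
    rw [apply_trivParam e hβ.2]
    exact hy
  rw [pull, h1]
  rfl

theorem chartIntegrand_eq_zero (hη : VanishesOff e C η) {b₀ : B} {β : Euc q}
    (hβ : β ∈ baseDomain e b₀) {y : Euc n} (hy : y ∉ κ '' C) :
    chartIntegrand o e b₀ κ η (β, y) = 0 := by
  by_cases ht : y ∈ κ.target
  · rw [chartIntegrand, if_pos ht, pull_eq_zero hη hβ fun hC => hy ⟨_, hC, κ.right_inv ht⟩,
      smul_zero]
  · rw [chartIntegrand, if_neg ht]

theorem eventually_chartIntegrand (hpr : ContMDiff (𝓡 m) (𝓡 q) ∞ pr) (he : IsSmoothTriv q m n e)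
    (hκ : IsSmoothChart κ) {b₀ : B} {β : Euc q} (hβ : β ∈ baseDomain e b₀) {y : Euc n}
    (hy : y ∈ κ.target) (η : DForm m M r ℂ) :
    chartIntegrand o e b₀ κ η =ᶠ[𝓝 (β, y)]
      chartSign o e b₀ κ (β, y) • pull (fiberChart e b₀ κ) η := by
  filter_upwards [eventually_chartSign o hpr he hκ hβ hy,
    continuous_snd.continuousAt.preimage_mem_nhds (hκ.open_target.mem_nhds hy)] with z h1 h2
  rw [chartIntegrand, if_pos (show z.2 ∈ κ.target from h2), h1]
  rfl

theorem eventually_chartIntegrand_zero (hη : VanishesOff e C η) (hK : IsClosed (κ '' C)) {b₀ : B}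
    {β : Euc q} (hβ : β ∈ baseDomain e b₀) {y : Euc n} (hy : y ∉ κ '' C) :
    chartIntegrand o e b₀ κ η =ᶠ[𝓝 (β, y)] 0 := by
  filter_upwards [continuous_fst.continuousAt.preimage_mem_nhds
    ((isOpen_baseDomain b₀).mem_nhds hβ), continuous_snd.continuousAt.preimage_mem_nhds
    (hK.isOpen_compl.mem_nhds hy)] with z h1 h2
  exact chartIntegrand_eq_zero o hη h1 h2

/-- The extension by zero is smooth because the closed set `κ '' C`, off which the integrand
vanishes, lies inside the chart target. -/
theorem contDiffOn_chartIntegrand (hpr : ContMDiff (𝓡 m) (𝓡 q) ∞ pr) (he : IsSmoothTriv q m n e)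
    (hκ : IsSmoothChart κ) (hη : VanishesOff e C η) (hs : IsSmoothForm η)
    (hK : IsClosed (κ '' C)) (hC : C ⊆ κ.source) (b₀ : B) :
    ContDiffOn ℝ ∞ (chartIntegrand o e b₀ κ η) (baseDomain e b₀ ×ˢ Set.univ) := by
  rintro ⟨β, y⟩ ⟨hβ, -⟩
  refine ContDiffAt.contDiffWithinAt ?_
  by_cases hy : y ∈ κ '' C
  · have ht : y ∈ κ.target := by
      obtain ⟨z, hz, rfl⟩ := hy
      exact κ.map_source (hC hz)
    exact ((contDiffAt_pull (contMDiffAt_fiberChart he hκ hβ ht) hs).const_smul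
      (chartSign o e b₀ κ (β, y))).congr_of_eventuallyEq (eventually_chartIntegrand o hpr he hκ hβ ht η)
  · exact contDiffAt_const.congr_of_eventuallyEq (eventually_chartIntegrand_zero o hη hK hβ hy)

theorem extDeriv_chartIntegrand (hpr : ContMDiff (𝓡 m) (𝓡 q) ∞ pr) (he : IsSmoothTriv q m n e)
    (hκ : IsSmoothChart κ) (hη : VanishesOff e C η) (hs : IsSmoothForm η)
    (hCc : IsClosed C) (hK : IsClosed (κ '' C)) (hC : C ⊆ κ.source) {b₀ : B} {β : Euc q}
    (hβ : β ∈ baseDomain e b₀) (y : Euc n) :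
    extDeriv (chartIntegrand o e b₀ κ η) (β, y) = chartIntegrand o e b₀ κ (dForm η) (β, y) := by
  by_cases hy : y ∈ κ '' C
  · have ht : y ∈ κ.target := by
      obtain ⟨z, hz, rfl⟩ := hy
      exact κ.map_source (hC hz)
    rw [(eventually_chartIntegrand o hpr he hκ hβ ht η).extDeriv_eq, extDeriv_smul,
      extDeriv_pull (contMDiffAt_fiberChart he hκ hβ ht) hs, chartIntegrand, if_pos ht]
  · rw [(eventually_chartIntegrand_zero o hη hK hβ hy).extDeriv_eq,
      chartIntegrand_eq_zero o (hη.dForm he hCc) hβ hy]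
    have := extDeriv_smul (𝕜 := ℝ) (x := (β, y)) (0:ℝ)
      (0 : Euc q × Euc n → (Euc q × Euc n) [⋀^Fin r]→L[ℝ] ℂ)
    simpa using this

variable [T2Space Z] [CompactSpace Z] [IsManifold (𝓡 n) ∞ Z]
  (hp : IsSmoothFibration (m := m) (q := q) pr n Z)

theorem isSmoothTriv_choose (b : B) : IsSmoothTriv q m n (hp.locally_trivial b).choose :=
  ⟨(hp.locally_trivial b).choose_spec.2.1, (hp.locally_trivial b).choose_spec.2.2⟩

theorem isSmoothChart_coordChange {e' : Trivialization Z pr} (he : IsSmoothTriv q m n e)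
    (he' : IsSmoothTriv q m n e') (hκ : IsSmoothChart κ) {b : B} (hb : b ∈ e.baseSet)
    (hb' : b ∈ e'.baseSet) :
    IsSmoothChart ((e.coordChangeHomeomorph e' hb hb').toEquiv.toPartialEquiv.trans κ) := by
  have hg : ∀ {e e' : Trivialization Z pr}, IsSmoothTriv q m n e → IsSmoothTriv q m n e' → 
      b ∈ e.baseSet → b ∈ e'.baseSet → ContMDiff (𝓡 n) (𝓡 n) ∞ (e.coordChange e' b) := by
    intro e e' he he' hb hb' z
    refine ContMDiffAt.comp (g := fun x => (e' x).2) (f := trivParam e b) z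
      (he'.contMDiffAt_snd ?_) (contMDiff_trivParam_right he hb z)
    rw [e'.mem_source, proj_trivParam e hb]
    exact hb'
  have hsrc : ((e.coordChangeHomeomorph e' hb hb').toEquiv.toPartialEquiv.trans κ).source =
      (e.coordChangeHomeomorph e' hb hb') ⁻¹' κ.source := by simp
  have htgt : ((e.coordChangeHomeomorph e' hb hb').toEquiv.toPartialEquiv.trans κ).target =
      κ.target := by simp
  constructor
  · rw [hsrc]
    exact hκ.open_source.preimage (e.coordChangeHomeomorph e' hb hb').continuous
  · rw [htgt]
    exact hκ.open_target
  · rw [hsrc]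
    exact hκ.smooth.comp (hg he he' hb hb').contMDiffOn fun z hz => hz
  · rw [htgt]
    exact (hg he' he hb' hb).comp_contMDiffOn hκ.smooth_symm

/-- The trivialization chosen at each base point need not vary continuously with it. This formula
replaces all of them by the single `e`, which makes the fiber integral a parameter integral over the
fixed compact set `κ '' C`. -/
theorem chartForm_fiberIntegral (he : IsSmoothTriv q m n e) (hκ : IsSmoothChart κ)
    (hη : VanishesOff e C η) (hs : IsSmoothForm η) (hCc : IsCompact C) (hC : C ⊆ κ.source) {b₀ : B}
    {β : Euc q} (hβ : β ∈ baseDomain e b₀) (v : Fin p → Euc q) :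
    chartForm (fiberIntegral hp o h η) b₀ β v = ∫ y in κ '' C, chartIntegrand o e b₀ κ η (β, y)
      (prodTuple h v fun j => EuclideanSpace.single j 1) := by
  set b := (extChartAt (𝓡 q) b₀).symm β with hb
  set e' := (hp.locally_trivial b).choose with he'
  have hs' : IsSmoothTriv q m n e' := isSmoothTriv_choose hp b
  have hb' : b ∈ e'.baseSet := (hp.locally_trivial b).choose_spec.1
  set g := e'.coordChangeHomeomorph e hb' hβ.2 with hg
  -- Transporting `κ` by the coordinate change makes `e'` with `κ'` and `e` with `κ` parametrize the
  -- fiber identically.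
  set κ' := g.toEquiv.toPartialEquiv.trans κ with hκ'
  have hsκ : IsSmoothChart κ' := isSmoothChart_coordChange hs' he hκ hb' hβ.2
  have htgt : κ'.target = κ.target := by simp [κ']
  have hpar : ∀ z, trivParam e b (g z) = trivParam e' b z := by
    intro z
    have h1 : (b, g z) = e (trivParam e' b z) := e'.mk_coordChange e hb' hβ.2 z
    rw [trivParam, h1]
    exact e.toOpenPartialHomeomorph.left_inv
      (e.mem_source.2 (by rw [proj_trivParam e' hb']; exact hβ.2))
  have hpar' : ∀ y, trivParam e' b (κ'.symm y) = trivParam e b (κ.symm y) := by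
    intro y
    rw [← hpar]
    exact congrArg (trivParam e b) (g.apply_symm_apply _)
  have h1 := fun y => coordDensity_change_triv (y := y) o h (θ := η) hp.smooth hs' he hsκ hκ hb' hβ.2 hpar'
  have h2 := integrateDensity_eq_setIntegral (isDensity_fiberDensity o h η e' b) hsκ
    (C := g ⁻¹' C) (g.isCompact_preimage.2 hCc) (by
      intro z hz
      simp only [κ', PartialEquiv.trans_source]
      exact ⟨trivial, hC hz⟩) (by
      intro z hz v'
      have h3 : η (trivParam e' b z) = 0 := by
        rw [← hpar]
        refine hη _ (trivParam_mem_source e hβ.2 _) ?_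
        rw [apply_trivParam e hβ.2]
        exact hz
      rw [fiberDensity, h3]
      exact ContinuousAlternatingMap.ext fun _ => smul_zero (M := ℝ) (A := ℂ) _) (continuousOn_coordDensity o h hp.smooth hs' hsκ hb' hs)
  have hcont := continuousOn_coordDensity o h hp.smooth he hκ hβ.2 hs
  have hsub : κ '' C ⊆ κ.target := by
    rintro _ ⟨z, hz, rfl⟩
    exact κ.map_source (hC hz)
  have h0 : ∀ y ∈ κ.target \ κ '' C, coordDensity κ (fiberDensity o h η e b) y = 0 := by
    rintro y ⟨hy, hyn⟩
    have h3 : η (trivParam e b (κ.symm y)) = 0 := by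
      refine hη _ (trivParam_mem_source e hβ.2 _) ?_
      rw [apply_trivParam e hβ.2]
      exact fun hC => hyn ⟨_, hC, κ.right_inv hy⟩
    rw [coordDensity_fiberDensity o h he hκ hβ.2 hy, h3]
    exact ContinuousAlternatingMap.ext fun _ => smul_zero (M := ℝ) (A := ℂ) _
  have hKc : IsCompact (κ '' C) := hCc.image_of_continuousOn (hκ.smooth.continuousOn.mono hC)
  have h4 : fiberIntegral hp o h η b =
      ∫ y in κ '' C, coordDensity κ (fiberDensity o h η e b) y := by
    rw [fiberIntegral_eq]
    refine h2.trans ?_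
    rw [htgt, setIntegral_congr_fun hκ.open_target.measurableSet
      fun y hy => h1 y (by rwa [htgt]) hy]
    exact setIntegral_eq_of_subset_of_forall_sdiff_eq_zero hκ.open_target.measurableSet hsub h0
  have h5 : chartForm (fiberIntegral hp o h η) b₀ β v =
      (∫ y in κ '' C, coordDensity κ (fiberDensity o h η e b) y) fun j => dChartSymm b₀ β (v j) :=
    congrArg (fun α : Euc q [⋀^Fin p]→L[ℝ] ℂ => α fun j => dChartSymm b₀ β (v j)) h4
  rw [h5]
  have hint : IntegrableOn (coordDensity κ (fiberDensity o h η e b)) (κ '' C) :=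
    (hcont.mono hsub).integrableOn_compact hKc
  refine ((ContinuousAlternatingMap.apply ℝ (Euc q) ℂ
    fun j => dChartSymm b₀ β (v j)).integral_comp_comm hint).symm.trans ?_
  refine setIntegral_congr_fun hKc.measurableSet fun y hy => ?_
  refine (coordDensity_apply o h he hκ hβ (hsub hy) v).trans ?_
  rw [chartIntegrand, if_pos (hsub hy)]
  rfl

theorem fiberIntegral_localized (he : IsSmoothTriv q m n e) (hκ : IsSmoothChart κ)
    (hη : VanishesOff e C η) (hs : IsSmoothForm η) (hCc : IsCompact C) (hC : C ⊆ κ.source) (b₀ : B) :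
    ContDiffOn ℝ ∞ (chartForm (fiberIntegral hp o h η) b₀) (baseDomain e b₀) ∧
    (∀ h' : p + 1 + n = r + 1, ∀ β ∈ baseDomain e b₀,
      extDeriv (chartForm (fiberIntegral hp o h η) b₀) β =
        chartForm (fiberIntegral hp o h' (dForm η)) b₀ β) := by
  have hKc : IsCompact (κ '' C) := hCc.image_of_continuousOn (hκ.smooth.continuousOn.mono hC)
  have hsm := contDiffOn_chartIntegrand o hp.smooth he hκ hη hs hKc.isClosed hC b₀
  have hformula := fun β hβ => chartForm_fiberIntegral o h hp he hκ hη hs hCc hC (b₀ := b₀) (β := β) hβ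
  refine ⟨contDiffOn_of_setIntegral (isOpen_baseDomain b₀) hKc hsm h _ hformula, ?_⟩
  intro h' β hβ
  ext v
  rw [extDeriv_of_setIntegral (isOpen_baseDomain b₀) hKc hsm
    (fun x hx y hy => chartIntegrand_eq_zero o hη hx hy) h h' _ hformula hβ v,
    chartForm_fiberIntegral o h' hp he hκ (hη.dForm he hCc.isClosed) hs.dForm hCc hC hβ v]
  simp only [extDeriv_chartIntegrand o hp.smooth he hκ hη hs hCc.isClosed hKc.isClosed hC hβ]

theorem fiberIntegral_dForm_localized [T2Space B] (he : IsSmoothTriv q m n e) (hκ : IsSmoothChart κ)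
    (hη : VanishesOff e C η) (hs : IsSmoothForm η) (hCc : IsCompact C) (hC : C ⊆ κ.source) 
    (h' : 0 + n = r + 1) {b : B} (hb : b ∈ e.baseSet) :
    fiberIntegral hp o h' (dForm η) b = 0 := by
  have hKc : IsCompact (κ '' C) := hCc.image_of_continuousOn (hκ.smooth.continuousOn.mono hC)
  have hsm := contDiffOn_chartIntegrand o hp.smooth he hκ hη hs hKc.isClosed hC b
  have hβ : extChartAt (𝓡 q) b b ∈ baseDomain e b :=
    ⟨mem_extChartAt_target b, by simpa using hb⟩
  rw [← chartForm_self (fiberIntegral hp o h' (dForm η)) b]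
  ext v
  rw [chartForm_fiberIntegral o h' hp he hκ (hη.dForm he hCc.isClosed) hs.dForm hCc hC hβ v]
  simp only [← extDeriv_chartIntegrand o hp.smooth he hκ hη hs hCc.isClosed hKc.isClosed hC hβ]
  -- With `p = 0` there is no base direction, so the remaining sum is empty.
  rw [setIntegral_extDeriv (isOpen_baseDomain b) hKc hsm
    (fun x hx y hy => chartIntegrand_eq_zero o hη hx hy) h' v _ hβ]
  rfl

end LocalizedFiberIntegral
end FamiliesChernWeil

end

noncomputable section
namespace FamiliesChernWeil
-- Fiber integration preserves smoothness and commutes with `d`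
section GlobalFiberIntegral

variable {q m n : ℕ}
  {B : Type*} [TopologicalSpace B] [T2Space B] [ChartedSpace (Euc q) B] [IsManifold (𝓡 q) ∞ B]
  {M : Type*} [TopologicalSpace M] [ChartedSpace (Euc m) M] [IsManifold (𝓡 m) ∞ M]
  {Z : Type*} [TopologicalSpace Z] [ChartedSpace (Euc n) Z]
  [T2Space Z] [CompactSpace Z] [IsManifold (𝓡 n) ∞ Z]
  {pr : M → B} (hp : IsSmoothFibration (m := m) (q := q) pr n Z)
  (o : FiberOrientation (m := m) (q := q) pr n) {p r : ℕ} (h : p + n = r)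

theorem fiberIntegral_congr {θ η : DForm m M r ℂ} {b : B} (hθη : ∀ x, pr x = b → θ x = η x) :
    fiberIntegral hp o h θ b = fiberIntegral hp o h η b := by
  rw [fiberIntegral_eq, fiberIntegral_eq]
  congr 1
  funext z v
  have hb : b ∈ (hp.locally_trivial b).choose.baseSet := (hp.locally_trivial b).choose_spec.1
  rw [fiberDensity, fiberDensity, hθη _ (proj_trivParam _ hb z)]

theorem fiberIntegral_zero : fiberIntegral hp o h (0 : DForm m M r ℂ) = 0 := by
  funext b
  rw [fiberIntegral_eq]
  have h1 : fiberDensity o h (0 : DForm m M r ℂ) (hp.locally_trivial b).choose b =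
      fun z v => (0 : ℝ) • fiberDensity o h (0 : DForm m M r ℂ) (hp.locally_trivial b).choose b z v := by
    funext z v
    exact ContinuousAlternatingMap.ext fun _ =>
      (smul_zero (M := ℝ) (A := ℂ) _).trans (zero_smul ℝ (_ : ℂ)).symm
  rw [h1, integrateDensity_const_smul, zero_smul]
  rfl

theorem fiberIntegral_add {θ η : DForm m M r ℂ} (hθ : IsSmoothForm θ) (hη : IsSmoothForm η) :
    fiberIntegral hp o h (θ + η) = fiberIntegral hp o h θ + fiberIntegral hp o h η := by
  funext b
  rw [Pi.add_apply]
  simp only [fiberIntegral_eq]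
  have hb : b ∈ (hp.locally_trivial b).choose.baseSet := (hp.locally_trivial b).choose_spec.1
  have hs := isSmoothTriv_choose hp b
  rw [← integrateDensity_add
    (fun z => continuousOn_coordDensity o h hp.smooth hs (isSmoothChart_extChartAt z) hb hθ)
    (fun z => continuousOn_coordDensity o h hp.smooth hs (isSmoothChart_extChartAt z) hb hη)]
  congr 1
  funext z v
  exact ContinuousAlternatingMap.ext fun _ => smul_add (M := ℝ) (A := ℂ) _ _ _

theorem fiberIntegral_sub {θ η : DForm m M r ℂ} (hθ : IsSmoothForm θ) (hη : IsSmoothForm η) :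
    fiberIntegral hp o h (θ - η) = fiberIntegral hp o h θ - fiberIntegral hp o h η := by
  have h1 := fiberIntegral_add hp o h (hθ.sub hη) hη
  rw [sub_add_cancel] at h1
  exact eq_sub_of_add_eq h1.symm

theorem fiberIntegral_sum {ι : Type*} {s : Finset ι} {θ : ι → DForm m M r ℂ}
    (hθ : ∀ i ∈ s, IsSmoothForm (θ i)) :
    fiberIntegral hp o h (∑ i ∈ s, θ i) = ∑ i ∈ s, fiberIntegral hp o h (θ i) := by
  classical
  induction s using Finset.induction_on with
  | empty => simpa using fiberIntegral_zero hp o h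
  | insert i s hi ih =>
    rw [Finset.sum_insert hi, Finset.sum_insert hi,
      fiberIntegral_add hp o h (hθ i (Finset.mem_insert_self _ _))
        (IsSmoothForm.sum fun j hj => hθ j (Finset.mem_insert_of_mem hj)),
      ih fun j hj => hθ j (Finset.mem_insert_of_mem hj)]

include hp in
/-- Every form is a finite sum, near a fiber, of forms supported in fibered charts. -/
theorem exists_localization {θ : DForm m M r ℂ} (hθ : IsSmoothForm θ) (b₁ : B) :
    ∃ (e : Trivialization Z pr) (s : Finset Z) (θ' : Z → DForm m M r ℂ), IsSmoothTriv q m n e ∧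
      b₁ ∈ e.baseSet ∧ (∀ z, IsSmoothForm (θ' z)) ∧
      (∀ z, VanishesOff e (tsupport (chartPartition n Z z)) (θ' z)) ∧
      ∀ᶠ b in 𝓝 b₁, ∀ x, pr x = b → ∑ z ∈ s, θ' z x = θ x := by
  obtain ⟨s, -, hsum⟩ := exists_finset_chartPartition n Z
  set e := (hp.locally_trivial b₁).choose with he
  have hb : b₁ ∈ e.baseSet := (hp.locally_trivial b₁).choose_spec.1
  have hs : IsSmoothTriv q m n e := isSmoothTriv_choose hp b₁
  -- The fiber coordinate exists only over `e.baseSet`; the cutoff `χ` on the base makes the pulled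
  -- back partition functions globally smooth without changing them near the fiber over `b₁`.
  obtain ⟨χ, hχ, hχs, hχ1⟩ := exists_bump (d := q) (e.open_baseSet.mem_nhds hb)
  have hf : ∀ z, ContMDiff (𝓡 m) 𝓘(ℝ, ℝ) ∞ fun x => χ (pr x) * chartPartition n Z z (e x).2 := by
    intro z x
    have h1 : ContMDiffAt (𝓡 m) 𝓘(ℝ, ℝ) ∞ (fun x => χ (pr x)) x :=
      hχ.contMDiffAt.comp x hp.smooth.contMDiffAt
    by_cases hx : pr x ∈ e.baseSet
    · refine h1.mul ?_
      exact ((chartPartition n Z z).contMDiff.contMDiffAt).comp x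
        (hs.contMDiffAt_snd (e.mem_source.2 hx))
    · have h2 : ∀ᶠ x' in 𝓝 x, χ (pr x') = 0 := by
        have h3 : (tsupport χ)ᶜ ∈ 𝓝 (pr x) :=
          (isClosed_tsupport χ).isOpen_compl.mem_nhds fun h => hx (hχs h)
        filter_upwards [hp.smooth.continuous.continuousAt.preimage_mem_nhds h3] with x' hx'
        exact image_eq_zero_of_notMem_tsupport hx'
      refine (contMDiffAt_const (c := (0 : ℝ))).congr_of_eventuallyEq ?_
      filter_upwards [h2] with x' hx'
      rw [hx', zero_mul]
  refine ⟨e, s, fun z => mulForm (fun x => χ (pr x) * chartPartition n Z z (e x).2) θ, hs, hb,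
    fun z => hθ.mulForm (hf z), fun z x _ hx => ?_, ?_⟩
  · simp only [mulForm, image_eq_zero_of_notMem_tsupport hx, mul_zero, zero_smul]
  · filter_upwards [hχ1] with b hb x hx
    simp only [mulForm, ← Finset.sum_smul, ← Finset.mul_sum, hsum, hx, hb]
    simp

theorem chartPartition_compact (z : Z) : IsCompact (tsupport (chartPartition n Z z)) :=
  (isClosed_tsupport _).isCompact

theorem eventually_fiberIntegral_eq_sum {θ : DForm m M r ℂ} {b₁ : B} {s : Finset Z}
    {θ' : Z → DForm m M r ℂ} (hs : ∀ z, IsSmoothForm (θ' z))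
    (hsum : ∀ᶠ b in 𝓝 b₁, ∀ x, pr x = b → ∑ z ∈ s, θ' z x = θ x) :
    ∀ᶠ b in 𝓝 b₁, fiberIntegral hp o h θ b = ∑ z ∈ s, fiberIntegral hp o h (θ' z) b := by
  filter_upwards [hsum] with b hb
  have h1 := congrFun (fiberIntegral_sum hp o h (s := s) fun z _ => hs z) b
  rw [Finset.sum_apply] at h1
  rw [← h1]
  exact fiberIntegral_congr hp o h fun x hx => by rw [← hb x hx, Finset.sum_apply]

theorem eventually_chartForm_eq_sum {θ : DForm m M r ℂ} {b₀ : B} {β : Euc q}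
    (hβ : β ∈ (extChartAt (𝓡 q) b₀).target) {s : Finset Z} {θ' : Z → DForm m M r ℂ}
    (hs : ∀ z, IsSmoothForm (θ' z))
    (hsum : ∀ᶠ b in 𝓝 ((extChartAt (𝓡 q) b₀).symm β), ∀ x, pr x = b → ∑ z ∈ s, θ' z x = θ x) :
    chartForm (fiberIntegral hp o h θ) b₀ =ᶠ[𝓝 β]
      fun β => ∑ z ∈ s, chartForm (fiberIntegral hp o h (θ' z)) b₀ β := by
  have hc : ContinuousAt (extChartAt (𝓡 q) b₀).symm β :=
    (contMDiffAt_chart_symm hβ).continuousAt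
  filter_upwards [hc.eventually (eventually_fiberIntegral_eq_sum hp o h hs hsum)] with β' hβ'
  ext v
  rw [chartForm, hβ', ContinuousAlternatingMap.sum_apply]
  exact ContinuousAlternatingMap.sum_apply _ _

theorem isSmoothForm_fiberIntegral {θ : DForm m M r ℂ} (hθ : IsSmoothForm θ) :
    IsSmoothForm (fiberIntegral hp o h θ) := by
  intro b₀ β hβ
  obtain ⟨e, s, θ', he, hb, hs, hv, hsum⟩ := exists_localization hp hθ
    ((extChartAt (𝓡 q) b₀).symm β)
  have hβ' : β ∈ baseDomain e b₀ := ⟨hβ, hb⟩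
  refine ContDiffAt.contDiffWithinAt (ContDiffAt.congr_of_eventuallyEq ?_
    (eventually_chartForm_eq_sum hp o h hβ hs hsum))
  exact ContDiffAt.sum fun z _ => ((fiberIntegral_localized o h hp he (isSmoothChart_extChartAt z)
    (hv z) (hs z) (chartPartition_compact z) (chartPartition_tsupport z) b₀).1).contDiffAt
      ((isOpen_baseDomain b₀).mem_nhds hβ')

/-- The decomposition holds on the preimage of a neighborhood of `b₁`, hence on an open set of `M`,
so it can be differentiated. -/
theorem eventually_dForm_sum {θ : DForm m M r ℂ} {b₁ : B} {s : Finset Z} (hp : Continuous pr)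
    {θ' : Z → DForm m M r ℂ} (hs : ∀ z, IsSmoothForm (θ' z))
    (hsum : ∀ᶠ b in 𝓝 b₁, ∀ x, pr x = b → ∑ z ∈ s, θ' z x = θ x) :
    ∀ᶠ b in 𝓝 b₁, ∀ x, pr x = b → ∑ z ∈ s, dForm (θ' z) x = dForm θ x := by
  filter_upwards [eventually_eventually_nhds.2 hsum] with b hb x hx
  have h1 : (∑ z ∈ s, θ' z) =ᶠ[𝓝 x] θ := by
    subst hx
    filter_upwards [hp.continuousAt.eventually hb] with x' hx'
    rw [Finset.sum_apply]
    exact hx' x' rfl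
  rw [← dForm_congr h1, dForm_sum fun z _ => hs z, Finset.sum_apply]

/-- Integration over the fiber commutes with the exterior derivative. -/
theorem dForm_fiberIntegral {θ : DForm m M r ℂ} (hθ : IsSmoothForm θ) (h' : p + 1 + n = r + 1) :
    dForm (fiberIntegral hp o h θ) = fiberIntegral hp o h' (dForm θ) := by
  funext b
  obtain ⟨e, s, θ', he, hb, hs, hv, hsum⟩ := exists_localization hp hθ b
  have hβ : extChartAt (𝓡 q) b b ∈ baseDomain e b :=
    ⟨mem_extChartAt_target b, by simpa using hb⟩
  have hloc := fun z => fiberIntegral_localized o h hp he (isSmoothChart_extChartAt z)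
    (hv z) (hs z) (chartPartition_compact z) (chartPartition_tsupport z) b
  have h1 := eventually_chartForm_eq_sum hp o h (mem_extChartAt_target b) hs
    (by rwa [extChartAt_to_inv])
  rw [(eventually_fiberIntegral_eq_sum hp o h' (fun z => (hs z).dForm)
    (eventually_dForm_sum hp.smooth.continuous hs hsum)).self_of_nhds]
  refine h1.extDeriv_eq.trans ?_
  have h2 : extDeriv (fun β => ∑ z ∈ s, chartForm (fiberIntegral hp o h (θ' z)) b β)
      (extChartAt (𝓡 q) b b) =
      ∑ z ∈ s, extDeriv (chartForm (fiberIntegral hp o h (θ' z)) b) (extChartAt (𝓡 q) b b) := by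
    have h3 : ∀ z, DifferentiableAt ℝ (chartForm (fiberIntegral hp o h (θ' z)) b)
        (extChartAt (𝓡 q) b b) := fun z =>
      differentiableAt_of_contDiffOn (isOpen_baseDomain b) (hloc z).1 hβ
    ext v
    rw [extDeriv_apply (DifferentiableAt.fun_sum fun z _ => h3 z), ContinuousAlternatingMap.sum_apply]
    simp only [extDeriv_apply (h3 _), ContinuousAlternatingMap.sum_apply]
    rw [Finset.sum_comm]
    refine Finset.sum_congr rfl fun i _ => ?_
    have h4 : ∀ z, DifferentiableAt ℝ
        (fun β => chartForm (fiberIntegral hp o h (θ' z)) b β (i.removeNth v))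
        (extChartAt (𝓡 q) b b) := fun z =>
      (ContinuousAlternatingMap.apply ℝ (Euc q) ℂ (i.removeNth v)).differentiableAt.comp _ (h3 z)
    rw [fderiv_fun_sum fun z _ => h4 z, ← Finset.smul_sum, _root_.sum_apply]
  rw [h2]
  refine Finset.sum_congr rfl fun z _ => ?_
  rw [(hloc z).2 h' _ hβ, chartForm_self]

/-- The fiber integral of an exact form vanishes in degree `0`. -/
theorem fiberIntegral_dForm_eq_zero {θ : DForm m M r ℂ} (hθ : IsSmoothForm θ)
    (h' : 0 + n = r + 1) : fiberIntegral hp o h' (dForm θ) = 0 := by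
  funext b
  obtain ⟨e, s, θ', he, hb, hs, hv, hsum⟩ := exists_localization hp hθ b
  rw [(eventually_fiberIntegral_eq_sum hp o h' (fun z => (hs z).dForm)
    (eventually_dForm_sum hp.smooth.continuous hs hsum)).self_of_nhds]
  exact Finset.sum_eq_zero fun z _ => fiberIntegral_dForm_localized o hp he
    (isSmoothChart_extChartAt z) (hv z) (hs z) (chartPartition_compact z)
    (chartPartition_tsupport z) h' hb

end GlobalFiberIntegral
end FamiliesChernWeil

end

noncomputable section
namespace FamiliesChernWeil
-- The characteristic forms of the push-forward
section CharacteristicForms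

variable {q m n : ℕ}
  {B : Type*} [TopologicalSpace B] [T2Space B] [ChartedSpace (Euc q) B] [IsManifold (𝓡 q) ∞ B]
  {M : Type*} [TopologicalSpace M] [T2Space M] [ChartedSpace (Euc m) M] [IsManifold (𝓡 m) ∞ M]
  {Z : Type*} [TopologicalSpace Z] [ChartedSpace (Euc n) Z]
  [T2Space Z] [CompactSpace Z] [IsManifold (𝓡 n) ∞ Z]
  {pr : M → B} (hp : IsSmoothFibration (m := m) (q := q) pr n Z)
  (o : FiberOrientation (m := m) (q := q) pr n) {E : ComplexBundle m M}

theorem isSmoothForm_charForm {p k : ℕ} (h : p + n = 2 * k) (D : Connection E) :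
    IsSmoothForm (charForm hp o h D) :=
  isSmoothForm_fiberIntegral hp o h (isSmoothForm_trPow D k)

theorem dForm_charForm {p k : ℕ} (h : p + n = 2 * k) (D : Connection E) :
    dForm (charForm hp o h D) = 0 := by
  rw [charForm, dForm_fiberIntegral hp o h (isSmoothForm_trPow D k) (by omega), dForm_trPow,
    fiberIntegral_zero]

theorem isExactForm_charForm_sub {p k : ℕ} (h : p + n = 2 * k) (D₀ D₁ : Connection E) :
    IsExactForm (charForm hp o h D₁ - charForm hp o h D₀) := by
  -- For `k = 0` the degree `p` is forced to be `0`, and `tr (R^0)` is the same for both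
  -- connections. Otherwise the difference is the fiber integral of `d` of the transgression form.
  cases k with
  | zero =>
    obtain rfl : p = 0 := by omega
    rw [charForm, charForm, trPow_zero_eq D₀ D₁]
    exact sub_self _
  | succ k =>
    have h1 : charForm hp o h D₁ - charForm hp o h D₀ =
        fiberIntegral hp o h (dForm (D₀.transgression D₁ k)) := by
      rw [dForm_transgression]
      exact (fiberIntegral_sub hp o h (isSmoothForm_trPow D₁ _) (isSmoothForm_trPow D₀ _)).symm
    rw [h1]
    cases p with
    -- In degree `0` exactness means vanishing, which is Stokes on the closed fibers.
    | zero => exact fiberIntegral_dForm_eq_zero hp o (isSmoothForm_transgression D₀ D₁ k) h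
    | succ p =>
      have h0 : p + n = 2 * k + 1 := by omega
      exact ⟨fiberIntegral hp o h0 (D₀.transgression D₁ k),
        isSmoothForm_fiberIntegral hp o h0 (isSmoothForm_transgression D₀ D₁ k),
        (dForm_fiberIntegral hp o h0 (isSmoothForm_transgression D₀ D₁ k) h).symm⟩

end CharacteristicForms
end FamiliesChernWeil

end

noncomputable section
namespace FamiliesChernWeil

/-! ### Lie brackets of related vector fields -/

section RelatedFields

variable {d q : ℕ} {M : Type*} [TopologicalSpace M] [ChartedSpace (Euc d) M] [IsManifold (𝓡 d) ∞ M]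
  {B : Type*} [TopologicalSpace B] [ChartedSpace (Euc q) B] [IsManifold (𝓡 q) ∞ B]

theorem IsSmoothField.mdifferentiableAt {X : ∀ x : M, TangentSpace (𝓡 d) x} (hX : IsSmoothField X)
    (x : M) : MDifferentiableAt (𝓡 d) ((𝓡 d).prod 𝓘(ℝ, Euc d))
      (fun x => (⟨x, X x⟩ : TangentBundle (𝓡 d) M)) x :=
  (hX x).mdifferentiableAt (by simp)

theorem IsSmoothField.mlieBracket [T2Space M] {X Y : ∀ x : M, TangentSpace (𝓡 d) x}
    (hX : IsSmoothField X) (hY : IsSmoothField Y) :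
    IsSmoothField (VectorField.mlieBracket (𝓡 d) X Y) := by
  have : IsManifold (𝓡 d) (((⊤ : ℕ∞) : WithTop ℕ∞) + 1) M := IsManifold.of_le (n := ∞) (by simp)
  have : IsManifold (𝓡 d) (minSmoothness ℝ 2) M := IsManifold.of_le (n := ∞)
    (by simpa using WithTop.coe_le_coe.2 (le_top (a := (2 : ℕ∞))))
  exact ContDiff.mlieBracket_vectorField (n := ⊤) (m := ⊤) hX hY (by simp)

theorem IsSmoothField.sub {X Y : ∀ x : M, TangentSpace (𝓡 d) x}
    (hX : IsSmoothField X) (hY : IsSmoothField Y) : IsSmoothField fun x => X x - Y x :=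
  ContMDiff.sub_section hX hY

theorem IsSmoothField.neg {X : ∀ x : M, TangentSpace (𝓡 d) x}
    (hX : IsSmoothField X) : IsSmoothField fun x => - X x :=
  ContMDiff.neg_section hX

theorem mlieBracket_center {X Y : ∀ x : M, TangentSpace (𝓡 d) x}
    (hX : IsSmoothField X) (hY : IsSmoothField Y) (x : M) :
    VectorField.mlieBracket (𝓡 d) X Y x =
      VectorField.lieBracket ℝ (fieldCoord x X) (fieldCoord x Y) (extChartAt (𝓡 d) x x) := by
  have h := mlieBracket_chart (mem_extChartAt_target (I := 𝓡 d) x) hX hY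
  rw [dChartSymm_self] at h
  exact (congrArg (fun x' => (VectorField.mlieBracket (𝓡 d) X Y x' : Euc d))
    (extChartAt_to_inv (I := 𝓡 d) x)).symm.trans h

theorem fieldCoord_center (X : ∀ x : M, TangentSpace (𝓡 d) x) (x : M) :
    fieldCoord x X (extChartAt (𝓡 d) x x) = X x := by
  have h := dChartSymm_fieldCoord (mem_extChartAt_target (I := 𝓡 d) x) X
  rw [dChartSymm_self] at h
  exact h.trans (congrArg (fun x' => (X x' : Euc d)) (extChartAt_to_inv (I := 𝓡 d) x))

theorem fieldCoord_eq_dChart {x₀ : M} {y : Euc d} (hy : y ∈ (extChartAt (𝓡 d) x₀).target)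
    (X : ∀ x : M, TangentSpace (𝓡 d) x) :
    fieldCoord x₀ X y = dChart x₀ ((extChartAt (𝓡 d) x₀).symm y)
      (X ((extChartAt (𝓡 d) x₀).symm y)) := by
  rw [← dChartSymm_fieldCoord hy X, dChart_dChartSymm hy]

/-- Differentiating the two relations, the second derivative of `F` enters symmetrically and
cancels. `F` need not be invertible, as required for a projection. -/
theorem lieBracket_related {V W : Type*} [NormedAddCommGroup V] [NormedSpace ℝ V]
    [NormedAddCommGroup W] [NormedSpace ℝ W] {F : V → W} {X Y : V → V} {X' Y' : W → W} {y : V}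
    (hF : ContDiffAt ℝ ∞ F y) (hX : DifferentiableAt ℝ X y) (hY : DifferentiableAt ℝ Y y)
    (hX' : DifferentiableAt ℝ X' (F y)) (hY' : DifferentiableAt ℝ Y' (F y))
    (h : ∀ᶠ z in 𝓝 y, fderiv ℝ F z (X z) = X' (F z))
    (h' : ∀ᶠ z in 𝓝 y, fderiv ℝ F z (Y z) = Y' (F z)) :
    fderiv ℝ F y (VectorField.lieBracket ℝ X Y y) = VectorField.lieBracket ℝ X' Y' (F y) := by
  have hF1 : DifferentiableAt ℝ F y := hF.differentiableAt (by simp)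
  have hF2 : DifferentiableAt ℝ (fderiv ℝ F) y :=
    (hF.fderiv_right (m := ∞) (by simp)).differentiableAt (by simp)
  have key : ∀ {X : V → V} {X' : W → W}, DifferentiableAt ℝ X y → DifferentiableAt ℝ X' (F y) →
      (∀ᶠ z in 𝓝 y, fderiv ℝ F z (X z) = X' (F z)) → ∀ w,
      fderiv ℝ X' (F y) (fderiv ℝ F y w) =
        fderiv ℝ (fderiv ℝ F) y w (X y) + fderiv ℝ F y (fderiv ℝ X y w) := by
    intro X X' hX hX' h w
    have h1 := (hF2.hasFDerivAt.clm_apply hX.hasFDerivAt).congr_of_eventuallyEq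
      (h.mono fun z hz => hz.symm)
    have h2 := h1.unique (hX'.hasFDerivAt.comp y hF1.hasFDerivAt)
    have h3 := congrArg (fun T : V →L[ℝ] W => T w) h2
    simp at h3
    rw [← h3]
    abel
  have hs : IsSymmSndFDerivAt ℝ F y := hF.isSymmSndFDerivAt (by simpa using WithTop.coe_le_coe.2 (le_top (a := (2 : ℕ∞))))
  rw [VectorField.lieBracket_eq, VectorField.lieBracket_eq]
  simp only [map_sub]
  rw [← h.self_of_nhds, ← h'.self_of_nhds, key hX hX' h, key hY hY' h', hs.eq]
  abel

variable {f : M → B}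

theorem mfderiv_mlieBracket (hf : ContMDiff (𝓡 d) (𝓡 q) ∞ f)
    {X Y : ∀ x : M, TangentSpace (𝓡 d) x} {X' Y' : ∀ b : B, TangentSpace (𝓡 q) b}
    (hX : IsSmoothField X) (hY : IsSmoothField Y) (hX' : IsSmoothField X') (hY' : IsSmoothField Y')
    (h : ∀ x, mfderiv (𝓡 d) (𝓡 q) f x (X x) = X' (f x))
    (h' : ∀ x, mfderiv (𝓡 d) (𝓡 q) f x (Y x) = Y' (f x)) (x : M) :
    mfderiv (𝓡 d) (𝓡 q) f x (VectorField.mlieBracket (𝓡 d) X Y x) =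
      VectorField.mlieBracket (𝓡 q) X' Y' (f x) := by
  set F : Euc d → Euc q := writtenInExtChartAt (𝓡 d) (𝓡 q) x f with hFdef
  set y := extChartAt (𝓡 d) x x with hy
  have hyt : y ∈ (extChartAt (𝓡 d) x).target := mem_extChartAt_target x
  have hFy : F y = extChartAt (𝓡 q) (f x) (f x) := by
    simp only [hFdef, writtenInExtChartAt, hy, Function.comp, extChartAt_to_inv]
  have hFd : mfderiv (𝓡 d) (𝓡 q) f x = fderiv ℝ F y := by
    rw [((hf x).mdifferentiableAt (by simp)).mfderiv, ModelWithCorners.range_eq_univ,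
      fderivWithin_univ]
  have hFs : ContDiffAt ℝ ∞ F y := by
    have := ((contMDiffAt_iff (I := 𝓡 d) (I' := 𝓡 q)).1 (hf x)).2
    rwa [ModelWithCorners.range_eq_univ, contDiffWithinAt_univ] at this
  have hdom : ∀ᶠ z in 𝓝 y, z ∈ (extChartAt (𝓡 d) x).target ∧
      f ((extChartAt (𝓡 d) x).symm z) ∈ (extChartAt (𝓡 q) (f x)).source := by
    refine Filter.Eventually.and (extChartAt_target_mem_nhds' (I := 𝓡 d) hyt)
      (eventually_chart_symm hyt (p := fun x' => f x' ∈ (extChartAt (𝓡 q) (f x)).source) ?_)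
    rw [hy, extChartAt_to_inv]
    exact hf.continuous.continuousAt.eventually (extChartAt_source_mem_nhds (I := 𝓡 q) (f x))
  have key : ∀ {X : ∀ x : M, TangentSpace (𝓡 d) x} {X' : ∀ b : B, TangentSpace (𝓡 q) b},
      (∀ x, mfderiv (𝓡 d) (𝓡 q) f x (X x) = X' (f x)) →
      ∀ᶠ z in 𝓝 y, fderiv ℝ F z (fieldCoord x X z) = fieldCoord (f x) X' (F z) := by
    intro X X' h
    filter_upwards [hdom] with z hz
    have h1 := mfderiv_comp (I := 𝓘(ℝ, Euc d)) (I' := 𝓡 d) (I'' := 𝓡 q) (g := f)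
      (f := (extChartAt (𝓡 d) x).symm) z ((hf _).mdifferentiableAt (by simp))
      ((contMDiffAt_chart_symm hz.1).mdifferentiableAt (by simp))
    have hfm : MDifferentiableAt 𝓘(ℝ, Euc d) (𝓡 q) (f ∘ (extChartAt (𝓡 d) x).symm) z :=
      ((hf _).mdifferentiableAt (by simp)).comp z
      ((contMDiffAt_chart_symm hz.1).mdifferentiableAt (by simp))
    have h2 := mfderiv_comp (I := 𝓘(ℝ, Euc d)) (I' := 𝓡 q) (I'' := 𝓘(ℝ, Euc q))
      (g := extChartAt (𝓡 q) (f x)) (f := f ∘ (extChartAt (𝓡 d) x).symm) z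
      (mdifferentiableAt_extChartAt (by simpa using hz.2)) hfm
    rw [h1] at h2
    have h3 : fderiv ℝ F z = mfderiv 𝓘(ℝ, Euc d) 𝓘(ℝ, Euc q)
      (extChartAt (𝓡 q) (f x) ∘ f ∘ (extChartAt (𝓡 d) x).symm) z := mfderiv_eq_fderiv.symm
    refine (congrArg (fun T => (T : Euc d →L[ℝ] Euc q) (fieldCoord x X z)) (h3.trans h2)).trans ?_
    have hFz : (extChartAt (𝓡 q) (f x)).symm (F z) = f ((extChartAt (𝓡 d) x).symm z) :=
      (extChartAt (𝓡 q) (f x)).left_inv hz.2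
    refine Eq.trans ?_ (fieldCoord_eq_dChart (y := F z)
      ((extChartAt (𝓡 q) (f x)).map_source hz.2) X').symm
    refine Eq.trans ?_ (congrArg (fun b => dChart (f x) b (X' b)) hFz.symm)
    refine congrArg (dChart (f x) (f ((extChartAt (𝓡 d) x).symm z))) ?_
    refine Eq.trans ?_ (h _)
    exact congrArg (mfderiv (𝓡 d) (𝓡 q) f ((extChartAt (𝓡 d) x).symm z)) (dChartSymm_fieldCoord hz.1 X)
  have hd : ∀ {X : ∀ x : M, TangentSpace (𝓡 d) x}, IsSmoothField X →
      DifferentiableAt ℝ (fieldCoord x X) y := fun hX =>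
    ((contDiffOn_fieldCoord x hX).contDiffAt (extChartAt_target_mem_nhds' hyt)).differentiableAt
      (by simp)
  have hd' : ∀ {X : ∀ x : B, TangentSpace (𝓡 q) x}, IsSmoothField X →
      DifferentiableAt ℝ (fieldCoord (f x) X) (F y) := fun hX => by
    rw [hFy]
    exact ((contDiffOn_fieldCoord (f x) hX).contDiffAt (extChartAt_target_mem_nhds'
      (mem_extChartAt_target _))).differentiableAt (by simp)
  have := lieBracket_related hFs (hd hX) (hd hY) (hd' hX') (hd' hY') (key h) (key h')
  rw [mlieBracket_center hX hY, mlieBracket_center hX' hY', ← hFy, ← this, hFd]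
  rfl

end RelatedFields
end FamiliesChernWeil

end

noncomputable section
namespace FamiliesChernWeil

/-! ### Horizontal lifts -/

section Horizontal

variable {q m n : ℕ}
  {B : Type*} [TopologicalSpace B] [ChartedSpace (Euc q) B] [IsManifold (𝓡 q) ∞ B]
  {M : Type*} [TopologicalSpace M] [ChartedSpace (Euc m) M] [IsManifold (𝓡 m) ∞ M]
  {Z : Type*} [TopologicalSpace Z] [ChartedSpace (Euc n) Z] [IsManifold (𝓡 n) ∞ Z]
  {pr : M → B}

theorem IsSmoothFibration.mfderiv_surjective
    (hp : IsSmoothFibration (m := m) (q := q) pr n Z) (x : M) (ξ : TangentSpace (𝓡 q) (pr x)) :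
    ∃ u, mfderiv (𝓡 m) (𝓡 q) pr x u = ξ := by
  obtain ⟨e, hb, h1, h2⟩ := hp.locally_trivial (pr x)
  have hx : trivParam e (pr x) (e x).2 = x := e.symm_apply_mk_proj (e.mem_source.2 hb)
  have h := mfderiv_pr_liftDeriv hp.smooth ⟨h1, h2⟩ hb (e x).2 (ξ : Euc q)
  refine ⟨liftDeriv q m e (pr x) (e x).2 (ξ : Euc q), ?_⟩
  exact (congrArg (fun x' => (mfderiv (𝓡 m) (𝓡 q) pr x' : Euc m →L[ℝ] Euc q)
    (liftDeriv q m e (pr x) (e x).2 (ξ : Euc q))) hx).symm.trans h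

variable (hp : IsSmoothFibration (m := m) (q := q) pr n Z)
  (HM : HorizontalComplement (m := m) (q := q) pr)

include hp in
-- The choice in `horizontalLift` is meaningful once a lift exists: `pr` is a submersion, and the
-- horizontal component of any preimage of `ξ` is a lift.
theorem HorizontalComplement.horizontalLift_spec (x : M) (ξ : TangentSpace (𝓡 q) (pr x)) :
    horizontalLift pr HM.H x ξ ∈ HM.H x ∧
      mfderiv (𝓡 m) (𝓡 q) pr x (horizontalLift pr HM.H x ξ) = ξ := by
  refine Classical.epsilon_spec (p := fun u => u ∈ HM.H x ∧ mfderiv (𝓡 m) (𝓡 q) pr x u = ξ) ?_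
  obtain ⟨u, hu⟩ := hp.mfderiv_surjective x ξ
  have htop : u ∈ HM.H x ⊔ LinearMap.ker (mfderiv (𝓡 m) (𝓡 q) pr x).toLinearMap := by
    rw [(HM.isCompl x).sup_eq_top]
    trivial
  obtain ⟨v, hv, w, hw, rfl⟩ := Submodule.mem_sup.1 htop
  have hw' : mfderiv (𝓡 m) (𝓡 q) pr x w = 0 := hw
  rw [map_add, hw', add_zero] at hu
  exact ⟨v, hv, hu⟩

include hp in
theorem HorizontalComplement.horizontalLift_eq {x : M} {ξ : TangentSpace (𝓡 q) (pr x)}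
    {u : TangentSpace (𝓡 m) x} (hu : u ∈ HM.H x) (hξ : mfderiv (𝓡 m) (𝓡 q) pr x u = ξ) :
    horizontalLift pr HM.H x ξ = u := by
  have h := HM.horizontalLift_spec hp x ξ
  have h1 : horizontalLift pr HM.H x ξ - u ∈
      HM.H x ⊓ LinearMap.ker (mfderiv (𝓡 m) (𝓡 q) pr x).toLinearMap := by
    refine ⟨Submodule.sub_mem _ h.1 hu, ?_⟩
    change mfderiv (𝓡 m) (𝓡 q) pr x (_ - u) = 0
    rw [map_sub, h.2, hξ, sub_self]
  rw [(HM.isCompl x).inf_eq_bot] at h1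
  exact sub_eq_zero.1 h1

include hp in
theorem HorizontalComplement.horizontalLift_sub (x : M) (ξ η : TangentSpace (𝓡 q) (pr x)) :
    horizontalLift pr HM.H x (ξ - η) = horizontalLift pr HM.H x ξ - horizontalLift pr HM.H x η := by
  have h := HM.horizontalLift_spec hp x ξ
  have h' := HM.horizontalLift_spec hp x η
  exact HM.horizontalLift_eq hp (Submodule.sub_mem _ h.1 h'.1) (by rw [map_sub, h.2, h'.2])

include hp in
theorem HorizontalComplement.horizontalLift_sum {ι : Type*} (s : Finset ι) (x : M) (a : ι → ℝ)
    (ξ : ι → TangentSpace (𝓡 q) (pr x)) :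
    horizontalLift pr HM.H x (∑ i ∈ s, a i • ξ i) =
      ∑ i ∈ s, a i • horizontalLift pr HM.H x (ξ i) := by
  refine HM.horizontalLift_eq hp (Submodule.sum_mem _ fun i _ =>
    Submodule.smul_mem _ _ (HM.horizontalLift_spec hp x _).1) ?_
  rw [map_sum]
  refine Finset.sum_congr rfl fun i _ => ?_
  rw [map_smul, (HM.horizontalLift_spec hp x _).2]

/-- From `[f V, Y] = f [V, Y] - Y(f) V`: at a zero of `f` only a multiple of `V` remains. -/
theorem mlieBracket_sum_mem {ι : Type*} (s : Finset ι) {V : ι → ∀ x : M, TangentSpace (𝓡 m) x}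
    {Y : ∀ x : M, TangentSpace (𝓡 m) x} {f : ι → M → ℝ} {x : M}
    {S : Submodule ℝ (TangentSpace (𝓡 m) x)}
    (hV : ∀ i, IsSmoothField (V i)) (hf : ∀ i, MDifferentiableAt (𝓡 m) 𝓘(ℝ, ℝ) (f i) x)
    (h0 : ∀ i, f i x = 0) (hS : ∀ i, V i x ∈ S) :
    VectorField.mlieBracket (𝓡 m) (fun x => ∑ i ∈ s, f i x • V i x) Y x ∈ S := by
  classical
  have : IsManifold (𝓡 m) (minSmoothness ℝ 2) M := IsManifold.of_le (n := ∞)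
    (by simpa using WithTop.coe_le_coe.2 (le_top (a := (2 : ℕ∞))))
  have : IsManifold (𝓡 m) (minSmoothness ℝ 3) M := IsManifold.of_le (n := ∞)
    (by simpa using WithTop.coe_le_coe.2 (le_top (a := (3 : ℕ∞))))
  induction s using Finset.induction_on with
  | empty =>
    have h := VectorField.mlieBracket_zero_left (I := 𝓡 m) (M := M) (W := Y)
    simp only [Finset.sum_empty]
    rw [show (fun x => (0 : TangentSpace (𝓡 m) x)) = (0 : ∀ x : M, TangentSpace (𝓡 m) x) from rfl, h]
    exact S.zero_mem
  | insert i s hi ih =>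
    have h1 : (fun x => ∑ i ∈ insert i s, f i x • V i x) =
        (f i • V i) + (fun x => ∑ i ∈ s, (f i • V i) x) := by
      funext x
      simp [Finset.sum_insert hi]
    have hd : ∀ i, MDifferentiableAt (𝓡 m) ((𝓡 m).prod 𝓘(ℝ, Euc m))
        (fun x => (⟨x, (f i • V i) x⟩ : TangentBundle (𝓡 m) M)) x := fun i =>
      MDifferentiableAt.smul_section (hf i) ((hV i).mdifferentiableAt x)
    rw [h1, VectorField.mlieBracket_add_left (hd i) (MDifferentiableAt.sum_section fun i _ => hd i),
      VectorField.mlieBracket_smul_left (hf i) ((hV i).mdifferentiableAt x), h0 i, zero_smul,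
      add_zero]
    exact S.add_mem (S.smul_mem _ (hS i)) ih

include hp in
/-- The bracket with the lift of a field that vanishes at a point is horizontal over that point. -/
theorem HorizontalComplement.mlieBracket_lift_mem [T2Space B] {X : ∀ b : B, TangentSpace (𝓡 q) b}
    (hX : IsSmoothField X) {x : M} (h0 : X (pr x) = 0) (Y : ∀ x : M, TangentSpace (𝓡 m) x) :
    VectorField.mlieBracket (𝓡 m) (fun x => horizontalLift pr HM.H x (X (pr x))) Y x ∈ HM.H x := by
  set b := pr x with hb
  have hbt := mem_extChartAt_target (I := 𝓡 q) b
  choose e he hes using fun i : Fin q => exists_chart_field hbt (EuclideanSpace.single i 1)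
  have hsrc : ∀ᶠ b' in 𝓝 b, b' ∈ (extChartAt (𝓡 q) b).source := extChartAt_source_mem_nhds b
  -- Near `b` the field is a combination of global fields extending a coordinate frame, with
  -- coefficients that vanish at `b`; its lift is the same combination of horizontal fields.
  have hXe : ∀ᶠ b' in 𝓝 b, X b' = ∑ i, fieldCoord b X (extChartAt (𝓡 q) b b') i • e i b' := by
    filter_upwards [hsrc, (continuousAt_extChartAt (I := 𝓡 q) b).eventually
      (Filter.eventually_all.2 hes)] with b' hb' h
    have hinv := (extChartAt (𝓡 q) b).left_inv hb'
    have h1 := dChartSymm_fieldCoord ((extChartAt (𝓡 q) b).map_source hb') X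
    have h2 : fieldCoord b X (extChartAt (𝓡 q) b b') =
        ∑ i, fieldCoord b X (extChartAt (𝓡 q) b b') i • EuclideanSpace.single i (1 : ℝ) := by
      simpa using ((EuclideanSpace.basisFun (Fin q) ℝ).sum_repr
        (fieldCoord b X (extChartAt (𝓡 q) b b'))).symm
    have h3 : ∀ c, c = b' → ∀ i, (e i c : Euc q) = (e i b' : Euc q) := by rintro c rfl i; rfl
    rw [h2, map_sum] at h1
    have h4 := congrArg (fun c => (X c : Euc q)) hinv
    refine h4.symm.trans (h1.symm.trans ?_)
    refine Finset.sum_congr rfl fun i _ => ?_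
    rw [map_smul, ← h i]
    exact congrArg _ (h3 _ hinv i)
  have hXH : (fun x => horizontalLift pr HM.H x (X (pr x))) =ᶠ[𝓝 x]
      fun x' => ∑ i, fieldCoord b X (extChartAt (𝓡 q) b (pr x')) i •
        horizontalLift pr HM.H x' (e i (pr x')) := by
    filter_upwards [hp.smooth.continuous.continuousAt.eventually hXe] with x' hx'
    rw [hx', HM.horizontalLift_sum hp]
    rfl
  rw [hXH.mlieBracket_vectorField_eq (Filter.EventuallyEq.refl _ Y)]
  refine mlieBracket_sum_mem Finset.univ
    (f := fun i x' => fieldCoord b X (extChartAt (𝓡 q) b (pr x')) i) (fun i => HM.smooth _ (he i))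
    (fun i => ?_) (fun i => ?_) fun i => (HM.horizontalLift_spec hp x _).1
  · have h1 : ContDiffAt ℝ ∞ (fun y => fieldCoord b X y i) (extChartAt (𝓡 q) b b) :=
      (EuclideanSpace.proj (𝕜 := ℝ) i).contDiff.contDiffAt.comp _
        ((contDiffOn_fieldCoord b hX).contDiffAt (extChartAt_target_mem_nhds' hbt))
    have h2 : MDifferentiableAt (𝓡 q) 𝓘(ℝ, Euc q) (extChartAt (𝓡 q) b) (pr x) :=
      mdifferentiableAt_extChartAt (mem_chart_source _ _)
    exact MDifferentiableAt.comp (g := fun y => fieldCoord b X y i)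
      (f := fun x' => extChartAt (𝓡 q) b (pr x')) x
      (h1.differentiableAt (by simp)).mdifferentiableAt
      (h2.comp x ((hp.smooth x).mdifferentiableAt (by simp)))
  · have h1 := fieldCoord_center X b
    change fieldCoord b X (extChartAt (𝓡 q) b b) i = 0
    rw [h1, h0]
    rfl

end Horizontal
end FamiliesChernWeil

end

noncomputable section
namespace FamiliesChernWeil

/-! ### Complex Leibniz rule and vertical derivatives -/

section Covariant

variable {m : ℕ}
  {M : Type*} [TopologicalSpace M] [ChartedSpace (Euc m) M] [IsManifold (𝓡 m) ∞ M] [T2Space M]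
  {E : ComplexBundle m M} (D : Connection E)

theorem Connection.cov_add {σ τ : ∀ x, E.Fiber x} (hσ : E.IsSmooth σ) (hτ : E.IsSmooth τ) (x : M)
    (u : TangentSpace (𝓡 m) x) : D.cov (σ + τ) x u = D.cov σ x u + D.cov τ x u := by
  rw [D.cov.isCovariantDerivativeOnUniv.add (hσ.mdifferentiableAt x) (hτ.mdifferentiableAt x)]
  rfl

omit [T2Space M] in
theorem mvfderiv_clm_comp {F G : Type*} [NormedAddCommGroup F] [NormedSpace ℝ F]
    [NormedAddCommGroup G] [NormedSpace ℝ G] (L : F →L[ℝ] G) {f : M → F} {x : M}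
    (hf : MDifferentiableAt (𝓡 m) 𝓘(ℝ, F) f x) (u : TangentSpace (𝓡 m) x) :
    mvfderiv (𝓡 m) (fun x => L (f x)) x u = L (mvfderiv (𝓡 m) f x u) := by
  have h := mfderiv_comp (I'' := 𝓘(ℝ, G)) (g := L) x L.differentiableAt.mdifferentiableAt hf
  rw [mfderiv_eq_fderiv, L.fderiv] at h
  exact congrArg (fun T => (T : Euc m →L[ℝ] G) u) h

/-- The Leibniz rule for complex functions. -/
theorem Connection.cov_smul {σ : ∀ x, E.Fiber x} (hσ : E.IsSmooth σ) {f : M → ℂ}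
    (hf : ContMDiff (𝓡 m) 𝓘(ℝ, ℂ) ∞ f) (x : M) (u : TangentSpace (𝓡 m) x) :
    D.cov (fun x => f x • σ x) x u = f x • D.cov σ x u + mvfderiv (𝓡 m) f x u • σ x := by
  have hfx := (hf x).mdifferentiableAt (by simp)
  have hL : ∀ L : ℂ →L[ℝ] ℝ, MDifferentiableAt (𝓡 m) 𝓘(ℝ, ℝ) (fun x => L (f x)) x := fun L =>
    L.differentiableAt.mdifferentiableAt.comp x hfx
  -- The Leibniz rule of a covariant derivative concerns real functions, so `f` is split into its
  -- real and imaginary parts.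
  have hsplit : (fun x => f x • σ x) = (fun x => Complex.reCLM (f x)) • σ +
      (fun x => Complex.imCLM (f x)) • (Complex.I • σ) := by
    funext x
    change f x • σ x = ((f x).re : ℝ) • σ x + ((f x).im : ℝ) • Complex.I • σ x
    conv_lhs => rw [← Complex.re_add_im (f x), add_smul, mul_smul]
    rfl
  have h2 : E.IsSmooth (Complex.I • σ) := hσ.smul _
  rw [hsplit, D.cov.isCovariantDerivativeOnUniv.add
    (MDifferentiableAt.smul_section (hL _) (hσ.mdifferentiableAt x))
    (MDifferentiableAt.smul_section (hL _) (h2.mdifferentiableAt x)),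
    D.cov.isCovariantDerivativeOnUniv.leibniz (hσ.mdifferentiableAt x) (hL _),
    D.cov.isCovariantDerivativeOnUniv.leibniz (h2.mdifferentiableAt x) (hL _)]
  have e1 := mvfderiv_clm_comp Complex.reCLM hfx u
  have e2 := mvfderiv_clm_comp Complex.imCLM hfx u
  have e3 := D.complex_linear σ hσ x u
  change (f x).re • D.cov σ x u + mvfderiv (𝓡 m) (fun x => Complex.reCLM (f x)) x u • σ x +
    ((f x).im • D.cov (Complex.I • σ) x u +
      mvfderiv (𝓡 m) (fun x => Complex.imCLM (f x)) x u • Complex.I • σ x) = _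
  rw [e1, e2, e3]
  conv_rhs => rw [← Complex.re_add_im (f x), ← Complex.re_add_im (mvfderiv (𝓡 m) f x u), add_smul,
    add_smul, mul_smul, mul_smul]
  change _ = ((f x).re • D.cov σ x u + (f x).im • Complex.I • D.cov σ x u) +
    ((mvfderiv (𝓡 m) f x u).re • σ x + (mvfderiv (𝓡 m) f x u).im • Complex.I • σ x)
  simp only [Complex.reCLM_apply, Complex.imCLM_apply]
  abel

theorem Connection.cov_const_smul {σ : ∀ x, E.Fiber x} (hσ : E.IsSmooth σ) (c : ℂ) (x : M)
    (u : TangentSpace (𝓡 m) x) : D.cov (c • σ) x u = c • D.cov σ x u := by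
  have h := D.cov_smul hσ (f := fun _ => c) contMDiff_const x u
  rw [mvfderiv_const] at h
  refine h.trans ?_
  change c • D.cov σ x u + (0 : ℂ) • σ x = _
  rw [zero_smul, add_zero]

theorem ComplexBundle.IsSmooth.smul_fun {σ : ∀ x, E.Fiber x} (hσ : E.IsSmooth σ) {f : M → ℂ}
    (hf : ContMDiff (𝓡 m) 𝓘(ℝ, ℂ) ∞ f) : E.IsSmooth (fun x => f x • σ x) := by
  have hL : ∀ L : ℂ →L[ℝ] ℝ, ContMDiff (𝓡 m) 𝓘(ℝ, ℝ) ∞ (fun x => L (f x)) := fun L =>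
    L.contDiff.contMDiff.comp hf
  have hsplit : (fun x => f x • σ x) = (fun x => Complex.reCLM (f x)) • σ +
      (fun x => Complex.imCLM (f x)) • (Complex.I • σ) := by
    funext x
    change f x • σ x = ((f x).re : ℝ) • σ x + ((f x).im : ℝ) • Complex.I • σ x
    conv_lhs => rw [← Complex.re_add_im (f x), add_smul, mul_smul]
    rfl
  rw [hsplit]
  exact ComplexBundle.IsSmooth.add (ContMDiff.smul_section (hL _) hσ)
    (ContMDiff.smul_section (hL _) (hσ.smul _))

variable {q n : ℕ} {B : Type*} [TopologicalSpace B] [ChartedSpace (Euc q) B] [IsManifold (𝓡 q) ∞ B]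
  {Z : Type*} [TopologicalSpace Z] [ChartedSpace (Euc n) Z] [IsManifold (𝓡 n) ∞ Z]
  {pr : M → B}

/-- A vertical derivative only depends on the restriction to the fiber. -/
theorem Connection.cov_eq_zero_of_fiber (hp : IsSmoothFibration (m := m) (q := q) pr n Z)
    {σ : ∀ x, E.Fiber x} (hσ : E.IsSmooth σ) {x : M} (h0 : ∀ x', pr x' = pr x → σ x' = 0)
    {u : TangentSpace (𝓡 m) x} (hu : mfderiv (𝓡 m) (𝓡 q) pr x u = 0) : D.cov σ x u = 0 := by
  obtain ⟨t, hb, h1, h2⟩ := hp.locally_trivial (pr x)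
  have ht : IsSmoothTriv q m n t := ⟨h1, h2⟩
  have hx : trivParam t (pr x) (t x).2 = x := t.symm_apply_mk_proj (t.mem_source.2 hb)
  set ζ := (t x).2 with hζ
  set κ := extChartAt (𝓡 n) ζ with hκ
  have hκs : IsSmoothChart κ := isSmoothChart_extChartAt ζ
  set y := κ ζ with hy
  have hyt : y ∈ κ.target := mem_extChartAt_target ζ
  have hyx : trivParam t (pr x) (κ.symm y) = x := by
    rw [hy, hκ, extChartAt_to_inv, hx]
  have hspan := mem_span_fiberDeriv hp.smooth ht hκs hb hyt (u := (u : Euc m))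
    ((congrArg (fun x' => (mfderiv (𝓡 m) (𝓡 q) pr x' : Euc m →L[ℝ] Euc q) (u : Euc m)) hyx).trans hu)
  -- The vertical vector `u` is the velocity of a map `y ↦ trivParam t (pr x) (κ.symm y)` that stays
  -- in the fiber.
  obtain ⟨w, hw⟩ : ∃ w, fiberDeriv (m := m) t (pr x) κ y w = (u : Euc m) := by
    have h3 : Submodule.span ℝ (Set.range fun j : Fin n =>
      fiberDeriv (m := m) t (pr x) κ y (EuclideanSpace.single j 1)) ≤
        LinearMap.range (fiberDeriv (m := m) t (pr x) κ y).toLinearMap := by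
      rw [Submodule.span_le]
      rintro _ ⟨j, rfl⟩
      exact ⟨_, rfl⟩
    exact h3 hspan
  set e := trivializationAt E.Model E.Fiber x with he
  have hxe : x ∈ e.baseSet := FiberBundle.mem_baseSet_trivializationAt' x
  have hyd : extChartAt (𝓡 m) x x ∈ chartDomain x e :=
    ⟨mem_extChartAt_target x, by simpa using hxe⟩
  have hcov := cov_eq_locCov e D x hyd hσ (u : Euc m)
  rw [secCoord_center, h0 x rfl] at hcov
  have hzero : ∀ {x' : M}, x' ∈ e.baseSet → (e ⟨x', (0 : E.Fiber x')⟩).2 = 0 := fun {x'} hx' =>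
    (e.linear ℝ hx').map_zero
  have hinj : ∀ v : E.Fiber x, (e ⟨x, v⟩).2 = 0 → v = 0 := fun v hv =>
    (e.linearEquivAt ℝ x hxe).map_eq_zero_iff.1 hv
  rw [hzero hxe, map_zero, add_zero] at hcov
  refine hinj _ ?_
  have hx0 : ∀ (x' : M) (w' : Euc m), x' = x → w' = u →
      (e ⟨x', (D.cov σ x' : Euc m →L[ℝ] E.Fiber x') w'⟩).2 = (e ⟨x, D.cov σ x u⟩).2 := by
    rintro _ _ rfl rfl
    rfl
  refine (hx0 _ _ (extChartAt_to_inv x) (dChartSymm_self x (u : Euc m))).symm.trans (hcov.trans ?_)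
  have hγ : MDifferentiableAt 𝓘(ℝ, Euc n) (𝓡 m) (fun y => trivParam t (pr x) (κ.symm y)) y :=
    ((contMDiff_trivParam_right ht hb _).mdifferentiableAt (by simp)).comp y
      ((hκs.smooth_symm.contMDiffAt (hκs.open_target.mem_nhds hyt)).mdifferentiableAt (by simp))
  have hγc : fderiv ℝ (fun y => extChartAt (𝓡 m) x (trivParam t (pr x) (κ.symm y))) y w = u := by
    rw [dChart_mfderiv hγ x (by rw [hyx]; exact mem_extChartAt_source x), hyx]
    exact (dChart_self x _).trans hw
  have hd : DifferentiableAt ℝ (fun y => extChartAt (𝓡 m) x (trivParam t (pr x) (κ.symm y))) y := by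
    have h4 : MDifferentiableAt (𝓡 m) 𝓘(ℝ, Euc m) (extChartAt (𝓡 m) x)
      (trivParam t (pr x) (κ.symm y)) := mdifferentiableAt_extChartAt (by
        rw [hyx]; exact mem_chart_source _ _)
    exact (h4.comp y hγ).differentiableAt
  have hs : DifferentiableAt ℝ (secCoord x e σ)
      (extChartAt (𝓡 m) x (trivParam t (pr x) (κ.symm y))) := by
    rw [hyx]
    exact ((contDiffOn_secCoord_of_contMDiff (d := m) e x hσ).contDiffAt
      ((isOpen_chartDomain e x).mem_nhds hyd)).differentiableAt (by simp)
  have hcomp := fderiv_comp y hs hd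
  -- Along the fiber the coordinates of `σ` vanish, so the chain rule kills the derivative term; the
  -- zeroth order term is already `0`.
  have hz : secCoord x e σ ∘ (fun y => extChartAt (𝓡 m) x (trivParam t (pr x) (κ.symm y))) =ᶠ[𝓝 y]
      fun _ => 0 := by
    have h5 : ∀ᶠ y' in 𝓝 y, trivParam t (pr x) (κ.symm y') ∈
        (extChartAt (𝓡 m) x).source ∩ e.baseSet := by
      refine hγ.continuousAt.eventually ?_
      beta_reduce
      rw [hyx]
      exact Filter.inter_mem (extChartAt_source_mem_nhds x) (e.open_baseSet.mem_nhds hxe)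
    filter_upwards [h5] with y' h6
    have h7 := (extChartAt (𝓡 m) x).left_inv h6.1
    have h8 : ∀ x', x' = trivParam t (pr x) (κ.symm y') → (e ⟨x', σ x'⟩).2 = 0 := by
      rintro x' rfl
      rw [h0 _ (proj_trivParam t hb _), hzero h6.2]
    exact h8 _ h7
  rw [hz.fderiv_eq, fderiv_fun_const] at hcomp
  have h9 := congrArg (fun T : Euc n →L[ℝ] E.Model => T w) hcomp
  simp only [ContinuousLinearMap.comp_apply, hγc, hyx] at h9
  exact h9.symm

end Covariant
end FamiliesChernWeil

end

noncomputable section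
namespace FamiliesChernWeil

/-! ### Fields, sections and functions with prescribed data at a point -/

section Extension

variable {m : ℕ} {M : Type*} [TopologicalSpace M] [ChartedSpace (Euc m) M] [IsManifold (𝓡 m) ∞ M]
  [T2Space M]

theorem exists_smoothField (x : M) (u : TangentSpace (𝓡 m) x) :
    ∃ X : ∀ x : M, TangentSpace (𝓡 m) x, IsSmoothField X ∧ X x = u := by
  obtain ⟨X, hX, hXu⟩ := exists_chart_field (mem_extChartAt_target (I := 𝓡 m) x) (u : Euc m)
  have h := hXu.self_of_nhds
  exact ⟨X, hX, (congrArg (fun x' => (X x' : Euc m)) (extChartAt_to_inv (I := 𝓡 m) x)).symm.trans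
    (h.trans (dChartSymm_self x (u : Euc m)))⟩

theorem ComplexBundle.exists_isSmooth (E : ComplexBundle m M) (x : M) (v : E.Fiber x) :
    ∃ σ, E.IsSmooth σ ∧ σ x = v := by
  set e := trivializationAt E.Model E.Fiber x
  have hx : x ∈ e.baseSet := FiberBundle.mem_baseSet_trivializationAt' x
  obtain ⟨s, hs, hsv⟩ := exists_smooth_frameSec e (e ⟨x, v⟩).2 hx
  refine ⟨s, hs, ?_⟩
  rw [hsv.self_of_nhds, frameSec, e.symmₗ_apply hx]
  exact e.symm_apply_apply_mk hx v

/-- In the chart at `x` the functional `⟨u, ·⟩`, cut off by a bump function, has derivative `‖u‖²`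
along `u`. -/
theorem exists_mvfderiv_ne_zero {x : M} {u : TangentSpace (𝓡 m) x} (hu : u ≠ 0) :
    ∃ f : M → ℂ, ContMDiff (𝓡 m) 𝓘(ℝ, ℂ) ∞ f ∧ mvfderiv (𝓡 m) f x u ≠ 0 := by
  obtain ⟨χ, hχ, hsupp, hχ1⟩ := exists_bump (d := m) (extChartAt_source_mem_nhds (I := 𝓡 m) x)
  let L : Euc m →L[ℝ] ℂ := Complex.ofRealCLM.comp (innerSL ℝ (u : Euc m))
  refine ⟨fun x' => χ x' • L (extChartAt (𝓡 m) x x'), ?_, ?_⟩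
  · refine contMDiff_of_tsupport fun x' hx' => ?_
    have hx2 : x' ∈ (chartAt (Euc m) x).source := by
      simpa using hsupp (closure_mono (Function.support_smul_subset_left _ _) hx')
    exact (hχ x').smul (L.contDiff.contMDiff.contMDiffAt.comp x' (contMDiffAt_extChartAt' hx2))
  · have h1 : (fun x' => χ x' • L (extChartAt (𝓡 m) x x')) =ᶠ[𝓝 x]
        L ∘ (extChartAt (𝓡 m) x) := by
      filter_upwards [hχ1] with x' hx'
      rw [hx']
      simp
    have h2 := mfderiv_comp (I'' := 𝓘(ℝ, ℂ)) (g := L) x L.differentiableAt.mdifferentiableAt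
      (mdifferentiableAt_extChartAt (I := 𝓡 m) (mem_chart_source (Euc m) x))
    rw [mfderiv_eq_fderiv, L.fderiv, ← h1.mfderiv_eq] at h2
    have h3 : mvfderiv (𝓡 m) (fun x' => χ x' • L (extChartAt (𝓡 m) x x')) x u =
        L (dChart x x (u : Euc m)) := congrArg (fun T => (T : Euc m →L[ℝ] ℂ) (u : Euc m)) h2
    have h4 : ∀ w : Euc m, w ≠ 0 → Complex.ofRealCLM.comp (innerSL ℝ w) w ≠ 0 := fun w hw => by
      simpa using hw
    exact fun h0 => h4 (u : Euc m) hu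
      ((congrArg L (dChart_self x (u : Euc m))).symm.trans (h3.symm.trans h0))

end Extension

/-! ### The curvature of the horizontal complement -/

section Bismut

variable {q m n : ℕ}
  {B : Type*} [TopologicalSpace B] [ChartedSpace (Euc q) B] [IsManifold (𝓡 q) ∞ B] [T2Space B]
  {M : Type*} [TopologicalSpace M] [ChartedSpace (Euc m) M] [IsManifold (𝓡 m) ∞ M] [T2Space M]
  {Z : Type*} [TopologicalSpace Z] [ChartedSpace (Euc n) Z] [IsManifold (𝓡 n) ∞ Z]
  {pr : M → B} (HM : HorizontalComplement (m := m) (q := q) pr)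

/-- The horizontal lift of a vector field. -/
def HorizontalComplement.liftField (X : ∀ b : B, TangentSpace (𝓡 q) b) (x : M) :
    TangentSpace (𝓡 m) x := horizontalLift pr HM.H x (X (pr x))

/-- The curvature `[X^H, Y^H] - [X, Y]^H` of the horizontal complement. -/
def HorizontalComplement.bracketDefect (X Y : ∀ b : B, TangentSpace (𝓡 q) b) (x : M) :
    TangentSpace (𝓡 m) x :=
  VectorField.mlieBracket (𝓡 m) (HM.liftField X) (HM.liftField Y) x
    - HM.liftField (VectorField.mlieBracket (𝓡 q) X Y) x

variable {X Y X' Y' : ∀ b : B, TangentSpace (𝓡 q) b}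

theorem HorizontalComplement.isSmoothField_bracketDefect (hX : IsSmoothField X)
    (hY : IsSmoothField Y) : IsSmoothField (HM.bracketDefect X Y) :=
  ((HM.smooth X hX).mlieBracket (HM.smooth Y hY)).sub (HM.smooth _ (hX.mlieBracket hY))

variable (hp : IsSmoothFibration (m := m) (q := q) pr n Z)

include hp in
-- Lifts are `pr`-related to their fields, hence `[X^H, Y^H]` projects to `[X, Y]`, as does `[X,
-- Y]^H`.
theorem HorizontalComplement.bracketDefect_vertical (hX : IsSmoothField X) (hY : IsSmoothField Y)
    (x : M) : mfderiv (𝓡 m) (𝓡 q) pr x (HM.bracketDefect X Y x) = 0 := by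
  have h := mfderiv_mlieBracket hp.smooth (HM.smooth X hX) (HM.smooth Y hY) hX hY
    (fun x => (HM.horizontalLift_spec hp x _).2) (fun x => (HM.horizontalLift_spec hp x _).2) x
  rw [HorizontalComplement.bracketDefect, map_sub]
  refine (congrArg₂ (· - ·) h (HM.horizontalLift_spec hp x _).2).trans (sub_self _)

include hp in
theorem HorizontalComplement.bracketDefect_swap (x : M) :
    HM.bracketDefect X Y x = - HM.bracketDefect Y X x := by
  have h := HM.horizontalLift_spec hp x (VectorField.mlieBracket (𝓡 q) X Y (pr x))
  have h1 : HM.liftField (VectorField.mlieBracket (𝓡 q) Y X) x =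
      - HM.liftField (VectorField.mlieBracket (𝓡 q) X Y) x := by
    refine HM.horizontalLift_eq hp (Submodule.neg_mem _ h.1) ?_
    rw [map_neg, VectorField.mlieBracket_swap_apply (V := Y)]
    exact congrArg Neg.neg h.2
  rw [HorizontalComplement.bracketDefect, HorizontalComplement.bracketDefect, h1,
    VectorField.mlieBracket_swap_apply]
  abel

include hp in
-- The difference of the two defects is vertical. It is also horizontal, since `X - X'` vanishes at
-- the base point (`mlieBracket_lift_mem`). Hence it is zero.
theorem HorizontalComplement.bracketDefect_congr_left (hX : IsSmoothField X)
    (hX' : IsSmoothField X') (hY : IsSmoothField Y) {x : M} (h : X (pr x) = X' (pr x)) :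
    HM.bracketDefect X Y x = HM.bracketDefect X' Y x := by
  have : IsManifold (𝓡 m) (minSmoothness ℝ 2) M := IsManifold.of_le (n := ∞)
    (by simpa using WithTop.coe_le_coe.2 (le_top (a := (2 : ℕ∞))))
  have : IsManifold (𝓡 m) (minSmoothness ℝ 3) M := IsManifold.of_le (n := ∞)
    (by simpa using WithTop.coe_le_coe.2 (le_top (a := (3 : ℕ∞))))
  have hW := hX.sub hX'
  have hsplit : HM.liftField X = HM.liftField (fun b => X b - X' b) + HM.liftField X' := by
    funext x
    refine (sub_eq_iff_eq_add.1 ?_)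
    exact (HM.horizontalLift_sub hp x _ _).symm
  have hmem := HM.mlieBracket_lift_mem hp hW (x := x) (sub_eq_zero.2 h) (HM.liftField Y)
  have hadd : VectorField.mlieBracket (𝓡 m) (HM.liftField X) (HM.liftField Y) x =
      VectorField.mlieBracket (𝓡 m) (HM.liftField fun b => X b - X' b) (HM.liftField Y) x +
        VectorField.mlieBracket (𝓡 m) (HM.liftField X') (HM.liftField Y) x := by
    rw [hsplit]
    exact VectorField.mlieBracket_add_left ((HM.smooth _ hW).mdifferentiableAt x)
      ((HM.smooth _ hX').mdifferentiableAt x)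
  have hH : HM.bracketDefect X Y x - HM.bracketDefect X' Y x ∈ HM.H x := by
    have h1 : HM.bracketDefect X Y x - HM.bracketDefect X' Y x =
        VectorField.mlieBracket (𝓡 m) (HM.liftField fun b => X b - X' b) (HM.liftField Y) x -
        (HM.liftField (VectorField.mlieBracket (𝓡 q) X Y) x -
          HM.liftField (VectorField.mlieBracket (𝓡 q) X' Y) x) := by
      rw [HorizontalComplement.bracketDefect, HorizontalComplement.bracketDefect, hadd]
      abel
    rw [h1]
    exact Submodule.sub_mem _ hmem (Submodule.sub_mem _ (HM.horizontalLift_spec hp x _).1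
      (HM.horizontalLift_spec hp x _).1)
  have hV : HM.bracketDefect X Y x - HM.bracketDefect X' Y x ∈
      HM.H x ⊓ LinearMap.ker (mfderiv (𝓡 m) (𝓡 q) pr x).toLinearMap := by
    refine ⟨hH, ?_⟩
    change mfderiv (𝓡 m) (𝓡 q) pr x (_ - _) = 0
    rw [map_sub, HM.bracketDefect_vertical hp hX hY, HM.bracketDefect_vertical hp hX' hY, sub_self]
  rw [(HM.isCompl x).inf_eq_bot] at hV
  exact sub_eq_zero.1 hV

include hp in
/-- The curvature of a horizontal complement is tensorial. -/
theorem HorizontalComplement.bracketDefect_congr (hX : IsSmoothField X)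
    (hX' : IsSmoothField X') (hY : IsSmoothField Y) (hY' : IsSmoothField Y') {x : M}
    (h : X (pr x) = X' (pr x)) (h' : Y (pr x) = Y' (pr x)) :
    HM.bracketDefect X Y x = HM.bracketDefect X' Y' x := by
  rw [HM.bracketDefect_congr_left hp hX hX' hY h, HM.bracketDefect_swap hp,
    HM.bracketDefect_congr_left hp hY hY' hX' h', ← HM.bracketDefect_swap hp]

end Bismut
end FamiliesChernWeil

end

noncomputable section
namespace FamiliesChernWeil

/-! ### The curvature of the Bismut connection and its vertical part -/

section BismutCurvature

variable {q m n : ℕ}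
  {B : Type*} [TopologicalSpace B] [ChartedSpace (Euc q) B] [IsManifold (𝓡 q) ∞ B] [T2Space B]
  {M : Type*} [TopologicalSpace M] [ChartedSpace (Euc m) M] [IsManifold (𝓡 m) ∞ M] [T2Space M]
  {Z : Type*} [TopologicalSpace Z] [ChartedSpace (Euc n) Z] [IsManifold (𝓡 n) ∞ Z]
  {pr : M → B} (HM : HorizontalComplement (m := m) (q := q) pr)
  {E : ComplexBundle m M} (D : Connection E) {X Y : ∀ b : B, TangentSpace (𝓡 q) b}

/-- The value of the curvature of the Bismut connection on sections of `E`. -/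
def bismutOperator (X Y : ∀ b : B, TangentSpace (𝓡 q) b) (σ : ∀ x, E.Fiber x) (x : M) : E.Fiber x :=
  D.curvature x ![HM.liftField X x, HM.liftField Y x] (σ x)
    + D.cov σ x (HM.bracketDefect X Y x)

/-- The covariant derivative along `[X^H, Y^H]` is subtracted in the curvature of `E` and added in
the defect term, so it cancels. -/
theorem bismutOperator_eq (hX : IsSmoothField X) (hY : IsSmoothField Y)
    {σ : ∀ x, E.Fiber x} (hσ : E.IsSmooth σ) (x : M) :
    bismutOperator HM D X Y σ x =
      D.cov (fun y => D.cov σ y (HM.liftField Y y)) x (HM.liftField X x)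
        - D.cov (fun y => D.cov σ y (HM.liftField X y)) x (HM.liftField Y x)
        - D.cov σ x (HM.liftField (VectorField.mlieBracket (𝓡 q) X Y) x) := by
  have h := isCurvature_curvature D (HM.liftField X) (HM.liftField Y) (HM.smooth X hX)
    (HM.smooth Y hY) σ hσ x
  have hT : D.cov σ x (HM.bracketDefect X Y x) = _ - _ := map_sub _ _ _
  refine (congrArg₂ (· + ·) h hT).trans ?_
  abel

theorem isSmooth_bismutOperator (hX : IsSmoothField X) (hY : IsSmoothField Y)
    {σ : ∀ x, E.Fiber x} (hσ : E.IsSmooth σ) : E.IsSmooth (bismutOperator HM D X Y σ) := by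
  have h1 := D.cov_smooth (D.cov_smooth hσ (HM.smooth Y hY)) (HM.smooth X hX)
  have h2 := D.cov_smooth (D.cov_smooth hσ (HM.smooth X hX)) (HM.smooth Y hY)
  have h3 := D.cov_smooth hσ (HM.smooth _ (hX.mlieBracket hY))
  have h4 := (h1.add (h2.smul (-1))).add (h3.smul (-1))
  refine (congrArg E.IsSmooth (funext fun x => ?_)).mpr h4
  rw [bismutOperator_eq HM D hX hY hσ]
  rw [sub_eq_add_neg, sub_eq_add_neg, neg_one_smul, neg_one_smul]
  rfl

theorem bismutCurvature_eq (hX : IsSmoothField X) (hY : IsSmoothField Y)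
    {r : ∀ b : B, FiberSection E pr b} (hr : IsSmoothPush r) (b : B) (z : pr ⁻¹' {b}) :
    bismutCurvature D HM X Y r b z = bismutOperator HM D X Y (tilde r) z := by
  -- Taking `b` to be `pr z` by definition removes the transport hidden in `HM.lift`.
  obtain ⟨z, rfl⟩ := z
  rw [bismutOperator_eq HM D hX hY hr]
  rfl

variable (hp : IsSmoothFibration (m := m) (q := q) pr n Z)

include hp in
-- The only derivative left in the operator is along the vertical defect, so it descends to sections
-- over one fiber. This makes `bismutAut` independent of the chosen extensions.
theorem bismutOperator_congr (hX : IsSmoothField X) (hY : IsSmoothField Y)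
    {σ τ : ∀ x, E.Fiber x} (hσ : E.IsSmooth σ) (hτ : E.IsSmooth τ) {b : B}
    (h : ∀ z : pr ⁻¹' {b}, σ z = τ z) (z : pr ⁻¹' {b}) :
    bismutOperator HM D X Y σ z = bismutOperator HM D X Y τ z := by
  have hneg : E.IsSmooth ((-1 : ℂ) • τ) := hτ.smul _
  have h1 := D.cov_eq_zero_of_fiber hp (hσ.add hneg) (x := z) (fun x' hx' => by
    have := h ⟨x', hx'.trans z.2⟩
    simp only [Pi.add_apply, neg_smul, one_smul]
    exact (add_neg_eq_zero).2 this) (HM.bracketDefect_vertical hp hX hY z)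
  rw [D.cov_add hσ hneg, D.cov_const_smul hτ, neg_smul, one_smul, add_neg_eq_zero] at h1
  rw [bismutOperator, bismutOperator, h1, h z]

theorem bismutOperator_add {σ τ : ∀ x, E.Fiber x} (hσ : E.IsSmooth σ) (hτ : E.IsSmooth τ) (x : M) :
    bismutOperator HM D X Y (σ + τ) x =
      bismutOperator HM D X Y σ x + bismutOperator HM D X Y τ x := by
  rw [bismutOperator, D.cov_add hσ hτ, Pi.add_apply, map_add]
  exact add_add_add_comm _ _ _ _

theorem bismutOperator_const_smul {σ : ∀ x, E.Fiber x} (hσ : E.IsSmooth σ) (c : ℂ) (x : M) :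
    bismutOperator HM D X Y (c • σ) x = c • bismutOperator HM D X Y σ x := by
  rw [bismutOperator, D.cov_const_smul hσ, Pi.smul_apply, map_smul, ← smul_add]
  rfl

theorem bismutOperator_smul {σ : ∀ x, E.Fiber x} (hσ : E.IsSmooth σ) {f : M → ℂ}
    (hf : ContMDiff (𝓡 m) 𝓘(ℝ, ℂ) ∞ f) (x : M) :
    bismutOperator HM D X Y (fun x => f x • σ x) x = f x • bismutOperator HM D X Y σ x
      + mvfderiv (𝓡 m) f x (HM.bracketDefect X Y x) • σ x := by
  rw [bismutOperator, D.cov_smul hσ hf, map_smul, bismutOperator, smul_add, add_assoc]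

include hp in
theorem bismutOperator_congr_fields {X' Y' : ∀ b : B, TangentSpace (𝓡 q) b}
    (hX : IsSmoothField X) (hY : IsSmoothField Y) (hX' : IsSmoothField X') (hY' : IsSmoothField Y')
    {x : M} (h : X (pr x) = X' (pr x)) (h' : Y (pr x) = Y' (pr x)) (σ : ∀ x, E.Fiber x) :
    bismutOperator HM D X Y σ x = bismutOperator HM D X' Y' σ x := by
  rw [bismutOperator, bismutOperator, HM.bracketDefect_congr hp hX hX' hY hY' h h',
    HorizontalComplement.liftField, HorizontalComplement.liftField, h, h']
  rfl

include hp in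
/-- The curvature of the Bismut connection as an infinitesimal bundle automorphism. -/
def bismutAut (hX : IsSmoothField X) (hY : IsSmoothField Y) (b : B) :
    InfinitesimalAut (m := m) (q := q) E pr b where
  -- The minus sign comes from the convention that `(V, s)` acts by `s^v - ∇_V`.
  field z := - HM.bracketDefect X Y z
  vertical z := by rw [map_neg, HM.bracketDefect_vertical hp hX hY, neg_zero]
  smooth := ⟨_, (HM.isSmoothField_bracketDefect hX hY).neg, fun _ => rfl⟩
  act :=
    { toFun := fun s => restrictSection (isSmooth_bismutOperator HM D hX hY s.2.choose_spec.1) b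
      map_add' := fun s t => by
        refine Subtype.ext (funext fun z => ?_)
        change bismutOperator HM D X Y _ z = bismutOperator HM D X Y _ z +
          bismutOperator HM D X Y _ z
        rw [← bismutOperator_add HM D s.2.choose_spec.1 t.2.choose_spec.1]
        refine bismutOperator_congr HM D hp hX hY (s + t).2.choose_spec.1
          (s.2.choose_spec.1.add t.2.choose_spec.1) (fun z => ?_) z
        rw [← (s + t).2.choose_spec.2, Pi.add_apply, ← s.2.choose_spec.2, ← t.2.choose_spec.2]
        rfl
      map_smul' := fun c s => by
        refine Subtype.ext (funext fun z => ?_)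
        change bismutOperator HM D X Y _ z = c • bismutOperator HM D X Y _ z
        rw [← bismutOperator_const_smul HM D s.2.choose_spec.1]
        refine bismutOperator_congr HM D hp hX hY (c • s).2.choose_spec.1
          (s.2.choose_spec.1.smul c) (fun z => ?_) z
        rw [← (c • s).2.choose_spec.2, Pi.smul_apply, ← s.2.choose_spec.2]
        rfl }
  leibniz f hf s t hst z := by
    change bismutOperator HM D X Y _ z = f z • bismutOperator HM D X Y _ z -
      mvfderiv (𝓡 m) f z (- _) • s.1 z
    rw [map_neg, neg_smul, sub_neg_eq_add, s.2.choose_spec.2 z,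
      ← bismutOperator_smul HM D s.2.choose_spec.1 hf]
    refine bismutOperator_congr HM D hp hX hY t.2.choose_spec.1
      (s.2.choose_spec.1.smul_fun hf) (fun z => ?_) z
    rw [← t.2.choose_spec.2, hst, ← s.2.choose_spec.2]

theorem bismutAut_act (hX : IsSmoothField X) (hY : IsSmoothField Y) {b : B}
    (s : PushFiber E pr b) {σ : ∀ x, E.Fiber x} (hσ : E.IsSmooth σ) (h : ∀ z, s.1 z = σ z)
    (z : pr ⁻¹' {b}) :
    ((bismutAut HM D hp hX hY b).act s).1 z = bismutOperator HM D X Y σ z :=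
  bismutOperator_congr HM D hp hX hY s.2.choose_spec.1 hσ
    (fun z => (s.2.choose_spec.2 z).symm.trans (h z)) z

theorem isBismutCurvatureAt_bismutAut (hX : IsSmoothField X) (hY : IsSmoothField Y) (b : B) :
    IsBismutCurvatureAt D HM (X b) (Y b) (bismutAut HM D hp hX hY b) := by
  intro X' Y' hX' hY' h h' r hr
  funext z
  rw [bismutCurvature_eq HM D hX' hY' hr, bismutAut_act HM D hp hX hY _ hr (fun z => by
    obtain ⟨z, rfl⟩ := z; rfl)]
  obtain ⟨z, rfl⟩ := z
  exact bismutOperator_congr_fields HM D hp hX hY hX' hY' h.symm h'.symm _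

include hp in
-- The action of `g` is known on all smooth sections, and the Leibniz rule recovers its field as
-- minus the bracket defect. Adding `∇_V` then cancels the derivative term and leaves the curvature.
theorem isVerticalPart_of_isBismutCurvatureAt (hX : IsSmoothField X) (hY : IsSmoothField Y) {b : B}
    (g : InfinitesimalAut (m := m) (q := q) E pr b) (hg : IsBismutCurvatureAt D HM (X b) (Y b) g) :
    g.IsVerticalPart D fun z => D.curvature z ![HM.lift (X b) z, HM.lift (Y b) z] := by
  have hact : ∀ {σ : ∀ x, E.Fiber x} (hσ : E.IsSmooth σ) (z : pr ⁻¹' {b}),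
      (g.act (restrictSection hσ b)).1 z = bismutOperator HM D X Y σ z := by
    intro σ hσ z
    have h1 := hg X Y hX hY rfl rfl (fun _ z => σ z) hσ
    exact (congrFun h1 z).trans (bismutCurvature_eq HM D hX hY (r := fun _ z => σ z) hσ b z)
  intro σ hσ z
  have hlift : D.curvature z ![HM.lift (X b) z, HM.lift (Y b) z] =
      D.curvature z ![HM.liftField X z, HM.liftField Y z] := by
    obtain ⟨z, rfl⟩ := z
    rfl
  refine (congrArg (fun T : Module.End ℂ (E.Fiber z) => T (σ z)) hlift).trans ?_
  rw [hact hσ z, bismutOperator]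
  -- On a zero fiber the Leibniz rule says nothing about the field, but every identity in the fiber
  -- holds.
  by_cases htriv : ∀ v : E.Fiber z, v = 0
  · exact (htriv _).trans (htriv _).symm
  push Not at htriv
  obtain ⟨v, hv⟩ := htriv
  obtain ⟨τ, hτ, hτz⟩ := E.exists_isSmooth z v
  -- Comparing the two Leibniz rules, every function has derivative zero along this sum; a function
  -- detecting a nonzero vector would be a contradiction.
  have hfield : g.field z + HM.bracketDefect X Y z = 0 := by
    by_contra hne
    obtain ⟨f, hf, hfne⟩ := exists_mvfderiv_ne_zero hne
    have h1 := g.leibniz f hf (restrictSection hτ b) (restrictSection (hτ.smul_fun hf) b)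
      (fun _ => rfl) z
    rw [hact, hact, bismutOperator_smul HM D hτ hf] at h1
    have h2 : (mvfderiv (𝓡 m) f z (g.field z + HM.bracketDefect X Y z)) • v = 0 := by
      rw [map_add, add_smul, ← hτz]
      have h3 : (restrictSection hτ b).1 z = τ z := rfl
      rw [h3, sub_eq_add_neg, add_right_inj] at h1
      rw [h1, add_neg_cancel]
    rcases smul_eq_zero.1 h2 with h | h
    · exact hfne h
    · exact hv h
  rw [eq_neg_of_add_eq_zero_left hfield, map_neg, add_neg_cancel_right]

include hp in
/-- The vertical part of the curvature of the Bismut connection is the curvature of `E`. -/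
theorem exists_isBismutCurvatureAt_and_isVerticalPart {b : B} (ξ₁ ξ₂ : TangentSpace (𝓡 q) b) :
    (∃ g : InfinitesimalAut E pr b, IsBismutCurvatureAt D HM ξ₁ ξ₂ g) ∧
      ∀ g : InfinitesimalAut E pr b, IsBismutCurvatureAt D HM ξ₁ ξ₂ g →
        g.IsVerticalPart D fun z => D.curvature z ![HM.lift ξ₁ z, HM.lift ξ₂ z] := by
  obtain ⟨X, hX, rfl⟩ := exists_smoothField b ξ₁
  obtain ⟨Y, hY, rfl⟩ := exists_smoothField b ξ₂
  exact ⟨⟨_, isBismutCurvatureAt_bismutAut HM D hp hX hY b⟩,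
    isVerticalPart_of_isBismutCurvatureAt HM D hp hX hY⟩

end BismutCurvature
end FamiliesChernWeil

end

noncomputable section
namespace FamiliesChernWeil

/-! ### Binomial theorem for commuting curvature forms -/

section CommutingForms

variable {V A C F : Type*} [AddCommGroup V] [Module ℝ V] [Ring A] [Algebra ℝ A] [Ring C] [Algebra ℝ C]
  [Ring F] [Algebra ℝ F]

theorem GForm.of_compAlternatingMap_mem_range (ι : A →ₐ[ℝ] F) (γ : V [⋀^Fin 2]→ₗ[ℝ] A) (p : ℕ)
    (v : Fin p → V) :
    GForm.of 2 (ι.toLinearMap.compAlternatingMap γ) p v ∈ LinearMap.range ι.toLinearMap := by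
  by_cases hp : p = 2
  · subst hp
    rw [GForm.of_same]
    exact ⟨_, rfl⟩
  · rw [GForm.of_ne hp]
    exact Submodule.zero_mem _

/-- Forms of degree `2` are even, so commuting values suffice; the test functional is the identity,
with the two ranges as submodules. -/
theorem GForm.commute_of {ιA : A →ₐ[ℝ] F} {ιC : C →ₐ[ℝ] F} (hcomm : ∀ a c, ιA a * ιC c = ιC c * ιA a)
    (α : V [⋀^Fin 2]→ₗ[ℝ] A) (β : V [⋀^Fin 2]→ₗ[ℝ] C) :
    Commute (GForm.of 2 (ιA.toLinearMap.compAlternatingMap α))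
      (GForm.of 2 (ιC.toLinearMap.compAlternatingMap β)) :=
  funext fun r => (GForm.mapVal_mul_comm (LinearMap.id : F →ₗ[ℝ] F)
    (LinearMap.range ιA.toLinearMap) (LinearMap.range ιC.toLinearMap) (by
      rintro _ ⟨a, rfl⟩ _ ⟨c, rfl⟩
      exact hcomm a c) r _ _ (of_compAlternatingMap_mem_range ιA α)
    (of_compAlternatingMap_mem_range ιC β)).1 (GForm.parity_of_even even_two _)

theorem wedgePow_add_of_commute {ιA : A →ₐ[ℝ] F} {ιC : C →ₐ[ℝ] F}
    (hcomm : ∀ a c, ιA a * ιC c = ιC c * ιA a) (α : V [⋀^Fin 2]→ₗ[ℝ] A) (β : V [⋀^Fin 2]→ₗ[ℝ] C)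
    (k : ℕ) :
    wedgePow (ιA.toLinearMap.compAlternatingMap α + ιC.toLinearMap.compAlternatingMap β) k =
      ∑ i : Fin (k + 1), k.choose i • wedge (p := 2 * (i : ℕ)) (q := 2 * (k - i)) (by omega)
        (ιA.toLinearMap.compAlternatingMap (wedgePow α i))
        (ιC.toLinearMap.compAlternatingMap (wedgePow β (k - i))) := by
  have h := (GForm.commute_of hcomm α β).add_pow k
  rw [← map_add, GForm.of_pow, Finset.sum_range] at h
  have h2 := congrArg (GForm.proj (2 * k)) h
  rw [map_sum] at h2
  refine ((GForm.of_same _ _).symm.trans h2).trans (Finset.sum_congr rfl fun i _ => ?_)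
  rw [GForm.of_pow, GForm.of_pow, GForm.of_mul_of (r := 2 * k) (by omega), ← nsmul_eq_mul', map_nsmul,
    wedgePow_map, wedgePow_map]
  exact congrArg _ (GForm.of_same _ _)

/-- Traces of powers of a sum of commuting forms. -/
theorem trace_wedgePow_add {ιA : A →ₐ[ℝ] F} {ιC : C →ₐ[ℝ] F}
    (hcomm : ∀ a c, ιA a * ιC c = ιC c * ιA a) {τ : F →ₗ[ℝ] ℂ} {τA : A →ₗ[ℝ] ℂ} {τC : C →ₗ[ℝ] ℂ}
    (hτ : ∀ a c, τ (ιA a * ιC c) = τA a * τC c) (α : V [⋀^Fin 2]→ₗ[ℝ] A) (β : V [⋀^Fin 2]→ₗ[ℝ] C)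
    (k : ℕ) :
    τ.compAlternatingMap
        (wedgePow (ιA.toLinearMap.compAlternatingMap α + ιC.toLinearMap.compAlternatingMap β) k) =
      ∑ i : Fin (k + 1), k.choose i • wedge (p := 2 * (i : ℕ)) (q := 2 * (k - i)) (by omega)
        (τA.compAlternatingMap (wedgePow α i)) (τC.compAlternatingMap (wedgePow β (k - i))) := by
  rw [wedgePow_add_of_commute hcomm]
  simp_rw [← wedge_map τ ιA.toLinearMap ιC.toLinearMap τA τC hτ]
  let Φ : (V [⋀^Fin (2 * k)]→ₗ[ℝ] F) →+ (V [⋀^Fin (2 * k)]→ₗ[ℝ] ℂ) :=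
    AddMonoidHom.mk' (fun γ => τ.compAlternatingMap γ) fun γ δ =>
      AlternatingMap.ext fun v => map_add τ (γ v) (δ v)
  refine (map_sum Φ _ _).trans (Finset.sum_congr rfl fun i _ => map_nsmul Φ _ _)

/-- The wedge is built over `ℝ`, so complex scalars are moved through it as real linear maps of the
values. -/
theorem wedge_smul_smul {p q r : ℕ} (h : p + q = r) (c e : ℂ) (α : V [⋀^Fin p]→ₗ[ℝ] ℂ)
    (β : V [⋀^Fin q]→ₗ[ℝ] ℂ) : wedge h (c • α) (e • β) = (c * e) • wedge h α β := by
  have := wedge_map ((c * e) • (LinearMap.id : ℂ →ₗ[ℝ] ℂ)) LinearMap.id LinearMap.id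
    (c • (LinearMap.id : ℂ →ₗ[ℝ] ℂ)) (e • (LinearMap.id : ℂ →ₗ[ℝ] ℂ))
    (fun a b => by simp; ring) h α β
  exact this.symm

end CommutingForms

/-! ### The curvature of a tensor product connection -/

section TensorCurvature

variable {m : ℕ} {M : Type*} [TopologicalSpace M] [ChartedSpace (Euc m) M] [IsManifold (𝓡 m) ∞ M]
  [T2Space M] {S K E : ComplexBundle m M} (T : TensorBundle S K E) {DS : Connection S}
  {DK : Connection K} {D : Connection E}

theorem TensorBundle.cov_cov_tmul (hT : T.IsTensorConnection DS DK D) {s : ∀ x, S.Fiber x}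
    {κ : ∀ x, K.Fiber x} (hs : S.IsSmooth s) (hκ : K.IsSmooth κ)
    {Y : ∀ x : M, TangentSpace (𝓡 m) x} (hY : IsSmoothField Y) (x : M) (u : TangentSpace (𝓡 m) x) :
    D.cov (fun y => D.cov (fun y => T.tmul y (s y) (κ y)) y (Y y)) x u =
      T.tmul x (DS.cov (fun y => DS.cov s y (Y y)) x u) (κ x) +
        T.tmul x (DS.cov s x (Y x)) (DK.cov κ x u) +
      (T.tmul x (DS.cov s x u) (DK.cov κ x (Y x)) +
        T.tmul x (s x) (DK.cov (fun y => DK.cov κ y (Y y)) x u)) := by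
  have h1 : (fun y => D.cov (fun y => T.tmul y (s y) (κ y)) y (Y y)) =
      (fun y => T.tmul y (DS.cov s y (Y y)) (κ y)) + fun y => T.tmul y (s y) (DK.cov κ y (Y y)) :=
    funext fun y => hT s κ hs hκ y (Y y)
  have h2 := DS.cov_smooth hs hY
  have h3 := DK.cov_smooth hκ hY
  rw [h1, D.cov_add (T.smooth _ _ h2 hκ) (T.smooth _ _ hs h3), hT _ _ h2 hκ, hT _ _ hs h3]

/-- In the second covariant derivative the cross terms `∇_X s ⊗ ∇_Y κ + ∇_Y s ⊗ ∇_X κ` are symmetric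
in the two fields and drop out of the commutator. -/
theorem TensorBundle.curvature_tmul (hT : T.IsTensorConnection DS DK D) (x : M) (u w : Euc m)
    (a : S.Fiber x) (c : K.Fiber x) :
    D.curvature x ![u, w] (T.tmul x a c) =
      T.tmul x (DS.curvature x ![u, w] a) c + T.tmul x a (DK.curvature x ![u, w] c) := by
  obtain ⟨s, hs, rfl⟩ := S.exists_isSmooth x a
  obtain ⟨κ, hκ, rfl⟩ := K.exists_isSmooth x c
  obtain ⟨X, hX, hXu⟩ := exists_smoothField x (u : TangentSpace (𝓡 m) x)
  obtain ⟨Y, hY, hYw⟩ := exists_smoothField x (w : TangentSpace (𝓡 m) x)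
  have h1 := isCurvature_curvature D X Y hX hY _ (T.smooth s κ hs hκ) x
  have h2 := isCurvature_curvature DS X Y hX hY s hs x
  have h3 := isCurvature_curvature DK X Y hX hY κ hκ x
  rw [T.cov_cov_tmul hT hs hκ hY, T.cov_cov_tmul hT hs hκ hX, hT s κ hs hκ] at h1
  have hv : (![X x, Y x] : Fin 2 → Euc m) = ![u, w] := congrArg₂ (fun a b : Euc m => ![a, b]) hXu hYw
  have key : ∀ v : Fin 2 → Euc m, v = ![u, w] → D.curvature x v (T.tmul x (s x) (κ x)) =
      T.tmul x (DS.curvature x v (s x)) (κ x) + T.tmul x (s x) (DK.curvature x v (κ x)) →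
      D.curvature x ![u, w] (T.tmul x (s x) (κ x)) =
      T.tmul x (DS.curvature x ![u, w] (s x)) (κ x) +
        T.tmul x (s x) (DK.curvature x ![u, w] (κ x)) := by
    rintro _ rfl h
    exact h
  refine key _ hv (h1.trans ?_)
  refine Eq.trans ?_ (congrArg₂ (fun a c => T.tmul x a (κ x) + T.tmul x (s x) c) h2 h3).symm
  simp only [map_sub, LinearMap.sub_apply]
  abel

instance (E : ComplexBundle m M) (x : M) : Module.Finite ℂ (E.Fiber x) :=
  Module.Finite.equiv ((trivializationAt E.Model E.Fiber x).linearEquivAt ℂ x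
    (FiberBundle.mem_baseSet_trivializationAt' x)).symm

/-- The action on the left factor of a tensor product. -/
def TensorBundle.left (x : M) : Module.End ℂ (S.Fiber x) →ₐ[ℂ] Module.End ℂ (E.Fiber x) :=
  ((T.isTensorProduct x).equiv.conjAlgEquiv ℂ).toAlgHom.comp
    (Module.End.rTensorAlgHom ℂ (S.Fiber x) (K.Fiber x))

/-- The action on the right factor of a tensor product. -/
def TensorBundle.right (x : M) : Module.End ℂ (K.Fiber x) →ₐ[ℂ] Module.End ℂ (E.Fiber x) :=
  ((T.isTensorProduct x).equiv.conjAlgEquiv ℂ).toAlgHom.comp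
    (Module.End.lTensorAlgHom ℂ (K.Fiber x) (S.Fiber x))

theorem TensorBundle.ext_tmul (x : M) {f g : Module.End ℂ (E.Fiber x)}
    (h : ∀ a c, f (T.tmul x a c) = g (T.tmul x a c)) : f = g := by
  refine LinearMap.ext fun v => ?_
  obtain ⟨t, rfl⟩ := (T.isTensorProduct x).equiv.surjective v
  have h1 : f ∘ₗ (T.isTensorProduct x).equiv.toLinearMap =
      g ∘ₗ (T.isTensorProduct x).equiv.toLinearMap := TensorProduct.ext' fun a c => by
    simpa using h a c
  exact LinearMap.congr_fun h1 t

theorem TensorBundle.left_tmul (x : M) (f : Module.End ℂ (S.Fiber x)) (a : S.Fiber x)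
    (c : K.Fiber x) : T.left x f (T.tmul x a c) = T.tmul x (f a) c := by
  change (T.isTensorProduct x).equiv (f.rTensor _ ((T.isTensorProduct x).equiv.symm _)) = _
  rw [(T.isTensorProduct x).equiv_symm_apply, LinearMap.rTensor_tmul, (T.isTensorProduct x).equiv_apply,
    TensorProduct.lift.tmul]

theorem TensorBundle.right_tmul (x : M) (g : Module.End ℂ (K.Fiber x)) (a : S.Fiber x)
    (c : K.Fiber x) : T.right x g (T.tmul x a c) = T.tmul x a (g c) := by
  change (T.isTensorProduct x).equiv (g.lTensor _ ((T.isTensorProduct x).equiv.symm _)) = _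
  rw [(T.isTensorProduct x).equiv_symm_apply, LinearMap.lTensor_tmul, (T.isTensorProduct x).equiv_apply,
    TensorProduct.lift.tmul]

theorem TensorBundle.left_mul_right (x : M) (f : Module.End ℂ (S.Fiber x))
    (g : Module.End ℂ (K.Fiber x)) : T.left x f * T.right x g = T.right x g * T.left x f := by
  refine T.ext_tmul x fun a c => ?_
  rw [Module.End.mul_apply, Module.End.mul_apply, left_tmul, right_tmul, left_tmul, right_tmul]

theorem TensorBundle.trace_left_mul_right (x : M) (f : Module.End ℂ (S.Fiber x))
    (g : Module.End ℂ (K.Fiber x)) : LinearMap.trace ℂ _ (T.left x f * T.right x g) =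
      LinearMap.trace ℂ _ f * LinearMap.trace ℂ _ g := by
  have h : T.left x f * T.right x g = (T.isTensorProduct x).equiv.conj (TensorProduct.map f g) := by
    refine T.ext_tmul x fun a c => ?_
    rw [Module.End.mul_apply, right_tmul, left_tmul, LinearEquiv.conj_apply_apply,
      (T.isTensorProduct x).equiv_symm_apply, TensorProduct.map_tmul,
      (T.isTensorProduct x).equiv_apply, TensorProduct.lift.tmul]
  rw [h, LinearMap.trace_conj', LinearMap.trace_tensorProduct']

/-- The curvature of a tensor product connection. -/
theorem TensorBundle.curvature_eq (hT : T.IsTensorConnection DS DK D) (x : M) :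
    D.curvature x =
      ((T.left x).restrictScalars ℝ).toLinearMap.compAlternatingMap (DS.curvature x) +
        ((T.right x).restrictScalars ℝ).toLinearMap.compAlternatingMap (DK.curvature x) := by
  ext1 v
  have hv : v = ![v 0, v 1] := by ext1 i; fin_cases i <;> rfl
  rw [hv]
  refine T.ext_tmul x fun a c => (T.curvature_tmul hT x _ _ a c).trans ?_
  exact (congrArg₂ (· + ·) (T.left_tmul x _ a c) (T.right_tmul x _ a c)).symm

end TensorCurvature
end FamiliesChernWeil

end

noncomputable section
namespace FamiliesChernWeil

/-! ### Multiplicativity of the Chern character form -/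

section ChernCharacter

variable {m : ℕ} {M : Type*} [TopologicalSpace M] [ChartedSpace (Euc m) M] [IsManifold (𝓡 m) ∞ M]
  [T2Space M]

theorem ch_apply {E : ComplexBundle m M} (D : Connection E) (c : ℂ) (k : ℕ) (x : M) :
    (D.ch c k x).toAlternatingMap = (c ^ k / (k.factorial : ℂ)) •
      ((LinearMap.trace ℂ (E.Fiber x)).restrictScalars ℝ).compAlternatingMap
        (wedgePow (D.curvature x) k) := rfl

theorem wedgeForm_sub_left {p q r : ℕ} (h : p + q = r) (α α' : DForm m M p ℂ) (β : DForm m M q ℂ) :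
    wedgeForm h (α - α') β = wedgeForm h α β - wedgeForm h α' β := by
  rw [eq_sub_iff_add_eq]
  funext x
  refine ContinuousAlternatingMap.toAlternatingMap_injective ?_
  refine (wedge_add_left h ((α - α') x).toAlternatingMap (α' x).toAlternatingMap
    (β x).toAlternatingMap).symm.trans ?_
  refine congrArg (fun γ => wedge h γ (β x).toAlternatingMap) ?_
  exact AlternatingMap.ext fun v => sub_add_cancel (α x v) (α' x v)

/-- The Chern character form is multiplicative. -/
theorem TensorBundle.ch_eq {S K E : ComplexBundle m M} (T : TensorBundle S K E) {DS : Connection S}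
    {DK : Connection K} {D : Connection E} (hT : T.IsTensorConnection DS DK D) (c : ℂ) (k : ℕ) :
    D.ch c k = ∑ i : Fin (k + 1), wedgeForm (p := 2 * (i : ℕ)) (q := 2 * (k - i)) (by omega)
      (DS.ch c i) (DK.ch c (k - i)) := by
  funext x
  refine ContinuousAlternatingMap.toAlternatingMap_injective ?_
  rw [ch_apply, T.curvature_eq hT x, trace_wedgePow_add
    (τA := (LinearMap.trace ℂ (S.Fiber x)).restrictScalars ℝ)
    (τC := (LinearMap.trace ℂ (K.Fiber x)).restrictScalars ℝ)
    (fun a c => T.left_mul_right x a c) (fun a c => T.trace_left_mul_right x a c)]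
  ext v
  rw [Finset.sum_apply]
  let Ψ : (Euc m [⋀^Fin (2 * k)]→ₗ[ℝ] ℂ) →+ ℂ := AddMonoidHom.mk' (fun γ => γ v) fun _ _ => rfl
  refine (congrArg ((c ^ k / (k.factorial : ℂ)) * ·) (map_sum Ψ _ _)).trans ?_
  rw [Finset.mul_sum]
  refine Eq.trans (Finset.sum_congr rfl fun i _ => ?_)
    (ContinuousAlternatingMap.sum_apply _ _).symm
  rw [map_nsmul, nsmul_eq_mul, ← mul_assoc]
  change _ = wedge _ (DS.ch c i x).toAlternatingMap (DK.ch c (k - i) x).toAlternatingMap v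
  rw [ch_apply, ch_apply, wedge_smul_smul, AlternatingMap.smul_apply, smul_eq_mul]
  congr 1
  have hi : (i : ℕ) ≤ k := by omega
  have h1 : (((i : ℕ).factorial : ℕ) : ℂ) ≠ 0 := Nat.cast_ne_zero.2 (Nat.factorial_ne_zero _)
  have h2 : (((k - i).factorial : ℕ) : ℂ) ≠ 0 := Nat.cast_ne_zero.2 (Nat.factorial_ne_zero _)
  have h3 : ((k.factorial : ℕ) : ℂ) ≠ 0 := Nat.cast_ne_zero.2 (Nat.factorial_ne_zero _)
  -- The binomial coefficient from the power of a sum combines with `1 / k!` into `1 / (i! (k -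
  -- i)!)`, the coefficients of the two exponential series.
  have h4 : (k.factorial : ℂ) = k.choose i * (i : ℕ).factorial * (k - i).factorial := by
    exact_mod_cast (Nat.choose_mul_factorial_mul_factorial hi).symm
  have h5 : c ^ k = c ^ (i : ℕ) * c ^ (k - i) := by rw [← pow_add, Nat.add_sub_cancel' hi]
  rw [h5]
  field_simp
  rw [h4]
  ring

theorem ch_sub_ch_eq {S₁ S₂ K E₁ E₂ : ComplexBundle m M}
    {DS₁ : Connection S₁} {DS₂ : Connection S₂} {DK : Connection K} (T₁ : TensorBundle S₁ K E₁)
    (T₂ : TensorBundle S₂ K E₂) {D₁ : Connection E₁} {D₂ : Connection E₂}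
    (h₁ : T₁.IsTensorConnection DS₁ DK D₁) (h₂ : T₂.IsTensorConnection DS₂ DK D₂) (c : ℂ) (k : ℕ) :
    D₁.ch c k - D₂.ch c k = superChernProduct DS₁ DS₂ DK c k := by
  rw [T₁.ch_eq h₁, T₂.ch_eq h₂, superChernProduct, ← Finset.sum_sub_distrib]
  exact Finset.sum_congr rfl fun i _ => (wedgeForm_sub_left _ _ _ _).symm

theorem isSmoothForm_ch {E : ComplexBundle m M} (D : Connection E) (c : ℂ) (k : ℕ) :
    IsSmoothForm (D.ch c k) :=
  (isSmoothForm_trPow D k).const_smul _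

variable {q n : ℕ}
  {B : Type*} [TopologicalSpace B] [T2Space B] [ChartedSpace (Euc q) B] [IsManifold (𝓡 q) ∞ B]
  {Z : Type*} [TopologicalSpace Z] [ChartedSpace (Euc n) Z]
  [T2Space Z] [CompactSpace Z] [IsManifold (𝓡 n) ∞ Z]
  {pr : M → B} (hp : IsSmoothFibration (m := m) (q := q) pr n Z)
  (o : FiberOrientation (m := m) (q := q) pr n)

/-- The Chern character of the push-forward superbundle. -/
theorem pushChern_sub_pushChern {S₁ S₂ K E₁ E₂ : ComplexBundle m M}
    {DS₁ : Connection S₁} {DS₂ : Connection S₂} {DK : Connection K} (T₁ : TensorBundle S₁ K E₁)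
    (T₂ : TensorBundle S₂ K E₂) {D₁ : Connection E₁} {D₂ : Connection E₂}
    (h₁ : T₁.IsTensorConnection DS₁ DK D₁) (h₂ : T₂.IsTensorConnection DS₂ DK D₂) (c : ℂ)
    {p k : ℕ} (h : p + n = 2 * k) : pushChern hp o h D₁ c - pushChern hp o h D₂ c =
      fiberIntegral hp o h (superChernProduct DS₁ DS₂ DK c k) := by
  rw [pushChern, pushChern, ← ch_sub_ch_eq T₁ T₂ h₁ h₂,
    fiberIntegral_sub hp o h (isSmoothForm_ch D₁ c k) (isSmoothForm_ch D₂ c k)]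

end ChernCharacter
end FamiliesChernWeil

end

theorem mainTheorem5 {q m n : ℕ}
    {B : Type*} [TopologicalSpace B] [T2Space B] [CompactSpace B] [ConnectedSpace B]
    [ChartedSpace (EuclideanSpace ℝ (Fin q)) B] [IsManifold (𝓡 q) ∞ B]
    {M : Type*} [TopologicalSpace M] [T2Space M] [CompactSpace M] [ConnectedSpace M]
    [ChartedSpace (EuclideanSpace ℝ (Fin m)) M] [IsManifold (𝓡 m) ∞ M]
    {Z : Type*} [TopologicalSpace Z] [T2Space Z] [CompactSpace Z] [ConnectedSpace Z]
    [ChartedSpace (EuclideanSpace ℝ (Fin n)) Z] [IsManifold (𝓡 n) ∞ Z]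
    (pr : M → B) (hp : FamiliesChernWeil.IsSmoothFibration (m := m) (q := q) pr n Z)
    (o : FamiliesChernWeil.FiberOrientation (m := m) (q := q) pr n) :
    -- the vertical part of the curvature of the Bismut connection is the curvature of `E`
    (∀ (E : FamiliesChernWeil.ComplexBundle m M) (D : FamiliesChernWeil.Connection E)
        (HM : FamiliesChernWeil.HorizontalComplement (m := m) (q := q) pr)
        (b : B) (ξ₁ ξ₂ : TangentSpace (𝓡 q) b),
      (∃ g : FamiliesChernWeil.InfinitesimalAut E pr b,
        FamiliesChernWeil.IsBismutCurvatureAt D HM ξ₁ ξ₂ g) ∧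
      ∀ g : FamiliesChernWeil.InfinitesimalAut E pr b,
        FamiliesChernWeil.IsBismutCurvatureAt D HM ξ₁ ξ₂ g →
          g.IsVerticalPart D fun z => D.curvature z ![HM.lift ξ₁ z, HM.lift ξ₂ z]) ∧
    -- the characteristic forms are smooth and closed, with class independent of the connection
    (∀ (E : FamiliesChernWeil.ComplexBundle m M) (p k : ℕ) (h : p + n = 2 * k),
      (∀ D : FamiliesChernWeil.Connection E,
        FamiliesChernWeil.IsSmoothForm (FamiliesChernWeil.charForm hp o h D) ∧
        FamiliesChernWeil.dForm (FamiliesChernWeil.charForm hp o h D) = 0) ∧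
      ∀ D₀ D₁ : FamiliesChernWeil.Connection E,
        FamiliesChernWeil.IsExactForm
          (FamiliesChernWeil.charForm hp o h D₁ - FamiliesChernWeil.charForm hp o h D₀)) ∧
    -- the Chern character of the superbundle `pr_*(S⁺ ⊗ K) ⊕ pr_*(S⁻ ⊗ K)`
    (∀ (S₁ S₂ K E₁ E₂ : FamiliesChernWeil.ComplexBundle m M)
        (DS₁ : FamiliesChernWeil.Connection S₁) (DS₂ : FamiliesChernWeil.Connection S₂)
        (DK : FamiliesChernWeil.Connection K)
        (T₁ : FamiliesChernWeil.TensorBundle S₁ K E₁) (T₂ : FamiliesChernWeil.TensorBundle S₂ K E₂)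
        (D₁ : FamiliesChernWeil.Connection E₁) (D₂ : FamiliesChernWeil.Connection E₂),
      T₁.IsTensorConnection DS₁ DK D₁ → T₂.IsTensorConnection DS₂ DK D₂ →
      ∀ (c : ℂ) (p k : ℕ) (h : p + n = 2 * k),
        FamiliesChernWeil.pushChern hp o h D₁ c - FamiliesChernWeil.pushChern hp o h D₂ c =
          FamiliesChernWeil.fiberIntegral hp o h
            (FamiliesChernWeil.superChernProduct DS₁ DS₂ DK c k)) :=
  ⟨fun _ D HM _ ξ₁ ξ₂ =>
      FamiliesChernWeil.exists_isBismutCurvatureAt_and_isVerticalPart HM D hp ξ₁ ξ₂,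
    fun _ _ _ h => ⟨fun D => ⟨FamiliesChernWeil.isSmoothForm_charForm hp o h D,
      FamiliesChernWeil.dForm_charForm hp o h D⟩,
      fun D₀ D₁ => FamiliesChernWeil.isExactForm_charForm_sub hp o h D₀ D₁⟩,
    fun _ _ _ _ _ _ _ _ T₁ T₂ _ _ h₁ h₂ c _ _ h =>
      FamiliesChernWeil.pushChern_sub_pushChern hp o T₁ T₂ h₁ h₂ c h⟩
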